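/- **Setting.** Fix $n\ge 2$. An *$n$-welded tree* $T$ consists of two balanced binary trees of height $n$ (with $2\cdot(2^{n+1}-1)=2^{n+2}-2$ vertices in total) whose leaves are joined by a cycle through all leaves that alternates between leaves of the left tree and leaves of the right tree; its edges carry a proper colouring $\chi$ with nine colours. The entrance is the root of the left tree, the exit is the root of the right tree. A *labelling* $\ell$ assigns distinct $2n$-bit strings to the vertices so that the entrance has label $0\cdots0$ and no vertex has label $\mathrm{INVALID}=1\cdots1$. The black box of $(T,\chi,\ell)$ answers a query $(x,c)$ with the label of the neighbour that is joined to the vertex labelled $x$ by an edge of colour $c$, and with $\mathrm{INVALID}$ if there is none; a query gate acts by $(x,c,a)\mapsto(x,c,a\oplus K(x,c))$. An *$(n,\eta,c,q,g)$-hybrid-quantum circuit* has an $n$-bit input, padded with zeros to width $g\ge n$, and is a composition of $\eta$ tiers on $g$ wires. The odd-numbered tiers are classical circuits of depth $c$ (NOT, Toffoli, reset-to-zero and query gates), the even-numbered tiers are quantum circuits of depth $q$ (these gates, Hadamard gates and phase gates $|a\rangle\mapsto i^a|a\rangle$) followed by a measurement of all wires in the computational basis. In each layer the gates act on disjoint sets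 of wires. A *classical algorithm* is a classical circuit of NOT, Toffoli, reset and query gates whose wires initially hold the input, uniformly random bits, and zeros, and which outputs $g$ bits; its number of queries is its number of query gates and its running time is its number of wires plus its number of gates. For a circuit or algorithm $D$ with input $x$, let $\Pr[D(T,\chi)=y]$ be the probability of the output string $y\in\{0,1\}^g$, and let $\Pr[D(T,\chi)=\text{exit}]$ be the probability that the first $2n$ output bits (padded with zeros if $g<2n$) are the label of the exit; both probabilities are over a uniformly random labelling $\ell$ of $T$ and over the randomness of $D$. **Theorem.** There is an absolute constant $k$ such that for all $n\ge2$, $\eta\ge1$, $d\ge1$, $g\ge n$ and every $(n,\eta,4^d,d,g)$-hybrid-quantum circuit $C$ there is a classical algorithm $\mathcal A$ that makes at most $$4^{\eta(d+1)}\,(g\cdot d)$$ queries and runs in time at most $2^{k(g+\eta(d+1))}$, such that for every input $x\in\{0,1\}^n$, every $n$-welded tree $T$ and every proper edge colouring $\chi$ of $T$ with nine colours, $$\sum_{y\in\{0,1\}^g}\bigl|\Pr[C(T,\chi)=y]-\Pr[\mathcal A(T,\chi)=y]\bigr|\le 4^{(\eta+2)(d+2)}\,g^2\cdot\frac{2^{n+2}-2}{2^{2n}}$$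 and $$\bigl|\Pr[C(T,\chi)=\text{exit}]-\Pr[\mathcal A(T,\chi)=\text{exit}]\bigr|\le 4^{(\eta+2)(d+2)}\,g^2\cdot\frac{2^{n+2}-2}{2^{2n}} .$$ -/

import Mathlib

open scoped Matrix

namespace HybridWelded

/-! ### Bit strings, oracles and gates -/

/-- Bit strings of length `w`. -/
abbrev Bits (w : ℕ) : Type := Fin w → Bool

/-- The string `1⋯1`, called `INVALID`. -/
def invalid (m : ℕ) : Bits m := fun _ => true

/-- A black box: it takes a `2n`-bit string and a colour, written with four bits, and returns a
`2n`-bit string. -/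
abbrev Oracle (n : ℕ) : Type := Bits (2 * n) → Bits 4 → Bits (2 * n)

/-- The wires of a query gate: the string register, the colour register, the answer register. -/
abbrev QueryWires (n : ℕ) : Type := Fin (2 * n) ⊕ Fin 4 ⊕ Fin (2 * n)

/-- Classical gates on `w` wires. The gate `reset` discards a bit (garbage gate) and puts a fresh
zero bit (auxiliary gate) on its wire. -/
inductive CGate (n w : ℕ) : Type
  | not (i : Fin w) : CGate n w
  | toffoli (e : Fin 3 ↪ Fin w) : CGate n w
  | reset (i : Fin w) : CGate n w
  | query (e : QueryWires n ↪ Fin w) : CGate n w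

/-- Quantum gates on `w` wires: the classical gates, Hadamard gates, and phase gates. -/
inductive QGate (n w : ℕ) : Type
  | classical (γ : CGate n w) : QGate n w
  | hadamard (i : Fin w) : QGate n w
  | phase (i : Fin w) : QGate n w

namespace CGate

variable {n w : ℕ}

/-- The set of wires on which a gate acts. -/
def support : CGate n w → Finset (Fin w)
  | .not i => {i}
  | .toffoli e => Finset.univ.map e
  | .reset i => {i}
  | .query e => Finset.univ.map e

/-- Is this a query gate? -/
def isQuery : CGate n w → Bool
  | .query _ => true
  | _ => false

open Classical in
/-- The action of a classical gate on bit strings. The query gate is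
`(x, c, a) ↦ (x, c, a ⊕ K(x, c))`. -/
noncomputable def apply (K : Oracle n) : CGate n w → Bits w → Bits w
  | .not i, z => Function.update z i (!(z i))
  | .toffoli e, z => Function.update z (e 2) (xor (z (e 2)) (z (e 0) && z (e 1)))
  | .reset i, z => Function.update z i false
  | .query e, z => fun k =>
      if h : ∃ j, e (Sum.inr (Sum.inr j)) = k then
        xor (z k)
          (K (fun j => z (e (Sum.inl j))) (fun j => z (e (Sum.inr (Sum.inl j)))) h.choose)
      else z k

end CGate

/-- Density matrices (and other operators) on `w` qubits. -/
abbrev Op (w : ℕ) : Type := Matrix (Bits w) (Bits w) ℂ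

/-- The matrix of a map on computational basis states, `|z⟩ ↦ |f z⟩`. -/
def basisMap {w : ℕ} (f : Bits w → Bits w) : Op w :=
  Matrix.of fun z' z => if z' = f z then 1 else 0

/-- The projection onto the basis states whose bit `i` is `b`. -/
def bitProj {w : ℕ} (i : Fin w) (b : Bool) : Op w :=
  Matrix.diagonal fun z => if z i = b then 1 else 0

namespace QGate

variable {n w : ℕ}

/-- The set of wires on which a gate acts. -/
def support : QGate n w → Finset (Fin w)
  | .classical γ => γ.support
  | .hadamard i => {i}
  | .phase i => {i}

/-- The Kraus operators of a gate. All gates are unitary, with one Kraus operator, except `reset`,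
whose Kraus operators are `|0⟩⟨0|` and `|0⟩⟨1|` on its wire. -/
noncomputable def kraus (K : Oracle n) : QGate n w → List (Op w)
  | .classical (.reset i) =>
      [basisMap (CGate.apply K (.reset i)) * bitProj i false,
       basisMap (CGate.apply K (.reset i)) * bitProj i true]
  | .classical γ => [basisMap (γ.apply K)]
  | .hadamard i =>
      [Matrix.of fun z' z =>
        if ∀ j, j ≠ i → z' j = z j then
          (if z i && z' i then -1 else 1) / (Real.sqrt 2 : ℂ)
        else 0]
  | .phase i => [Matrix.diagonal fun z => if z i then Complex.I else 1]

/-- The action of a gate on density matrices. -/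
noncomputable def apply (K : Oracle n) (γ : QGate n w) (ρ : Op w) : Op w :=
  ((γ.kraus K).map fun A => A * ρ * Aᴴ).sum

end QGate

/-! ### Layers, tiers and hybrid-quantum circuits -/

/-- A classical circuit of depth one on `g` wires: gates on pairwise disjoint sets of wires, the
other wires being idle. -/
structure CLayer (n g : ℕ) : Type where
  gates : List (CGate n g)
  disjoint : gates.Pairwise fun a b => Disjoint a.support b.support

/-- A quantum circuit of depth one on `g` wires. -/
structure QLayer (n g : ℕ) : Type where
  gates : List (QGate n g)
  disjoint : gates.Pairwise fun a b => Disjoint a.support b.support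

/-- The action of a classical layer. -/
noncomputable def CLayer.apply {n g : ℕ} (K : Oracle n) (L : CLayer n g) (z : Bits g) : Bits g :=
  L.gates.foldl (fun s γ => γ.apply K s) z

/-- The action of a quantum layer on density matrices. -/
noncomputable def QLayer.apply {n g : ℕ} (K : Oracle n) (L : QLayer n g) (ρ : Op g) : Op g :=
  L.gates.foldl (fun s γ => γ.apply K s) ρ

/-- A relativized tier on `g` wires: a classical circuit of depth `c`, or a quantum circuit of
depth `q` that is followed by a measurement of all wires in the computational basis. -/
inductive Tier (n g c q : ℕ) : Type
  | classical (L : Fin c → CLayer n g) : Tier n g c q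
  | quantum (L : Fin q → QLayer n g) : Tier n g c q

namespace Tier

variable {n g c q : ℕ}

/-- Is this a classical tier? -/
def IsClassical : Tier n g c q → Prop
  | .classical _ => True
  | .quantum _ => False

/-- The probability that a tier with input string `z` has the output string `y`. -/
noncomputable def prob (K : Oracle n) : Tier n g c q → Bits g → Bits g → ℝ
  | .classical L, z, y => if y = (List.ofFn L).foldl (fun s l => l.apply K s) z then 1 else 0
  | .quantum L, z, y =>
      ((List.ofFn L).foldl (fun s l => l.apply K s) (Matrix.single z z (1 : ℂ)) y y).re

end Tier

/-- An `(n, η, c, q, g)`-hybrid-quantum circuit: `η` tiers of width `g`, alternately classical of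
depth `c` and quantum of depth `q`, the first one being classical. (The tiers are numbered from
zero here.) -/
structure HybridCircuit (n η c q g : ℕ) : Type where
  tier : Fin η → Tier n g c q
  alternates : ∀ i : Fin η, (tier i).IsClassical ↔ Even (i : ℕ)

/-- The `n`-bit input, padded with zeros to `g` bits. -/
def padInput {n : ℕ} (g : ℕ) (x : Bits n) : Bits g :=
  fun i => if h : (i : ℕ) < n then x ⟨i, h⟩ else false

/-- The probability that the circuit, with input `x` and black box `K`, has the output string `y`;
each tier gets the output of the tier before it. -/
noncomputable def HybridCircuit.prob {n η c q g : ℕ} (C : HybridCircuit n η c q g) (K : Oracle n)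
    (x : Bits n) : Bits g → ℝ :=
  (List.ofFn C.tier).foldl (fun P t y => ∑ z, P z * t.prob K z y)
    (fun z => if z = padInput g x then 1 else 0)

/-! ### Classical algorithms -/

/-- A classical randomized query algorithm with `n` input bits and `g` output bits, as a classical
circuit with query gates. The wires hold the input, uniformly random bits, and zeros; the output is
read from the first `g` wires. -/
structure ClassicalAlgorithm (n g : ℕ) : Type where
  coins : ℕ
  width : ℕ
  input_le : n + coins ≤ width
  output_le : g ≤ width
  gates : List (CGate n width)

namespace ClassicalAlgorithm

variable {n g : ℕ}

/-- The number of queries. -/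
def queries (A : ClassicalAlgorithm n g) : ℕ := A.gates.countP CGate.isQuery

/-- The running time: the number of wires plus the number of gates. -/
def time (A : ClassicalAlgorithm n g) : ℕ := A.width + A.gates.length

/-- The initial content of the wires, for the input `x` and the random bits `r`. -/
def start (A : ClassicalAlgorithm n g) (x : Bits n) (r : Bits A.coins) : Bits A.width := fun i =>
  if h : (i : ℕ) < n then x ⟨i, h⟩
  else if h' : (i : ℕ) - n < A.coins then r ⟨i - n, h'⟩
  else false

/-- The output for the input `x` and the random bits `r`. -/
noncomputable def run (A : ClassicalAlgorithm n g) (K : Oracle n) (x : Bits n) (r : Bits A.coins) :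
    Bits g :=
  fun i => A.gates.foldl (fun s γ => γ.apply K s) (A.start x r) (Fin.castLE A.output_le i)

/-- The probability, over uniform random bits, of the output string `y`. -/
noncomputable def prob (A : ClassicalAlgorithm n g) (K : Oracle n) (x : Bits n) (y : Bits g) : ℝ :=
  (∑ r : Bits A.coins, if A.run K x r = y then (1 : ℝ) else 0) / 2 ^ A.coins

end ClassicalAlgorithm

/-! ### Welded trees and black boxes -/

/-- A node of the balanced binary tree of height `n`: the root is `1`, the children of `i` are `2i`
and `2i + 1`, and the leaves are `2 ^ n, …, 2 ^ (n + 1) - 1`. -/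
abbrev Node (n : ℕ) : Type := {i : ℕ // i ∈ Finset.Ico 1 (2 ^ (n + 1))}

/-- A vertex of a welded tree: a node of the left tree (`false`) or of the right tree (`true`). -/
abbrev Vertex (n : ℕ) : Type := Bool × Node n

/-- The `j`-th leaf. -/
def leaf (n : ℕ) (j : Fin (2 ^ n)) : Node n :=
  ⟨2 ^ n + j, by
    have := j.isLt
    rw [Finset.mem_Ico, pow_succ]
    omega⟩

/-- The root of the binary tree. -/
def root (n : ℕ) : Node n :=
  ⟨1, by
    have := Nat.one_lt_two_pow (n := n + 1) (by omega)
    rw [Finset.mem_Ico]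
    omega⟩

/-- The root of the left tree. -/
def entrance (n : ℕ) : Vertex n := (false, root n)

/-- The root of the right tree. -/
def exit (n : ℕ) : Vertex n := (true, root n)

/-- A possible value of a random `n`-welded tree: a cycle through all leaves that alternates between
the left and the right leaves, that is, the cycle
`left 0, right 0, left 1, right 1, …, left (2 ^ n - 1), right (2 ^ n - 1)` for two enumerations of
the leaves. -/
structure WeldedTree (n : ℕ) : Type where
  left : Equiv.Perm (Fin (2 ^ n))
  right : Equiv.Perm (Fin (2 ^ n))

/-- The graph: the edges of the two binary trees and the edges of the cycle. -/
def WeldedTree.graph {n : ℕ} (T : WeldedTree n) : SimpleGraph (Vertex n) :=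
  SimpleGraph.fromRel fun u v =>
    (u.1 = v.1 ∧ (u.2 : ℕ) = (v.2 : ℕ) / 2) ∨
    ∃ i : Fin (2 ^ n), u = (false, leaf n (T.left i)) ∧
      (v = (true, leaf n (T.right i)) ∨ v = (true, leaf n (T.right ((finRotate (2 ^ n)).symm i))))

/-- An edge colouring with the nine colours: edges with a common end have different colours. -/
structure EdgeColouring {V : Type} (G : SimpleGraph V) : Type where
  colour : Sym2 V → Fin 9
  proper : ∀ u v w, G.Adj u v → G.Adj u w → colour s(u, v) = colour s(u, w) → v = w

/-- A labelling of the vertices by distinct `2n`-bit strings in which the entrance has the label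
`0⋯0` and no vertex has the label `INVALID`. -/
abbrev Labelling (n : ℕ) : Type :=
  {ℓ : Vertex n → Bits (2 * n) //
    Function.Injective ℓ ∧ ℓ (entrance n) = (fun _ => false) ∧ ∀ v, ℓ v ≠ invalid (2 * n)}

/-- The number with binary digits `c` (least significant digit first). -/
def colourCode (c : Bits 4) : ℕ := ∑ i, if c i then 2 ^ (i : ℕ) else 0

open Classical in
/-- The black box of a coloured and labelled tree: the answer to `(x, c)` is the label of the
`c`-neighbour of the vertex with label `x`, or `INVALID` if there is none. -/
noncomputable def blackBox {n : ℕ} (T : WeldedTree n) (χ : EdgeColouring T.graph)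
    (ℓ : Labelling n) : Oracle n := fun x c =>
  if h : ∃ v u, ℓ.1 u = x ∧ T.graph.Adj u v ∧ (χ.colour s(u, v) : ℕ) = colourCode c then
    ℓ.1 h.choose
  else invalid (2 * n)

/-! ### Output probabilities over all labellings -/

open Classical in
/-- The average over all labellings. -/
noncomputable def average {n : ℕ} (f : Labelling n → ℝ) : ℝ :=
  (∑ ℓ, f ℓ) / Fintype.card (Labelling n)

/-- The first `2n` bits of the output string `y` (padded with zeros if `y` is shorter) are the label
of the exit. -/
def ReturnsExit {n g : ℕ} (ℓ : Labelling n) (y : Bits g) : Prop :=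
  padInput (2 * n) y = ℓ.1 (exit n)

/-- For a device whose output string is `y` with probability `P K y` when its black box is `K`: the
probability of the output `y`, over a uniformly random labelling of the tree and the randomness of
the device. -/
noncomputable def outputProb {n g : ℕ} (P : Oracle n → Bits g → ℝ) (T : WeldedTree n)
    (χ : EdgeColouring T.graph) (y : Bits g) : ℝ :=
  average fun ℓ => P (blackBox T χ ℓ) y

open Classical in
/-- The probability, over a uniformly random labelling and the randomness of the device, that the
device returns the label of the exit. -/
noncomputable def successProb {n g : ℕ} (P : Oracle n → Bits g → ℝ) (T : WeldedTree n)
    (χ : EdgeColouring T.graph) : ℝ :=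
  average fun ℓ => ∑ y, if ReturnsExit ℓ y then P (blackBox T χ ℓ) y else 0

end HybridWelded

/-! The simulation keeps a set of known strings, at first only the label `0⋯0` of the entrance. A
classical tier is executed literally, and every query enlarges the set. In a quantum tier of depth
`d`, layer `k` can honestly know only the strings within distance `k` of the known ones. The
simulation therefore explores the ball of radius `d`, computes the distribution of the outcome
exactly for the truncated oracles `simO`, and samples from it. Any other use of a label is a lucky
guess. Given all other labels, the label of a vertex is uniform among `4 ^ n - card (Vertex n)`
strings (`average_resample`), so a layer with at most `G` queries hits it with squared amplitude at
most `G * luck n`. Over all vertices this adds up to the order of `density n`.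

The plain hybrid argument adds amplitudes and would only give the square root of this density. Hence
the term of first order has to be understood. If the real state is `φ + δ`, the probabilities are
`outP φ + outD φ δ + outP δ`, and `outP δ` is harmless. Split `δ` into parts `dl`, one for each
vertex `v` whose label is guessed, and test `outD` against an arbitrary functional of what follows.
If no string that is ever touched lies within distance `d + 1` of `v`, the test vector knows nothing
about `v`. It overlaps with the part of `v` only if its own backward evolution guesses the label as
well. A product of two small amplitudes is a small probability (`inner_diff_le`,
`abs_average_far_le`). Vertices near the exit are exempt, because the functional may know the label
of the exit, but there are few of them. If `v` is near the touched strings, its part is replaced by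
`dd`, which is computable from the oracle near these strings. The replacement fails only after two
lucky guesses (`average_del_sub_apx_sq_le`). The resulting change of the probabilities is known at
the end of the simulation, which can correct for it.

The correction uses two independent runs. Each tier owns two slots of probability `2 ^ (-s)`; in
them one run is replaced by the other with a probability that is proportional to the correction
(`outAv_eq`). Corrections have to be clipped to the size of a slot, which costs only second order
(`average_clip_error_le`). In `vr_sub_outAv` there remain the first-order errors, now corrected, and
products of errors of different tiers, which are of second order (`abs_secondOrder_le`). If `η ≤ 2`,
at most the last tier is quantum. Then the near vertices do not depend on the outcome and no
correction is needed (`qTier_lastBounded`).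

The simulation is an honest circuit. Resets are dilated to exchanges with fresh ancillas. Each
Hadamard gate contributes `1 / √2` on both sides of the density matrix, so all probabilities are
integers over `2 ^ (g * d)` and are computed with Gaussian integers. The computations are written as
NAND programs with queries, whose length is tracked in powers of `P = 2 ^ (g + η * (d + 1))`, and
are then translated to gates. Both claims follow from one estimate for bounded functionals of the
output and the label of the exit (`claims_of_functional`). If the claimed bound is at least `2`, a
constant algorithm suffices; otherwise `n ≥ 27`. -/

namespace HybridWelded

noncomputable section

set_option linter.unusedSectionVars false

open Function (update update_eq_self update_of_ne update_self)
open Fintype (card card_bool card_fin card_fun card_prod equivFin sum_prod_type)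
open Finset (abs_sum_le_sum_abs card_le_card card_range card_univ mem_filter mem_insert mem_range
  mem_sdiff mem_sigma mem_singleton mem_univ mul_sum nodup_toList range single_le_sum subset_insert
  subset_union_left sum_add_distrib sum_comm sum_congr sum_const sum_const_zero sum_div
  sum_eq_single sum_eq_zero sum_filter sum_image sum_insert sum_ite_eq' sum_le_sum sum_mul
  sum_nonneg sum_range_succ sum_sub_distrib univ)
open EuclideanSpace (norm_sq_eq)
open LinearIsometryEquiv (apply_symm_apply trans_apply)
open Nat (cast_nonneg le_succ lt_two_pow_self pow_le_pow_right succ_le_of_lt)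
open Matrix (conjTranspose_apply mul_apply of_apply)
open List (countP_append length_append length_cons)

local notation "Str" n:max => Bits (2 * n)
local notation "Vec" Ω:max => EuclideanSpace ℂ Ω

/-! ### Masked oracles and balls -/

/-- The oracle that answers only the strings in `S`. -/
def mask {n : ℕ} (K : Oracle n) (S : Finset (Str n)) : Oracle n := fun x c =>
  if x ∈ S then K x c else invalid _

/-- `S` together with all valid answers to strings in `S`. -/
def grow {n : ℕ} (K : Oracle n) (S : Finset (Str n)) : Finset (Str n) := S ∪ univ.filter fun y => y ≠ invalid _ ∧ ∃ x ∈ S, ∃ c, K x c = y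

/-- The strings that are reached from `S` with at most `k` steps. -/
def ball {n : ℕ} (K : Oracle n) (S : Finset (Str n)) : ℕ → Finset (Str n)
  | 0 => S
  | k + 1 => grow K (ball K S k)

/-- `K'` gives the same answers as `K` to the queries from `S` that stay in `S`. -/
def Agree {n : ℕ} (K K' : Oracle n) (S : Finset (Str n)) : Prop := ∀ x ∈ S, ∀ c, (K x c ∈ S ∨ K x c = invalid _) → K' x c = K x c

section
variable {n : ℕ} {K K' : Oracle n} {S S' : Finset (Str n)}

theorem Agree.mono (h : Agree K K' S') (hS : S ⊆ S') : Agree K K' S := fun x hx c hc => h x (hS hx) c (hc.imp (fun h => hS h) id)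

theorem mem_grow {y : Str n} : y ∈ grow K S ↔ y ∈ S ∨ (y ≠ invalid _ ∧ ∃ x ∈ S, ∃ c, K x c = y) := by simp [grow]

theorem subset_grow : S ⊆ grow K S := subset_union_left

theorem grow_mono (h : S ⊆ S') : grow K S ⊆ grow K S' := by
  intro y hy
  rw [mem_grow] at hy ⊢
  rcases hy with hy | ⟨h1, x, hx, h2⟩
  · grind
  · grind

theorem ball_subset_succ (k : ℕ) : ball K S k ⊆ ball K S (k + 1) := subset_grow

theorem ball_mono {j k : ℕ} (h : j ≤ k) : ball K S j ⊆ ball K S k := by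
  induction k, h using Nat.le_induction with
  | base => exact subset_rfl
  | succ k _ ih => exact ih.trans (ball_subset_succ k)

theorem subset_ball (k : ℕ) : S ⊆ ball K S k := ball_mono (Nat.zero_le k)

theorem ball_mono_left (h : S ⊆ S') (k : ℕ) : ball K S k ⊆ ball K S' k := by
  induction k with
  | zero => exact h
  | succ k ih => exact grow_mono ih

theorem ball_add (j k : ℕ) : ball K (ball K S j) k = ball K S (j + k) := by
  induction k with
  | zero => rfl
  | succ k ih => rw [ball, ih]; rfl

variable {k : ℕ}

theorem answer_mem_ball_succ {x : Str n} (hx : x ∈ ball K S k) (c : Bits 4) : K x c ∈ ball K S (k + 1) ∨ K x c = invalid _ := by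
  by_cases h : K x c = invalid _
  · exact .inr h
  · exact .inl (mem_grow.2 (Or.inr ⟨h, x, hx, c, rfl⟩))

/-- Agreement on a ball says nothing about edges that leave it. At radius `j < k` every answer still
lies inside the ball of radius `k`, which is why all locality statements lose one step of radius per
query. -/
theorem Agree.answer {k j : ℕ} (h : Agree K K' (ball K S k)) (hj : j < k) {x : Str n} (hx : x ∈ ball K S j) (c : Bits 4) : K' x c = K x c :=
  h x (ball_mono hj.le hx) c ((answer_mem_ball_succ hx c).imp (fun h => ball_mono (succ_le_of_lt hj) h) id)

theorem grow_congr (h : ∀ x ∈ S, ∀ c, K' x c = K x c) : grow K' S = grow K S := by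
  ext y
  simp only [mem_grow]
  refine or_congr_right (and_congr_right fun _ => ?_)
  constructor
  · grind
  · grind

theorem Agree.ball_eq (h : Agree K K' (ball K S k)) {j : ℕ} (hj : j ≤ k) : ball K' S j = ball K S j := by
  induction j with
  | zero => rfl
  | succ j ih =>
    simp only [ball]
    rw [ih (by omega)]
    exact grow_congr fun x hx c => h.answer (by omega) hx c

theorem mask_congr (h : ∀ x ∈ S, ∀ c, K' x c = K x c) : mask K' S = mask K S := by
  funext x c
  by_cases hx : x ∈ S
  · simp [mask, hx, h x hx c]
  · simp [mask, hx]

theorem ball_congr (h : ∀ j < k, ∀ x ∈ ball K S j, ∀ c, K' x c = K x c) : ball K' S k = ball K S k := by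
  induction k with
  | zero => rfl
  | succ k ih =>
    simp only [ball]
    rw [ih fun j hj => h j (by omega)]
    exact grow_congr (h k (by omega))

/-! ### Growth of balls in a graph of degree three. -/

/-- The oracle of a symmetric graph of degree at most three. -/
structure Tame (K : Oracle n) : Prop where
  symm : ∀ x c, K x c ≠ invalid _ → K (K x c) c = x
  inv : ∀ c, K (invalid _) c = invalid _
  deg : ∀ x, (univ.filter fun y => y ≠ invalid _ ∧ ∃ c, K x c = y).card ≤ 3

/-- A string of the outer shell `S'` spends one of its three edges on the way back to `S`, so at
most two edges lead outwards. -/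
theorem Tame.card_grow_sdiff (hK : Tame K) (hx : ∀ x ∈ S', ∃ c, K x c ∈ S ∧ K x c ≠ invalid _) (hsub : grow K S ⊆ S ∪ S') :
  (grow K (S ∪ S') \ (S ∪ S')).card ≤ 2 * S'.card := by
  classical
  have h1 : grow K (S ∪ S') \ (S ∪ S') ⊆ S'.biUnion fun x =>
      (univ.filter fun y => y ≠ invalid _ ∧ ∃ c, K x c = y) \ (S ∪ S') := by
    intro y hy; rw [mem_sdiff, mem_grow] at hy; obtain ⟨h | ⟨hy1, x, hxs, c, hc⟩, hy2⟩ := hy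
    · grind
    rw [Finset.mem_biUnion]; rcases Finset.mem_union.1 hxs with h | h
    · exact absurd (hsub (mem_grow.2 (Or.inr ⟨hy1, x, h, c, hc⟩))) hy2
    · grind
  refine (card_le_card h1).trans ((Finset.card_biUnion_le_card_mul _ _ 2 ?_).trans (by rw [mul_comm]))
  intro x hxs
  obtain ⟨c, hc, hc'⟩ := hx x hxs
  have h2 : (univ.filter fun y => y ≠ invalid _ ∧ ∃ c, K x c = y) \ (S ∪ S') ⊆
      (univ.filter fun y => y ≠ invalid _ ∧ ∃ c, K x c = y).erase (K x c) := by grind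
  have h3 := Finset.card_erase_of_mem (s := univ.filter fun y => y ≠ invalid _ ∧ ∃ c, K x c = y) (a := K x c) (by simp [hc'])
  have := hK.deg x
  have := card_le_card h2
  omega

theorem Tame.card_shell (hK : Tame K) (k : ℕ) : (ball K S (k + 1) \ ball K S k).card ≤ 3 * 2 ^ k * S.card := by
  classical
  induction k with
  | zero =>
    have h1 : ball K S 1 \ ball K S 0 ⊆ S.biUnion fun x =>
        (univ.filter fun y => y ≠ invalid _ ∧ ∃ c, K x c = y) := by
      intro y hy; rw [mem_sdiff] at hy; obtain ⟨hy, hy2⟩ := hy; rcases mem_grow.1 hy with h | ⟨hy1, x, hxs, c, hc⟩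
      · exact absurd h hy2
      exact Finset.mem_biUnion.2 ⟨x, hxs, by simp [hy1]; exact ⟨c, hc⟩⟩
    refine (card_le_card h1).trans ((Finset.card_biUnion_le_card_mul _ _ 3 ?_).trans ?_)
    · exact fun x _ => hK.deg x
    · grind
  | succ k ih =>
    have h := hK.card_grow_sdiff (S := ball K S k) (S' := ball K S (k + 1) \ ball K S k) ?_ ?_
    · rw [Finset.union_sdiff_of_subset (ball_subset_succ k)] at h; refine (show _ ≤ _ from h).trans ?_; rw [pow_succ]
      calc _ ≤ 2 * (3 * 2 ^ k * S.card) := Nat.mul_le_mul_left _ ih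
        _ = _ := by ring
    · intro x hx; rw [mem_sdiff] at hx; rcases mem_grow.1 hx.1 with h | ⟨hy1, y, hy, c, hc⟩
      · grind
      by_cases hyi : y = invalid _
      · refine absurd ?_ hy1; rw [← hc, hyi, hK.inv]
      · refine ⟨c, ?_, ?_⟩
        · rw [← hc, hK.symm y c (by rw [hc]; exact hy1)]; exact hy
        · rw [← hc, hK.symm y c (by rw [hc]; exact hy1)]; exact hyi
    · rw [Finset.union_sdiff_of_subset (ball_subset_succ k)]; exact subset_rfl

theorem Tame.card_ball (hK : Tame K) (S : Finset (Str n)) (k : ℕ) : (ball K S k).card ≤ 3 * 2 ^ k * S.card := by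
  -- The shells form a geometric series with sum `3 * (2 ^ k - 1) * S.card`; the summand `2 *
  -- S.card` makes the induction close.
  suffices h : (ball K S k).card + 2 * S.card ≤ 3 * 2 ^ k * S.card by omega
  induction k with
  | zero => simp only [ball]; omega
  | succ k ih =>
    have h := hK.card_shell (S := S) k; have h2 := Finset.card_sdiff_add_card_eq_card (ball_subset_succ (K := K) (S := S) k)
    have h3 : 3 * 2 ^ (k + 1) * S.card = 3 * 2 ^ k * S.card + 3 * 2 ^ k * S.card := by ring
    omega
end

/-! ### Layers of unitary maps that read an oracle -/

section
variable {Ω : Type*}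

open Classical in
/-- The projection onto the span of the basis vectors that satisfy `p`. -/
def cut (p : Ω → Prop) (ψ : Vec Ω) : Vec Ω := WithLp.toLp 2 fun ω => if p ω then ψ ω else 0

open Classical in
@[simp] theorem cut_apply (p : Ω → Prop) (ψ : Vec Ω) (ω : Ω) : cut p ψ ω = if p ω then ψ ω else 0 := rfl

theorem cut_cut (p q : Ω → Prop) (ψ : Vec Ω) : cut p (cut q ψ) = cut (fun ω => p ω ∧ q ω) ψ := by
  ext ω; by_cases h : p ω <;> by_cases h' : q ω <;> simp [h, h']

theorem cut_add_cut_not (p : Ω → Prop) (ψ : Vec Ω) : cut p ψ + cut (fun ω => ¬ p ω) ψ = ψ := by ext ω; by_cases h : p ω <;> simp [h]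

theorem cut_true (ψ : Vec Ω) : cut (fun _ => True) ψ = ψ := by ext ω; simp

theorem cut_false (ψ : Vec Ω) : cut (fun _ => False) ψ = 0 := by ext ω; simp

open Classical in
theorem cut_congr {p q : Ω → Prop} {ψ : Vec Ω} (h : ∀ ω, ψ ω ≠ 0 → (p ω ↔ q ω)) : cut p ψ = cut q ψ := by
  ext ω
  by_cases h0 : ψ ω = 0
  · simp [h0]
  · rw [cut_apply, cut_apply]; exact if_congr (h ω h0) rfl rfl

variable [Fintype Ω]

open Classical in
theorem norm_cut_sq (p : Ω → Prop) (ψ : Vec Ω) : ‖cut p ψ‖ ^ 2 = ∑ ω, if p ω then ‖ψ ω‖ ^ 2 else 0 := by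
  rw [norm_sq_eq]
  refine sum_congr rfl fun ω _ => ?_
  by_cases h : p ω <;> simp [h]

theorem norm_cut_sq_mono {p q : Ω → Prop} (h : ∀ ω, p ω → q ω) (ψ : Vec Ω) : ‖cut p ψ‖ ^ 2 ≤ ‖cut q ψ‖ ^ 2 := by
  classical
  rw [norm_cut_sq, norm_cut_sq]
  refine sum_le_sum fun ω _ => ?_
  by_cases hp : p ω
  · grind
  · simp only [hp, if_false]; split_ifs <;> positivity

theorem norm_cut_mono {p q : Ω → Prop} (h : ∀ ω, p ω → q ω) (ψ : Vec Ω) : ‖cut p ψ‖ ≤ ‖cut q ψ‖ :=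
  le_of_sq_le_sq (norm_cut_sq_mono h ψ) (norm_nonneg _)

theorem norm_cut_le (p : Ω → Prop) (ψ : Vec Ω) : ‖cut p ψ‖ ≤ ‖ψ‖ := by
  have := norm_cut_mono (p := p) (q := fun _ => True) (fun _ _ => trivial) ψ
  rwa [cut_true] at this

theorem inner_cut (p : Ω → Prop) (β ψ : Vec Ω) : inner ℂ β (cut p ψ) = inner ℂ (cut p β) ψ := by
  classical
  simp only [PiLp.inner_apply, cut_apply]
  refine sum_congr rfl fun ω _ => ?_
  by_cases h : p ω <;> simp [h]

/-- A union bound for squared amplitudes: a basis state that satisfies several of the properties is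
counted once on the left. -/
theorem norm_cut_exists_le {ι : Type*} (s : Finset ι) (p : ι → Ω → Prop) (ψ : Vec Ω) :
  ‖cut (fun ω => ∃ i ∈ s, p i ω) ψ‖ ^ 2 ≤ ∑ i ∈ s, ‖cut (p i) ψ‖ ^ 2 := by
  classical
  simp only [norm_cut_sq]
  rw [sum_comm]
  refine sum_le_sum fun ω _ => ?_
  split_ifs with h
  · obtain ⟨i, hi, hp⟩ := h
    calc ‖ψ ω‖ ^ 2 = if p i ω then ‖ψ ω‖ ^ 2 else 0 := by simp [hp]
      _ ≤ _ := single_le_sum (f := fun i => if p i ω then ‖ψ ω‖ ^ 2 else 0) (fun j _ => by dsimp only; split_ifs <;> positivity) hi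
  · exact sum_nonneg fun j _ => by split_ifs <;> positivity

/-- A layer of unitary maps: `rd ω` are the strings that are queried at the basis state `ω`. -/
structure QLay (n : ℕ) (Ω : Type*) [Fintype Ω] where
  U : Oracle n → Vec Ω ≃ₗᵢ[ℂ] Vec Ω
  rd : Ω → Finset (Str n)
  -- The set of queried strings is conserved by a layer. Hence a projection that is defined by
  -- queried strings may be placed before or after the layer, and on either side of an inner
  -- product.
  comm : ∀ (O : Oracle n) (p : Finset (Str n) → Prop) (ψ : Vec Ω), cut (fun ω => p (rd ω)) (U O ψ) = U O (cut (fun ω => p (rd ω)) ψ)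
  loc : ∀ (O O' : Oracle n) (ψ : Vec Ω), (∀ ω, ψ ω ≠ 0 → ∀ x ∈ rd ω, ∀ c, O x c = O' x c) → U O ψ = U O' ψ

namespace QLay
variable {n : ℕ} (A : QLay n Ω)

theorem comm_symm (O : Oracle n) (p : Finset (Str n) → Prop) (ψ : Vec Ω) :
  cut (fun ω => p (A.rd ω)) ((A.U O).symm ψ) = (A.U O).symm (cut (fun ω => p (A.rd ω)) ψ) := by
  apply (A.U O).injective
  rw [← A.comm, apply_symm_apply, apply_symm_apply]

/-- The projection onto the states that query a string in `Y`. -/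
def hit (Y : Set (Str n)) (ψ : Vec Ω) : Vec Ω := cut (fun ω => ∃ x ∈ A.rd ω, x ∈ Y) ψ

/-- The components that query nothing in `Y` are treated alike by both oracles and cancel. -/
theorem diff_eq (O O' : Oracle n) (Y : Set (Str n)) (h : ∀ x ∉ Y, ∀ c, O x c = O' x c) (ψ : Vec Ω) :
  A.U O ψ - A.U O' ψ = A.U O (A.hit Y ψ) - A.U O' (A.hit Y ψ) := by
  have h1 := A.loc O O' (cut (fun ω => ¬ ∃ x ∈ A.rd ω, x ∈ Y) ψ) (by
    intro ω hω x hx c; apply h; intro hxY; apply hω; simp only [cut_apply, ite_eq_right_iff]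
    grind)
  conv_lhs => rw [← cut_add_cut_not (fun ω => ∃ x ∈ A.rd ω, x ∈ Y) ψ]
  simp only [map_add, h1, hit]
  abel

theorem norm_diff_le (O O' : Oracle n) (Y : Set (Str n)) (h : ∀ x ∉ Y, ∀ c, O x c = O' x c) (ψ : Vec Ω) :
  ‖A.U O ψ - A.U O' ψ‖ ≤ 2 * ‖A.hit Y ψ‖ := by
  rw [A.diff_eq O O' Y h]
  refine (norm_sub_le _ _).trans ?_
  simp only [LinearIsometryEquiv.norm_map]
  linarith

theorem norm_diff_symm_le (O O' : Oracle n) (Y : Set (Str n)) (h : ∀ x ∉ Y, ∀ c, O x c = O' x c) (ψ : Vec Ω) :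
  ‖(A.U O).symm ψ - (A.U O').symm ψ‖ ≤ 2 * ‖A.hit Y ψ‖ := by
  have h1 : ‖(A.U O).symm ψ - (A.U O').symm ψ‖ = ‖A.U O' ((A.U O').symm ψ) - A.U O ((A.U O').symm ψ)‖ := by
    rw [← LinearIsometryEquiv.norm_map (A.U O), map_sub, apply_symm_apply,
      apply_symm_apply]
  rw [h1]
  refine (A.norm_diff_le O' O Y (fun x hx c => (h x hx c).symm) _).trans ?_
  rw [hit, A.comm_symm O' (fun s => ∃ x ∈ s, x ∈ Y), LinearIsometryEquiv.norm_map]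
  exact le_rfl

/-- The projection commutes with the layer and so acts on `β` too. The bound is a product of two
amplitudes at `x`, one forward and one backward. This is what turns the square root of the density
into the density itself. -/
theorem inner_diff_le (O O' : Oracle n) (x : Str n) (p : Finset (Str n) → Prop) (hp : ∀ s, p s → x ∈ s) (β ψ : Vec Ω) :
  ‖inner ℂ β (A.U O (cut (fun ω => p (A.rd ω)) ψ) - A.U O' (cut (fun ω => p (A.rd ω)) ψ))‖ ≤ 2 * ‖A.hit {x} β‖ * ‖A.hit {x} ψ‖ := by
  have h1 : ∀ s : Finset (Str n), p s → ∃ y ∈ s, y ∈ ({x} : Set (Str n)) := fun s hs => ⟨x, hp s hs, rfl⟩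
  have h2 : ∀ O, inner ℂ β (A.U O (cut (fun ω => p (A.rd ω)) ψ)) =
      inner ℂ (cut (fun ω => p (A.rd ω)) β) (A.U O (cut (fun ω => p (A.rd ω)) ψ)) := by
    intro O; rw [← inner_cut, A.comm, cut_cut]; simp
  rw [inner_sub_right, h2, h2, ← inner_sub_right]
  refine (norm_inner_le_norm _ _).trans ?_
  have h3 : ‖cut (fun ω => p (A.rd ω)) β‖ ≤ ‖A.hit {x} β‖ := norm_cut_mono (fun ω => h1 _) β
  have h4 : ‖A.U O (cut (fun ω => p (A.rd ω)) ψ) - A.U O' (cut (fun ω => p (A.rd ω)) ψ)‖ ≤ 2 * ‖A.hit {x} ψ‖ := by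
    refine (norm_sub_le _ _).trans ?_; simp only [LinearIsometryEquiv.norm_map]
    have : ‖cut (fun ω => p (A.rd ω)) ψ‖ ≤ ‖A.hit {x} ψ‖ := norm_cut_mono (fun ω => h1 _) ψ; linarith
  calc _ ≤ ‖A.hit {x} β‖ * (2 * ‖A.hit {x} ψ‖) := mul_le_mul h3 h4 (norm_nonneg _) (norm_nonneg _)
    _ = _ := by ring

theorem hit_singleton (x : Str n) (ψ : Vec Ω) : A.hit {x} ψ = cut (fun ω => x ∈ A.rd ω) ψ := by simp [hit]

theorem norm_hit_sq_le (Y : Set (Str n)) (ι : Type*) (s : Finset ι) (f : ι → Str n) (hY : ∀ y ∈ Y, ∃ i ∈ s, f i = y) (ψ : Vec Ω) :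
  ‖A.hit Y ψ‖ ^ 2 ≤ ∑ i ∈ s, ‖A.hit {f i} ψ‖ ^ 2 := by
  refine le_trans ?_ (norm_cut_exists_le s (fun i ω => ∃ x ∈ A.rd ω, x ∈ ({f i} : Set _)) ψ)
  refine norm_cut_sq_mono (fun ω h => ?_) ψ
  grind

/-- Each basis state is counted once for each of the at most `G` strings that it queries. -/
theorem sum_norm_hit_sq_le {G : ℕ} (hG : ∀ ω, (A.rd ω).card ≤ G) (ψ : Vec Ω) : ∑ x, ‖A.hit {x} ψ‖ ^ 2 ≤ G * ‖ψ‖ ^ 2 := by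
  classical
  simp only [hit_singleton, norm_cut_sq]
  rw [sum_comm, norm_sq_eq, mul_sum]
  refine sum_le_sum fun ω _ => ?_
  rw [← sum_filter, sum_const, nsmul_eq_mul]
  refine mul_le_mul_of_nonneg_right ?_ (by positivity)
  have : (univ.filter fun x => x ∈ A.rd ω) = A.rd ω := by ext; simp
  rw [this]
  exact_mod_cast hG ω
end QLay
end

/-! ### The truncated simulation of a quantum tier -/

section
variable {Ω : Type*} [Fintype Ω] {n : ℕ} (lay : ℕ → QLay n Ω)

/-- The evolution through the first layers, with an oracle for each layer. -/
def evo (Os : ℕ → Oracle n) : ℕ → Vec Ω ≃ₗᵢ[ℂ] Vec Ω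
  | 0 => LinearIsometryEquiv.refl ℂ _
  | k + 1 => (evo Os k).trans ((lay k).U (Os k))

/-- The oracle of the simulation in layer `k`, when the strings in `S` are known. -/
def simO (K : Oracle n) (S : Finset (Str n)) (k : ℕ) : Oracle n := mask K (ball K S k)

/-- The state of the simulation. -/
def phi (K : Oracle n) (S : Finset (Str n)) (ψ : Vec Ω) (k : ℕ) : Vec Ω := evo lay (simO K S) k ψ

/-- The state of the tier. -/
def real (K : Oracle n) (ψ : Vec Ω) (k : ℕ) : Vec Ω := evo lay (fun _ => K) k ψ

/-- The strings on which the simulation errs in layer `k`. -/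
def bad (K : Oracle n) (S : Finset (Str n)) (k : ℕ) : Set (Str n) := {x | x ∉ ball K S k ∧ ∃ c, K x c ≠ invalid _}

open Classical in
/-- An element of `s` that lies in `Y`. -/
def rep (Y : Set (Str n)) (s : Finset (Str n)) : Option (Str n) :=
  if h : ∃ x ∈ s, x ∈ Y then some h.choose else none

variable {x : Str n} {k : ℕ}

theorem rep_eq_some {Y : Set (Str n)} {s : Finset (Str n)} (h : rep Y s = some x) : x ∈ s ∧ x ∈ Y := by
  unfold rep at h
  split_ifs at h with h1
  grind

theorem exists_rep {Y : Set (Str n)} {s : Finset (Str n)} (h : ∃ x ∈ s, x ∈ Y) : ∃ x, rep Y s = some x := by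
  unfold rep
  rw [dif_pos h]
  exact ⟨_, rfl⟩

/-- The part of the error that starts at the string `x`. -/
def dl (K : Oracle n) (S : Finset (Str n)) (ψ : Vec Ω) (x : Str n) : ℕ → Vec Ω
  | 0 => 0
  | k + 1 => (lay k).U K (dl K S ψ x k) +
    ((lay k).U K (cut (fun ω => rep (bad K S k) ((lay k).rd ω) = some x) (phi lay K S ψ k)) - (lay k).U (simO K S k)
      (cut (fun ω => rep (bad K S k) ((lay k).rd ω) = some x) (phi lay K S ψ k)))

/-- An approximation to `dl` that uses only the strings near `S` and near `x`. -/
def dd (K : Oracle n) (S : Finset (Str n)) (ψ : Vec Ω) (x : Str n) : ℕ → Vec Ω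
  | 0 => 0
  | k + 1 => (lay k).U (simO K (insert x S) k) (dd K S ψ x k) +
    ((lay k).U (mask K (insert x (ball K S k))) (phi lay K S ψ k) - (lay k).U (simO K S k) (phi lay K S ψ k))

open Classical in
/-- The amplitude with which layer `k` of the simulation queries the bad string `x`. -/
def amp (K : Oracle n) (S : Finset (Str n)) (ψ : Vec Ω) (k : ℕ) (x : Str n) : ℝ :=
  if x ∈ bad K S k then ‖(lay k).hit {x} (phi lay K S ψ k)‖ else 0

variable {lay} {K K' : Oracle n} {S : Finset (Str n)} {ψ : Vec Ω}

theorem phi_succ (k : ℕ) : phi lay K S ψ (k + 1) = (lay k).U (simO K S k) (phi lay K S ψ k) := rfl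

theorem real_succ (k : ℕ) : real lay K ψ (k + 1) = (lay k).U K (real lay K ψ k) := rfl

theorem norm_phi (k : ℕ) : ‖phi lay K S ψ k‖ = ‖ψ‖ := LinearIsometryEquiv.norm_map _ _

theorem norm_real (k : ℕ) : ‖real lay K ψ k‖ = ‖ψ‖ := LinearIsometryEquiv.norm_map _ _

theorem simO_agree (k : ℕ) : ∀ x ∉ bad K S k, ∀ c, K x c = simO K S k x c := by
  intro x hx c
  unfold simO mask
  split_ifs with h
  · rfl
  · by_contra h2; exact hx ⟨h, c, h2⟩

/-- A basis state may query several bad strings; `rep` charges it to exactly one of them, so that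
the parts of the error add up without overlap. -/
theorem real_eq (k : ℕ) : real lay K ψ k = phi lay K S ψ k + ∑ x, dl lay K S ψ x k := by
  classical
  induction k with
  | zero => simp [real, phi, evo, dl]
  | succ k ih =>
    rw [real_succ, ih, phi_succ, map_add, map_sum]; simp only [dl]
    rw [sum_add_distrib, sum_sub_distrib, ← map_sum, ← map_sum, ← map_sum]
    have h1 : ∑ x, cut (fun ω => rep (bad K S k) ((lay k).rd ω) = some x) (phi lay K S ψ k) =
        (lay k).hit (bad K S k) (phi lay K S ψ k) := by
      ext ω; rw [WithLp.ofLp_sum, Finset.sum_apply]; simp only [cut_apply, QLay.hit]; split_ifs with h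
      · obtain ⟨x, hx⟩ := exists_rep h; simp [hx]
      · refine sum_eq_zero fun x _ => ?_; rw [if_neg]; intro hx; exact h ⟨x, rep_eq_some hx⟩
    rw [h1, ← (lay k).diff_eq K (simO K S k) _ (simO_agree k)]; abel

theorem norm_real_sub_phi_le (k : ℕ) : ‖real lay K ψ k - phi lay K S ψ k‖ ≤
  ∑ j ∈ range k, 2 * ‖(lay j).hit (bad K S j) (phi lay K S ψ j)‖ := by
  induction k with
  | zero => simp [real, phi, evo]
  | succ k ih =>
    rw [sum_range_succ, real_succ, phi_succ]; have h := (lay k).norm_diff_le K (simO K S k) _ (simO_agree k) (phi lay K S ψ k)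
    calc _ = ‖(lay k).U K (real lay K ψ k - phi lay K S ψ k) + ((lay k).U K (phi lay K S ψ k) -
          (lay k).U (simO K S k) (phi lay K S ψ k))‖ := by rw [map_sub]; congr 1; abel
      _ ≤ _ := norm_add_le _ _
      _ ≤ _ := by rw [LinearIsometryEquiv.norm_map]; exact add_le_add ih h

theorem norm_cut_rep_le (k : ℕ) (x : Str n) :
  ‖cut (fun ω => rep (bad K S k) ((lay k).rd ω) = some x) (phi lay K S ψ k)‖ ≤ amp lay K S ψ k x := by
  unfold amp
  split_ifs with h
  · exact norm_cut_mono (fun ω hω => ⟨x, (rep_eq_some hω).1, rfl⟩) _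
  · have : cut (fun ω => rep (bad K S k) ((lay k).rd ω) = some x) (phi lay K S ψ k) = 0 := by
      rw [← cut_false (phi lay K S ψ k)]; exact cut_congr fun ω _ => ⟨fun hω => h (rep_eq_some hω).2, False.elim⟩
    rw [this, norm_zero]

theorem norm_dl_le (x : Str n) (k : ℕ) : ‖dl lay K S ψ x k‖ ≤ ∑ j ∈ range k, 2 * amp lay K S ψ j x := by
  induction k with
  | zero => simp [dl]
  | succ k ih =>
    rw [sum_range_succ, dl]; refine (norm_add_le _ _).trans (add_le_add ?_ ?_)
    · rwa [LinearIsometryEquiv.norm_map]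
    · refine (norm_sub_le _ _).trans ?_; rw [LinearIsometryEquiv.norm_map, LinearIsometryEquiv.norm_map]
      linarith [norm_cut_rep_le (lay := lay) (K := K) (S := S) (ψ := ψ) k x]

theorem mask_insert_eq {T : Finset (Str n)} (h : x ∈ T ∨ ∀ c, K x c = invalid _) : mask K (insert x T) = mask K T := by
  funext y c
  unfold mask
  by_cases hy : y = x
  · grind
  · simp [hy]

theorem mask_insert_eq_of_not_bad (h : x ∉ bad K S k) : mask K (insert x (ball K S k)) = simO K S k := by
  refine mask_insert_eq ?_
  by_cases hx : x ∈ ball K S k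
  · exact .inl hx
  · refine .inr fun c => ?_; by_contra hc; exact h ⟨hx, c, hc⟩

theorem mask_insert_agree {T : Finset (Str n)} : ∀ y ∉ ({x} : Set (Str n)), ∀ c, mask K (insert x T) y c = mask K T y c := by
  intro y hy c
  have : y ≠ x := hy
  simp [mask, this]

theorem norm_dd_le (x : Str n) (k : ℕ) : ‖dd lay K S ψ x k‖ ≤ ∑ j ∈ range k, 2 * amp lay K S ψ j x := by
  induction k with
  | zero => simp [dd]
  | succ k ih =>
    rw [sum_range_succ, dd]; refine (norm_add_le _ _).trans (add_le_add ?_ ?_)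
    · rwa [LinearIsometryEquiv.norm_map]
    · unfold amp; split_ifs with h
      · exact (lay k).norm_diff_le _ _ _ mask_insert_agree _
      · rw [mask_insert_eq_of_not_bad h]; simp

open Classical in
/-- The amplitude with which layer `k` queries `x` and another bad string. -/
def amp2 (lay : ℕ → QLay n Ω) (K : Oracle n) (S : Finset (Str n)) (ψ : Vec Ω) (k : ℕ) (x : Str n) : ℝ :=
  if x ∈ bad K S k then
    ‖cut (fun ω => x ∈ (lay k).rd ω ∧ ∃ y ∈ (lay k).rd ω, y ≠ x ∧ y ∈ bad K S k) (phi lay K S ψ k)‖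
  else 0

/-- Split the part of the state that queries `x` into `s`, where `x` is the only bad string, and
`q`, where there is another one. On `s` the true oracle and the one that reveals only `x` give the
same answers, and `rep` has to choose `x`. What remains are four vectors of norm at most `‖q‖`, and
`q` already contains two lucky guesses. -/
theorem norm_bracket_le (x : Str n) (k : ℕ) :
  ‖((lay k).U K (cut (fun ω => rep (bad K S k) ((lay k).rd ω) = some x) (phi lay K S ψ k)) - (lay k).U (simO K S k)
      (cut (fun ω => rep (bad K S k) ((lay k).rd ω) = some x) (phi lay K S ψ k))) -
    ((lay k).U (mask K (insert x (ball K S k))) (phi lay K S ψ k) -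
     (lay k).U (simO K S k) (phi lay K S ψ k))‖ ≤ 4 * amp2 lay K S ψ k x := by
  classical
  unfold amp2
  set A := lay k
  set φ := phi lay K S ψ k
  split_ifs with hx
  swap
  · rw [mask_insert_eq_of_not_bad hx]
    have : cut (fun ω => rep (bad K S k) (A.rd ω) = some x) φ = 0 := by
      rw [← cut_false φ]; exact cut_congr fun ω _ => ⟨fun hω => hx (rep_eq_some hω).2, False.elim⟩
    rw [this]; simp
  set q := cut (fun ω => x ∈ A.rd ω ∧ ∃ y ∈ A.rd ω, y ≠ x ∧ y ∈ bad K S k) φ with hq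
  set s := cut (fun ω => x ∈ A.rd ω ∧ ¬ ∃ y ∈ A.rd ω, y ≠ x ∧ y ∈ bad K S k) φ with hs
  set q' := cut (fun ω => rep (bad K S k) (A.rd ω) = some x) q with hq'
  have h1 : cut (fun ω => rep (bad K S k) (A.rd ω) = some x) φ = s + q' := by
    ext ω; simp only [hs, hq', hq, cut_apply, PiLp.add_apply]; by_cases hxr : x ∈ A.rd ω
    · by_cases hy : ∃ y ∈ A.rd ω, y ≠ x ∧ y ∈ bad K S k
      · simp [hxr, hy]
      · obtain ⟨z, hz⟩ := exists_rep (Y := bad K S k) ⟨x, hxr, hx⟩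
        have hzx : z = x := by by_contra hne; exact hy ⟨z, (rep_eq_some hz).1, hne, (rep_eq_some hz).2⟩
        rw [hzx] at hz; simp [hxr, hy, hz]
    · have : rep (bad K S k) (A.rd ω) ≠ some x := fun h => hxr (rep_eq_some h).1; simp [hxr, this]
  have h2 : A.U (mask K (insert x (ball K S k))) φ - A.U (simO K S k) φ =
      A.U (mask K (insert x (ball K S k))) (s + q) - A.U (simO K S k) (s + q) := by
    rw [A.diff_eq _ (simO K S k) {x} mask_insert_agree]
    have : A.hit {x} φ = s + q := by
      rw [A.hit_singleton]; ext ω; simp only [hs, hq, cut_apply, PiLp.add_apply]; by_cases hxr : x ∈ A.rd ω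
      · by_cases hy : ∃ y ∈ A.rd ω, y ≠ x ∧ y ∈ bad K S k
        · simp [hxr, hy]
        · simp [hxr, hy]
      · simp [hxr]
    rw [this]
  have h3 : A.U K s = A.U (mask K (insert x (ball K S k))) s := by
    apply A.loc; intro ω hω y hy c
    have hω' : x ∈ A.rd ω ∧ ¬ ∃ y ∈ A.rd ω, y ≠ x ∧ y ∈ bad K S k := by
      by_contra h
      exact hω (by simp only [hs, cut_apply, if_neg h])
    by_cases hyx : y = x
    · simp [mask, hyx]
    · have hyb : y ∉ bad K S k := fun h => hω'.2 ⟨y, hy, hyx, h⟩; rw [simO_agree k y hyb, mask_insert_agree y hyx]; rfl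
  rw [h1, h2]
  have h4 : (A.U K (s + q') - A.U (simO K S k) (s + q')) - (A.U (mask K (insert x (ball K S k))) (s + q) - A.U (simO K S k) (s + q)) =
      (A.U K q' - A.U (simO K S k) q') -
      (A.U (mask K (insert x (ball K S k))) q - A.U (simO K S k) q) := by
    simp only [map_add, h3]; abel
  rw [h4]
  have h5 : ‖q'‖ ≤ ‖q‖ := norm_cut_le _ _
  refine (norm_sub_le _ _).trans ?_
  refine (add_le_add (norm_sub_le _ _) (norm_sub_le _ _)).trans ?_
  simp only [LinearIsometryEquiv.norm_map]
  linarith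

/-- After the first guess `x`, the two vectors evolve with the true oracle and with the truncated
one that knows `x`. They separate only by a further guess: a later one that `dd` makes, or a
simultaneous one, measured by `amp2`. -/
theorem norm_dl_sub_dd_le (x : Str n) (k : ℕ) : ‖dl lay K S ψ x k - dd lay K S ψ x k‖ ≤ ∑ j ∈ range k,
    (2 * ‖(lay j).hit (bad K (insert x S) j) (dd lay K S ψ x j)‖ + 4 * amp2 lay K S ψ j x) := by
  induction k with
  | zero => simp [dl, dd]
  | succ k ih =>
    rw [sum_range_succ]; have h := (lay k).norm_diff_le K (simO K (insert x S) k) _ (simO_agree k) (dd lay K S ψ x k)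
    have h2 := norm_bracket_le (lay := lay) (K := K) (S := S) (ψ := ψ) x k; set A := lay k; rw [dl, dd]
    set B := A.U K (cut (fun ω => rep (bad K S k) (A.rd ω) = some x) (phi lay K S ψ k)) -
       A.U (simO K S k) (cut (fun ω => rep (bad K S k) (A.rd ω) = some x) (phi lay K S ψ k))
    set B' := A.U (mask K (insert x (ball K S k))) (phi lay K S ψ k) - A.U (simO K S k) (phi lay K S ψ k)
    calc _ = ‖A.U K (dl lay K S ψ x k - dd lay K S ψ x k) + ((A.U K (dd lay K S ψ x k) - A.U (simO K (insert x S) k) (dd lay K S ψ x k)) +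
            (B - B'))‖ := by rw [map_sub]; congr 1; abel
      _ ≤ _ := norm_add_le _ _
      _ ≤ _ := by rw [LinearIsometryEquiv.norm_map]; exact add_le_add ih ((norm_add_le _ _).trans (add_le_add h h2))

/-! ### Backward evolution of a test vector. -/

/-- The state before layer `j` of the computation that ends in `β`. -/
def back (lay : ℕ → QLay n Ω) (Os : ℕ → Oracle n) (k : ℕ) (β : Vec Ω) (j : ℕ) : Vec Ω := evo lay Os j ((evo lay Os k).symm β)

theorem back_self (Os : ℕ → Oracle n) (k : ℕ) (β : Vec Ω) : back lay Os k β k = β := by simp [back]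

theorem back_eq (Os : ℕ → Oracle n) (k : ℕ) (β : Vec Ω) (j : ℕ) :
  back lay Os k β j = ((lay j).U (Os j)).symm (back lay Os k β (j + 1)) := by
  simp [back, evo]

theorem back_succ (Os : ℕ → Oracle n) (k : ℕ) (β : Vec Ω) (j : ℕ) : back lay Os k β (j + 1) = (lay j).U (Os j) (back lay Os k β j) := by
  simp [back, evo]

theorem norm_back (Os : ℕ → Oracle n) (k : ℕ) (β : Vec Ω) (j : ℕ) : ‖back lay Os k β j‖ = ‖β‖ := by simp [back]

/-- The true evolution preserves the inner product of `dl` with the backward evolved vector. It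
changes only where a new contribution at `x` is born, and `inner_diff_le` bounds each of these. -/
theorem norm_inner_dl_le (x : Str n) (m : ℕ) (β : Vec Ω) (k : ℕ) :
  ‖inner ℂ (back lay (fun _ => K) m β k) (dl lay K S ψ x k)‖ ≤ ∑ j ∈ range k,
    2 * ‖(lay j).hit {x} (back lay (fun _ => K) m β (j + 1))‖ * amp lay K S ψ j x := by
  induction k with
  | zero => simp [dl]
  | succ k ih =>
    rw [sum_range_succ, dl, inner_add_right]; refine (norm_add_le _ _).trans (add_le_add ?_ ?_)
    · rwa [back_succ, LinearIsometryEquiv.inner_map_map]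
    · by_cases h : x ∈ bad K S k
      · simp only [amp, if_pos h]; exact (lay k).inner_diff_le K (simO K S k) x _ (fun s hs => (rep_eq_some hs).1) _ _
      · have : cut (fun ω => rep (bad K S k) ((lay k).rd ω) = some x) (phi lay K S ψ k) = 0 := by
          rw [← norm_le_zero_iff]; refine (norm_cut_rep_le k x).trans ?_; simp [amp, h]
        rw [this]; simp [amp, h]

/-- The hybrid argument in reverse: going back from layer `k`, every layer costs the amplitude with
which the approximate state queries a wrongly answered string. The amplitude is measured after the
layer, hence the index `i + 1`. -/
theorem norm_back_sub_le (Os : ℕ → Oracle n) (Y : ℕ → Set (Str n)) (k : ℕ) (hY : ∀ j < k, ∀ x ∉ Y j, ∀ c, K x c = Os j x c) (β : Vec Ω)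
  {j : ℕ} (hj : j ≤ k) :
  ‖back lay (fun _ => K) k β j - back lay Os k β j‖ ≤ ∑ i ∈ Finset.Ico j k, 2 * ‖(lay i).hit (Y i) (back lay Os k β (i + 1))‖ := by
  induction hj using Nat.decreasingInduction with
  | self => simp [back_self]
  | of_succ j hj ih =>
    rw [Finset.sum_eq_sum_Ico_succ_bot hj, back_eq, back_eq Os]
    have h := (lay j).norm_diff_symm_le K (Os j) (Y j) (hY j hj) (back lay Os k β (j + 1)); set A := lay j
    calc _ = ‖((A.U K).symm (back lay Os k β (j + 1)) - (A.U (Os j)).symm (back lay Os k β (j + 1)))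
          + (A.U K).symm (back lay (fun _ => K) k β (j + 1) - back lay Os k β (j + 1))‖ := by rw [map_sub]; congr 1; abel
      _ ≤ _ := norm_add_le _ _
      _ ≤ _ := by rw [LinearIsometryEquiv.norm_map]; exact add_le_add h ih

/-! ### Locality -/

theorem Agree.simO_eq (h : Agree K K' (ball K S k)) {j : ℕ} (hj : j < k) : simO K' S j = simO K S j := by
  unfold simO
  rw [h.ball_eq hj.le]
  exact mask_congr fun x hx c => h.answer hj hx c

theorem evo_congr {Os Os' : ℕ → Oracle n} (h : ∀ j < k, Os j = Os' j) : evo lay Os k = evo lay Os' k := by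
  induction k with
  | zero => rfl
  | succ k ih => simp only [evo, ih fun j hj => h j (by omega), h k (by omega)]

theorem Agree.phi_eq (h : Agree K K' (ball K S k)) : phi lay K' S ψ k = phi lay K S ψ k := by
  unfold phi
  rw [evo_congr fun j hj => h.simO_eq hj]

/-- All masks that occur in `dd` up to layer `k` live in the ball of radius `k` around `S` and `x`.
A program that has explored this ball can therefore compute `dd`. -/
theorem Agree.dd_eq (h : Agree K K' (ball K (insert x S) k)) : dd lay K' S ψ x k = dd lay K S ψ x k := by
  induction k with
  | zero => rfl
  | succ k ih =>
    have h0 : Agree K K' (ball K S (k + 1)) := h.mono (ball_mono_left (subset_insert _ _) _)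
    have h1 : Agree K K' (ball K S k) := h0.mono (ball_subset_succ k); simp only [dd]
    rw [ih (h.mono (ball_subset_succ k)), h1.phi_eq, h.simO_eq (Nat.lt_succ_self k),
      h0.simO_eq (Nat.lt_succ_self k), h0.ball_eq (le_succ k)]
    have : mask K' (insert x (ball K S k)) = mask K (insert x (ball K S k)) := by
      refine mask_congr fun y hy c => ?_; refine h.answer (Nat.lt_succ_self k) ?_ c; rcases mem_insert.1 hy with rfl | hy
      · exact subset_ball k (Finset.mem_insert_self _ _)
      · exact ball_mono_left (subset_insert _ _) _ hy
    rw [this]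
end

/-! ### Labellings and black boxes without some vertices -/

section
variable {n : ℕ} (T : WeldedTree n) (χ : EdgeColouring T.graph)

/-- `v` and `w` are joined by an edge of colour `c`. -/
def Joined (v w : Vertex n) (c : Bits 4) : Prop := T.graph.Adj v w ∧ (χ.colour s(v, w) : ℕ) = colourCode c

variable {T χ}

variable {v w : Vertex n} {c : Bits 4} {k : ℕ} {S : Finset (Str n)}

theorem Joined.symm (h : Joined T χ v w c) : Joined T χ w v c := ⟨h.1.symm, by rw [Sym2.eq_swap]; exact h.2⟩

theorem Joined.unique {v w w' : Vertex n} (h : Joined T χ v w c) (h' : Joined T χ v w' c) : w = w' :=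
  χ.proper v w w' h.1 h'.1 (Fin.ext (h.2.trans h'.2.symm))

variable (T χ)

open Classical in
/-- The black box of the tree without the vertices in `H`. -/
def hid (ℓ : Labelling n) (H : Set (Vertex n)) : Oracle n := fun x c =>
  if h : ∃ w v, ℓ.1 v = x ∧ v ∉ H ∧ w ∉ H ∧ Joined T χ v w c then ℓ.1 h.choose else invalid _

variable {T χ} {ℓ : Labelling n} {H : Set (Vertex n)}

theorem hid_of_joined (hv : v ∉ H) (hw : w ∉ H) (h : Joined T χ v w c) : hid T χ ℓ H (ℓ.1 v) c = ℓ.1 w := by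
  have h0 : ∃ w v', ℓ.1 v' = ℓ.1 v ∧ v' ∉ H ∧ w ∉ H ∧ Joined T χ v' w c := ⟨w, v, rfl, hv, hw, h⟩
  unfold hid
  rw [dif_pos h0]
  obtain ⟨v', hv', -, -, h'⟩ := h0.choose_spec
  rw [ℓ.2.1 hv'] at h'
  rw [h'.unique h]

theorem hid_cases (x : Str n) (c : Bits 4) : (∃ v w, ℓ.1 v = x ∧ v ∉ H ∧ w ∉ H ∧ Joined T χ v w c ∧ hid T χ ℓ H x c = ℓ.1 w) ∨
    ((¬ ∃ v w, ℓ.1 v = x ∧ v ∉ H ∧ w ∉ H ∧ Joined T χ v w c) ∧ hid T χ ℓ H x c = invalid _) := by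
  by_cases h : ∃ v w, ℓ.1 v = x ∧ v ∉ H ∧ w ∉ H ∧ Joined T χ v w c
  · obtain ⟨v, w, rfl, hv, hw, hj⟩ := h; exact .inl ⟨v, w, rfl, hv, hw, hj, hid_of_joined hv hw hj⟩
  · refine .inr ⟨h, ?_⟩; unfold hid; rw [dif_neg]; rintro ⟨w, v, h'⟩; exact h ⟨v, w, h'⟩

theorem hid_eq_label {x : Str n} (h : hid T χ ℓ H x c ≠ invalid _) :
  ∃ v w, ℓ.1 v = x ∧ v ∉ H ∧ w ∉ H ∧ Joined T χ v w c ∧ hid T χ ℓ H x c = ℓ.1 w :=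
  (hid_cases x c).resolve_right fun h' => h h'.2

theorem hid_empty : hid T χ ℓ ∅ = blackBox T χ ℓ := by
  funext x c
  unfold blackBox
  rcases hid_cases (H := ∅) x c with ⟨v, w, hv, -, -, hj, h⟩ | ⟨h, h'⟩
  · have h0 : ∃ v u, ℓ.1 u = x ∧ T.graph.Adj u v ∧ (χ.colour s(u, v) : ℕ) = colourCode c := ⟨w, v, hv, hj⟩
    rw [h, dif_pos h0]; obtain ⟨v', hv', hj'⟩ := h0.choose_spec; rw [← hv] at hv'; rw [ℓ.2.1 hv'] at hj'; rw [hj.unique hj']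
  · rw [h', dif_neg]; rintro ⟨v, u, h1, h2⟩
    exact h ⟨u, v, h1, by simp, by simp, h2⟩

theorem leaf_injective : Function.Injective (leaf n) := by
  intro i j h
  have := congrArg Subtype.val h
  simp only [leaf] at this
  exact Fin.ext (by omega)

theorem card_neighbours_le (T : WeldedTree n) (v : Vertex n) : ∃ s : Finset (Vertex n), s.card ≤ 3 ∧ ∀ w, T.graph.Adj v w → w ∈ s := by
  classical
  obtain ⟨b, i, hi⟩ := v
  have hi' := Finset.mem_Ico.1 hi
  -- Numbers outside the range, such as the parent number `0` of the root, are sent to the root.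
  -- This is harmless, because only a superset of the neighbours is needed.
  let nd : ℕ → Node n := fun j => if h : j ∈ Finset.Ico 1 (2 ^ (n + 1)) then ⟨j, h⟩ else root n
  have hnd : ∀ (j : ℕ) (a : Node n), (a : ℕ) = j → a = nd j := by grind
  by_cases hl : 2 ^ n ≤ i
  · obtain ⟨j, hj⟩ : ∃ j : Fin (2 ^ n), (⟨i, hi⟩ : Node n) = leaf n j := by
      refine ⟨⟨i - 2 ^ n, by rw [pow_succ] at hi'; omega⟩, ?_⟩
      apply Subtype.ext; simp only [leaf]; omega
    rw [hj]
    have hpar : ∀ (b' : Bool) (w : Vertex n), b' = w.1 → ((leaf n j : Node n) : ℕ) = (w.2 : ℕ) / 2 → False := by grind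
    cases b
    · refine ⟨{(false, nd (i / 2)), (true, leaf n (T.right (T.left.symm j))),
        (true, leaf n (T.right ((finRotate (2 ^ n)).symm (T.left.symm j))))},
        Finset.card_le_three, ?_⟩
      rintro ⟨b', a⟩ h; simp only [mem_insert, mem_singleton]; rw [WeldedTree.graph, SimpleGraph.fromRel_adj] at h
      rcases h with ⟨-, (⟨h1, h2⟩ | ⟨k, h1, h2⟩) | (⟨h1, h2⟩ | ⟨k, h1, h2⟩)⟩
      · exact (hpar _ _ h1 h2).elim
      · obtain rfl : k = T.left.symm j := by rw [Equiv.eq_symm_apply]; exact (leaf_injective (congrArg Prod.snd h1)).symm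
        exact .inr h2
      · left; simp only at h1 h2; subst h1; congr 1; apply hnd; rw [h2, ← hj]
      · simp at h2
    · refine ⟨{(true, nd (i / 2)), (false, leaf n (T.left (T.right.symm j))),
        (false, leaf n (T.left (finRotate (2 ^ n) (T.right.symm j))))},
        Finset.card_le_three, ?_⟩
      rintro ⟨b', a⟩ h; simp only [mem_insert, mem_singleton]; rw [WeldedTree.graph, SimpleGraph.fromRel_adj] at h
      rcases h with ⟨-, (⟨h1, h2⟩ | ⟨k, h1, h2⟩) | (⟨h1, h2⟩ | ⟨k, h1, h2⟩)⟩
      · exact (hpar _ _ h1 h2).elim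
      · simp at h1
      · left; simp only at h1 h2; subst h1; congr 1; apply hnd; rw [h2, ← hj]
      · right; rw [h1]; rcases h2 with h2 | h2
        · left; have := leaf_injective (congrArg Prod.snd h2); rw [this]; simp
        · right; have := leaf_injective (congrArg Prod.snd h2); rw [this]; simp
  · have hlf : ∀ j : Fin (2 ^ n), (⟨i, hi⟩ : Node n) ≠ leaf n j := by
      intro j h; have := congrArg Subtype.val h; simp only [leaf] at this; omega
    refine ⟨{(b, nd (i / 2)), (b, nd (2 * i)), (b, nd (2 * i + 1))}, Finset.card_le_three, ?_⟩; rintro ⟨b', a⟩ h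
    simp only [mem_insert, mem_singleton]; rw [WeldedTree.graph, SimpleGraph.fromRel_adj] at h
    rcases h with ⟨-, (⟨h1, h2⟩ | ⟨k, h1, h2⟩) | (⟨h1, h2⟩ | ⟨k, h1, h2⟩)⟩
    · grind
    · grind
    · grind
    · grind

theorem tame_hid : Tame (hid T χ ℓ H) where
  symm x c h := by obtain ⟨v, w, rfl, hv, hw, hj, h'⟩ := hid_eq_label h; rw [h', hid_of_joined hw hv hj.symm]
  inv c := by by_contra h; obtain ⟨v, w, h1, -⟩ := hid_eq_label h; exact ℓ.2.2.2 v h1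
  deg x := by
    classical
    by_cases h : ∃ v, ℓ.1 v = x
    · obtain ⟨v, rfl⟩ := h; obtain ⟨s, hs, hs'⟩ := card_neighbours_le T v
      refine le_trans (card_le_card (t := s.image ℓ.1) ?_) (Finset.card_image_le.trans hs); intro y hy
      rw [mem_filter] at hy; obtain ⟨-, hy, c, rfl⟩ := hy; obtain ⟨v', w, h1, hv, hw, hj, h'⟩ := hid_eq_label hy
      rw [ℓ.2.1 h1] at hj; rw [h']; exact Finset.mem_image_of_mem _ (hs' w hj.1)
    · rw [Finset.card_eq_zero.2]
      · simp
      · rw [Finset.filter_eq_empty_iff]; rintro y - ⟨hy, c, rfl⟩; obtain ⟨v, w, h1, -⟩ := hid_eq_label hy; grind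

/-! ### Balls of vertices -/

variable (T) in
open Classical in
/-- The vertices at distance at most `k` from `v`. -/
def vball (v : Vertex n) : ℕ → Finset (Vertex n)
  | 0 => {v}
  | k + 1 => vball v k ∪ (vball v k).biUnion fun w => univ.filter fun a => T.graph.Adj w a

theorem mem_vball_succ {v a : Vertex n} : a ∈ vball T v (k + 1) ↔ a ∈ vball T v k ∨ ∃ w ∈ vball T v k, T.graph.Adj w a := by simp [vball]

theorem vball_mono {j k : ℕ} (h : j ≤ k) : vball T v j ⊆ vball T v k := by
  induction k, h using Nat.le_induction with
  | base => exact subset_rfl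
  | succ k _ ih => exact ih.trans subset_union_left

theorem self_mem_vball (v : Vertex n) (k : ℕ) : v ∈ vball T v k := vball_mono (Nat.zero_le k) (Finset.mem_singleton_self v)

theorem mem_vball_of_adj {v w a : Vertex n} (h : w ∈ vball T v k) (h' : T.graph.Adj w a) :
  a ∈ vball T v (k + 1) := mem_vball_succ.2 (Or.inr ⟨w, h, h'⟩)

theorem vball_subset_of_adj (h : T.graph.Adj v w) (k : ℕ) : vball T w k ⊆ vball T v (k + 1) := by
  induction k with
  | zero =>
    intro a ha; rw [vball, mem_singleton] at ha; rw [ha]; exact mem_vball_of_adj (self_mem_vball v 0) h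
  | succ k ih =>
    intro a ha; rcases mem_vball_succ.1 ha with ha | ⟨b, hb, ha⟩
    · exact vball_mono (le_succ _) (ih ha)
    · exact mem_vball_of_adj (ih hb) ha

theorem mem_vball_comm (h : w ∈ vball T v k) : v ∈ vball T w k := by
  induction k generalizing w with
  | zero => rw [vball, mem_singleton] at h ⊢; exact h.symm
  | succ k ih =>
    rcases mem_vball_succ.1 h with h | ⟨a, ha, h⟩
    · exact vball_mono (le_succ k) (ih h)
    · exact vball_subset_of_adj h.symm k (ih ha)

theorem card_vball_succ_sdiff (v : Vertex n) (k : ℕ) : (vball T v (k + 1) \ vball T v k).card ≤ 3 * 2 ^ k ∧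
    ∀ a ∈ vball T v (k + 1) \ vball T v k, ∃ w ∈ vball T v k, T.graph.Adj a w := by
  classical
  have h2 : ∀ k, ∀ a ∈ vball T v (k + 1) \ vball T v k, ∃ w ∈ vball T v k, T.graph.Adj a w := by
    intro k a ha; rw [mem_sdiff, mem_vball_succ] at ha; obtain ⟨w, hw, h⟩ := ha.1.resolve_left ha.2; exact ⟨w, hw, h.symm⟩
  refine ⟨?_, h2 k⟩
  induction k with
  | zero =>
    obtain ⟨s, hs, hs'⟩ := card_neighbours_le T v
    refine le_trans (card_le_card ?_) (by simpa using hs)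
    intro a ha; obtain ⟨w, hw, h⟩ := h2 0 a ha; rw [vball, mem_singleton] at hw; exact hs' a (hw ▸ h.symm)
  | succ k ih =>
    have h1 : vball T v (k + 2) \ vball T v (k + 1) ⊆ (vball T v (k + 1) \ vball T v k).biUnion fun w =>
          (univ.filter fun a => T.graph.Adj w a) \ vball T v k := by
      intro a ha; obtain ⟨w, hw, h⟩ := h2 (k + 1) a ha; have hak := (mem_sdiff.1 ha).2; rw [Finset.mem_biUnion]
      refine ⟨w, mem_sdiff.2 ⟨hw, fun hw' => hak (mem_vball_of_adj hw' h.symm)⟩, ?_⟩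
      exact mem_sdiff.2 ⟨by simp [h.symm], fun h' => hak (vball_mono (le_succ k) h')⟩
    refine (card_le_card h1).trans ((Finset.card_biUnion_le_card_mul _ _ 2 ?_).trans ?_)
    · intro w hw; obtain ⟨b, hb, hwb⟩ := h2 k w hw; obtain ⟨s, hs, hs'⟩ := card_neighbours_le T w
      have h3 : (univ.filter fun a => T.graph.Adj w a) \ vball T v k ⊆ s.erase b := by grind
      have := card_le_card h3; rw [Finset.card_erase_of_mem (hs' b hwb)] at this; omega
    · grind

theorem card_vball (v : Vertex n) (k : ℕ) : (vball T v k).card ≤ 3 * 2 ^ k := by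
  classical
  suffices h : (vball T v k).card + 2 ≤ 3 * 2 ^ k by omega
  induction k with
  | zero => simp [vball]
  | succ k ih =>
    have h := (card_vball_succ_sdiff (T := T) v k).1; grind

theorem exists_of_mem_ball (h : ℓ.1 v ∈ ball (hid T χ ℓ H) S k) : ∃ w ∈ vball T v k, ℓ.1 w ∈ S := by
  induction k generalizing v with
  | zero => exact ⟨v, self_mem_vball v 0, h⟩
  | succ k ih =>
    rcases mem_grow.1 h with h | ⟨h1, x, hx, c, hc⟩
    · obtain ⟨w, hw, hw'⟩ := ih h; exact ⟨w, vball_mono (le_succ k) hw, hw'⟩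
    · obtain ⟨a, b, rfl, -, -, hj, h2⟩ := hid_eq_label (hc ▸ h1); rw [hc] at h2; rw [← ℓ.2.1 h2] at hj
      obtain ⟨w, hw, hw'⟩ := ih hx; exact ⟨w, vball_subset_of_adj hj.1.symm k hw, hw'⟩

theorem mem_ball_of_vball (hw : w ∈ vball T v k) (h : ℓ.1 w ∈ S) (hcol : ∀ a b, T.graph.Adj a b → ∃ c, Joined T χ a b c) :
  ℓ.1 v ∈ ball (hid T χ ℓ ∅) S k := by
  have hv := mem_vball_comm hw
  clear hw
  induction k generalizing v with
  | zero => rw [vball, mem_singleton] at hv; rw [hv]; exact h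
  | succ k ih =>
    rcases mem_vball_succ.1 hv with hv | ⟨a, ha, hv⟩
    · exact ball_subset_succ k (ih hv)
    · obtain ⟨c, hc⟩ := hcol a v hv; refine mem_grow.2 (Or.inr ⟨ℓ.2.2.2 v, ℓ.1 a, ih ha, c, ?_⟩)
      exact hid_of_joined (by simp) (by simp) hc

theorem exists_joined {a b : Vertex n} (h : T.graph.Adj a b) : ∃ c, Joined T χ a b c := by
  obtain ⟨k, hk⟩ : ∃ k, χ.colour s(a, b) = k := ⟨_, rfl⟩
  -- Nine colours fit into four bits; the remaining code words belong to no edge.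
  have h1 : ∀ k : Fin 9, ∃ c : Bits 4, (k : ℕ) = colourCode c := by decide
  obtain ⟨c, hc⟩ := h1 k
  exact ⟨c, h, by rw [hk, hc]⟩

theorem mem_ball_blackBox_iff : ℓ.1 v ∈ ball (blackBox T χ ℓ) S k ↔ ∃ w ∈ vball T v k, ℓ.1 w ∈ S := by
  rw [← hid_empty]
  exact ⟨exists_of_mem_ball, fun ⟨w, hw, h⟩ => mem_ball_of_vball hw h fun _ _ => exists_joined⟩

/-! ### Hiding vertices that are not seen -/

/-- Hiding vertices with labels outside `S` can only remove answers that lead out of `S`, and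
`Agree` disregards these. -/
theorem agree_hid {H' : Set (Vertex n)} (hH : H ⊆ H') (h : ∀ v ∈ H', v ∉ H → ℓ.1 v ∉ S) : Agree (hid T χ ℓ H) (hid T χ ℓ H') S := by
  intro x hx c hc
  rcases hid_cases (T := T) (χ := χ) (ℓ := ℓ) (H := H) x c with
    ⟨v, w, rfl, hv, hw, hj, h1⟩ | ⟨h1, h2⟩
  · rw [h1] at hc ⊢; refine hid_of_joined (fun hv' => h v hv' hv hx) (fun hw' => ?_) hj; rcases hc with hc | hc
    · grind
    · grind
  · rw [h2]
    rcases hid_cases x c with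
      ⟨v, w, hx, hv, hw, hj, h3⟩ | ⟨h3, h4⟩
    · exact absurd ⟨v, w, hx, fun h => hv (hH h), fun h => hw (hH h), hj⟩ h1
    · exact h4

/-- In this direction answers appear that were missing before. They belong to neighbours of the
vertices that are shown, so the neighbours too have to be outside `S`. -/
theorem agree_hid_symm {H' : Set (Vertex n)} (hH : H ⊆ H') (h : ∀ v ∈ H', ∀ w, (w = v ∨ T.graph.Adj w v) → ℓ.1 w ∉ S) :
  Agree (hid T χ ℓ H') (hid T χ ℓ H) S := by
  intro x hx c _
  rcases hid_cases (T := T) (χ := χ) (ℓ := ℓ) (H := H) x c with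
    ⟨v, w, rfl, hv, hw, hj, h1⟩ | ⟨h1, h2⟩
  · rw [h1]; refine (hid_of_joined (fun hv' => h v hv' v (Or.inl rfl) hx) (fun hw' => ?_) hj).symm
    exact h w hw' v (Or.inr hj.1) hx
  · rw [h2]
    rcases hid_cases x c with
      ⟨v, w, hx, hv, hw, hj, h3⟩ | ⟨h3, h4⟩
    · exact absurd ⟨v, w, hx, fun h => hv (hH h), fun h => hw (hH h), hj⟩ h1
    · exact h4.symm

end

set_option hygiene false in
local notation "𝔎" => hid T χ ℓ ∅

/-! ### Averages over labellings -/

section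
variable {n : ℕ}

theorem average_mono {f f' : Labelling n → ℝ} (h : ∀ ℓ, f ℓ ≤ f' ℓ) : average f ≤ average f' := by
  classical
  exact div_le_div_of_nonneg_right (sum_le_sum fun ℓ _ => h ℓ) (cast_nonneg _)

theorem average_nonneg {f : Labelling n → ℝ} (h : ∀ ℓ, 0 ≤ f ℓ) : 0 ≤ average f := by
  classical
  exact div_nonneg (sum_nonneg fun ℓ _ => h ℓ) (cast_nonneg _)

theorem average_sum {ι : Type*} (s : Finset ι) (f : ι → Labelling n → ℝ) : average (fun ℓ => ∑ i ∈ s, f i ℓ) = ∑ i ∈ s, average (f i) := by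
  classical
  unfold average
  rw [sum_comm, sum_div]

theorem average_add (f f' : Labelling n → ℝ) : average (fun ℓ => f ℓ + f' ℓ) = average f + average f' := by
  classical
  unfold average
  rw [sum_add_distrib, add_div]

theorem average_sub (f f' : Labelling n → ℝ) : average (fun ℓ => f ℓ - f' ℓ) = average f - average f' := by
  classical
  unfold average
  rw [sum_sub_distrib, sub_div]

theorem average_mul_left (a : ℝ) (f : Labelling n → ℝ) : average (fun ℓ => a * f ℓ) = a * average f := by
  classical
  unfold average
  rw [← mul_sum, mul_div_assoc]

theorem average_const_le {a : ℝ} (ha : 0 ≤ a) : average (fun _ : Labelling n => a) ≤ a := by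
  classical
  unfold average
  rw [sum_const, nsmul_eq_mul, card_univ]
  by_cases h : (card (Labelling n) : ℝ) = 0
  · simp_all
  · simp_all

theorem average_le {f : Labelling n → ℝ} {a : ℝ} (ha : 0 ≤ a) (h : ∀ ℓ, f ℓ ≤ a) :
  average f ≤ a := (average_mono h).trans (average_const_le ha)

theorem abs_average_le (f : Labelling n → ℝ) : |average f| ≤ average fun ℓ => |f ℓ| := by
  classical
  unfold average
  rw [abs_div, Nat.abs_cast]
  exact div_le_div_of_nonneg_right (abs_sum_le_sum_abs _ _) (cast_nonneg _)

/-! ### Changing the label of one vertex -/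

/-- The string `x` is not the label of a vertex other than `v`. -/
def Free (ℓ : Labelling n) (v : Vertex n) (x : Str n) : Prop := x ≠ invalid _ ∧ ∀ w, w ≠ v → ℓ.1 w ≠ x

open Classical in
/-- The labelling with the label of `v` replaced by `x`. -/
def relabel (ℓ : Labelling n) (v : Vertex n) (x : Str n) : Labelling n :=
  if h : v ≠ entrance n ∧ Free ℓ v x then
    ⟨update ℓ.1 v x, by
      obtain ⟨hv, hx, hf⟩ := h; refine ⟨?_, ?_, ?_⟩
      · intro a b hab; by_cases ha : a = v <;> by_cases hb : b = v
        · rw [ha, hb]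
        · grind
        · grind
        · grind
      · grind
      · grind⟩
  else ℓ

theorem relabel_of_ne (ℓ : Labelling n) {v w : Vertex n} (x : Str n) (h : w ≠ v) : (relabel ℓ v x).1 w = ℓ.1 w := by
  unfold relabel
  split_ifs with h0
  · simp [h]
  · rfl

theorem relabel_self {ℓ : Labelling n} {v : Vertex n} {x : Str n} (hv : v ≠ entrance n) (h : Free ℓ v x) : (relabel ℓ v x).1 v = x := by
  unfold relabel
  rw [dif_pos ⟨hv, h⟩]
  simp

theorem free_self (ℓ : Labelling n) (v : Vertex n) : Free ℓ v (ℓ.1 v) := ⟨ℓ.2.2.2 v, fun _ hw h => hw (ℓ.2.1 h)⟩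

theorem free_relabel {ℓ : Labelling n} {v : Vertex n} {x y : Str n} : Free (relabel ℓ v x) v y ↔ Free ℓ v y := by
  unfold Free
  refine and_congr_right fun _ => forall₂_congr fun w hw => ?_
  rw [relabel_of_ne ℓ x hw]

theorem relabel_relabel {ℓ : Labelling n} {v : Vertex n} {x : Str n}
  (hv : v ≠ entrance n) (h : Free ℓ v x) : relabel (relabel ℓ v x) v (ℓ.1 v) = ℓ := by
  apply Subtype.ext
  funext w
  by_cases hw : w = v
  · subst hw; exact relabel_self hv (free_relabel.2 (free_self ℓ w))
  · rw [relabel_of_ne _ _ hw, relabel_of_ne _ _ hw]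

theorem card_vertex : card (Vertex n) = 2 ^ (n + 2) - 2 := by
  rw [card_prod, card_bool, Fintype.card_coe, Nat.card_Ico]
  grind

open Classical in
theorem card_free (ℓ : Labelling n) (v : Vertex n) : (univ.filter fun x => Free ℓ v x).card + card (Vertex n) = 4 ^ n := by
  have h1 : (univ.filter fun x => Free ℓ v x) = (insert (invalid _) ((univ.erase v).image ℓ.1))ᶜ := by ext x; rw [mem_filter]; simp [Free]
  rw [h1, Finset.card_compl, Finset.card_insert_of_notMem, Finset.card_image_of_injective _ ℓ.2.1,
    Finset.card_erase_of_mem (mem_univ v), card_univ]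
  · have h2 : card (Str n) = 4 ^ n := by rw [card_fun, card_bool, card_fin, pow_mul]; norm_num
    have h3 : card (Vertex n) ≤ card (Str n) := Fintype.card_le_of_injective _ ℓ.2.1
    have h4 : 0 < card (Vertex n) := Fintype.card_pos_iff.2 ⟨v⟩; omega
  · grind

/-! ### The chance of guessing a label. -/

/-- A bound for the probability that a given string is the label of a given vertex. -/
def luck (n : ℕ) : ℝ := 1 / ((4 : ℝ) ^ n - card (Vertex n))

theorem luck_nonneg (ℓ : Labelling n) : 0 ≤ luck n := by
  unfold luck
  have := card_free ℓ (entrance n)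
  have h2 : (card (Vertex n) : ℝ) ≤ 4 ^ n := by exact_mod_cast (by omega)
  apply div_nonneg zero_le_one
  linarith

/-- Exchanging the label of `v` with a free string is an involution of the pairs of a labelling and
a free string. If `f` does not see the label of `v`, this label may thus be replaced by a uniformly
random free string. The number of free strings is the same for all labellings, and since `f` is
nonnegative the sum can be extended to all strings. -/
theorem average_resample {v : Vertex n} (hv : v ≠ entrance n) (f : Labelling n → Str n → ℝ)
  (h0 : ∀ ℓ x, 0 ≤ f ℓ x) (hf : ∀ ℓ x, Free ℓ v x → f (relabel ℓ v x) x = f ℓ x) :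
  average (fun ℓ => f ℓ (ℓ.1 v)) ≤ luck n * average fun ℓ => ∑ x, f ℓ x := by
  classical
  by_cases hne : Nonempty (Labelling n)
  swap
  · rw [not_nonempty_iff] at hne; simp [average]
  obtain ⟨ℓ0⟩ := hne
  set m := (univ.filter fun x => Free ℓ0 v x).card with hm
  have hcard : ∀ ℓ, (univ.filter fun x => Free ℓ v x).card = m := by intro ℓ; have h1 := card_free ℓ v; have h2 := card_free ℓ0 v; omega
  have hm0 : 0 < m := Finset.card_pos.2 ⟨_, mem_filter.2 ⟨mem_univ _, free_self ℓ0 v⟩⟩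
  have hluck : luck n = 1 / m := by unfold luck; congr 1; have := card_free ℓ0 v; rw [sub_eq_iff_eq_add]; exact_mod_cast this.symm
  have h1 : ∑ ℓ : Labelling n, ∑ x ∈ univ.filter (fun x => Free ℓ v x), f ℓ (ℓ.1 v) = m * ∑ ℓ, f ℓ (ℓ.1 v) := by
    rw [mul_sum]; refine sum_congr rfl fun ℓ _ => ?_; rw [sum_const, hcard, nsmul_eq_mul]
  have h2 : ∑ ℓ : Labelling n, ∑ x ∈ univ.filter (fun x => Free ℓ v x), f ℓ (ℓ.1 v) =
      ∑ ℓ : Labelling n, ∑ x ∈ univ.filter (fun x => Free ℓ v x), f ℓ x := by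
    rw [Finset.sum_sigma', Finset.sum_sigma']
    refine Finset.sum_bij' (fun p _ => ⟨relabel p.1 v p.2, p.1.1 v⟩) (fun p _ => ⟨relabel p.1 v p.2, p.1.1 v⟩) ?_ ?_ ?_ ?_ ?_
    · rintro ⟨ℓ, x⟩ _; simp only [mem_sigma, mem_univ, true_and, mem_filter]; exact free_relabel.2 (free_self ℓ v)
    · rintro ⟨ℓ, x⟩ _; simp only [mem_sigma, mem_univ, true_and, mem_filter]; exact free_relabel.2 (free_self ℓ v)
    · rintro ⟨ℓ, x⟩ h; simp only [mem_sigma, mem_univ, true_and, mem_filter] at h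
      simp only [relabel_relabel hv h, relabel_self hv h]
    · rintro ⟨ℓ, x⟩ h; simp only [mem_sigma, mem_univ, true_and, mem_filter] at h
      simp only [relabel_relabel hv h, relabel_self hv h]
    · rintro ⟨ℓ, x⟩ h; simp only [mem_sigma, mem_univ, true_and, mem_filter] at h
      have h3 := hf (relabel ℓ v x) (ℓ.1 v) (free_relabel.2 (free_self ℓ v)); rw [relabel_relabel hv h] at h3; exact h3
  have h3 : ∑ ℓ : Labelling n, ∑ x ∈ univ.filter (fun x => Free ℓ v x), f ℓ x ≤ ∑ ℓ : Labelling n, ∑ x, f ℓ x := sum_le_sum fun ℓ _ =>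
      Finset.sum_le_sum_of_subset_of_nonneg (Finset.filter_subset _ _) fun x _ _ => h0 ℓ x
  unfold average
  rw [hluck, ← mul_div_assoc]
  refine div_le_div_of_nonneg_right ?_ (cast_nonneg _)
  rw [one_div, ← div_eq_inv_mul, le_div_iff₀ (by exact_mod_cast hm0), mul_comm, ← h1, h2]
  exact h3

variable {T : WeldedTree n} {χ : EdgeColouring T.graph}

theorem hid_congr {ℓ ℓ' : Labelling n} {H : Set (Vertex n)} (h : ∀ v ∉ H, ℓ.1 v = ℓ'.1 v) : hid T χ ℓ H = hid T χ ℓ' H := by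
  funext x c
  rcases hid_cases (T := T) (χ := χ) (ℓ := ℓ) (H := H) x c with
    ⟨v, w, rfl, hv, hw, hj, h1⟩ | ⟨h1, h2⟩
  · rw [h1, h v hv, h w hw, hid_of_joined hv hw hj]
  · rw [h2]
    rcases hid_cases x c with
      ⟨v, w, hx, hv, hw, hj, h3⟩ | ⟨h3, h4⟩
    · exact absurd ⟨v, w, by rw [h v hv, hx], hv, hw, hj⟩ h1
    · exact h4.symm

theorem hid_relabel (ℓ : Labelling n) {H : Set (Vertex n)} {v : Vertex n} (hv : v ∈ H)
  (x : Str n) : hid T χ (relabel ℓ v x) H = hid T χ ℓ H :=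
  hid_congr fun _ hw => relabel_of_ne _ _ fun h => hw (h ▸ hv)

/-- The form in which lucky guesses are estimated: `f` is the weight that a computation ignorant of
`v` puts on each string, and `a * b` bounds its total weight. -/
theorem average_label_le {v : Vertex n} {a : ℝ} (f : Labelling n → Str n → ℝ)
  (h0 : ∀ ℓ x, 0 ≤ f ℓ x) (hf : ∀ ℓ y x, f (relabel ℓ v y) x = f ℓ x)
  (hv : v ≠ entrance n) (b : Labelling n → ℝ) (hb : ∀ ℓ, ∑ x, f ℓ x ≤ a * b ℓ) :
  average (fun ℓ => f ℓ (ℓ.1 v)) ≤ luck n * a * average b := by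
  by_cases hne : Nonempty (Labelling n)
  · obtain ⟨ℓ⟩ := hne; refine (average_resample hv f h0 fun ℓ x _ => hf ℓ x x).trans ?_
    rw [mul_assoc, ← average_mul_left a b]; exact mul_le_mul_of_nonneg_left (average_mono hb) (luck_nonneg ℓ)
  · rw [not_nonempty_iff] at hne; simp [average]

end

/-! ### Lucky guesses in a quantum tier -/

section
variable {n : ℕ} {Ω : Type*} [Fintype Ω]

/-- The known strings and the state at the start of a quantum tier, as functions of the oracle. -/
structure Start (n : ℕ) (Ω : Type*) [Fintype Ω] where
  S : Oracle n → Finset (Str n)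
  ψ : Oracle n → Vec Ω
  loc : ∀ K K', Agree K K' (S K) → S K' = S K ∧ ψ K' = ψ K
  zero_mem : ∀ K, (fun _ => false) ∈ S K
  norm_le : ∀ K, ‖ψ K‖ ≤ 1

variable (p : Start n Ω) (lay : ℕ → QLay n Ω)

namespace Start

/-- The state of the simulation. -/
def ph (K : Oracle n) (k : ℕ) : Vec Ω := phi lay K (p.S K) (p.ψ K) k

/-- The part of the error that starts at `x`. -/
def del (K : Oracle n) (x : Str n) (k : ℕ) : Vec Ω := dl lay K (p.S K) (p.ψ K) x k

/-- The approximation of `del`. -/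
def apx (K : Oracle n) (x : Str n) (k : ℕ) : Vec Ω := dd lay K (p.S K) (p.ψ K) x k

/-- The amplitude of bad queries. -/
def am (K : Oracle n) (k : ℕ) (x : Str n) : ℝ := amp lay K (p.S K) (p.ψ K) k x

variable {p lay}

variable {K K' : Oracle n} {k : ℕ} {ℓ : Labelling n} {H : Set (Vertex n)} {x : Str n} {S : Finset (Str n)}

theorem ball_agree (h : Agree K K' (ball K (p.S K) k)) : p.S K' = p.S K ∧ p.ψ K' = p.ψ K := p.loc K K' (h.mono (subset_ball k))

theorem ph_agree (h : Agree K K' (ball K (p.S K) k)) : p.ph lay K' k = p.ph lay K k := by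
  unfold ph
  rw [(ball_agree h).1, (ball_agree h).2, h.phi_eq]

theorem apx_agree (h : Agree K K' (ball K (insert x (p.S K)) k)) : p.apx lay K' x k = p.apx lay K x k := by
  have h0 : Agree K K' (ball K (p.S K) k) := h.mono (ball_mono_left (subset_insert _ _) _)
  unfold apx
  rw [(ball_agree h0).1, (ball_agree h0).2, h.dd_eq]

theorem norm_ph_le (K : Oracle n) (k : ℕ) : ‖p.ph lay K k‖ ≤ 1 := by
  unfold ph
  rw [norm_phi]
  exact p.norm_le K

theorem norm_ph_sq_le (K : Oracle n) (k : ℕ) : ‖p.ph lay K k‖ ^ 2 ≤ 1 := pow_le_one₀ (norm_nonneg _) (norm_ph_le K k)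

variable {T : WeldedTree n} {χ : EdgeColouring T.graph} {G : ℕ}

theorem agree_of_bad {v : Vertex n} (h : ℓ.1 v ∈ bad (hid T χ ℓ H) S k) :
  Agree (hid T χ ℓ H) (hid T χ ℓ (insert v H)) (ball (hid T χ ℓ H) S k) := by
  refine agree_hid (Set.subset_insert _ _) fun w hw hw' => ?_
  rw [Set.mem_insert_iff, or_iff_left hw'] at hw
  rw [hw]
  exact h.1

theorem exists_label_of_bad (h : x ∈ bad (hid T χ ℓ H) S k) : ∃ v, ℓ.1 v = x := by
  obtain ⟨-, c, hc⟩ := h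
  obtain ⟨v, w, hv, -⟩ := hid_eq_label hc
  exact ⟨v, hv⟩

theorem label_entrance_not_bad (k : ℕ) : ℓ.1 (entrance n) ∉ bad (hid T χ ℓ H) (p.S (hid T χ ℓ H)) k := by
  intro h
  apply h.1
  rw [ℓ.2.2.1]
  exact subset_ball k (p.zero_mem _)

/-- A bad string lies outside the ball that the simulation has used so far, so its vertex can be
hidden without changing the state. On the right the state no longer depends on the label of `v`, as
`average_label_le` requires. -/
theorem am_sq_le (ℓ : Labelling n) (H : Set (Vertex n)) (v : Vertex n) (k : ℕ) : p.am lay (hid T χ ℓ H) k (ℓ.1 v) ^ 2 ≤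
    ‖(lay k).hit {ℓ.1 v} (p.ph lay (hid T χ ℓ (insert v H)) k)‖ ^ 2 := by
  unfold am amp
  split_ifs with h
  · rw [ph_agree (agree_of_bad h)]; exact le_rfl
  · rw [zero_pow two_ne_zero]; positivity

theorem am_entrance (ℓ : Labelling n) (H : Set (Vertex n)) (k : ℕ) : p.am lay (hid T χ ℓ H) k (ℓ.1 (entrance n)) = 0 := by
  unfold am amp
  rw [if_neg (label_entrance_not_bad k)]

/-- The weight `J`, which may not depend on the label of `v`, will select the labellings in which
`v` is close to a known string. The label of the entrance is always known and cannot be bad. -/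
theorem average_am_sq_le (hG : ∀ k ω, ((lay k).rd ω).card ≤ G) {J : Labelling n → ℝ}
  (hJ0 : ∀ ℓ, 0 ≤ J ℓ) (H : Set (Vertex n)) (v : Vertex n)
  (hJ : ∀ ℓ y, J (relabel ℓ v y) = J ℓ) (k : ℕ) :
  average (fun ℓ => J ℓ * p.am lay (hid T χ ℓ H) k (ℓ.1 v) ^ 2) ≤ luck n * G * average J := by
  by_cases hv : v = entrance n
  · subst hv; simp only [am_entrance]; by_cases hne : Nonempty (Labelling n)
    · have h1 : average (fun ℓ : Labelling n => J ℓ * (0 : ℝ) ^ 2) = 0 := by simp [average]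
      rw [h1]; exact mul_nonneg (mul_nonneg (luck_nonneg hne.some) (cast_nonneg _)) (average_nonneg hJ0)
    · rw [not_nonempty_iff] at hne; simp [average]
  refine le_trans (average_mono fun ℓ => mul_le_mul_of_nonneg_left (am_sq_le ℓ H v k) (hJ0 ℓ)) ?_
  refine average_label_le (fun ℓ x => J ℓ * ‖(lay k).hit {x} (p.ph lay (hid T χ ℓ (insert v H)) k)‖ ^ 2)
    (fun ℓ x => mul_nonneg (hJ0 ℓ) (sq_nonneg _)) ?_ hv J ?_
  · intro ℓ y x; rw [hJ, hid_relabel ℓ (Set.mem_insert v H)]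
  · intro ℓ; rw [← mul_sum, mul_comm]; refine mul_le_mul_of_nonneg_right ?_ (hJ0 ℓ)
    refine ((lay k).sum_norm_hit_sq_le (hG k) _).trans ?_; exact mul_le_of_le_one_right (cast_nonneg _) (norm_ph_sq_le _ _)

theorem sq_norm_le_of_le_sum {a : ℝ} (ha : 0 ≤ a) {f : ℕ → ℝ} {m : ℕ}
  (h : a ≤ ∑ j ∈ range m, f j) : a ^ 2 ≤ m * ∑ j ∈ range m, f j ^ 2 := by
  calc a ^ 2 ≤ (∑ j ∈ range m, f j) ^ 2 := pow_le_pow_left₀ ha h 2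
    _ ≤ _ := by have := sq_sum_le_card_mul_sum_sq (s := range m) (f := f); rwa [card_range] at this

theorem average_sq_le_of_norm_le (hG : ∀ k ω, ((lay k).rd ω).card ≤ G) {J : Labelling n → ℝ}
  (hJ0 : ∀ ℓ, 0 ≤ J ℓ) (H : Set (Vertex n)) (v : Vertex n)
  (hJ : ∀ ℓ y, J (relabel ℓ v y) = J ℓ) {m : ℕ} (X : Labelling n → ℝ) (hX : ∀ ℓ, 0 ≤ X ℓ)
  (h : ∀ ℓ, X ℓ ≤ ∑ j ∈ range m, 2 * p.am lay (hid T χ ℓ H) j (ℓ.1 v)) :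
  average (fun ℓ => J ℓ * X ℓ ^ 2) ≤ 4 * m ^ 2 * G * luck n * average J := by
  calc _ ≤ average (fun ℓ => ∑ j ∈ range m, 4 * m * (J ℓ * p.am lay (hid T χ ℓ H) j (ℓ.1 v) ^ 2)) := by
        refine average_mono fun ℓ => ?_; refine (mul_le_mul_of_nonneg_left (sq_norm_le_of_le_sum (hX ℓ) (h ℓ)) (hJ0 ℓ)).trans ?_
        rw [mul_sum, mul_sum]; grind
    _ ≤ ∑ j ∈ range m, 4 * m * (luck n * G * average J) := by
        rw [average_sum]; refine sum_le_sum fun j _ => ?_; rw [average_mul_left]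
        exact mul_le_mul_of_nonneg_left (average_am_sq_le hG hJ0 H v hJ j) (by positivity)
    _ = _ := by rw [sum_const, card_range, nsmul_eq_mul]; ring

theorem average_one_le : average (fun _ : Labelling n => (1 : ℝ)) ≤ 1 := average_const_le zero_le_one

theorem average_del_sq_le (hG : ∀ k ω, ((lay k).rd ω).card ≤ G) (hl : 0 ≤ luck n) (H : Set (Vertex n)) (v : Vertex n) (m : ℕ) :
  average (fun ℓ => ‖p.del lay (hid T χ ℓ H) (ℓ.1 v) m‖ ^ 2) ≤ 4 * m ^ 2 * G * luck n := by
  have h := average_sq_le_of_norm_le (J := fun _ => 1) hG (fun _ => zero_le_one) H v (fun _ _ => rfl)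
    (fun ℓ => ‖p.del lay (hid T χ ℓ H) (ℓ.1 v) m‖) (fun ℓ => norm_nonneg _)
    (fun ℓ => norm_dl_le _ _)
  simp only [one_mul] at h
  exact h.trans (mul_le_of_le_one_right (by positivity) average_one_le)

theorem average_apx_sq_le (hG : ∀ k ω, ((lay k).rd ω).card ≤ G) (hl : 0 ≤ luck n) (H : Set (Vertex n)) (v : Vertex n) (m : ℕ) :
  average (fun ℓ => ‖p.apx lay (hid T χ ℓ H) (ℓ.1 v) m‖ ^ 2) ≤ 4 * m ^ 2 * G * luck n := by
  have h := average_sq_le_of_norm_le (J := fun _ => 1) hG (fun _ => zero_le_one) H v (fun _ _ => rfl)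
    (fun ℓ => ‖p.apx lay (hid T χ ℓ H) (ℓ.1 v) m‖) (fun ℓ => norm_nonneg _)
    (fun ℓ => norm_dd_le _ _)
  simp only [one_mul] at h
  exact h.trans (mul_le_of_le_one_right (by positivity) average_one_le)

/-- The plain hybrid argument, applied to the square of the error: one lucky guess, summed over all
vertices. -/
theorem average_real_sub_ph_sq_le (hG : ∀ k ω, ((lay k).rd ω).card ≤ G) (hl : 0 ≤ luck n) (H : Set (Vertex n)) (m : ℕ) :
  average (fun ℓ => ‖real lay (hid T χ ℓ H) (p.ψ (hid T χ ℓ H)) m -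
    p.ph lay (hid T χ ℓ H) m‖ ^ 2) ≤ 4 * m ^ 2 * G * luck n * card (Vertex n) := by
  have h1 : ∀ (ℓ : Labelling n) (j : ℕ), ‖(lay j).hit (bad (hid T χ ℓ H) (p.S (hid T χ ℓ H)) j) (p.ph lay (hid T χ ℓ H) j)‖ ^ 2 ≤
      ∑ v, p.am lay (hid T χ ℓ H) j (ℓ.1 v) ^ 2 := by
    classical
    intro ℓ j
    refine ((lay j).norm_hit_sq_le _ _ (univ.filter fun v =>
      ℓ.1 v ∈ bad (hid T χ ℓ H) (p.S (hid T χ ℓ H)) j) ℓ.1 ?_ _).trans ?_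
    · intro y hy; obtain ⟨v, rfl⟩ := exists_label_of_bad hy; grind
    · rw [sum_filter]; refine sum_le_sum fun v _ => ?_; unfold am amp; split_ifs <;> simp [ph]
  calc _ ≤ average (fun ℓ => ∑ j ∈ range m, ∑ v, 4 * m * (1 * p.am lay (hid T χ ℓ H) j (ℓ.1 v) ^ 2)) := by
        refine average_mono fun ℓ => ?_; refine (sq_norm_le_of_le_sum (norm_nonneg _) (norm_real_sub_phi_le m)).trans ?_
        rw [mul_sum]; refine sum_le_sum fun j _ => ?_; rw [← mul_sum, mul_pow]; simp only [one_mul]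
        have := mul_le_mul_of_nonneg_left (h1 ℓ j) (show (0 : ℝ) ≤ 4 * m by positivity)
        unfold ph at this; linarith
    _ ≤ ∑ j ∈ range m, ∑ v : Vertex n, 4 * m * (luck n * G * 1) := by
        rw [average_sum]; refine sum_le_sum fun j _ => ?_; rw [average_sum]; refine sum_le_sum fun v _ => ?_
        rw [average_mul_left]
        refine mul_le_mul_of_nonneg_left ?_ (by positivity)
        refine (average_am_sq_le hG (J := fun _ => 1) (fun _ => zero_le_one) H v (fun _ _ => rfl) j).trans ?_
        exact mul_le_mul_of_nonneg_left average_one_le (by positivity)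
    _ = _ := by rw [sum_const, sum_const, card_range, nsmul_eq_mul, nsmul_eq_mul, card_univ]; ring

/-! ### Two lucky guesses -/

/-- Two successive guesses. With `w` hidden the approximation for `v` is unchanged and independent
of the label of `w`, which gives one factor `luck n`. The squared norm of that approximation is
itself the price of guessing the label of `v`, which gives the second one. -/
theorem average_hit_apx_sq_le (hG : ∀ k ω, ((lay k).rd ω).card ≤ G) (hl : 0 ≤ luck n) (v : Vertex n) (j : ℕ) :
  average (fun ℓ => ‖(lay j).hit (bad 𝔎 (insert (ℓ.1 v) (p.S 𝔎)) j) (p.apx lay 𝔎 (ℓ.1 v) j)‖ ^ 2) ≤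
    4 * j ^ 2 * G ^ 2 * luck n ^ 2 * card (Vertex n) := by
  classical
  calc _ ≤ average (fun ℓ => ∑ w, if w = v ∨ w = entrance n then 0 else
        ‖(lay j).hit {ℓ.1 w} (p.apx lay (hid T χ ℓ {w}) (ℓ.1 v) j)‖ ^ 2) := by
        refine average_mono fun ℓ => ?_
        refine ((lay j).norm_hit_sq_le _ _ (univ.filter fun w =>
          ℓ.1 w ∈ bad 𝔎 (insert (ℓ.1 v) (p.S 𝔎)) j) ℓ.1 ?_ _).trans ?_
        · intro y hy; obtain ⟨w, rfl⟩ := exists_label_of_bad hy; grind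
        · rw [sum_filter]; refine sum_le_sum fun w _ => ?_; by_cases h : ℓ.1 w ∈ bad 𝔎 (insert (ℓ.1 v) (p.S 𝔎)) j
          · rw [if_pos h, if_neg]
            · have h2 := agree_of_bad h; rw [show (insert w ∅ : Set (Vertex n)) = {w} from insert_empty_eq w] at h2
              rw [apx_agree h2]
            · rintro (rfl | rfl)
              · exact h.1 (subset_ball j (Finset.mem_insert_self _ _))
              · apply h.1; rw [ℓ.2.2.1]; exact subset_ball j (Finset.mem_insert_of_mem (p.zero_mem _))
          · rw [if_neg h]; split_ifs <;> positivity
    _ ≤ ∑ w : Vertex n, luck n * G * (4 * j ^ 2 * G * luck n) := by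
        rw [average_sum]; refine sum_le_sum fun w _ => ?_; by_cases hw : w = v ∨ w = entrance n
        · simp only [hw, if_true]
          exact average_le (by positivity) fun _ => by positivity
        simp only [hw, if_false]; rw [not_or] at hw
        refine (average_label_le (fun ℓ x => ‖(lay j).hit {x} (p.apx lay (hid T χ ℓ {w}) (ℓ.1 v) j)‖ ^ 2) (fun _ _ => by positivity) ?_ hw.2
          (fun ℓ => ‖p.apx lay (hid T χ ℓ {w}) (ℓ.1 v) j‖ ^ 2) (a := G) ?_).trans ?_
        · intro ℓ y x; rw [hid_relabel ℓ (Set.mem_singleton w), relabel_of_ne _ _ (Ne.symm hw.1)]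
        · exact fun ℓ => (lay j).sum_norm_hit_sq_le (hG j) _
        · exact mul_le_mul_of_nonneg_left (average_apx_sq_le hG hl {w} v j) (by positivity)
    _ = _ := by rw [sum_const, nsmul_eq_mul, card_univ]; ring

/-- Two simultaneous guesses: with both vertices hidden, the labels of `v` and `w` are averaged one
after the other. -/
theorem average_amp2_sq_le (hG : ∀ k ω, ((lay k).rd ω).card ≤ G) (hl : 0 ≤ luck n) (v : Vertex n) (j : ℕ) :
  average (fun ℓ => amp2 lay 𝔎 (p.S 𝔎) (p.ψ 𝔎) j (ℓ.1 v) ^ 2) ≤ G ^ 2 * luck n ^ 2 * card (Vertex n) := by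
  classical
  calc _ ≤ average (fun ℓ => ∑ w, if w = v ∨ w = entrance n ∨ v = entrance n then 0 else
        ‖(lay j).hit {ℓ.1 v} ((lay j).hit {ℓ.1 w} (p.ph lay (hid T χ ℓ {v, w}) j))‖ ^ 2) := by
        refine average_mono fun ℓ => ?_; unfold amp2; split_ifs with h
        swap
        · rw [zero_pow two_ne_zero]
          exact sum_nonneg fun w _ => by split_ifs <;> positivity
        have hv : v ≠ entrance n := by rintro rfl; exact label_entrance_not_bad j h
        set B := bad 𝔎 (p.S 𝔎) j with hB
        refine le_trans (norm_cut_sq_mono (q := fun ω => ∃ w ∈ univ.filter (fun w =>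
          w ≠ v ∧ ℓ.1 w ∈ B), ℓ.1 v ∈ (lay j).rd ω ∧ ℓ.1 w ∈ (lay j).rd ω) ?_ _) ?_
        · rintro ω ⟨h1, y, h2, h3, h4⟩; obtain ⟨w, rfl⟩ := exists_label_of_bad h4; refine ⟨w, ?_, h1, h2⟩; grind
        refine (norm_cut_exists_le _ (fun w ω => ℓ.1 v ∈ (lay j).rd ω ∧ ℓ.1 w ∈ (lay j).rd ω) _).trans ?_
        rw [sum_filter]; refine sum_le_sum fun w _ => ?_; by_cases h1 : w ≠ v ∧ ℓ.1 w ∈ B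
        · rw [if_pos h1, if_neg, QLay.hit_singleton, QLay.hit_singleton, cut_cut]
          · have h2 : Agree 𝔎 (hid T χ ℓ {v, w}) (ball 𝔎 (p.S 𝔎) j) := by
              refine agree_hid (Set.empty_subset _) fun a ha _ => ?_; rcases ha with rfl | ha
              · exact h.1
              · rw [Set.mem_singleton_iff.1 ha]; exact h1.2.1
            rw [ph_agree h2]; exact le_rfl
          · rintro (h2 | h2 | h2)
            · exact h1.1 h2
            · subst h2; exact label_entrance_not_bad j h1.2
            · exact hv h2
        · rw [if_neg h1]; split_ifs <;> positivity
    _ ≤ ∑ w : Vertex n, luck n * G * (luck n * G * 1) := by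
        rw [average_sum]; refine sum_le_sum fun w _ => ?_; by_cases hw : w = v ∨ w = entrance n ∨ v = entrance n
        · simp only [hw, if_true]
          exact average_le (by positivity) fun _ => by positivity
        simp only [hw, if_false]; rw [not_or, not_or] at hw
        refine (average_label_le (fun ℓ x => ‖(lay j).hit {x} ((lay j).hit {ℓ.1 w}
          (p.ph lay (hid T χ ℓ {v, w}) j))‖ ^ 2) (fun _ _ => by positivity) ?_ hw.2.2
          (fun ℓ => ‖(lay j).hit {ℓ.1 w} (p.ph lay (hid T χ ℓ {v, w}) j)‖ ^ 2) (a := G) ?_).trans ?_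
        · intro ℓ y x; rw [hid_relabel ℓ (Set.mem_insert v {w}), relabel_of_ne _ _ hw.1]
        · exact fun ℓ => (lay j).sum_norm_hit_sq_le (hG j) _
        refine mul_le_mul_of_nonneg_left ?_ (by positivity)
        refine (average_label_le (fun ℓ x => ‖(lay j).hit {x} (p.ph lay (hid T χ ℓ {v, w}) j)‖ ^ 2) (fun _ _ => by positivity) ?_ hw.2.1
          (fun _ => 1) (a := G) ?_).trans ?_
        · intro ℓ y x; rw [hid_relabel ℓ (Set.mem_insert_of_mem v (Set.mem_singleton w))]
        · intro ℓ; refine ((lay j).sum_norm_hit_sq_le (hG j) _).trans ?_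
          exact mul_le_mul_of_nonneg_left (norm_ph_sq_le _ _) (cast_nonneg _)
        · exact mul_le_mul_of_nonneg_left average_one_le (by positivity)
    _ = _ := by rw [sum_const, nsmul_eq_mul, card_univ]; ring

theorem average_del_sub_apx_sq_le (hG : ∀ k ω, ((lay k).rd ω).card ≤ G) (hl : 0 ≤ luck n) (v : Vertex n) (m : ℕ) :
  average (fun ℓ => ‖p.del lay 𝔎 (ℓ.1 v) m - p.apx lay 𝔎 (ℓ.1 v) m‖ ^ 2) ≤ 64 * m ^ 4 * G ^ 2 * luck n ^ 2 * card (Vertex n) := by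
  rcases Nat.eq_zero_or_pos m with rfl | hm
  · simp [del, apx, dl, dd, average]
  calc _ ≤ average (fun ℓ => ∑ j ∈ range m, ((8 * m) * ‖(lay j).hit (bad 𝔎 (insert (ℓ.1 v) (p.S 𝔎)) j)
          (p.apx lay 𝔎 (ℓ.1 v) j)‖ ^ 2 + (32 * m) *
        amp2 lay 𝔎 (p.S 𝔎) (p.ψ 𝔎) j (ℓ.1 v) ^ 2)) := by
        refine average_mono fun ℓ => ?_; refine (sq_norm_le_of_le_sum (norm_nonneg _) (norm_dl_sub_dd_le _ m)).trans ?_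
        rw [mul_sum]; refine sum_le_sum fun j _ => ?_; unfold apx
        set a := ‖(lay j).hit (bad 𝔎 (insert (ℓ.1 v) (p.S 𝔎)) j) (dd lay 𝔎 (p.S 𝔎) (p.ψ 𝔎) (ℓ.1 v) j)‖
        set b := amp2 lay 𝔎 (p.S 𝔎) (p.ψ 𝔎) j (ℓ.1 v)
        have h1 : (2 * a + 4 * b) ^ 2 ≤ 8 * a ^ 2 + 32 * b ^ 2 := by nlinarith [sq_nonneg (2 * a - 4 * b)]
        have := mul_le_mul_of_nonneg_left h1 (cast_nonneg m); linarith
    _ ≤ ∑ j ∈ range m, ((8 * m) * (4 * m ^ 2 * G ^ 2 * luck n ^ 2 * card (Vertex n)) +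
          (32 * m) * (G ^ 2 * luck n ^ 2 * card (Vertex n))) := by
        rw [average_sum]; refine sum_le_sum fun j hj => ?_; rw [average_add, average_mul_left, average_mul_left]
        refine add_le_add (mul_le_mul_of_nonneg_left ?_ (by positivity))
          (mul_le_mul_of_nonneg_left (average_amp2_sq_le hG hl v j) (by positivity))
        refine (average_hit_apx_sq_le hG hl v j).trans ?_
        have : (j : ℝ) ≤ m := by exact_mod_cast (mem_range.1 hj).le
        gcongr
    _ ≤ _ := by
        rw [sum_const, card_range, nsmul_eq_mul]
        have h1 : (1 : ℝ) ≤ m := by exact_mod_cast hm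
        have h2 : 0 ≤ (G : ℝ) ^ 2 * luck n ^ 2 * card (Vertex n) := by positivity
        have h3 : (m : ℝ) ^ 2 ≤ m ^ 4 := pow_le_pow_right₀ h1 (by norm_num)
        nlinarith [mul_le_mul_of_nonneg_right h3 h2]

/-! ### Errors near the known strings -/

/-- Only few vertices are close to the strings that are known beforehand, and restricting to them
replaces the factor `card (Vertex n)` by the size of a ball. The restriction has to be expressed
without the label of `v`. -/
theorem average_near_le (hG : ∀ k ω, ((lay k).rd ω).card ≤ G) (hl : 0 ≤ luck n) {M : ℕ} (hM : ∀ K, Tame K → (p.S K).card ≤ M) (R m : ℕ) :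
  average (fun ℓ => ∑ v, (open Classical in
    if ℓ.1 v ∈ ball 𝔎 (p.S 𝔎) R then
      ‖p.del lay 𝔎 (ℓ.1 v) m‖ ^ 2 else 0)) ≤
    4 * m ^ 2 * G * luck n * (3 * 2 ^ R * M) := by
  classical
  -- The known strings are computed with `v` hidden and `v` itself is not admitted as a witness, so
  -- `J v` does not depend on the label of `v`.
  let J : Vertex n → Labelling n → ℝ := fun v ℓ =>
    if ∃ w ∈ vball T v R, w ≠ v ∧ ℓ.1 w ∈ p.S (hid T χ ℓ {v}) then 1 else 0
  have hJ0 : ∀ v ℓ, 0 ≤ J v ℓ := fun v ℓ => by dsimp only [J]; split_ifs <;> norm_num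
  have hJ1 : ∀ v ℓ y, J v (relabel ℓ v y) = J v ℓ := by
    intro v ℓ y; dsimp only [J]; rw [hid_relabel ℓ (Set.mem_singleton v)]
    refine if_congr (exists_congr fun w => and_congr_right fun _ => and_congr_right fun hw => ?_) rfl rfl
    rw [relabel_of_ne _ _ hw]
  have hJ2 : ∀ v ℓ, J v ℓ ≤ ∑ w ∈ vball T v R, if ℓ.1 w ∈ p.S 𝔎 then 1 else 0 := by
    intro v ℓ; dsimp only [J]; split_ifs with h
    swap
    · exact sum_nonneg fun w _ => by split_ifs <;> norm_num
    by_cases h2 : ∃ w ∈ vball T v R, ℓ.1 w ∈ p.S 𝔎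
    · obtain ⟨w, hw, hw'⟩ := h2
      refine le_trans (le_of_eq ?_) (single_le_sum (f := fun w =>
        if ℓ.1 w ∈ p.S 𝔎 then (1 : ℝ) else 0) (fun i _ => ?_) hw)
      · simp [hw']
      · grind
    · push Not at h2
      have h3 : Agree 𝔎 (hid T χ ℓ {v}) (p.S 𝔎) := agree_hid (Set.empty_subset _) fun a ha _ => by
          rw [Set.mem_singleton_iff.1 ha]; exact h2 v (self_mem_vball v R)
      obtain ⟨w, hw, -, hw'⟩ := h; rw [(p.loc _ _ h3).1] at hw'; exact absurd hw' (h2 w hw)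
  have hdel : ∀ ℓ v, (if ℓ.1 v ∈ ball 𝔎 (p.S 𝔎) R then
      ‖p.del lay 𝔎 (ℓ.1 v) m‖ ^ 2 else 0) ≤
      J v ℓ * ‖p.del lay 𝔎 (ℓ.1 v) m‖ ^ 2 := by
    intro ℓ v; split_ifs with h
    swap
    · exact mul_nonneg (hJ0 v ℓ) (sq_nonneg _)
    -- A label that is known from the start is never bad, so it contributes no error.
    by_cases hS : ℓ.1 v ∈ p.S 𝔎
    · have : p.del lay 𝔎 (ℓ.1 v) m = 0 := by
        rw [← norm_le_zero_iff]; refine (norm_dl_le _ _).trans (le_of_eq (sum_eq_zero fun j _ => ?_)); unfold amp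
        rw [if_neg fun hb => hb.1 (subset_ball j hS), mul_zero]
      rw [this]; simp
    · have h3 : Agree 𝔎 (hid T χ ℓ {v}) (p.S 𝔎) := agree_hid (Set.empty_subset _) fun a ha _ => by grind
      obtain ⟨w, hw, hw'⟩ := exists_of_mem_ball h
      have : J v ℓ = 1 := by
        dsimp only [J]; rw [if_pos]; refine ⟨w, hw, ?_, ?_⟩
        · rintro rfl; exact hS hw'
        · rw [(p.loc _ _ h3).1]; exact hw'
      rw [this, one_mul]
  calc _ ≤ average (fun ℓ => ∑ v, J v ℓ * ‖p.del lay 𝔎 (ℓ.1 v) m‖ ^ 2) := by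
        refine average_mono fun ℓ => sum_le_sum fun v _ => ?_; exact hdel ℓ v
    _ ≤ ∑ v, 4 * m ^ 2 * G * luck n * average (J v) := by
        rw [average_sum]; refine sum_le_sum fun v _ => ?_
        exact average_sq_le_of_norm_le hG (hJ0 v) ∅ v (hJ1 v) (fun ℓ => ‖p.del lay 𝔎 (ℓ.1 v) m‖) (fun ℓ => norm_nonneg _)
          (fun ℓ => norm_dl_le _ _)
    _ = 4 * m ^ 2 * G * luck n * average (fun ℓ => ∑ v, J v ℓ) := by rw [← mul_sum, average_sum]
    _ ≤ _ := by
        refine mul_le_mul_of_nonneg_left ?_ (by positivity)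
        refine average_le (by positivity) fun ℓ => ?_
        refine (sum_le_sum fun v _ => hJ2 v ℓ).trans ?_
        have h1 : ∑ v, ∑ w ∈ vball T v R, (if ℓ.1 w ∈ p.S 𝔎 then (1 : ℝ) else 0) =
            ∑ w, ∑ v ∈ vball T w R, (if ℓ.1 w ∈ p.S 𝔎 then (1 : ℝ) else 0) := by
          refine Finset.sum_comm' fun v w => ?_; simp only [mem_univ, true_and, and_true]; exact ⟨mem_vball_comm, mem_vball_comm⟩
        rw [h1]; simp only [sum_const, nsmul_eq_mul]
        calc _ ≤ ∑ w : Vertex n, (3 * 2 ^ R : ℝ) * (if ℓ.1 w ∈ p.S 𝔎 then (1 : ℝ) else 0) := by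
              refine sum_le_sum fun w _ => mul_le_mul_of_nonneg_right ?_ ?_
              · exact_mod_cast card_vball w R
              · grind
          _ ≤ _ := by
              rw [← mul_sum, ← sum_filter, sum_const, nsmul_eq_mul, mul_one]
              refine mul_le_mul_of_nonneg_left ?_ (by positivity)
              refine Nat.cast_le.2 (le_trans ?_ (hM 𝔎 tame_hid))
              refine Finset.card_le_card_of_injOn ℓ.1 (fun w hw => ?_) ℓ.2.1.injOn; simpa using hw

end Start
end

/-! ### Errors far from all strings that are touched later -/

section
variable {n : ℕ} {Ω : Type*} [Fintype Ω] {lay : ℕ → QLay n Ω}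

theorem back_congr {Os Os' : ℕ → Oracle n} {m : ℕ} {j : ℕ} (hj : j ≤ m) (h : ∀ i, j ≤ i → i < m → Os i = Os' i) (β : Vec Ω) :
  back lay Os m β j = back lay Os' m β j := by
  induction hj using Nat.decreasingInduction with
  | self => rw [back_self, back_self]
  | of_succ j hj ih =>
    rw [back_eq, back_eq Os', ih fun i h1 h2 => h i (by omega) h2, h j le_rfl hj]

/-- What happens after a quantum tier, for each basis state after the tier: the strings that are
touched, and a functional that may depend on the label of the exit. -/
structure Cont (p : Start n Ω) (d : ℕ) where
  Q : Oracle n → Ω → Finset (Str n)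
  f : Oracle n → Ω → Str n → ℝ
  loc : ∀ K K' ω, Agree K K' (Q K ω) → Q K' ω = Q K ω ∧ f K' ω = f K ω
  sub : ∀ K ω, ball K (p.S K) d ⊆ Q K ω
  bound : ∀ K ω e, |f K ω e| ≤ 2

namespace Cont
variable {p : Start n Ω} {d : ℕ} (q : Cont p d) {T : WeldedTree n} {χ : EdgeColouring T.graph}

/-- No label of a vertex in `A` is touched. -/
def Far (T : WeldedTree n) (χ : EdgeColouring T.graph) (ℓ : Labelling n) (H : Set (Vertex n))
  (A : Finset (Vertex n)) (ω : Ω) : Prop := ∀ w ∈ A, ℓ.1 w ∉ q.Q (hid T χ ℓ H) ω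

open Classical in
/-- The test vector: the state of the simulation, weighted with the functional. -/
def test (lay : ℕ → QLay n Ω) (T : WeldedTree n) (χ : EdgeColouring T.graph)
  (ℓ : Labelling n) (H : Set (Vertex n)) (A : Finset (Vertex n)) : Vec Ω :=
  WithLp.toLp 2 fun ω => if q.Far T χ ℓ H A ω then
    (q.f (hid T χ ℓ H) ω (ℓ.1 (exit n)) : ℂ) * p.ph lay (hid T χ ℓ H) d ω else 0

variable {q}

/-- Hiding the ball of radius `k` is unnoticed if the labels in the ball of radius `k + 1` are
untouched. The extra step is needed to return from the hidden oracle to the full one by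
`agree_hid_symm`. -/
theorem far_iff (ℓ : Labelling n) (v : Vertex n) (k : ℕ) (ω : Ω) :
  (q.Far T χ ℓ ∅ (vball T v (k + 1)) ω ↔ q.Far T χ ℓ ↑(vball T v k) (vball T v (k + 1)) ω) ∧
  (q.Far T χ ℓ ∅ (vball T v (k + 1)) ω → Agree 𝔎 (hid T χ ℓ ↑(vball T v k)) (q.Q 𝔎 ω)) := by
  have h1 : q.Far T χ ℓ ∅ (vball T v (k + 1)) ω → Agree 𝔎 (hid T χ ℓ ↑(vball T v k)) (q.Q 𝔎 ω) := by
    intro h; exact agree_hid (Set.empty_subset _) fun a ha _ => h a (vball_mono (le_succ k) ha)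
  refine ⟨⟨fun h w hw => ?_, fun h w hw => ?_⟩, h1⟩
  · rw [(q.loc _ _ ω (h1 h)).1]; exact h w hw
  · have h2 : Agree (hid T χ ℓ ↑(vball T v k)) 𝔎 (q.Q (hid T χ ℓ ↑(vball T v k)) ω) := by
      refine agree_hid_symm (Set.empty_subset _) fun a ha w hw => h w ?_; rcases hw with rfl | hw
      · exact vball_mono (le_succ k) ha
      · exact mem_vball_of_adj ha hw.symm
    rw [(q.loc _ _ ω h2).1]; exact h w hw

/-- The test vector is expressed with the ball of radius `k` hidden. The labels of the hidden
vertices then enter only through the projection; the vector that is projected is ignorant of them.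
-/
theorem test_eq (ℓ : Labelling n) (v : Vertex n) (k : ℕ) : q.test lay T χ ℓ ∅ (vball T v (k + 1)) =
    cut (fun ω => q.Far T χ ℓ ↑(vball T v k) (vball T v k) ω) (q.test lay T χ ℓ ↑(vball T v k) (vball T v (k + 1) \ vball T v k)) := by
  classical
  ext ω
  simp only [test, cut_apply]
  have h1 : q.Far T χ ℓ ↑(vball T v k) (vball T v (k + 1)) ω ↔ q.Far T χ ℓ ↑(vball T v k) (vball T v k) ω ∧
      q.Far T χ ℓ ↑(vball T v k) (vball T v (k + 1) \ vball T v k) ω := by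
    constructor
    · exact fun h => ⟨fun w hw => h w (vball_mono (le_succ k) hw), fun w hw => h w (mem_sdiff.1 hw).1⟩
    · rintro ⟨h2, h3⟩ w hw; by_cases hw' : w ∈ vball T v k
      · exact h2 w hw'
      · exact h3 w (mem_sdiff.2 ⟨hw, hw'⟩)
  obtain ⟨h2, h3⟩ := far_iff ℓ v k ω
  by_cases h : q.Far T χ ℓ ∅ (vball T v (k + 1)) ω
  · have h4 := h1.1 (h2.1 h); have h5 := h3 h
    rw [if_pos h, if_pos h4.1, if_pos h4.2, (q.loc _ _ ω h5).2, Start.ph_agree (h5.mono (q.sub _ ω))]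
  · grind

theorem norm_test_apply_le (ℓ : Labelling n) (H : Set (Vertex n)) (A : Finset (Vertex n)) (ω : Ω) :
  ‖q.test lay T χ ℓ H A ω‖ ≤ 2 * ‖p.ph lay (hid T χ ℓ H) d ω‖ := by
  simp only [test]
  split_ifs
  · rw [norm_mul, Complex.norm_real, Real.norm_eq_abs]; exact mul_le_mul_of_nonneg_right (q.bound _ _ _) (norm_nonneg _)
  · rw [norm_zero]; positivity

theorem norm_test_sq_le (ℓ : Labelling n) (H : Set (Vertex n)) (A : Finset (Vertex n)) : ‖q.test lay T χ ℓ H A‖ ^ 2 ≤ 4 := by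
  calc _ ≤ ∑ ω, 4 * ‖p.ph lay (hid T χ ℓ H) d ω‖ ^ 2 := by
        rw [norm_sq_eq]; refine sum_le_sum fun ω _ => ?_
        refine (pow_le_pow_left₀ (norm_nonneg _) (norm_test_apply_le ℓ H A ω) 2).trans ?_; rw [mul_pow]; norm_num
    _ = 4 * ‖p.ph lay (hid T χ ℓ H) d‖ ^ 2 := by rw [← mul_sum, norm_sq_eq]
    _ ≤ 4 * 1 := mul_le_mul_of_nonneg_left (Start.norm_ph_sq_le _ _) (by norm_num)
    _ = 4 := by norm_num

variable {v w : Vertex n} {k : ℕ}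

theorem test_relabel (ℓ : Labelling n) {H : Finset (Vertex n)} {A : Finset (Vertex n)}
  (hA : Disjoint A H) (he : exit n ∉ H) (hw : w ∈ H) (y : Str n) :
  q.test lay T χ (relabel ℓ w y) ↑H A = q.test lay T χ ℓ ↑H A := by
  classical
  have h1 : hid T χ (relabel ℓ w y) ↑H = hid T χ ℓ ↑H := hid_relabel ℓ (by exact_mod_cast hw) y
  have h2 : exit n ≠ w := fun h => he (h ▸ hw)
  ext ω
  simp only [test, h1, relabel_of_ne _ _ h2]
  refine if_congr ?_ rfl rfl
  unfold Far
  refine forall₂_congr fun a ha => ?_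
  rw [h1, relabel_of_ne]
  rintro rfl
  exact Finset.disjoint_left.1 hA ha hw

variable {M G : ℕ}

/-- Dropping the projection of `test_eq` matters only where a computation that does not see the ball
touches one of its labels by luck. There are at most `M` touched strings, at most `3 * 2 ^ k` hidden
vertices, and a vector of squared norm at most `4`. -/
theorem average_sub_test_sq_le (hl : 0 ≤ luck n) (hM : ∀ K ω, Tame K → (q.Q K ω).card ≤ M) (hent : entrance n ∉ vball T v k) (hexit : exit n ∉ vball T v k) :
  average (fun ℓ => ‖q.test lay T χ ℓ ∅ (vball T v (k + 1)) - q.test lay T χ ℓ ↑(vball T v k) (vball T v (k + 1) \ vball T v k)‖ ^ 2) ≤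
    (3 * 2 ^ k) * (4 * M * luck n) := by
  classical
  set H := vball T v k with hH
  set A := vball T v (k + 1) \ H with hA
  have hdis : Disjoint A H := Finset.sdiff_disjoint
  calc _ ≤ average (fun ℓ => ∑ w ∈ H, ∑ ω, if ℓ.1 w ∈ q.Q (hid T χ ℓ ↑H) ω then
        ‖q.test lay T χ ℓ ↑H A ω‖ ^ 2 else 0) := by
        refine average_mono fun ℓ => ?_; rw [test_eq ℓ v k, norm_sq_eq, sum_comm]; refine sum_le_sum fun ω _ => ?_
        rw [PiLp.sub_apply, cut_apply]; split_ifs with h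
        · rw [sub_self, norm_zero, zero_pow two_ne_zero]
          exact sum_nonneg fun w _ => by split_ifs <;> positivity
        · unfold Far at h
          push Not at h
          obtain ⟨w, hw, h⟩ := h; rw [zero_sub, norm_neg]
          refine le_trans (le_of_eq ?_) (single_le_sum (f := fun w =>
            if ℓ.1 w ∈ q.Q (hid T χ ℓ ↑H) ω then ‖q.test lay T χ ℓ ↑H A ω‖ ^ 2 else 0)
            (fun i _ => ?_) hw)
          · grind
          · dsimp only; split_ifs <;> positivity
    _ ≤ ∑ w ∈ H, luck n * M * 4 := by
        rw [average_sum]; refine sum_le_sum fun w hw => ?_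
        refine (average_label_le (fun ℓ x => ∑ ω, if x ∈ q.Q (hid T χ ℓ ↑H) ω then
          ‖q.test lay T χ ℓ ↑H A ω‖ ^ 2 else 0)
          (fun ℓ x => sum_nonneg fun ω _ => by split_ifs <;> positivity) ?_
          (fun h => hent (h ▸ hw)) (fun _ => 4) (a := M) ?_).trans ?_
        · intro ℓ y x
          rw [hid_relabel ℓ (by exact_mod_cast hw), test_relabel ℓ hdis hexit hw]
        · intro ℓ; rw [sum_comm]
          calc _ ≤ ∑ ω, (M : ℝ) * ‖q.test lay T χ ℓ ↑H A ω‖ ^ 2 := by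
                refine sum_le_sum fun ω _ => ?_; rw [← sum_filter, sum_const, nsmul_eq_mul]
                refine mul_le_mul_of_nonneg_right ?_ (by positivity)
                refine Nat.cast_le.2 (le_trans (le_of_eq ?_) (hM (hid T χ ℓ ↑H) ω tame_hid)); congr 1; ext; simp
            _ ≤ _ := by rw [← mul_sum, ← norm_sq_eq]; exact mul_le_mul_of_nonneg_left (norm_test_sq_le _ _ _) (cast_nonneg _)
        · exact mul_le_mul_of_nonneg_left (average_const_le (by norm_num)) (by positivity)
    _ ≤ _ := by
        rw [sum_const, nsmul_eq_mul]
        have : (H.card : ℝ) ≤ 3 * 2 ^ k := by exact_mod_cast card_vball v k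
        calc _ ≤ (3 * 2 ^ k : ℝ) * (luck n * M * 4) := mul_le_mul_of_nonneg_right this (by positivity)
          _ = _ := by ring

/-- The backward evolution of the test vector in which more and more vertices are shown. -/
def shade (q : Cont p d) (lay : ℕ → QLay n Ω) (T : WeldedTree n)
  (χ : EdgeColouring T.graph) (v : Vertex n) (ℓ : Labelling n) (k : ℕ) : Vec Ω :=
  back lay (fun j => hid T χ ℓ ↑(vball T v j)) d (q.test lay T χ ℓ ↑(vball T v d) (vball T v (d + 1) \ vball T v d)) k

/-- Before layer `k` the backward evolution has used only layers from `k` on, and in all of them the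
ball of radius `k` was hidden. The label of the exit enters the functional, so the exit must not be
hidden. -/
theorem shade_relabel (hexit : exit n ∉ vball T v d) (ℓ : Labelling n) (hk : k ≤ d) (hw : w ∈ vball T v k) (y : Str n) :
  q.shade lay T χ v (relabel ℓ w y) k = q.shade lay T χ v ℓ k := by
  unfold shade
  rw [test_relabel ℓ Finset.sdiff_disjoint hexit (vball_mono hk hw)]
  exact back_congr hk (fun i hi _ => hid_relabel ℓ (by exact_mod_cast vball_mono hi hw) y) _

theorem average_hit_shade_sq_le (hG : ∀ k ω, ((lay k).rd ω).card ≤ G) (hl : 0 ≤ luck n) (hexit : exit n ∉ vball T v d) (hk : k + 1 ≤ d) (hw : w ∈ vball T v (k + 1)) (hent : w ≠ entrance n) :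
  average (fun ℓ => ‖(lay k).hit {ℓ.1 w} (q.shade lay T χ v ℓ (k + 1))‖ ^ 2) ≤ 4 * G * luck n := by
  refine (average_label_le (fun ℓ x => ‖(lay k).hit {x} (q.shade lay T χ v ℓ (k + 1))‖ ^ 2)
    (fun _ _ => by positivity) ?_ hent (fun _ => 4) (a := G) ?_).trans ?_
  · intro ℓ y x; rw [shade_relabel hexit ℓ hk hw]
  · intro ℓ; refine ((lay k).sum_norm_hit_sq_le (hG k) _).trans ?_; unfold shade; rw [norm_back]
    exact mul_le_mul_of_nonneg_left (norm_test_sq_le _ _ _) (cast_nonneg _)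
  · calc _ ≤ luck n * G * 4 := mul_le_mul_of_nonneg_left (average_const_le (by norm_num)) (by positivity)
      _ = _ := by ring

theorem add_three_sq_le (a b c : ℝ) : (a + b + c) ^ 2 ≤ 3 * (a ^ 2 + b ^ 2 + c ^ 2) := by
  nlinarith [sq_nonneg (a - b), sq_nonneg (b - c), sq_nonneg (a - c)]

theorem norm_hit_le (A : QLay n Ω) (Y : Set (Str n)) (ψ : Vec Ω) : ‖A.hit Y ψ‖ ≤ ‖ψ‖ := norm_cut_le _ _

theorem hit_add (A : QLay n Ω) (Y : Set (Str n)) (ψ φ : Vec Ω) : A.hit Y (ψ + φ) = A.hit Y ψ + A.hit Y φ := by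
  ext ω
  simp only [QLay.hit, cut_apply, PiLp.add_apply]
  split_ifs <;> simp

theorem back_sub (Os : ℕ → Oracle n) (m : ℕ) (β β' : Vec Ω) (j : ℕ) :
  back lay Os m (β - β') j = back lay Os m β j - back lay Os m β' j := by
  simp [back]

/-- The true backward state is compared with `shade` in three steps: the test vector is replaced by
one that is ignorant of the ball of radius `d`, the oracles are replaced by those that hide balls,
and the amplitude of the ignorant state at the label of `v` is left over. Each step costs a lucky
guess. -/
theorem hit_back_le (ℓ : Labelling n) (hk : k + 1 ≤ d) :
  ‖(lay k).hit {ℓ.1 v} (back lay (fun _ => 𝔎) d (q.test lay T χ ℓ ∅ (vball T v (d + 1))) (k + 1))‖ ^ 2 ≤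
  3 * (‖q.test lay T χ ℓ ∅ (vball T v (d + 1)) - q.test lay T χ ℓ ↑(vball T v d) (vball T v (d + 1) \ vball T v d)‖ ^ 2 +
    4 * d * ∑ i ∈ range d, ∑ w ∈ vball T v (i + 1), ‖(lay i).hit {ℓ.1 w} (q.shade lay T χ v ℓ (i + 1))‖ ^ 2 +
    ‖(lay k).hit {ℓ.1 v} (q.shade lay T χ v ℓ (k + 1))‖ ^ 2) := by
  set β := q.test lay T χ ℓ ∅ (vball T v (d + 1))
  set β' := q.test lay T χ ℓ ↑(vball T v d) (vball T v (d + 1) \ vball T v d)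
  -- Hiding the ball of radius `i` changes answers only for vertices within distance `i + 1`. This
  -- is exactly the ball about which `shade` at `i + 1` knows nothing.
  let Y : ℕ → Set (Str n) := fun i => ℓ.1 '' ↑(vball T v (i + 1))
  have h1 := norm_back_sub_le (lay := lay) (K := 𝔎) (fun j => hid T χ ℓ ↑(vball T v j)) Y d (by
      intro j _ x hx c; have hx' : ∀ w ∈ vball T v (j + 1), ℓ.1 w ≠ x := fun w hw h => hx ⟨w, hw, h⟩
      rcases hid_cases (T := T) (χ := χ) (ℓ := ℓ) (H := ∅) x c with
        ⟨a, b, rfl, -, -, hj, h2⟩ | ⟨h2, h3⟩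
      · rw [h2]; refine (hid_of_joined (fun ha => ?_) (fun hb => ?_) hj).symm
        · exact hx' a (vball_mono (le_succ j) ha) rfl
        · exact hx' a (mem_vball_of_adj hb hj.1.symm) rfl
      · rw [h3]
        rcases hid_cases (H := ↑(vball T v j)) x c with
          ⟨a, b, ha, -, -, hj, h4⟩ | ⟨-, h4⟩
        · exact absurd ⟨a, b, ha, by simp, by simp, hj⟩ h2
        · exact h4.symm) β' hk
  set b0 := back lay (fun _ => 𝔎) d β' (k + 1)
  have h2 : back lay (fun _ => 𝔎) d β (k + 1) = back lay (fun _ => 𝔎) d (β - β') (k + 1) +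
        ((b0 - q.shade lay T χ v ℓ (k + 1)) + q.shade lay T χ v ℓ (k + 1)) := by
    rw [back_sub]; simp only [b0]; abel
  set s := ∑ i ∈ Finset.Ico (k + 1) d, 2 * ‖(lay i).hit (Y i) (q.shade lay T χ v ℓ (i + 1))‖
  have h3 : s ≤ ∑ i ∈ range d, 2 * ‖(lay i).hit (Y i) (q.shade lay T χ v ℓ (i + 1))‖ := by
    refine Finset.sum_le_sum_of_subset_of_nonneg (fun i hi => ?_) fun i _ _ => by positivity
    grind
  have h4 : ‖(lay k).hit {ℓ.1 v} (back lay (fun _ => 𝔎) d β (k + 1))‖ ≤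
      ‖β - β'‖ + s + ‖(lay k).hit {ℓ.1 v} (q.shade lay T χ v ℓ (k + 1))‖ := by
    rw [h2, hit_add, hit_add, ← add_assoc]
    refine (norm_add_le _ _).trans (add_le_add_left ((norm_add_le _ _).trans (add_le_add ?_ ?_)) _)
    · refine (norm_hit_le _ _ _).trans ?_; rw [norm_back]
    · exact (norm_hit_le _ _ _).trans h1
  have h5 : s ^ 2 ≤ 4 * d * ∑ i ∈ range d, ∑ w ∈ vball T v (i + 1), ‖(lay i).hit {ℓ.1 w} (q.shade lay T χ v ℓ (i + 1))‖ ^ 2 := by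
    refine (Start.sq_norm_le_of_le_sum (sum_nonneg fun i _ => by positivity) h3).trans ?_
    rw [mul_sum, mul_sum]; refine sum_le_sum fun i _ => ?_
    have h6 := (lay i).norm_hit_sq_le (Y i) _ (vball T v (i + 1)) ℓ.1 (fun y ⟨w, hw, h⟩ => ⟨w, hw, h⟩) (q.shade lay T χ v ℓ (i + 1))
    rw [mul_pow]
    have := mul_le_mul_of_nonneg_left h6 (show (0 : ℝ) ≤ 4 * d by positivity)
    linarith
  refine (pow_le_pow_left₀ (norm_nonneg _) h4 2).trans ((add_three_sq_le _ _ _).trans ?_)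
  linarith

/-- The overlap is a sum over layers of products of a forward and a backward amplitude at the label
of `v`. By `2 * a * b ≤ a ^ 2 + b ^ 2` it is bounded by squares, each of which is the weight of a
lucky guess. -/
theorem abs_average_far_le (hG : ∀ k ω, ((lay k).rd ω).card ≤ G) (hl : 0 ≤ luck n)
  (hM : ∀ K ω, Tame K → (q.Q K ω).card ≤ M) (hexit : exit n ∉ vball T v d) :
  |average fun ℓ => (inner ℂ (q.test lay T χ ℓ ∅ (vball T v (d + 1))) (p.del lay 𝔎 (ℓ.1 v) d)).re| ≤
    d * luck n * (13 * G + 36 * 2 ^ d * M + 144 * d ^ 2 * 2 ^ d * G) := by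
  classical
  -- The label of the entrance is touched in any case, so for such `v` no outcome is far and the
  -- test vector vanishes.
  by_cases hent : entrance n ∈ vball T v (d + 1)
  · have h0 : ∀ ℓ, q.test lay T χ ℓ ∅ (vball T v (d + 1)) = 0 := by
      intro ℓ; ext ω; simp only [test]; rw [if_neg]
      · rfl
      intro h; apply h _ hent; rw [ℓ.2.2.1]; exact q.sub _ ω (subset_ball d (p.zero_mem _))
    simp only [h0, inner_zero_left, Complex.zero_re]
    have : average (fun _ : Labelling n => (0 : ℝ)) = 0 := by simp [average]
    rw [this, abs_zero]; positivity
  have hent' : ∀ {k}, k ≤ d + 1 → ∀ w ∈ vball T v k, w ≠ entrance n := by rintro k hk w hw rfl; exact hent (vball_mono hk hw)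
  refine (abs_average_le _).trans ?_
  calc _ ≤ average (fun ℓ => ∑ k ∈ range d, (p.am lay 𝔎 k (ℓ.1 v) ^ 2 + (3 * ‖q.test lay T χ ℓ ∅ (vball T v (d + 1)) -
          q.test lay T χ ℓ ↑(vball T v d) (vball T v (d + 1) \ vball T v d)‖ ^ 2 +
        (12 * d * ∑ i ∈ range d, ∑ w ∈ vball T v (i + 1), ‖(lay i).hit {ℓ.1 w} (q.shade lay T χ v ℓ (i + 1))‖ ^ 2 +
        3 * ‖(lay k).hit {ℓ.1 v} (q.shade lay T χ v ℓ (k + 1))‖ ^ 2)))) := by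
        refine average_mono fun ℓ => ?_; refine (Complex.abs_re_le_norm _).trans ?_
        have h := norm_inner_dl_le (lay := lay) (K := 𝔎) (S := p.S 𝔎) (ψ := p.ψ 𝔎) (ℓ.1 v) d (q.test lay T χ ℓ ∅ (vball T v (d + 1))) d
        rw [back_self] at h; refine h.trans (sum_le_sum fun k hk => ?_)
        have h1 := hit_back_le (T := T) (χ := χ) (lay := lay) (q := q) (v := v) ℓ (succ_le_of_lt (mem_range.1 hk))
        set a := ‖(lay k).hit {ℓ.1 v} (back lay (fun _ => 𝔎) d (q.test lay T χ ℓ ∅ (vball T v (d + 1))) (k + 1))‖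
        unfold Start.am; set b := amp lay 𝔎 (p.S 𝔎) (p.ψ 𝔎) k (ℓ.1 v); nlinarith [sq_nonneg (a - b)]
    _ ≤ ∑ k ∈ range d, (luck n * G * 1 + (3 * ((3 * 2 ^ d) * (4 * M * luck n)) + (12 * d * (∑ i ∈ range d, (3 * 2 ^ d) * (4 * G * luck n)) +
          3 * (4 * G * luck n)))) := by
        rw [average_sum]; refine sum_le_sum fun k hk => ?_; have hk' : k + 1 ≤ d := succ_le_of_lt (mem_range.1 hk)
        have e1 : average (fun ℓ => p.am lay 𝔎 k (ℓ.1 v) ^ 2) ≤ luck n * G * 1 := by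
          have := Start.average_am_sq_le (p := p) (T := T) (χ := χ) hG (J := fun _ => 1) (fun _ => zero_le_one) ∅ v (fun _ _ => rfl) k
          simp only [one_mul] at this
          exact this.trans (mul_le_mul_of_nonneg_left Start.average_one_le (by positivity))
        have e2 := average_sub_test_sq_le (lay := lay) (χ := χ) hl hM (fun h => hent (vball_mono (le_succ d) h)) hexit
        have e3 : average (fun ℓ => ∑ i ∈ range d, ∑ w ∈ vball T v (i + 1), ‖(lay i).hit {ℓ.1 w} (q.shade lay T χ v ℓ (i + 1))‖ ^ 2) ≤
            ∑ i ∈ range d, (3 * 2 ^ d) * (4 * G * luck n) := by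
          rw [average_sum]; refine sum_le_sum fun i hi => ?_
          have hi' : i + 1 ≤ d := succ_le_of_lt (mem_range.1 hi); rw [average_sum]
          calc _ ≤ ∑ w ∈ vball T v (i + 1), 4 * G * luck n :=
                sum_le_sum fun w hw => average_hit_shade_sq_le hG hl hexit hi' hw (hent' (by omega) w hw)
            _ ≤ _ := by
                rw [sum_const, nsmul_eq_mul]
                refine mul_le_mul_of_nonneg_right ?_ (by positivity)
                have h1 := card_vball (T := T) v d; have h2 := card_le_card (vball_mono (T := T) (v := v) hi')
                exact_mod_cast h2.trans h1
        have e4 := average_hit_shade_sq_le (q := q) (χ := χ) hG hl hexit hk' (self_mem_vball v _)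
            (hent' (by omega) v (self_mem_vball v (d + 1)))
        rw [average_add, average_add, average_add, average_mul_left, average_mul_left, average_mul_left]
        exact add_le_add e1 (add_le_add (mul_le_mul_of_nonneg_left e2 (by norm_num))
          (add_le_add (mul_le_mul_of_nonneg_left e3 (by positivity)) (mul_le_mul_of_nonneg_left e4 (by norm_num))))
    _ = _ := by rw [sum_const, sum_const, card_range, nsmul_eq_mul, nsmul_eq_mul]; ring

end Cont
end

/-! ### The distribution of the outcome of a quantum tier -/

section
variable {n : ℕ} {Z E : Type*} [Fintype Z] [Fintype E]

/-- The probabilities of the outcomes. -/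
def outP (ψ : Vec (Z × E)) (z : Z) : ℝ := ∑ e, ‖ψ (z, e)‖ ^ 2

/-- The first-order change of the probabilities of the outcomes. -/
def outD (φ δ : Vec (Z × E)) (z : Z) : ℝ := 2 * ∑ e, ((starRingEnd ℂ) (φ (z, e)) * δ (z, e)).re

/-- The number in `[-b, b]` that is closest to `x`. -/
def clip (b x : ℝ) : ℝ := max (-b) (min b x)

theorem abs_sub_clip_le {b x c : ℝ} (hb : 0 ≤ b) (hc : 0 ≤ c) (h : |x| ≤ b + c) :
  |x - clip b x| ≤ c := by
  rw [abs_le] at h ⊢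
  unfold clip
  rcases le_total b x with h1 | h1
  · grind
  · grind

theorem outP_nonneg (ψ : Vec (Z × E)) (z : Z) : 0 ≤ outP ψ z := sum_nonneg fun _ _ => by positivity

theorem sum_outP (ψ : Vec (Z × E)) : ∑ z, outP ψ z = ‖ψ‖ ^ 2 := by
  rw [norm_sq_eq, sum_prod_type]
  rfl

theorem norm_add_sq_complex (a b : ℂ) : ‖a + b‖ ^ 2 = ‖a‖ ^ 2 + 2 * ((starRingEnd ℂ) a * b).re + ‖b‖ ^ 2 := by
  rw [← Complex.normSq_eq_norm_sq, ← Complex.normSq_eq_norm_sq, ← Complex.normSq_eq_norm_sq, Complex.normSq_add]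
  have : (a * (starRingEnd ℂ) b).re = ((starRingEnd ℂ) a * b).re := by simp [Complex.mul_re]
  rw [this]
  ring

theorem outP_add (φ δ : Vec (Z × E)) (z : Z) : outP (φ + δ) z = outP φ z + outD φ δ z + outP δ z := by
  unfold outP outD
  rw [mul_sum, ← sum_add_distrib, ← sum_add_distrib]
  exact sum_congr rfl fun e _ => norm_add_sq_complex _ _

theorem abs_re_conj_mul_le (a b : ℂ) : |((starRingEnd ℂ) a * b).re| ≤ ‖a‖ * ‖b‖ := by
  refine (Complex.abs_re_le_norm _).trans ?_
  rw [norm_mul, RCLike.norm_conj]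

/-- The weight `t` will be `2 ^ (-n)` or the size of a slot. A first-order change is traded for a
small multiple of the probability plus a large multiple of a squared error. -/
theorem abs_outD_le (φ δ : Vec (Z × E)) (z : Z) {t : ℝ} (ht : 0 < t) :
  |outD φ δ z| ≤ t * outP φ z + t⁻¹ * outP δ z := by
  unfold outD outP
  rw [abs_mul, abs_two, mul_sum, mul_sum, ← sum_add_distrib]
  refine (mul_le_mul_of_nonneg_left (abs_sum_le_sum_abs _ _) zero_le_two).trans ?_
  rw [mul_sum]
  refine sum_le_sum fun e _ => ?_
  have h1 := abs_re_conj_mul_le (φ (z, e)) (δ (z, e))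
  set a := ‖φ (z, e)‖
  set b := ‖δ (z, e)‖
  have h2 : 2 * (a * b) ≤ t * a ^ 2 + t⁻¹ * b ^ 2 := by
    have h3 : t * a ^ 2 + t⁻¹ * b ^ 2 - 2 * (a * b) = t⁻¹ * (t * a - b) ^ 2 := by field_simp; ring
    have h4 : 0 ≤ t⁻¹ * (t * a - b) ^ 2 := by positivity
    linarith
  linarith

theorem abs_outD_mul_le (φ δ : Vec (Z × E)) (z : Z) {A : ℝ} (hA : 0 ≤ A) :
  |outD φ δ z| * A ≤ outP φ z * A ^ 2 + outP δ z := by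
  unfold outD outP
  rw [abs_mul, abs_two, sum_mul, ← sum_add_distrib]
  refine (mul_le_mul_of_nonneg_right (mul_le_mul_of_nonneg_left (abs_sum_le_sum_abs _ _) zero_le_two) hA).trans ?_
  rw [mul_sum, sum_mul]
  refine sum_le_sum fun e _ => ?_
  have h1 := mul_le_mul_of_nonneg_right (abs_re_conj_mul_le (φ (z, e)) (δ (z, e))) hA
  nlinarith [sq_nonneg (‖φ (z, e)‖ * A - ‖δ (z, e)‖)]

theorem outD_sum {ι : Type*} (s : Finset ι) (φ : Vec (Z × E)) (δ : ι → Vec (Z × E)) (z : Z) :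
  outD φ (∑ i ∈ s, δ i) z = ∑ i ∈ s, outD φ (δ i) z := by
  unfold outD
  rw [← mul_sum, sum_comm]
  congr 1
  refine sum_congr rfl fun e _ => ?_
  rw [WithLp.ofLp_sum, Finset.sum_apply, mul_sum, Complex.re_sum]

theorem outD_sub (φ δ δ' : Vec (Z × E)) (z : Z) : outD φ (δ - δ') z = outD φ δ z - outD φ δ' z := by
  unfold outD
  rw [← mul_sub, ← sum_sub_distrib]
  congr 1
  refine sum_congr rfl fun e _ => ?_
  rw [PiLp.sub_apply, mul_sub, Complex.sub_re]

theorem outP_sum_le {ι : Type*} (s : Finset ι) (δ : ι → Vec (Z × E)) (z : Z) : outP (∑ i ∈ s, δ i) z ≤ s.card * ∑ i ∈ s, outP (δ i) z := by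
  unfold outP
  rw [sum_comm, mul_sum]
  refine sum_le_sum fun e _ => ?_
  rw [WithLp.ofLp_sum, Finset.sum_apply]
  exact (pow_le_pow_left₀ (norm_nonneg _) (norm_sum_le _ _) 2).trans (sq_sum_le_card_mul_sum_sq)

variable {p : Start n (Z × E)} {lay : ℕ → QLay n (Z × E)} {d : ℕ}

namespace Start

variable (p lay)

/-- The state of the real tier. -/
def re (K : Oracle n) (k : ℕ) : Vec (Z × E) := real lay K (p.ψ K) k

/-- The correction of the probability of an outcome, for the strings in `Y`. -/
def corr (K : Oracle n) (d : ℕ) (Y : Finset (Str n)) (z : Z) : ℝ := outD (p.ph lay K d) (∑ x ∈ Y, p.apx lay K x d) z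

variable {p lay} {T : WeldedTree n} {χ : EdgeColouring T.graph}

theorem re_eq (ℓ : Labelling n) (k : ℕ) : p.re lay 𝔎 k - p.ph lay 𝔎 k = ∑ v, p.del lay 𝔎 (ℓ.1 v) k := by
  classical
  unfold re ph del
  rw [real_eq (S := p.S 𝔎) k, add_sub_cancel_left, ← sum_image (f := fun x => dl lay 𝔎 (p.S 𝔎) (p.ψ 𝔎) x k) (fun a _ b _ h => ℓ.2.1 h)]
  refine (Finset.sum_subset (Finset.subset_univ _) fun x _ hx => ?_).symm
  rw [← norm_le_zero_iff]
  refine (norm_dl_le _ _).trans (le_of_eq (sum_eq_zero fun j _ => ?_))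
  unfold amp
  rw [if_neg, mul_zero]
  intro hb
  obtain ⟨v, rfl⟩ := exists_label_of_bad hb
  exact hx (Finset.mem_image_of_mem _ (mem_univ v))

open Classical in
theorem sum_apx_eq (ℓ : Labelling n) (k : ℕ) (Y : Finset (Str n)) : ∑ x ∈ Y, p.apx lay 𝔎 x k =
    ∑ v ∈ univ.filter (fun v => ℓ.1 v ∈ Y), p.apx lay 𝔎 (ℓ.1 v) k := by
  rw [← sum_image (f := fun x => p.apx lay 𝔎 x k) (fun a _ b _ h => ℓ.2.1 h)]
  refine (Finset.sum_subset ?_ fun x hxY hx => ?_).symm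
  · grind
  · rw [← norm_le_zero_iff]; refine (norm_dd_le _ _).trans (le_of_eq (sum_eq_zero fun j _ => ?_)); unfold amp
    rw [if_neg, mul_zero]; intro hb; obtain ⟨v, rfl⟩ := exists_label_of_bad hb
    exact hx (Finset.mem_image_of_mem _ (mem_filter.2 ⟨mem_univ v, hxY⟩))

end Start

namespace Cont
variable (q : Cont p d) {T : WeldedTree n} {χ : EdgeColouring T.graph}

/-- The link between inner products and probabilities: the test vector picks out the outcomes whose
touched strings stay away from `v` and weighs the first-order change with the functional. -/
theorem inner_test_eq (hq : ∀ K z e e', q.Q K (z, e) = q.Q K (z, e') ∧ q.f K (z, e) = q.f K (z, e'))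
  (e0 : E) (ℓ : Labelling n) (v : Vertex n) (δ : Vec (Z × E)) :
  2 * (inner ℂ (q.test lay T χ ℓ ∅ (vball T v (d + 1))) δ).re = ∑ z, (open Classical in if ℓ.1 v ∈ ball 𝔎 (q.Q 𝔎 (z, e0)) (d + 1) then 0
      else q.f 𝔎 (z, e0) (ℓ.1 (exit n)) * outD (p.ph lay 𝔎 d) δ z) := by
  classical
  rw [PiLp.inner_apply, Complex.re_sum, sum_prod_type, mul_sum]
  refine sum_congr rfl fun z _ => ?_
  have h1 : ∀ e, q.Far T χ ℓ ∅ (vball T v (d + 1)) (z, e) ↔ ¬ ℓ.1 v ∈ ball 𝔎 (q.Q 𝔎 (z, e0)) (d + 1) := by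
    intro e; rw [hid_empty, mem_ball_blackBox_iff, ← hid_empty]
    push Not
    unfold Far; rw [(hq _ z e e0).1]
  simp only [test, h1]
  split_ifs with h
  · simp
  · unfold outD; rw [mul_sum, mul_sum, mul_sum]; refine sum_congr rfl fun e _ => ?_
    rw [(hq _ z e e0).2, RCLike.inner_apply, map_mul, Complex.conj_ofReal, mul_comm (δ (z, e)), mul_assoc, Complex.re_ofReal_mul]
    ring

variable {q} {M G : ℕ}

/-- For `v` within distance `d` of the exit, hiding a ball would hide the exit, whose label the
functional may use. There are at most `3 * 2 ^ d` such vertices; for them a single amplitude of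
order `2 ^ (-n)` is affordable, by `2 * b ≤ 2 ^ (-n) + 2 ^ n * b ^ 2`. -/
theorem sum_far_le (hG : ∀ k ω, ((lay k).rd ω).card ≤ G) (hl : 0 ≤ luck n) (hM : ∀ K ω, Tame K → (q.Q K ω).card ≤ M) :
  |average fun ℓ => ∑ v, 2 * (inner ℂ (q.test lay T χ ℓ ∅ (vball T v (d + 1))) (p.del lay 𝔎 (ℓ.1 v) d)).re| ≤
    2 * (card (Vertex n) * (d * luck n * (13 * G + 36 * 2 ^ d * M + 144 * d ^ 2 * 2 ^ d * G)) +
      3 * 2 ^ d * ((2 ^ n)⁻¹ + 2 ^ n * (4 * d ^ 2 * G * luck n))) := by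
  classical
  rw [average_sum]
  refine (abs_sum_le_sum_abs _ _).trans ?_
  calc _ ≤ ∑ v : Vertex n, (2 * (d * luck n * (13 * G + 36 * 2 ^ d * M + 144 * d ^ 2 * 2 ^ d * G)) +
        if v ∈ vball T (exit n) d then 2 * ((2 ^ n)⁻¹ + 2 ^ n * (4 * d ^ 2 * G * luck n)) else 0) := by
        refine sum_le_sum fun v _ => ?_; rw [average_mul_left, abs_mul, abs_two]; by_cases hv : exit n ∈ vball T v d
        · rw [if_pos (mem_vball_comm hv), ← mul_add]
          refine mul_le_mul_of_nonneg_left (le_add_of_nonneg_of_le (by positivity) ?_) zero_le_two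
          refine (abs_average_le _).trans ?_
          calc _ ≤ average (fun ℓ => ((2 : ℝ) ^ n)⁻¹ + 2 ^ n * ‖p.del lay 𝔎 (ℓ.1 v) d‖ ^ 2) := by
                refine average_mono fun ℓ => ?_; refine (Complex.abs_re_le_norm _).trans ((norm_inner_le_norm _ _).trans ?_)
                have h1 : ‖q.test lay T χ ℓ ∅ (vball T v (d + 1))‖ ≤ 2 := by
                  have := norm_test_sq_le (q := q) (T := T) (χ := χ) (lay := lay) ℓ ∅ (vball T v (d + 1))
                  nlinarith [norm_nonneg (q.test lay T χ ℓ ∅ (vball T v (d + 1)))]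
                set b := ‖p.del lay 𝔎 (ℓ.1 v) d‖ with hb; have hb0 : 0 ≤ b := norm_nonneg _
                have h2 : ((2 : ℝ) ^ n)⁻¹ + 2 ^ n * b ^ 2 - 2 * b = ((2 : ℝ) ^ n)⁻¹ * (2 ^ n * b - 1) ^ 2 := by field_simp; ring
                have h3 : 0 ≤ ((2 : ℝ) ^ n)⁻¹ * (2 ^ n * b - 1) ^ 2 := by positivity
                nlinarith
            _ ≤ _ := by
                rw [average_add, average_mul_left]
                exact add_le_add (average_const_le (by positivity))
                  (mul_le_mul_of_nonneg_left (Start.average_del_sq_le hG hl ∅ v d) (by positivity))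
        · refine le_add_of_le_of_nonneg (mul_le_mul_of_nonneg_left (abs_average_far_le hG hl hM hv) zero_le_two) ?_
          split_ifs <;> positivity
    _ ≤ _ := by
        rw [sum_add_distrib, sum_const, card_univ, nsmul_eq_mul, Finset.sum_ite_mem, Finset.univ_inter, sum_const, nsmul_eq_mul]
        have h1 : ((vball T (exit n) d).card : ℝ) ≤ 3 * 2 ^ d := by exact_mod_cast card_vball (exit n) d
        have h2 := mul_le_mul_of_nonneg_right h1 (show 0 ≤ 2 * (((2 : ℝ) ^ n)⁻¹ + 2 ^ n * (4 * d ^ 2 * G * luck n)) by positivity)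
        linarith

theorem card_filter_label_le (ℓ : Labelling n) (Y : Finset (Str n)) : (open Classical in (univ.filter fun v => ℓ.1 v ∈ Y).card) ≤ Y.card :=
  Finset.card_le_card_of_injOn ℓ.1 (fun w hw => by simpa using hw) ℓ.2.1.injOn

/-- Far vertices are handled by `sum_far_le`, and the correction removes `apx` for the near ones.
What is near depends on the outcome, so the remainders of all vertices have to be summed with weight
`2 ^ n`. That is affordable only because `del - apx` contains two lucky guesses. -/
theorem average_first_order_le (hG : ∀ k ω, ((lay k).rd ω).card ≤ G) (hl : 0 ≤ luck n) (hM : ∀ K ω, Tame K → (q.Q K ω).card ≤ M)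
  (hq : ∀ K z e e', q.Q K (z, e) = q.Q K (z, e') ∧ q.f K (z, e) = q.f K (z, e')) (e0 : E) :
  |average fun ℓ => ∑ z, q.f 𝔎 (z, e0) (ℓ.1 (exit n)) * (outD (p.ph lay 𝔎 d) (p.re lay 𝔎 d - p.ph lay 𝔎 d) z -
    p.corr lay 𝔎 d (ball 𝔎 (q.Q 𝔎 (z, e0)) (d + 1)) z)| ≤
    2 * (card (Vertex n) * (d * luck n * (13 * G + 36 * 2 ^ d * M + 144 * d ^ 2 * 2 ^ d * G)) +
      3 * 2 ^ d * ((2 ^ n)⁻¹ + 2 ^ n * (4 * d ^ 2 * G * luck n))) +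
    2 * ((2 ^ n)⁻¹ * (6 * 2 ^ d * M) + 2 ^ n * (64 * d ^ 4 * G ^ 2 * luck n ^ 2 * card (Vertex n) ^ 2)) := by
  classical
  set near : Labelling n → Z → Finset (Str n) := fun ℓ z =>
    ball 𝔎 (q.Q 𝔎 (z, e0)) (d + 1) with hnear
  have key : ∀ ℓ : Labelling n, ∑ z, q.f 𝔎 (z, e0) (ℓ.1 (exit n)) * (outD (p.ph lay 𝔎 d) (p.re lay 𝔎 d - p.ph lay 𝔎 d) z -
      p.corr lay 𝔎 d (near ℓ z) z) =
      (∑ v, 2 * (inner ℂ (q.test lay T χ ℓ ∅ (vball T v (d + 1))) (p.del lay 𝔎 (ℓ.1 v) d)).re) +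
      ∑ z, ∑ v ∈ univ.filter (fun v => ℓ.1 v ∈ near ℓ z), q.f 𝔎 (z, e0) (ℓ.1 (exit n)) * outD (p.ph lay 𝔎 d)
          (p.del lay 𝔎 (ℓ.1 v) d - p.apx lay 𝔎 (ℓ.1 v) d) z := by
    intro ℓ; simp only [inner_test_eq q hq e0]; rw [sum_comm, ← sum_add_distrib]; refine sum_congr rfl fun z _ => ?_
    unfold Start.corr
    rw [Start.sum_apx_eq, Start.re_eq, outD_sum, outD_sum, mul_sub, mul_sum, mul_sum,
      ← Finset.sum_filter_not_add_sum_filter univ (fun v => ℓ.1 v ∈ near ℓ z) (fun v => q.f 𝔎 (z, e0) (ℓ.1 (exit n)) *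
          outD (p.ph lay 𝔎 d) (p.del lay 𝔎 (ℓ.1 v) d) z),
      add_sub_assoc, ← sum_sub_distrib]
    congr 1
    · rw [sum_filter]; refine sum_congr rfl fun v _ => ?_; by_cases h : ℓ.1 v ∈ near ℓ z
      · grind
      · grind
    · refine sum_congr rfl fun v _ => ?_; rw [outD_sub, mul_sub]
  refine (le_of_eq (congrArg (fun f => |average f|) (funext key))).trans ?_
  rw [average_add]
  refine (abs_add_le _ _).trans (add_le_add (sum_far_le hG hl hM) ?_)
  refine (abs_average_le _).trans ?_
  calc _ ≤ average (fun ℓ => 2 * ((2 ^ n)⁻¹ * (6 * 2 ^ d * M) + 2 ^ n * ∑ v, ‖p.del lay 𝔎 (ℓ.1 v) d - p.apx lay 𝔎 (ℓ.1 v) d‖ ^ 2)) := by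
        refine average_mono fun ℓ => ?_
        set γ : Vertex n → Vec (Z × E) := fun v =>
          p.del lay 𝔎 (ℓ.1 v) d - p.apx lay 𝔎 (ℓ.1 v) d with hγ
        have h1 : ∀ z v, |q.f 𝔎 (z, e0) (ℓ.1 (exit n)) * outD (p.ph lay 𝔎 d) (γ v) z| ≤
            2 * ((2 ^ n)⁻¹ * outP (p.ph lay 𝔎 d) z + 2 ^ n * outP (γ v) z) := by
          intro z v; rw [abs_mul]
          have := abs_outD_le (p.ph lay 𝔎 d) (γ v) z (t := ((2 : ℝ) ^ n)⁻¹) (by positivity)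
          rw [inv_inv] at this; exact mul_le_mul (q.bound _ _ _) this (abs_nonneg _) zero_le_two
        have h2 : ∀ z, ((univ.filter (fun v => ℓ.1 v ∈ near ℓ z)).card : ℝ) ≤ 6 * 2 ^ d * M := by
          intro z; have h3 := card_filter_label_le ℓ (near ℓ z)
          have h4 := (tame_hid (T := T) (χ := χ) (ℓ := ℓ) (H := ∅)).card_ball (q.Q 𝔎 (z, e0)) (d + 1)
          have h5 := Nat.mul_le_mul_left (3 * 2 ^ (d + 1)) (hM 𝔎 (z, e0) tame_hid)
          have h6 : 3 * 2 ^ (d + 1) * M = 6 * 2 ^ d * M := by ring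
          exact_mod_cast (h3.trans (h4.trans (h5.trans h6.le)))
        calc _ ≤ ∑ z, ∑ v ∈ univ.filter (fun v => ℓ.1 v ∈ near ℓ z), 2 * ((2 ^ n)⁻¹ * outP (p.ph lay 𝔎 d) z + 2 ^ n * outP (γ v) z) := by
              refine (abs_sum_le_sum_abs _ _).trans (sum_le_sum fun z _ => ?_)
              exact (abs_sum_le_sum_abs _ _).trans (sum_le_sum fun v _ => h1 z v)
          _ ≤ ∑ z, (2 * ((2 ^ n)⁻¹ * (6 * 2 ^ d * M) * outP (p.ph lay 𝔎 d) z + 2 ^ n * ∑ v, outP (γ v) z)) := by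
              refine sum_le_sum fun z _ => ?_; rw [← mul_sum]; refine mul_le_mul_of_nonneg_left ?_ zero_le_two
              rw [sum_add_distrib, sum_const, nsmul_eq_mul, ← mul_sum]; refine add_le_add ?_ ?_
              · have := mul_le_mul_of_nonneg_right (h2 z) (show 0 ≤ ((2 : ℝ) ^ n)⁻¹ * outP (p.ph lay 𝔎 d) z from
                    mul_nonneg (by positivity) (outP_nonneg _ _))
                linarith
              · refine mul_le_mul_of_nonneg_left ?_ (by positivity)
                exact Finset.sum_le_sum_of_subset_of_nonneg (Finset.filter_subset _ _) fun v _ _ => outP_nonneg _ _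
          _ ≤ _ := by
              rw [← mul_sum, sum_add_distrib, ← mul_sum, ← mul_sum, sum_outP, sum_comm]
              simp only [sum_outP]; refine mul_le_mul_of_nonneg_left (add_le_add_left ?_ _) zero_le_two
              exact mul_le_of_le_one_right (by positivity) (Start.norm_ph_sq_le _ _)
    _ ≤ _ := by
        rw [average_mul_left, average_add, average_mul_left ((2 : ℝ) ^ n), average_sum]
        refine mul_le_mul_of_nonneg_left (add_le_add (average_const_le (by positivity))
          (mul_le_mul_of_nonneg_left ?_ (by positivity))) zero_le_two
        refine (sum_le_sum fun v _ => Start.average_del_sub_apx_sq_le hG hl v d).trans ?_; rw [sum_const, card_univ, nsmul_eq_mul]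
        exact le_of_eq (by ring)

/-- Clipping at `t` times the probability loses at most `t⁻¹` times the squared norm of the summed
approximations, by `abs_outD_le`. At most `6 * 2 ^ d * M` of them occur for one outcome. -/
theorem average_clip_error_le (hG : ∀ k ω, ((lay k).rd ω).card ≤ G) (hl : 0 ≤ luck n)
  (hM : ∀ K ω, Tame K → (q.Q K ω).card ≤ M) (e0 : E) {t : ℝ} (ht : 0 < t) :
  |average fun ℓ => ∑ z, q.f 𝔎 (z, e0) (ℓ.1 (exit n)) * (p.corr lay 𝔎 d (ball 𝔎 (q.Q 𝔎 (z, e0)) (d + 1)) z -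
    clip (t * outP (p.ph lay 𝔎 d) z) (p.corr lay 𝔎 d (ball 𝔎 (q.Q 𝔎 (z, e0)) (d + 1)) z))| ≤
    2 * (t⁻¹ * (6 * 2 ^ d * M * (4 * d ^ 2 * G * luck n * card (Vertex n)))) := by
  classical
  refine (abs_average_le _).trans ?_
  calc _ ≤ average (fun ℓ => 2 * (t⁻¹ * (6 * 2 ^ d * M * ∑ v, ‖p.apx lay 𝔎 (ℓ.1 v) d‖ ^ 2))) := by
        refine average_mono fun ℓ => ?_; refine (abs_sum_le_sum_abs _ _).trans ?_
        calc _ ≤ ∑ z, 2 * (t⁻¹ * (6 * 2 ^ d * M * ∑ v, outP (p.apx lay 𝔎 (ℓ.1 v) d) z)) := by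
              refine sum_le_sum fun z _ => ?_; rw [abs_mul]
              refine mul_le_mul (q.bound _ _ _) ?_ (abs_nonneg _) zero_le_two; set Y := ball 𝔎 (q.Q 𝔎 (z, e0)) (d + 1)
              have h1 : outP (∑ x ∈ Y, p.apx lay 𝔎 x d) z ≤ 6 * 2 ^ d * M * ∑ v, outP (p.apx lay 𝔎 (ℓ.1 v) d) z := by
                rw [Start.sum_apx_eq]
                refine (outP_sum_le _ _ z).trans (mul_le_mul ?_ ?_ ?_ (by positivity))
                · have h3 := card_filter_label_le ℓ Y
                  have h4 := (tame_hid (T := T) (χ := χ) (ℓ := ℓ) (H := ∅)).card_ball (q.Q 𝔎 (z, e0)) (d + 1)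
                  have h5 := Nat.mul_le_mul_left (3 * 2 ^ (d + 1)) (hM 𝔎 (z, e0) tame_hid)
                  have h6 : 3 * 2 ^ (d + 1) * M = 6 * 2 ^ d * M := by ring
                  exact_mod_cast (h3.trans (h4.trans (h5.trans h6.le)))
                · exact Finset.sum_le_sum_of_subset_of_nonneg (Finset.filter_subset _ _) fun v _ _ => outP_nonneg _ _
                · exact sum_nonneg fun v _ => outP_nonneg _ _
              refine (abs_sub_clip_le (mul_nonneg ht.le (outP_nonneg _ _))
                (mul_nonneg (inv_nonneg.2 ht.le) (outP_nonneg _ _)) (abs_outD_le _ _ z ht)).trans ?_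
              exact mul_le_mul_of_nonneg_left h1 (inv_nonneg.2 ht.le)
          _ = _ := by rw [← mul_sum, ← mul_sum, ← mul_sum, sum_comm]; simp only [sum_outP]
    _ ≤ _ := by
        rw [average_mul_left, average_mul_left, average_mul_left, average_sum]
        refine mul_le_mul_of_nonneg_left (mul_le_mul_of_nonneg_left (mul_le_mul_of_nonneg_left
          ((sum_le_sum fun v _ => Start.average_apx_sq_le hG hl ∅ v d).trans ?_)
          (by positivity)) (inv_nonneg.2 ht.le)) zero_le_two
        rw [sum_const, card_univ, nsmul_eq_mul]
        exact le_of_eq (by ring)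

end Cont
end

/-! ### Choosing an element with given weights -/

section
variable {Z : Type} [Fintype Z]

/-- The total weight of the elements before `z`. -/
def cum (N : Z → ℕ) (z : Z) : ℕ := ∑ y, if equivFin Z y < equivFin Z z then N y else 0

open Classical in
/-- The element that owns the number `γ`. -/
def pick [Nonempty Z] (N : Z → ℕ) (γ : ℕ) : Z :=
  if h : ∃ z, cum N z ≤ γ ∧ γ < cum N z + N z then h.choose else Classical.arbitrary Z

variable {N : Z → ℕ}

theorem cum_add_le {z z' : Z} (h : equivFin Z z < equivFin Z z') : cum N z + N z ≤ cum N z' := by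
  classical
  unfold cum
  rw [← sum_filter, ← sum_filter]
  have h1 : z ∉ univ.filter fun y => equivFin Z y < equivFin Z z := by simp
  rw [add_comm, ← sum_insert h1]
  refine Finset.sum_le_sum_of_subset fun y hy => ?_
  rw [mem_insert, mem_filter] at hy
  rw [mem_filter]
  rcases hy with rfl | ⟨-, hy⟩
  · grind
  · grind

theorem owner_unique {z z' : Z} {γ : ℕ} (h : cum N z ≤ γ ∧ γ < cum N z + N z) (h' : cum N z' ≤ γ ∧ γ < cum N z' + N z') : z = z' := by
  rcases lt_trichotomy (equivFin Z z) (equivFin Z z') with h1 | h1 | h1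
  · have := cum_add_le (N := N) h1; omega
  · exact (equivFin Z).injective h1
  · have := cum_add_le (N := N) h1; omega

theorem pick_eq [Nonempty Z] {z : Z} {γ : ℕ} (h : cum N z ≤ γ ∧ γ < cum N z + N z) : pick N γ = z := by
  have h0 : ∃ z, cum N z ≤ γ ∧ γ < cum N z + N z := ⟨z, h⟩
  unfold pick
  rw [dif_pos h0]
  exact owner_unique h0.choose_spec h

theorem cum_add_le_sum (N : Z → ℕ) (z : Z) : cum N z + N z ≤ ∑ y, N y := by
  classical
  unfold cum
  rw [← sum_filter]
  have h1 : z ∉ univ.filter fun y => equivFin Z y < equivFin Z z := by simp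
  rw [add_comm, ← sum_insert h1]
  exact Finset.sum_le_sum_of_subset (Finset.subset_univ _)

/-- The intervals from `cum N z` of length `N z` partition the range. Besides the outcome `z`, the
position `r` inside its interval is kept, because it serves as further randomness for the
corrections. -/
theorem sum_range_eq (N : Z → ℕ) (φ : ℕ → ℝ) : ∑ γ ∈ range (∑ z, N z), φ γ = ∑ z, ∑ r ∈ range (N z), φ (cum N z + r) := by
  classical
  set s : Finset (Σ _ : Z, ℕ) := univ.sigma fun z => range (N z) with hs
  have hinj : Set.InjOn (fun p : Σ _ : Z, ℕ => cum N p.1 + p.2) s := by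
    rintro ⟨z, r⟩ h ⟨z', r'⟩ h' heq
    simp only [hs, Finset.coe_sigma, Set.mem_sigma_iff, Finset.mem_coe, mem_univ, mem_range, true_and] at h h' heq
    obtain rfl : z = z' := owner_unique (N := N) (γ := cum N z + r) ⟨by omega, by omega⟩
      ⟨by omega, by omega⟩
    obtain rfl : r = r' := by omega
    rfl
  have h1 : s.image (fun p => cum N p.1 + p.2) = range (∑ z, N z) := by
    refine Finset.eq_of_subset_of_card_le (fun γ hγ => ?_) ?_
    · obtain ⟨⟨z, r⟩, h, rfl⟩ := Finset.mem_image.1 hγ; simp only [hs, mem_sigma, mem_univ, mem_range, true_and] at h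
      rw [mem_range]; have := cum_add_le_sum N z; dsimp only; omega
    · rw [Finset.card_image_of_injOn hinj, Finset.card_sigma]; simp
  rw [← h1, sum_image hinj, Finset.sum_sigma]

/-! ### Independent uniform coins -/

/-- The coins, continued by zeros. -/
def ext {m D : ℕ} (c : Fin m → Fin D) (j : ℕ) : ℕ := if h : j < m then c ⟨j, h⟩ else 0

/-- The average over `m` coins from `0, …, D - 1`. -/
def coinAv (m D : ℕ) (φ : (ℕ → ℕ) → ℝ) : ℝ := (∑ c : Fin m → Fin D, φ (ext c)) / (D : ℝ) ^ m

variable {m D : ℕ}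

theorem ext_update (c : Fin m → Fin D) (i : Fin m) (γ : Fin D) :
  ext (update c i γ) = update (ext c) i γ := by
  funext j
  unfold ext
  by_cases hj : j = i
  · subst hj; simp
  · grind

theorem coinAv_mono {φ φ' : (ℕ → ℕ) → ℝ} (h : ∀ c, φ c ≤ φ' c) : coinAv m D φ ≤ coinAv m D φ' :=
  div_le_div_of_nonneg_right (sum_le_sum fun c _ => h _) (by positivity)

theorem coinAv_add (φ φ' : (ℕ → ℕ) → ℝ) : coinAv m D (fun c => φ c + φ' c) = coinAv m D φ + coinAv m D φ' := by
  unfold coinAv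
  rw [sum_add_distrib, add_div]

theorem coinAv_sub (φ φ' : (ℕ → ℕ) → ℝ) : coinAv m D (fun c => φ c - φ' c) = coinAv m D φ - coinAv m D φ' := by
  unfold coinAv
  rw [sum_sub_distrib, sub_div]

theorem coinAv_mul_left (a : ℝ) (φ : (ℕ → ℕ) → ℝ) : coinAv m D (fun c => a * φ c) = a * coinAv m D φ := by
  unfold coinAv
  rw [← mul_sum, mul_div_assoc]

theorem coinAv_sum {ι : Type*} (s : Finset ι) (φ : ι → (ℕ → ℕ) → ℝ) : coinAv m D (fun c => ∑ i ∈ s, φ i c) = ∑ i ∈ s, coinAv m D (φ i) := by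
  unfold coinAv
  rw [sum_comm, sum_div]

theorem coinAv_const (hD : 0 < D) (a : ℝ) : coinAv m D (fun _ => a) = a := by
  unfold coinAv
  have : (D : ℝ) ^ m ≠ 0 := by positivity
  rw [sum_const, card_univ, card_fun, card_fin, card_fin, nsmul_eq_mul, Nat.cast_pow, mul_div_cancel_left₀ _ this]

theorem abs_coinAv_le (φ : (ℕ → ℕ) → ℝ) : |coinAv m D φ| ≤ coinAv m D fun c => |φ c| := by
  unfold coinAv
  rw [abs_div, abs_of_nonneg (show (0 : ℝ) ≤ (D : ℝ) ^ m by positivity)]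
  exact div_le_div_of_nonneg_right (abs_sum_le_sum_abs _ _) (by positivity)

theorem coinAv_comm (m' D' : ℕ) (φ : (ℕ → ℕ) → (ℕ → ℕ) → ℝ) : coinAv m D (fun c => coinAv m' D' fun c' => φ c c') =
    coinAv m' D' (fun c' => coinAv m D fun c => φ c c') := by
  unfold coinAv
  simp only [← sum_div]
  rw [sum_comm, div_right_comm]

theorem average_coinAv {n : ℕ} (φ : Labelling n → (ℕ → ℕ) → ℝ) :
  average (fun ℓ => coinAv m D (φ ℓ)) = coinAv m D fun c => average fun ℓ => φ ℓ c := by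
  classical
  unfold coinAv average
  simp only [← sum_div]
  rw [sum_comm, div_right_comm]

theorem coinAv_le (hD : 0 < D) {φ : (ℕ → ℕ) → ℝ} {a : ℝ} (h : ∀ c, φ c ≤ a) :
  coinAv m D φ ≤ a := (coinAv_mono h).trans (le_of_eq (coinAv_const hD a))

theorem abs_average_coinAv_le (hD : 0 < D) {n : ℕ} {φ : Labelling n → (ℕ → ℕ) → ℝ} {a : ℝ}
  (h : ∀ c, |average fun ℓ => φ ℓ c| ≤ a) : |average fun ℓ => coinAv m D (φ ℓ)| ≤ a := by
  rw [average_coinAv]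
  exact (abs_coinAv_le _).trans (coinAv_le hD h)

/-- Exchanging coin `i` with a fresh coin is an involution of the coins together with the fresh one.
-/
theorem coinAv_resample (hD : 0 < D) {i : ℕ} (hi : i < m) (φ : (ℕ → ℕ) → ℝ) : coinAv m D φ =
    coinAv m D fun c => (∑ γ ∈ range D, φ (update c i γ)) / D := by
  classical
  unfold coinAv
  rw [← sum_div]
  congr 1
  have hD' : (D : ℝ) ≠ 0 := by positivity
  rw [eq_div_iff hD']
  have h1 : ∑ c : Fin m → Fin D, ∑ γ ∈ range D, φ (update (ext c) i γ) =
      ∑ p : (Fin m → Fin D) × Fin D, φ (ext (update p.1 ⟨i, hi⟩ p.2)) := by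
    rw [sum_prod_type]; refine sum_congr rfl fun c _ => ?_; rw [Finset.sum_range]; refine sum_congr rfl fun γ _ => ?_
    rw [ext_update]
  have h2 : (∑ c : Fin m → Fin D, φ (ext c)) * D = ∑ p : (Fin m → Fin D) × Fin D, φ (ext p.1) := by
    rw [sum_prod_type, sum_mul]; refine sum_congr rfl fun c _ => ?_; simp [mul_comm]
  rw [h1, h2]
  let σ : (Fin m → Fin D) × Fin D → (Fin m → Fin D) × Fin D := fun p =>
    (update p.1 ⟨i, hi⟩ p.2, p.1 ⟨i, hi⟩)
  have hσ : Function.Involutive σ := by rintro ⟨c, γ⟩; simp [σ]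
  refine (Fintype.sum_bijective σ hσ.bijective _ _ ?_).symm
  intro p
  rfl

end

/-! ### The simulation of a sequence of tiers -/

/-- A tier and its simulation. The simulation knows the strings in `S`; the output `z'` has the
probability `wt / D`, and the strings in `known` are known afterwards. The numbers `cr / D` are
corrections of these probabilities, and `dev` bounds the error. -/
structure STier (n : ℕ) (Z : Type) [Fintype Z] (D : ℕ) where
  known : Oracle n → Finset (Str n) → Z → Finset (Str n)
  wt : Oracle n → Finset (Str n) → Z → Z → ℕ
  cr : Oracle n → Finset (Str n) → Z → Finset (Str n) → Z → ℤ
  prob : Oracle n → Z → Z → ℝ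
  dev : Oracle n → Finset (Str n) → Z → ℝ
  sum_wt : ∀ K S z, ∑ z', wt K S z z' = D
  loc : ∀ K K' S z, Agree K K' (known K S z) → known K' S z = known K S z ∧ wt K' S z = wt K S z
  subset_known : ∀ K S z, S ⊆ known K S z
  prob_nonneg : ∀ K z z', 0 ≤ prob K z z'
  sum_prob : ∀ K z, ∑ z', prob K z z' = 1
  dev_nonneg : ∀ K S z, 0 ≤ dev K S z
  sum_abs_mul_le : ∀ K S z (A : Z → ℝ), (∀ z', 0 ≤ A z') → (∀ z', A z' ≤ 2) →
    ∑ z', |prob K z z' - wt K S z z' / D| * A z' ≤ ∑ z', (wt K S z z' / D : ℝ) * A z' ^ 2 + 3 * dev K S z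
  sum_abs_sq_le : ∀ K S z, (∑ z', |prob K z z' - wt K S z z' / D|) ^ 2 ≤ 4 * dev K S z

section
variable {n D : ℕ} {Z : Type} [Fintype Z]

/-- The state of the simulation: the wires, and the known strings. -/
abbrev State (n : ℕ) (Z : Type) : Type := Z × Finset (Str n)

variable (τ : ℕ → STier n Z D) (K : Oracle n)

namespace STier

/-- The probability of the simulated tier. -/
def sp (t : STier n Z D) (σ : State n Z) (z' : Z) : ℝ := t.wt K σ.2 σ.1 z' / D

/-- The error of the simulated probability. -/
def er (t : STier n Z D) (σ : State n Z) (z' : Z) : ℝ := t.prob K σ.1 z' - t.sp K σ z'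

/-- The state after the output `z'`. -/
def nxt (t : STier n Z D) (σ : State n Z) (z' : Z) : State n Z := (z', t.known K σ.2 σ.1)

/-- One step of the simulation. -/
def step [Nonempty Z] (t : STier n Z D) (σ : State n Z) (γ : ℕ) : State n Z := t.nxt K σ (pick (t.wt K σ.2 σ.1) γ)

variable {K}

theorem sp_nonneg (t : STier n Z D) (σ : State n Z) (z' : Z) : 0 ≤ t.sp K σ z' := by unfold sp; positivity

theorem sum_sp (hD : 0 < D) (t : STier n Z D) (σ : State n Z) : ∑ z', t.sp K σ z' = 1 := by
  unfold sp
  rw [← sum_div, ← Nat.cast_sum, t.sum_wt, div_self]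
  positivity

theorem sum_er (hD : 0 < D) (t : STier n Z D) (σ : State n Z) : ∑ z', t.er K σ z' = 0 := by
  unfold er
  rw [sum_sub_distrib, t.sum_prob, t.sum_sp hD, sub_self]

theorem sum_step [Nonempty Z] (t : STier n Z D) (σ : State n Z) (φ : Z → ℕ → ℝ) :
  ∑ γ ∈ range D, φ (pick (t.wt K σ.2 σ.1) γ) (γ - cum (t.wt K σ.2 σ.1) (pick (t.wt K σ.2 σ.1) γ)) =
    ∑ z', ∑ r ∈ range (t.wt K σ.2 σ.1 z'), φ z' r := by
  refine ((congrArg (fun m => ∑ γ ∈ range m, φ (pick (t.wt K σ.2 σ.1) γ)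
    (γ - cum (t.wt K σ.2 σ.1) (pick (t.wt K σ.2 σ.1) γ))) (t.sum_wt K σ.2 σ.1).symm).trans
    (sum_range_eq _ _)).trans ?_
  refine sum_congr rfl fun z _ => sum_congr rfl fun r hr => ?_
  rw [mem_range] at hr
  rw [pick_eq (N := t.wt K σ.2 σ.1) (z := z) ⟨by omega, by omega⟩]
  congr 1
  omega

theorem sum_step_div [Nonempty Z] (t : STier n Z D) (σ : State n Z) (Φ : State n Z → ℝ) :
  (∑ γ ∈ range D, Φ (t.step K σ γ)) / D = ∑ z', t.sp K σ z' * Φ (t.nxt K σ z') := by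
  have h := t.sum_step (K := K) σ (fun z' _ => Φ (t.nxt K σ z'))
  unfold step
  rw [h, sum_div]
  refine sum_congr rfl fun z' _ => ?_
  rw [sum_const, card_range, nsmul_eq_mul, sp]
  ring

end STier

/-- `k` steps of the simulation, from tier `i` on. -/
def run [Nonempty Z] (c : ℕ → ℕ) (i : ℕ) (σ : State n Z) : ℕ → State n Z
  | 0 => σ
  | k + 1 => (τ (i + k)).step K (run c i σ k) (c (i + k))

/-- The expected value of `F` after `k` real tiers. -/
def vr (F : Z → ℝ) : ℕ → ℕ → Z → ℝ
  | 0, _, z => F z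
  | k + 1, i, z => ∑ z', (τ i).prob K z z' * vr F k (i + 1) z'

/-- The expected value of `F` after `k` simulated tiers. -/
def vs (F : Z → ℝ) : ℕ → ℕ → State n Z → ℝ
  | 0, _, σ => F σ.1
  | k + 1, i, σ => ∑ z', (τ i).sp K σ z' * vs F k (i + 1) ((τ i).nxt K σ z')

/-- The accumulated deviations. -/
def vd : ℕ → ℕ → State n Z → ℝ
  | 0, _, _ => 0
  | k + 1, i, σ => 4 * (τ i).dev K σ.2 σ.1 + ∑ z', (τ i).sp K σ z' * vd k (i + 1) ((τ i).nxt K σ z')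

variable {τ K} {F : Z → ℝ}

theorem abs_vr_le (hF : ∀ z, |F z| ≤ 1) (k i : ℕ) (z : Z) : |vr τ K F k i z| ≤ 1 := by
  induction k generalizing i z with
  | zero => exact hF z
  | succ k ih =>
    rw [vr, ← (τ i).sum_prob K z]; refine (abs_sum_le_sum_abs _ _).trans (sum_le_sum fun z' _ => ?_)
    rw [abs_mul, abs_of_nonneg ((τ i).prob_nonneg K z z')]; exact mul_le_of_le_one_right ((τ i).prob_nonneg K z z') (ih _ _)

theorem abs_vs_le (hD : 0 < D) (hF : ∀ z, |F z| ≤ 1) (k i : ℕ) (σ : State n Z) :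
  |vs τ K F k i σ| ≤ 1 := by
  induction k generalizing i σ with
  | zero => exact hF σ.1
  | succ k ih =>
    rw [vs, ← (τ i).sum_sp hD σ]; refine (abs_sum_le_sum_abs _ _).trans (sum_le_sum fun z' _ => ?_)
    rw [abs_mul, abs_of_nonneg ((τ i).sp_nonneg σ z')]; exact mul_le_of_le_one_right ((τ i).sp_nonneg σ z') (ih _ _)

theorem vd_nonneg (k i : ℕ) (σ : State n Z) : 0 ≤ vd τ K k i σ := by
  induction k generalizing i σ with
  | zero => exact le_rfl
  | succ k ih =>
    rw [vd]
    exact add_nonneg (mul_nonneg (by norm_num) ((τ i).dev_nonneg _ _ _)) (sum_nonneg fun z' _ => mul_nonneg ((τ i).sp_nonneg σ z') (ih _ _))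

/-- The new error `a` of the first tier and the mean `b` of the later errors satisfy `a ^ 2 ≤ 4 *
dev` and `b ^ 2 ≤ k * β`. Then `2 * a * b ≤ k * a ^ 2 + β` gives the factor `k + 1`. -/
theorem sq_sub_le (hD : 0 < D) (hF : ∀ z, |F z| ≤ 1) (k i : ℕ) (σ : State n Z) :
  (vr τ K F k i σ.1 - vs τ K F k i σ) ^ 2 ≤ k * vd τ K k i σ := by
  induction k generalizing i σ with
  | zero => simp [vr, vs]
  | succ k ih =>
    set t := τ i; set a := ∑ z', |t.er K σ z'| with ha
    set w : Z → ℝ := fun z' => |vr τ K F k (i + 1) z' - vs τ K F k (i + 1) (t.nxt K σ z')| with hw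
    set b := ∑ z', t.sp K σ z' * w z' with hb; set β := ∑ z', t.sp K σ z' * vd τ K k (i + 1) (t.nxt K σ z') with hβ
    have h1 : |vr τ K F (k + 1) i σ.1 - vs τ K F (k + 1) i σ| ≤ a + b := by
      rw [vr, vs, ← sum_sub_distrib, ha, hb, ← sum_add_distrib]; refine (abs_sum_le_sum_abs _ _).trans (sum_le_sum fun z' _ => ?_)
      have h2 : t.prob K σ.1 z' * vr τ K F k (i + 1) z' - t.sp K σ z' * vs τ K F k (i + 1) (t.nxt K σ z') =
          t.er K σ z' * vr τ K F k (i + 1) z' + t.sp K σ z' * (vr τ K F k (i + 1) z' - vs τ K F k (i + 1) (t.nxt K σ z')) := by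
        unfold STier.er; ring
      rw [h2]; refine (abs_add_le _ _).trans (add_le_add ?_ ?_)
      · rw [abs_mul]; exact mul_le_of_le_one_right (abs_nonneg _) (abs_vr_le hF _ _ _)
      · rw [abs_mul, abs_of_nonneg (t.sp_nonneg σ z')]
    have h2 : a ^ 2 ≤ 4 * t.dev K σ.2 σ.1 := t.sum_abs_sq_le K σ.2 σ.1
    have h3 : b ^ 2 ≤ k * β := by
      calc b ^ 2 = (∑ z', t.sp K σ z' * w z') ^ 2 := rfl
        _ ≤ (∑ z', t.sp K σ z') * ∑ z', t.sp K σ z' * w z' ^ 2 := by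
            refine Finset.sum_sq_le_sum_mul_sum_of_sq_le_mul _ (fun z' _ => t.sp_nonneg σ z')
              (fun z' _ => mul_nonneg (t.sp_nonneg σ z') (sq_nonneg _)) fun z' _ =>
                le_of_eq (by ring)
        _ ≤ ∑ z', t.sp K σ z' * (k * vd τ K k (i + 1) (t.nxt K σ z')) := by
            rw [t.sum_sp hD, one_mul]
            refine sum_le_sum fun z' _ =>
              mul_le_mul_of_nonneg_left ?_ (t.sp_nonneg σ z')
            rw [hw, sq_abs]; exact ih (i + 1) (t.nxt K σ z')
        _ = k * β := by
            rw [hβ, mul_sum]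
            exact sum_congr rfl fun z' _ => by ring
    have ha0 : 0 ≤ a := sum_nonneg fun _ _ => abs_nonneg _
    have hβ0 : 0 ≤ β := sum_nonneg fun z' _ =>
      mul_nonneg (t.sp_nonneg σ z') (vd_nonneg _ _ _)
    have h4 : (vr τ K F (k + 1) i σ.1 - vs τ K F (k + 1) i σ) ^ 2 ≤ (a + b) ^ 2 := by
      rw [← sq_abs]; exact pow_le_pow_left₀ (abs_nonneg _) h1 2
    -- The inequality for `2 * a * b` is obtained by dividing by `k`; for `k = 0` there are no later
    -- errors and `b = 0`.
    refine h4.trans ?_; rw [vd]; push_cast; rcases Nat.eq_zero_or_pos k with rfl | hk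
    · simp only [Nat.cast_zero, zero_mul, zero_add, one_mul] at h3 ⊢
      have : b = 0 := by nlinarith
      rw [this]; nlinarith
    · have hk' : (0 : ℝ) < k := by exact_mod_cast hk
      have h5 : 2 * a * b ≤ k * a ^ 2 + β := by
        have h6 : k * (2 * a * b) ≤ k * (k * a ^ 2 + β) := by nlinarith [sq_nonneg (k * a - b)]
        exact le_of_mul_le_mul_left h6 hk'
      nlinarith

section
variable [Nonempty Z]

theorem run_congr {c c' : ℕ → ℕ} {i k : ℕ} (h : ∀ j, i ≤ j → j < i + k → c j = c' j)
  (σ : State n Z) : run τ K c i σ k = run τ K c' i σ k := by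
  induction k with
  | zero => rfl
  | succ k ih =>
    rw [run, run, ih fun j h1 h2 => h j h1 (by omega), h (i + k) (by omega) (by omega)]

theorem run_add (c : ℕ → ℕ) (i : ℕ) (σ : State n Z) (j k : ℕ) : run τ K c i σ (j + k) = run τ K c (i + j) (run τ K c i σ j) k := by
  induction k with
  | zero => rfl
  | succ k ih => rw [← add_assoc, run, run, ih, add_assoc]

theorem run_subset (c : ℕ → ℕ) (i : ℕ) (σ : State n Z) {j k : ℕ} (h : j ≤ k) : (run τ K c i σ j).2 ⊆ (run τ K c i σ k).2 := by
  induction k, h using Nat.le_induction with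
  | base => exact subset_rfl
  | succ k _ ih => exact ih.trans ((τ _).subset_known _ _ _)

theorem run_local {K' : Oracle n} (c : ℕ → ℕ) (i : ℕ) (σ : State n Z) (k : ℕ)
  (h : Agree K K' (run τ K c i σ k).2) : run τ K' c i σ k = run τ K c i σ k := by
  induction k with
  | zero => rfl
  | succ k ih =>
    have h1 := ih (h.mono (run_subset c i σ (le_succ k))); rw [run, run, h1]; have h2 := (τ (i + k)).loc K K' _ _ h
    unfold STier.step STier.nxt; rw [h2.1, h2.2]

variable {m : ℕ}

theorem run_update {c : ℕ → ℕ} {i j k : ℕ} (h : j < i ∨ i + k ≤ j) (γ : ℕ) (σ : State n Z) :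
  run τ K (update c j γ) i σ k = run τ K c i σ k :=
  run_congr (fun j' h1 h2 => update_of_ne (by omega) _ _) σ

theorem coinAv_step (hD : 0 < D) {j : ℕ} (hj : j < m) (σ0 : State n Z) (Φ : State n Z → ℝ) :
  coinAv m D (fun c => Φ (run τ K c 0 σ0 (j + 1))) = coinAv m D fun c =>
    ∑ z', (τ j).sp K (run τ K c 0 σ0 j) z' * Φ ((τ j).nxt K (run τ K c 0 σ0 j) z') := by
  rw [coinAv_resample hD hj]
  congr 1
  funext c
  rw [← STier.sum_step_div]
  congr 1
  refine sum_congr rfl fun γ _ => ?_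
  rw [run, run_update (by omega), zero_add, update_self]

/-- The weight and the state may depend only on the coins before `i`, so the later coins are still
free to realise the expectation `vs`. -/
theorem coinAv_vs (hD : 0 < D) {k i : ℕ} (hk : i + k ≤ m) (w : (ℕ → ℕ) → ℝ)
  (σ : (ℕ → ℕ) → State n Z) (hw : ∀ c j γ, i ≤ j → w (update c j γ) = w c)
  (hσ : ∀ c j γ, i ≤ j → σ (update c j γ) = σ c) :
  coinAv m D (fun c => w c * vs τ K F k i (σ c)) = coinAv m D fun c => w c * F (run τ K c i (σ c) k).1 := by
  induction k generalizing i σ with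
  | zero => rfl
  | succ k ih =>
    have h1 : ∀ c, run τ K c i (σ c) (k + 1) = run τ K c (i + 1) ((τ i).step K (σ c) (c i)) k := by intro c; rw [add_comm k 1, run_add]; rfl
    simp only [h1]
    rw [← ih (i := i + 1) (σ := fun c => (τ i).step K (σ c) (c i)) (by omega) (fun c j γ hj => hw c j γ (by omega))
      (fun c j γ hj => by rw [hσ c j γ (by omega), update_of_ne (by omega)])]
    rw [coinAv_resample hD (show i < m by omega) (fun c => w c * vs τ K F k (i + 1) ((τ i).step K (σ c) (c i)))]
    congr 1; funext c; rw [vs, ← (τ i).sum_step_div (σ c) (fun σ' => vs τ K F k (i + 1) σ'), mul_div_assoc', mul_sum]; congr 1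
    refine sum_congr rfl fun γ _ => ?_; rw [hw c i γ le_rfl, hσ c i γ le_rfl, update_self]

/-- Telescoping: the tiers are replaced by their simulations one after the other, and tier `i`
contributes its error followed by real tiers. -/
theorem vr_sub_eq (hD : 0 < D) (z0 : Z) (S0 : Finset (Str n)) {k : ℕ} (hk : k ≤ m) :
  vr τ K F m 0 z0 - coinAv m D (fun c => vr τ K F (m - k) k (run τ K c 0 (z0, S0) k).1) = ∑ i ∈ range k, coinAv m D fun c => ∑ z',
      (τ i).er K (run τ K c 0 (z0, S0) i) z' * vr τ K F (m - (i + 1)) (i + 1) z' := by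
  induction k with
  | zero =>
    rw [Finset.sum_range_zero, sub_eq_zero, Nat.sub_zero]; exact (coinAv_const hD _).symm
  | succ k ih =>
    rw [sum_range_succ, ← ih (by omega), coinAv_step hD (by omega) (z0, S0) (fun σ => vr τ K F (m - (k + 1)) (k + 1) σ.1)]
    have h1 : (fun c => vr τ K F (m - k) k (run τ K c 0 (z0, S0) k).1) = fun c =>
        (∑ z', (τ k).er K (run τ K c 0 (z0, S0) k) z' * vr τ K F (m - (k + 1)) (k + 1) z') +
        ∑ z', (τ k).sp K (run τ K c 0 (z0, S0) k) z' * vr τ K F (m - (k + 1)) (k + 1) ((τ k).nxt K (run τ K c 0 (z0, S0) k) z').1 := by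
      funext c
      rw [show m - k = m - (k + 1) + 1 by omega, vr, ← sum_add_distrib]
      refine sum_congr rfl fun z' _ => ?_; unfold STier.er STier.nxt; ring
    rw [h1, coinAv_add]; ring

theorem coinAv_vd (hD : 0 < D) (σ0 : State n Z) {k i : ℕ} (hk : i + k ≤ m) :
  coinAv m D (fun c => vd τ K k i (run τ K c 0 σ0 i)) = ∑ j ∈ range k, 4 * coinAv m D fun c =>
      (τ (i + j)).dev K (run τ K c 0 σ0 (i + j)).2 (run τ K c 0 σ0 (i + j)).1 := by
  induction k generalizing i with
  | zero => simp [vd, coinAv_const hD]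
  | succ k ih =>
    have h1 := ih (i := i + 1) (by omega)
    rw [coinAv_step hD (by omega) σ0 (fun σ => vd τ K k (i + 1) σ)] at h1
    simp only [vd]; rw [coinAv_add, h1, coinAv_mul_left, Finset.sum_range_succ', add_zero, add_comm]; congr 1
    refine sum_congr rfl fun j _ => ?_
    rw [show i + 1 + j = i + (j + 1) by omega]

end
end

/-! ### The corrected simulation -/

section
variable {n D : ℕ} {Z : Type} [Fintype Z] [Nonempty Z]

/-- The correction of step `i` of the run with coins `c` is triggered; `c'` are the coins of the
other run. -/
def flag (τ : ℕ → STier n Z D) (m s : ℕ) (σ0 : State n Z) (ns : Oracle n → Finset (Str n) → Finset (Str n)) (K : Oracle n)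
  (c c' : ℕ → ℕ) (i : ℕ) (sgn : ℤ) : Prop :=
  ((c i - cum ((τ i).wt K (run τ K c 0 σ0 i).2 (run τ K c 0 σ0 i).1)
      (pick ((τ i).wt K (run τ K c 0 σ0 i).2 (run τ K c 0 σ0 i).1) (c i)) : ℕ) : ℤ) <
    sgn * (2 ^ s * (τ i).cr K (run τ K c 0 σ0 i).2 (run τ K c 0 σ0 i).1 (ns K ((run τ K c 0 σ0 m).2 ∪ (run τ K c' 0 σ0 m).2))
      (pick ((τ i).wt K (run τ K c 0 σ0 i).2 (run τ K c 0 σ0 i).1) (c i)))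

open Classical in
/-- The output of the corrected simulation with the two runs `c` and `c'`. -/
def out (τ : ℕ → STier n Z D) (m s : ℕ) (σ0 : State n Z) (ns : Oracle n → Finset (Str n) → Finset (Str n)) (K : Oracle n)
  (c c' : ℕ → ℕ) (κ : ℕ) : Z :=
  if ∃ i < m, (κ = 2 * i ∧ flag τ m s σ0 ns K c c' i (-1)) ∨ (κ = 2 * i + 1 ∧ flag τ m s σ0 ns K c' c i 1) then (run τ K c' 0 σ0 m).1
  else (run τ K c 0 σ0 m).1

/-- The expected value of `F` for the output of the corrected simulation. -/
def outAv (τ : ℕ → STier n Z D) (m s : ℕ) (σ0 : State n Z) (ns : Oracle n → Finset (Str n) → Finset (Str n)) (K : Oracle n)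
  (F : Z → ℝ) : ℝ :=
  coinAv m D fun c => coinAv m D fun c' =>
    (∑ κ ∈ range (2 ^ s), F (out τ m s σ0 ns K c c' κ)) / 2 ^ s

open Classical in
-- Tier `i` owns the slots `2 * i` and `2 * i + 1`. They are all different, so at most one flag
-- matters for each `κ` and the disjunction becomes a sum.
theorem sum_slots {m s : ℕ} (h : 2 * m ≤ 2 ^ s) (A B : ℕ → Prop) :
  (∑ κ ∈ range (2 ^ s), if ∃ i < m, (κ = 2 * i ∧ A i) ∨ (κ = 2 * i + 1 ∧ B i) then (1 : ℝ)
    else 0) = ∑ i ∈ range m, ((if A i then 1 else 0) + if B i then 1 else 0) := by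
  have h1 : ∀ κ, (if ∃ i < m, (κ = 2 * i ∧ A i) ∨ (κ = 2 * i + 1 ∧ B i) then (1 : ℝ) else 0) =
      ∑ i ∈ range m, ((if κ = 2 * i then if A i then 1 else 0 else 0) +
        if κ = 2 * i + 1 then if B i then 1 else 0 else 0) := by
    intro κ; by_cases hκ : κ / 2 < m
    · rw [Finset.sum_eq_single_of_mem (κ / 2) (mem_range.2 hκ)]
      · have h2 : (∃ i < m, (κ = 2 * i ∧ A i) ∨ (κ = 2 * i + 1 ∧ B i)) ↔
            (κ = 2 * (κ / 2) ∧ A (κ / 2)) ∨ (κ = 2 * (κ / 2) + 1 ∧ B (κ / 2)) := by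
          constructor
          · rintro ⟨i, -, h | h⟩
            · obtain rfl : i = κ / 2 := by omega
              exact .inl h
            · obtain rfl : i = κ / 2 := by omega
              exact .inr h
          · exact fun h => ⟨κ / 2, hκ, h⟩
        rw [if_congr h2 rfl rfl]; by_cases h3 : κ = 2 * (κ / 2)
        · have h4 : ¬ κ = 2 * (κ / 2) + 1 := by omega
          simp only [h4, false_and, or_false, if_false, add_zero]; rw [if_pos h3]
          exact if_congr (by simp [← h3]) rfl rfl
        · have h4 : κ = 2 * (κ / 2) + 1 := by omega
          simp only [h3, false_and, false_or, if_false, zero_add]; rw [if_pos h4]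
          exact if_congr (by simp [← h4]) rfl rfl
      · grind
    · rw [if_neg, sum_eq_zero]
      · grind
      · grind
  simp only [h1]
  rw [sum_comm]
  refine sum_congr rfl fun i hi => ?_
  rw [mem_range] at hi
  rw [sum_add_distrib, sum_ite_eq', sum_ite_eq', if_pos (mem_range.2 (by omega)), if_pos (mem_range.2 (by omega))]

open Classical in
-- Comparing the uniformly distributed position `r` with `x` and with `-x` realises the signed
-- probability `x`, up to clipping at the length of the interval.
theorem sum_range_lt_sub (N : ℕ) (x : ℤ) :
  ∑ r ∈ range N, ((if (r : ℤ) < x then (1 : ℝ) else 0) - if (r : ℤ) < -x then 1 else 0) = clip N x := by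
  have h1 : ∀ y : ℤ, ∑ r ∈ range N, (if (r : ℤ) < y then (1 : ℝ) else 0) = max 0 (min (N : ℝ) (y : ℝ)) := by
    intro y; rw [← sum_filter, sum_const, nsmul_eq_mul, mul_one]
    have h2 : (range N).filter (fun r : ℕ => (r : ℤ) < y) = range (min N y.toNat) := by grind
    rw [h2, card_range]
    have h3 : ((min N y.toNat : ℕ) : ℤ) = max 0 (min (N : ℤ) y) := by omega
    have h4 := congrArg (Int.cast (R := ℝ)) h3; push_cast at h4; simpa using h4
  rw [sum_sub_distrib, h1, h1]
  unfold clip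
  push_cast
  have hN : (0 : ℝ) ≤ N := cast_nonneg N
  rcases le_total 0 (x : ℝ) with hx | hx
  · grind
  · grind

theorem clip_mul {a : ℝ} (ha : 0 ≤ a) (b x : ℝ) : clip (a * b) (a * x) = a * clip b x := by
  unfold clip
  rw [mul_max_of_nonneg _ _ ha, mul_min_of_nonneg _ _ ha, mul_neg]

variable (τ : ℕ → STier n Z D) (m s : ℕ) (σ0 : State n Z) (ns : Oracle n → Finset (Str n) → Finset (Str n)) (K : Oracle n)

/-- The final state, if tier `i` has the output `z'`. -/
def fin (c : ℕ → ℕ) (i : ℕ) (z' : Z) : State n Z := run τ K c (i + 1) ((τ i).nxt K (run τ K c 0 σ0 i) z') (m - (i + 1))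

/-- The clipped correction of the probability that tier `i` has the output `z'`. -/
def clipped (c c' : ℕ → ℕ) (i : ℕ) (z' : Z) : ℝ := clip ((2 ^ s)⁻¹ * (τ i).sp K (run τ K c 0 σ0 i) z')
    (((τ i).cr K (run τ K c 0 σ0 i).2 (run τ K c 0 σ0 i).1 (ns K ((fin τ m σ0 K c i z').2 ∪ (run τ K c' 0 σ0 m).2)) z' : ℝ) / D)

variable {τ m s σ0 ns K} {F : Z → ℝ}

theorem run_update_eq {c : ℕ → ℕ} {i : ℕ} (hi : i < m) (γ : ℕ) : run τ K (update c i γ) 0 σ0 m =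
    fin τ m σ0 K c i (pick ((τ i).wt K (run τ K c 0 σ0 i).2 (run τ K c 0 σ0 i).1) γ) := by
  have h1 : m = (i + 1) + (m - (i + 1)) := by omega
  conv_lhs => rw [h1, run_add, zero_add, run, zero_add, update_self]
  rw [run_update (by omega), run_update (by omega)]
  rfl

open Classical in
-- Resampling coin `i` determines the outcome of tier `i` and its position, while the second run
-- stays fixed. The threshold carries a factor `2 ^ s` that the probability of the slot removes;
-- clipping thus occurs at `2 ^ (-s)` times the simulated probability.
theorem coinAv_flag (hD : 0 < D) {i : ℕ} (hi : i < m) (c' : ℕ → ℕ) :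
  (2 ^ s : ℝ)⁻¹ * coinAv m D (fun c => ((if flag τ m s σ0 ns K c c' i 1 then (1 : ℝ) else 0) -
    if flag τ m s σ0 ns K c c' i (-1) then 1 else 0) *
    (F (run τ K c 0 σ0 m).1 - F (run τ K c' 0 σ0 m).1)) =
  coinAv m D (fun c => ∑ z', clipped τ m s σ0 ns K c c' i z' * (F (fin τ m σ0 K c i z').1 - F (run τ K c' 0 σ0 m).1)) := by
  rw [coinAv_resample hD hi, ← coinAv_mul_left]
  congr 1
  funext c
  set σ := run τ K c 0 σ0 i with hσ
  set f : Z → ℝ := fun z' => F (fin τ m σ0 K c i z').1 - F (run τ K c' 0 σ0 m).1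
  set X : Z → ℤ := fun z' => 2 ^ s * (τ i).cr K σ.2 σ.1 (ns K ((fin τ m σ0 K c i z').2 ∪ (run τ K c' 0 σ0 m).2)) z' with hX
  have h1 : ∀ γ, ((if flag τ m s σ0 ns K (update c i γ) c' i 1 then (1 : ℝ) else 0) -
      if flag τ m s σ0 ns K (update c i γ) c' i (-1) then 1 else 0) *
      (F (run τ K (update c i γ) 0 σ0 m).1 - F (run τ K c' 0 σ0 m).1) =
      (fun (z' : Z) (r : ℕ) => ((if (r : ℤ) < X z' then (1 : ℝ) else 0) - if (r : ℤ) < - X z' then 1 else 0) *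
        f z') (pick ((τ i).wt K σ.2 σ.1) γ)
        (γ - cum ((τ i).wt K σ.2 σ.1) (pick ((τ i).wt K σ.2 σ.1) γ)) := by
    intro γ
    have h3 : ∀ sgn : ℤ, flag τ m s σ0 ns K (update c i γ) c' i sgn ↔
        ((γ - cum ((τ i).wt K σ.2 σ.1) (pick ((τ i).wt K σ.2 σ.1) γ) : ℕ) : ℤ) < sgn * X (pick ((τ i).wt K σ.2 σ.1) γ) := by
      intro sgn; unfold flag
      rw [run_update_eq hi, run_update (by omega), update_self]
    have h4 := h3 1; have h5 := h3 (-1); rw [one_mul] at h4; rw [neg_one_mul] at h5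
    rw [if_congr h4 rfl rfl, if_congr h5 rfl rfl, run_update_eq hi]
  simp only [h1]
  rw [(τ i).sum_step σ (fun (z' : Z) (r : ℕ) => ((if (r : ℤ) < X z' then (1 : ℝ) else 0) -
    if (r : ℤ) < - X z' then 1 else 0) * f z'), sum_div, mul_sum]
  refine sum_congr rfl fun z' _ => ?_
  rw [← sum_mul, sum_range_lt_sub]
  have h2 : clipped τ m s σ0 ns K c c' i z' = ((2 ^ s)⁻¹ * (D : ℝ)⁻¹) * clip ((τ i).wt K σ.2 σ.1 z') (X z') := by
    rw [← clip_mul (by positivity)]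
    unfold clipped STier.sp; congr 1
    · grind
    · rw [hX, ← hσ]; push_cast; field_simp
  rw [h2]
  ring

/-- A negative correction discards the first run, a positive one of the second run lets it replace
the first. Exchanging the names of the two runs in the positive case combines both into the signed
correction of a single run, relative to an independent one. -/
theorem outAv_eq (hD : 0 < D) (hs : 2 * m ≤ 2 ^ s) : outAv τ m s σ0 ns K F = coinAv m D (fun c => F (run τ K c 0 σ0 m).1) +
    ∑ i ∈ range m, coinAv m D fun c => coinAv m D fun c' =>
      ∑ z', clipped τ m s σ0 ns K c c' i z' * (F (fin τ m σ0 K c i z').1 - F (run τ K c' 0 σ0 m).1) := by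
  classical
  have h1 : ∀ c c', (∑ κ ∈ range (2 ^ s), F (out τ m s σ0 ns K c c' κ)) / (2 : ℝ) ^ s =
      F (run τ K c 0 σ0 m).1 + ∑ i ∈ range m, (2 ^ s)⁻¹ * ((if flag τ m s σ0 ns K c c' i (-1) then (1 : ℝ) else 0) *
          (F (run τ K c' 0 σ0 m).1 - F (run τ K c 0 σ0 m).1) +
        (if flag τ m s σ0 ns K c' c i 1 then (1 : ℝ) else 0) * (F (run τ K c' 0 σ0 m).1 - F (run τ K c 0 σ0 m).1)) := by
    intro c c'
    have h2 : ∀ κ, F (out τ m s σ0 ns K c c' κ) = F (run τ K c 0 σ0 m).1 + (if ∃ i < m, (κ = 2 * i ∧ flag τ m s σ0 ns K c c' i (-1)) ∨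
          (κ = 2 * i + 1 ∧ flag τ m s σ0 ns K c' c i 1) then (1 : ℝ) else 0) *
        (F (run τ K c' 0 σ0 m).1 - F (run τ K c 0 σ0 m).1) := by
      intro κ; unfold out; split_ifs <;> ring
    simp only [h2]
    rw [sum_add_distrib, ← sum_mul, sum_slots hs, sum_const, card_range, nsmul_eq_mul, Nat.cast_pow, Nat.cast_ofNat, add_div,
      mul_div_cancel_left₀ _ (by positivity), sum_mul, sum_div]
    congr 1; refine sum_congr rfl fun i _ => ?_; ring
  unfold outAv
  simp only [h1]
  have h3 : ∀ c, coinAv m D (fun c' => F (run τ K c 0 σ0 m).1 + ∑ i ∈ range m, (2 ^ s)⁻¹ *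
        ((if flag τ m s σ0 ns K c c' i (-1) then (1 : ℝ) else 0) * (F (run τ K c' 0 σ0 m).1 - F (run τ K c 0 σ0 m).1) +
        (if flag τ m s σ0 ns K c' c i 1 then (1 : ℝ) else 0) * (F (run τ K c' 0 σ0 m).1 - F (run τ K c 0 σ0 m).1))) =
      F (run τ K c 0 σ0 m).1 + ∑ i ∈ range m, (2 ^ s)⁻¹ * (coinAv m D (fun c' =>
        (if flag τ m s σ0 ns K c c' i (-1) then (1 : ℝ) else 0) *
          (F (run τ K c' 0 σ0 m).1 - F (run τ K c 0 σ0 m).1)) + coinAv m D (fun c' =>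
        (if flag τ m s σ0 ns K c' c i 1 then (1 : ℝ) else 0) * (F (run τ K c' 0 σ0 m).1 - F (run τ K c 0 σ0 m).1))) := by
    intro c; rw [coinAv_add, coinAv_const hD, coinAv_sum]; simp only [coinAv_mul_left, coinAv_add]
  simp only [h3]
  rw [coinAv_add, coinAv_sum]
  congr 1
  refine sum_congr rfl fun i hi => ?_
  rw [coinAv_mul_left, coinAv_add, coinAv_comm m D (fun c c' =>
    (if flag τ m s σ0 ns K c' c i 1 then (1 : ℝ) else 0) * (F (run τ K c' 0 σ0 m).1 - F (run τ K c 0 σ0 m).1)), ← coinAv_add,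
    coinAv_comm m D (fun c c' => ∑ z', clipped τ m s σ0 ns K c c' i z' * (F (fin τ m σ0 K c i z').1 - F (run τ K c' 0 σ0 m).1))]
  simp only [← coinAv_flag hD (mem_range.1 hi)]
  rw [coinAv_mul_left, ← coinAv_comm m D]
  congr 2
  funext c
  rw [← coinAv_add]
  congr 1
  funext c'
  ring

/-! ### Errors of first and second order. -/

/-- The first-order error of tier `i`. -/
def firstOrder (τ : ℕ → STier n Z D) (m s : ℕ) (σ0 : State n Z) (ns : Oracle n → Finset (Str n) → Finset (Str n)) (K : Oracle n)
  (F : Z → ℝ) (c c' : ℕ → ℕ) (i : ℕ) : ℝ :=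
  ∑ z', ((τ i).er K (run τ K c 0 σ0 i) z' - clipped τ m s σ0 ns K c c' i z') * (F (fin τ m σ0 K c i z').1 - F (run τ K c' 0 σ0 m).1)

/-- The second-order error of tier `i`. -/
def secondOrder (τ : ℕ → STier n Z D) (m : ℕ) (σ0 : State n Z) (K : Oracle n) (F : Z → ℝ) (c : ℕ → ℕ) (i : ℕ) : ℝ :=
  ∑ z', (τ i).er K (run τ K c 0 σ0 i) z' * (vr τ K F (m - (i + 1)) (i + 1) z' -
    vs τ K F (m - (i + 1)) (i + 1) ((τ i).nxt K (run τ K c 0 σ0 i) z'))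

/-- The error of tier `i` is followed by real tiers. Replacing them by simulated ones costs
`secondOrder`; the rest is compared with the correction of that tier and gives `firstOrder`. -/
theorem vr_sub_outAv (hD : 0 < D) (hs : 2 * m ≤ 2 ^ s) : vr τ K F m 0 σ0.1 - outAv τ m s σ0 ns K F =
    (∑ i ∈ range m, coinAv m D fun c => coinAv m D fun c' =>
      firstOrder τ m s σ0 ns K F c c' i) +
    ∑ i ∈ range m, coinAv m D fun c => secondOrder τ m σ0 K F c i := by
  have h0 := vr_sub_eq (τ := τ) (K := K) (F := F) hD σ0.1 σ0.2 (le_refl m)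
  rw [Nat.sub_self] at h0
  simp only [vr] at h0
  rw [outAv_eq hD hs, ← sub_sub, h0, ← sum_sub_distrib, ← sum_add_distrib]
  refine sum_congr rfl fun i hi => ?_
  rw [mem_range] at hi
  have h1 : coinAv m D (fun c => ∑ z', (τ i).er K (run τ K c 0 σ0 i) z' *
      vs τ K F (m - (i + 1)) (i + 1) ((τ i).nxt K (run τ K c 0 σ0 i) z')) =
      coinAv m D fun c => ∑ z', (τ i).er K (run τ K c 0 σ0 i) z' * F (fin τ m σ0 K c i z').1 := by
    rw [coinAv_sum, coinAv_sum]; refine sum_congr rfl fun z' _ => ?_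
    refine coinAv_vs hD (by omega) _ (fun c => (τ i).nxt K (run τ K c 0 σ0 i) z') ?_ ?_
    · intro c j γ hj
      rw [run_update (by omega)]
    · intro c j γ hj
      rw [run_update (by omega)]
  have h2 : coinAv m D (fun c => secondOrder τ m σ0 K F c i) =
      coinAv m D (fun c => ∑ z', (τ i).er K (run τ K c 0 σ0 i) z' * vr τ K F (m - (i + 1)) (i + 1) z') -
      coinAv m D (fun c => ∑ z', (τ i).er K (run τ K c 0 σ0 i) z' * F (fin τ m σ0 K c i z').1) := by
    rw [← h1, ← coinAv_sub]; congr 1; funext c; unfold secondOrder; rw [← sum_sub_distrib]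
    exact sum_congr rfl fun z' _ => by ring
  have h3 : coinAv m D (fun c => coinAv m D fun c' => firstOrder τ m s σ0 ns K F c c' i) =
      coinAv m D (fun c => ∑ z', (τ i).er K (run τ K c 0 σ0 i) z' * F (fin τ m σ0 K c i z').1) -
      coinAv m D (fun c => coinAv m D fun c' => ∑ z', clipped τ m s σ0 ns K c c' i z' *
        (F (fin τ m σ0 K c i z').1 - F (run τ K c' 0 σ0 m).1)) := by
    rw [← coinAv_sub]; congr 1; funext c
    rw [← coinAv_const hD (∑ z', (τ i).er K (run τ K c 0 σ0 i) z' * F (fin τ m σ0 K c i z').1), ← coinAv_sub]; congr 1; funext c'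
    -- The errors of the probabilities sum to zero, so the output of the independent run may be
    -- subtracted at no cost. This matches the form of the corrections.
    have h4 : ∑ z', (τ i).er K (run τ K c 0 σ0 i) z' * F (run τ K c' 0 σ0 m).1 = 0 := by rw [← sum_mul, STier.sum_er hD, zero_mul]
    unfold firstOrder
    rw [← sub_zero (∑ z', (τ i).er K (run τ K c 0 σ0 i) z' * F (fin τ m σ0 K c i z').1), ← h4, ← sum_sub_distrib, ← sum_sub_distrib]
    exact sum_congr rfl fun z' _ => by ring
  have h5 : (fun c => ∑ z', (τ i).er K (run τ K c 0 (σ0.1, σ0.2) i) z' *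
      vr τ K F (m - (i + 1)) (i + 1) z') = fun c => ∑ z', (τ i).er K (run τ K c 0 σ0 i) z' *
      vr τ K F (m - (i + 1)) (i + 1) z' := rfl
  rw [h3, h2, h5]
  ring

/-- The error of tier `i` multiplies the accumulated error of the later tiers. `sum_abs_mul_le`
splits the product into the square of the latter, which `sq_sub_le` bounds, and a deviation of tier
`i`. -/
theorem abs_secondOrder_le (hD : 0 < D) (hF : ∀ z, |F z| ≤ 1) (c : ℕ → ℕ) (i : ℕ) :
  |secondOrder τ m σ0 K F c i| ≤ (m - (i + 1) : ℕ) * ∑ z', (τ i).sp K (run τ K c 0 σ0 i) z' *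
      vd τ K (m - (i + 1)) (i + 1) ((τ i).nxt K (run τ K c 0 σ0 i) z') +
    3 * (τ i).dev K (run τ K c 0 σ0 i).2 (run τ K c 0 σ0 i).1 := by
  unfold secondOrder
  set σ := run τ K c 0 σ0 i
  set w : Z → ℝ := fun z' => |vr τ K F (m - (i + 1)) (i + 1) z' - vs τ K F (m - (i + 1)) (i + 1) ((τ i).nxt K σ z')| with hw
  refine (abs_sum_le_sum_abs _ _).trans ?_
  simp only [abs_mul]
  refine ((τ i).sum_abs_mul_le K σ.2 σ.1 w (fun z' => abs_nonneg _) fun z' => ?_).trans (add_le_add_left ?_ _)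
  · refine (abs_sub _ _).trans ?_; have h1 := abs_vr_le (τ := τ) (K := K) hF (m - (i + 1)) (i + 1) z'
    have h2 := abs_vs_le (τ := τ) (K := K) hD hF (m - (i + 1)) (i + 1) ((τ i).nxt K σ z'); linarith
  · rw [mul_sum]; refine sum_le_sum fun z' _ => ?_
    have h1 := sq_sub_le (τ := τ) (K := K) hD hF (m - (i + 1)) (i + 1) ((τ i).nxt K σ z'); rw [hw, sq_abs]
    have h2 := mul_le_mul_of_nonneg_left h1 ((τ i).sp_nonneg (K := K) σ z'); unfold STier.sp at h2 ⊢
    refine (show _ ≤ _ from h2).trans (le_of_eq (by ring))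

end

/-! ### The error of the corrected simulation, averaged over the labellings -/

section
variable {n D : ℕ} {Z : Type} [Fintype Z]

/-- A state of the simulation, as a function of the oracle. -/
structure Pre (n : ℕ) (Z : Type) where
  st : Oracle n → State n Z
  loc : ∀ K K', Agree K K' (st K).2 → st K' = st K
  zero_mem : ∀ K, (fun _ => false) ∈ (st K).2

/-- What happens after a tier, for each outcome: the strings that are touched, and a functional that
may depend on the label of the exit. -/
structure Post (t : STier n Z D) (p : Pre n Z) where
  Q : Oracle n → Z → Finset (Str n)
  f : Oracle n → Z → Str n → ℝ
  loc : ∀ K K' z, Agree K K' (Q K z) → Q K' z = Q K z ∧ f K' z = f K z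
  sub : ∀ K z, t.known K (p.st K).2 (p.st K).1 ⊆ Q K z
  bound : ∀ K z e, |f K z e| ≤ 2

/-- Bounds for the average errors of a simulated tier. -/
structure STier.Bounded (t : STier n Z D) (T : WeldedTree n) (χ : EdgeColouring T.graph) (d M : ℕ) (th e1 e2 : ℝ) : Prop where
  dev_le : ∀ p : Pre n Z, average (fun ℓ => t.dev 𝔎 (p.st 𝔎).2 (p.st 𝔎).1) ≤ e2
  main : ∀ (p : Pre n Z) (q : Post t p), (∀ K z, Tame K → (q.Q K z).card ≤ M) →
    |average fun ℓ => ∑ z', (t.er 𝔎 (p.st 𝔎) z' - clip (th * t.sp 𝔎 (p.st 𝔎) z') ((t.cr 𝔎 (p.st 𝔎).2 (p.st 𝔎).1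
          (ball 𝔎 (q.Q 𝔎 z') (d + 1)) z' : ℝ) / D)) *
      q.f 𝔎 z' (ℓ.1 (exit n))| ≤ e1

/-- A bound for the average error of a simulated tier that is not followed by another tier. -/
def STier.LastBounded (t : STier n Z D) (T : WeldedTree n) (χ : EdgeColouring T.graph) (M : ℕ) (e : ℝ) : Prop :=
  ∀ (p : Pre n Z) (f : Z → Str n → ℝ), (∀ K, Tame K → (p.st K).2.card ≤ M) → (∀ z x, |f z x| ≤ 1) →
    |average fun ℓ => ∑ z', t.er 𝔎 (p.st 𝔎) z' * f z' (ℓ.1 (exit n))| ≤ e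

variable [Nonempty Z] {τ : ℕ → STier n Z D} {m s : ℕ} {σ0 : State n Z}

/-- The state of the simulation before tier `i`. -/
def preRun (τ : ℕ → STier n Z D) (σ0 : State n Z) (h0 : (fun _ => false) ∈ σ0.2) (c : ℕ → ℕ) (i : ℕ) : Pre n Z where
  st K := run τ K c 0 σ0 i
  loc K K' h := run_local c 0 σ0 i h
  zero_mem K := run_subset c 0 σ0 (Nat.zero_le i) h0

theorem known_subset_fin (K : Oracle n) (c : ℕ → ℕ) (i : ℕ) (z' : Z) :
  (τ i).known K (run τ K c 0 σ0 i).2 (run τ K c 0 σ0 i).1 ⊆ (fin τ m σ0 K c i z').2 :=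
  run_subset c (i + 1) ((τ i).nxt K (run τ K c 0 σ0 i) z') (Nat.zero_le (m - (i + 1)))

variable {i : ℕ} {μ : ℕ → ℕ} {K : Oracle n} {F : Z → Str n → ℝ}

theorem fin_local {K K' : Oracle n} {c : ℕ → ℕ} {z' : Z}
  (h : Agree K K' (fin τ m σ0 K c i z').2) : fin τ m σ0 K' c i z' = fin τ m σ0 K c i z' := by
  have h0 := h.mono (known_subset_fin K c i z')
  have h1 := run_local c 0 σ0 i (h0.mono ((τ i).subset_known _ _ _))
  have h2 := ((τ i).loc K K' _ _ h0).1
  unfold fin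
  have h3 : (τ i).nxt K' (run τ K' c 0 σ0 i) z' = (τ i).nxt K (run τ K c 0 σ0 i) z' := by unfold STier.nxt; rw [h1, h2]
  rw [h3]
  exact run_local c (i + 1) _ _ h

/-- The rest of the two runs after tier `i` of the first one. -/
def postRun (τ : ℕ → STier n Z D) (m : ℕ) (σ0 : State n Z) (h0 : (fun _ => false) ∈ σ0.2) (F : Z → Str n → ℝ) (hF : ∀ z x, |F z x| ≤ 1)
  (c c' : ℕ → ℕ) (i : ℕ) : Post (τ i) (preRun τ σ0 h0 c i) where
  Q K z' := (fin τ m σ0 K c i z').2 ∪ (run τ K c' 0 σ0 m).2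
  f K z' x := F (fin τ m σ0 K c i z').1 x - F (run τ K c' 0 σ0 m).1 x
  loc K K' z' h := by rw [fin_local (h.mono subset_union_left), run_local c' 0 σ0 m (h.mono Finset.subset_union_right)]; exact ⟨rfl, rfl⟩
  sub K z' := (known_subset_fin K c i z').trans subset_union_left
  bound K z' x := by refine (abs_sub _ _).trans ?_; have h1 := hF (fin τ m σ0 K c i z').1 x; have h2 := hF (run τ K c' 0 σ0 m).1 x; linarith

theorem card_run_le (hμ : ∀ i S z, S.card ≤ μ i → ((τ i).known K S z).card ≤ μ (i + 1)) (c : ℕ → ℕ) {σ : State n Z}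
  (hσ : σ.2.card ≤ μ i) (k : ℕ) : (run τ K c i σ k).2.card ≤ μ (i + k) := by
  induction k with
  | zero => exact hσ
  | succ k ih => exact hμ _ _ _ ih

theorem card_fin_le (hμ : ∀ i S z, S.card ≤ μ i → ((τ i).known K S z).card ≤ μ (i + 1)) (c : ℕ → ℕ) (hi : i < m)
  (hσ : σ0.2.card ≤ μ 0) (z' : Z) : (fin τ m σ0 K c i z').2.card ≤ μ m := by
  have h1 := card_run_le hμ c hσ i
  rw [zero_add] at h1
  have h2 := card_run_le (i := i + 1) (σ := (τ i).nxt K (run τ K c 0 σ0 i) z') hμ c (hμ _ _ _ h1) (m - (i + 1))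
  rwa [show i + 1 + (m - (i + 1)) = m by omega] at h2

variable {T : WeldedTree n} {χ : EdgeColouring T.graph} {d M : ℕ} {e1 e2 : ℝ}

theorem average_secondOrder_le (hD : 0 < D) (h0 : (fun _ => false) ∈ σ0.2) (hF : ∀ z x, |F z x| ≤ 1) (he : 0 ≤ e2)
  (hdev : ∀ i < m, ∀ p : Pre n Z, average (fun ℓ => (τ i).dev 𝔎 (p.st 𝔎).2 (p.st 𝔎).1) ≤ e2) (hi : i < m) :
  |average fun ℓ => coinAv m D fun c =>
    secondOrder τ m σ0 𝔎 (fun z => F z (ℓ.1 (exit n))) c i| ≤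
    (4 * m ^ 2 + 3) * e2 := by
  refine (abs_average_le _).trans ?_
  have h1 : ∀ ℓ : Labelling n, |coinAv m D fun c =>
      secondOrder τ m σ0 𝔎 (fun z => F z (ℓ.1 (exit n))) c i| ≤
      (m - (i + 1) : ℕ) * (∑ j ∈ range (m - (i + 1)), 4 * coinAv m D fun c =>
        (τ (i + 1 + j)).dev 𝔎 (run τ 𝔎 c 0 σ0 (i + 1 + j)).2 (run τ 𝔎 c 0 σ0 (i + 1 + j)).1) +
      3 * coinAv m D fun c => (τ i).dev 𝔎 (run τ 𝔎 c 0 σ0 i).2 (run τ 𝔎 c 0 σ0 i).1 := by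
    intro ℓ; refine (abs_coinAv_le _).trans ((coinAv_mono fun c => abs_secondOrder_le hD (fun z => hF z _) c i).trans ?_)
    rw [coinAv_add, coinAv_mul_left, coinAv_mul_left, ← coinAv_vd hD σ0 (by omega),
      coinAv_step hD hi σ0 (fun σ => vd τ 𝔎 (m - (i + 1)) (i + 1) σ)]
  have h2 : ∀ j < m, average (fun ℓ => coinAv m D fun c => (τ j).dev 𝔎 (run τ 𝔎 c 0 σ0 j).2 (run τ 𝔎 c 0 σ0 j).1) ≤ e2 := by
    intro j hj; rw [average_coinAv]; exact coinAv_le hD fun c => hdev j hj (preRun τ σ0 h0 c j)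
  refine (average_mono h1).trans ?_
  rw [average_add, average_mul_left, average_mul_left, average_sum]
  simp only [average_mul_left]
  have h3 : ∑ j ∈ range (m - (i + 1)), 4 * average (fun ℓ => coinAv m D fun c =>
        (τ (i + 1 + j)).dev 𝔎 (run τ 𝔎 c 0 σ0 (i + 1 + j)).2 (run τ 𝔎 c 0 σ0 (i + 1 + j)).1) ≤
      ∑ j ∈ range (m - (i + 1)), 4 * e2 := by
    refine sum_le_sum fun j hj => ?_; rw [mem_range] at hj
    exact mul_le_mul_of_nonneg_left (h2 _ (by omega)) (by norm_num)
  rw [sum_const, card_range, nsmul_eq_mul] at h3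
  have h4 : ((m - (i + 1) : ℕ) : ℝ) ≤ m := by exact_mod_cast Nat.sub_le _ _
  have h5 := mul_le_mul_of_nonneg_left h3 (cast_nonneg (m - (i + 1)))
  have h6 := h2 i hi
  have h7 : ((m - (i + 1) : ℕ) : ℝ) * ((m - (i + 1) : ℕ) * (4 * e2)) ≤ m * (m * (4 * e2)) := by gcongr
  nlinarith

/-- For fixed coins, the rest of both runs is a functional of the outcome of tier `i`, and `postRun`
makes it an instance of `Post`. It touches the known strings of both runs, hence `2 * μ m`. -/
theorem abs_average_sub_outAv_le (hD : 0 < D) (hs : 2 * m ≤ 2 ^ s) (h0 : (fun _ => false) ∈ σ0.2) (hF : ∀ z x, |F z x| ≤ 1) (he : 0 ≤ e2)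
  (hμ : ∀ K, Tame K → ∀ i S z, S.card ≤ μ i → ((τ i).known K S z).card ≤ μ (i + 1))
  (hσ : σ0.2.card ≤ μ 0)
  (hB : ∀ i < m, (τ i).Bounded T χ d (2 * μ m) (2 ^ s)⁻¹ e1 e2) :
  |average fun ℓ => vr τ 𝔎 (fun z => F z (ℓ.1 (exit n))) m 0 σ0.1 -
    outAv τ m s σ0 (fun K Y => ball K Y (d + 1)) 𝔎 fun z => F z (ℓ.1 (exit n))| ≤
    m * (e1 + (4 * m ^ 2 + 3) * e2) := by
  simp only [vr_sub_outAv hD hs]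
  rw [average_add, average_sum, average_sum, mul_add]
  have hsum : ∀ (a : ℕ → ℝ) (e : ℝ), (∀ i < m, |a i| ≤ e) →
      |∑ i ∈ range m, a i| ≤ m * e := by
    intro a e h
    refine (abs_sum_le_sum_abs _ _).trans ((sum_le_sum fun i hi =>
      h i (mem_range.1 hi)).trans (le_of_eq ?_))
    rw [sum_const, card_range, nsmul_eq_mul]
  refine (abs_add_le _ _).trans (add_le_add (hsum _ _ fun i hi => ?_) (hsum _ _ fun i hi => ?_))
  · refine abs_average_coinAv_le hD fun c => abs_average_coinAv_le hD fun c' => ?_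
    refine (hB i hi).main (preRun τ σ0 h0 c i) (postRun τ m σ0 h0 F hF c c' i) fun K z hK => ?_
    refine (Finset.card_union_le _ _).trans ?_; have h1 := card_fin_le (hμ K hK) c hi hσ z
    have h2 := card_run_le (hμ K hK) c' hσ m; rw [zero_add] at h2; omega
  · exact average_secondOrder_le hD h0 hF he (fun i hi => (hB i hi).dev_le) hi

/-- With no strings to correct for, a flag would require a natural number to be negative. -/
theorem out_empty (hcr : ∀ i K S z z', (τ i).cr K S z ∅ z' = 0) (c c' : ℕ → ℕ) (κ : ℕ) :
  out τ m s σ0 (fun _ _ => ∅) K c c' κ = (run τ K c 0 σ0 m).1 := by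
  unfold out
  rw [if_neg]
  rintro ⟨i, -, ⟨-, h⟩ | ⟨-, h⟩⟩ <;>
  · unfold flag at h; rw [hcr] at h; omega

/-- If only the last tier errs, there is no accumulation and only one term of `vr_sub_eq` survives.
-/
theorem abs_average_sub_outAv_last_le (hD : 0 < D) (h0 : (fun _ => false) ∈ σ0.2) (hF : ∀ z x, |F z x| ≤ 1)
  (hμ : ∀ K, Tame K → ∀ i S z, S.card ≤ μ i → ((τ i).known K S z).card ≤ μ (i + 1))
  (hσ : σ0.2.card ≤ μ 0) (hcr : ∀ i K S z z', (τ i).cr K S z ∅ z' = 0)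
  (her : ∀ i < m, ∀ K σ z', (τ i).er K σ z' = 0)
  (hB : (τ m).LastBounded T χ (μ m) e1) :
  |average fun ℓ => vr τ 𝔎 (fun z => F z (ℓ.1 (exit n))) (m + 1) 0 σ0.1 -
    outAv τ (m + 1) s σ0 (fun _ _ => ∅) 𝔎 fun z => F z (ℓ.1 (exit n))| ≤ e1 := by
  have h2 : ∀ ℓ : Labelling n, vr τ 𝔎 (fun z => F z (ℓ.1 (exit n))) (m + 1) 0 σ0.1 -
      outAv τ (m + 1) s σ0 (fun _ _ => ∅) 𝔎 (fun z => F z (ℓ.1 (exit n))) =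
      coinAv (m + 1) D fun c => ∑ z', (τ m).er 𝔎 (run τ 𝔎 c 0 σ0 m) z' * F z' (ℓ.1 (exit n)) := by
    intro ℓ
    have h3 : outAv τ (m + 1) s σ0 (fun _ _ => ∅) 𝔎 (fun z => F z (ℓ.1 (exit n))) =
        coinAv (m + 1) D fun c => F (run τ 𝔎 c 0 σ0 (m + 1)).1 (ℓ.1 (exit n)) := by
      unfold outAv; congr 1; funext c; simp only [out_empty hcr]
      rw [sum_const, card_range, nsmul_eq_mul, coinAv_const hD]; push_cast
      rw [mul_div_cancel_left₀ _ (by positivity)]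
    have h4 := vr_sub_eq (τ := τ) (K := 𝔎) (F := fun z => F z (ℓ.1 (exit n))) hD σ0.1 σ0.2 (le_refl (m + 1))
    rw [sum_range_succ, sum_eq_zero, zero_add, Nat.sub_self] at h4
    · simp only [vr] at h4; rw [h3]; exact h4
    · intro i hi; simp only [her i (mem_range.1 hi), zero_mul, sum_const_zero]; exact coinAv_const hD 0
  simp only [h2]
  refine abs_average_coinAv_le hD fun c => hB (preRun τ σ0 h0 c m) F (fun K hK => ?_) hF
  have h5 := card_run_le (hμ K hK) c hσ m
  rwa [zero_add] at h5

end

/-! ### Gates -/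

namespace CGate
variable {n w : ℕ} {K K' : Oracle n}

/-- The strings that are queried by a gate. -/
def reads (z : Bits w) : CGate n w → List (Str n)
  | .query e => [fun j => z (e (Sum.inl j))]
  | _ => []

theorem apply_of_notMem (γ : CGate n w) (z : Bits w) {k : Fin w} (h : k ∉ γ.support) : γ.apply K z k = z k := by
  cases γ with
  | not i => exact update_of_ne (by simpa [support] using h) _ _
  | toffoli e =>
    refine update_of_ne (fun hk => h ?_) _ _; rw [hk]; exact Finset.mem_map_of_mem _ (mem_univ _)
  | reset i => exact update_of_ne (by simpa [support] using h) _ _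
  | query e =>
    refine dif_neg ?_; rintro ⟨j, rfl⟩; exact h (Finset.mem_map_of_mem _ (mem_univ _))

theorem reads_congr (γ : CGate n w) {z z' : Bits w} (h : ∀ i ∈ γ.support, z i = z' i) : γ.reads z = γ.reads z' := by
  cases γ with
  | query e =>
    exact congrArg (fun x => [x]) (funext fun j => h _ (Finset.mem_map_of_mem _ (mem_univ _)))
  | _ => rfl

theorem query_apply (e : QueryWires n ↪ Fin w) (z : Bits w) (j : Fin (2 * n)) :
  (CGate.query e).apply K z (e (Sum.inr (Sum.inr j))) = xor (z (e (Sum.inr (Sum.inr j))))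
    (K (fun j => z (e (Sum.inl j))) (fun j => z (e (Sum.inr (Sum.inl j)))) j) := by
  have h : ∃ j', e (Sum.inr (Sum.inr j')) = e (Sum.inr (Sum.inr j)) := ⟨j, rfl⟩
  refine (dif_pos h).trans ?_
  have h1 : h.choose = j := Sum.inr_injective (Sum.inr_injective (e.injective h.choose_spec))
  rw [h1]

theorem query_apply_of_ne (e : QueryWires n ↪ Fin w) (z : Bits w) {k : Fin w}
  (h : ∀ j, e (Sum.inr (Sum.inr j)) ≠ k) : (CGate.query e).apply K z k = z k :=
  dif_neg fun ⟨j, hj⟩ => h j hj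

theorem reads_apply (γ : CGate n w) (z : Bits w) : γ.reads (γ.apply K z) = γ.reads z := by
  cases γ with
  | query e =>
    exact congrArg (fun x => [x]) (funext fun j => query_apply_of_ne e z (by simp))
  | _ => rfl

theorem apply_congr (γ : CGate n w) (z : Bits w) (h : ∀ x ∈ γ.reads z, ∀ c, K x c = K' x c) : γ.apply K z = γ.apply K' z := by
  cases γ with
  | query e =>
    have h1 := h (fun j => z (e (Sum.inl j))) (List.mem_singleton.2 rfl); funext k; by_cases hk : ∃ j, e (Sum.inr (Sum.inr j)) = k
    · obtain ⟨j, rfl⟩ := hk; rw [query_apply, query_apply, h1]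
    · push Not at hk
      rw [query_apply_of_ne _ _ hk, query_apply_of_ne _ _ hk]
  | _ => rfl

theorem apply_apply (γ : CGate n w) (hγ : ∀ i, γ ≠ .reset i) (z : Bits w) : γ.apply K (γ.apply K z) = z := by
  cases γ with
  | not i => simp [apply]
  | toffoli e =>
    have h1 : e 0 ≠ e 2 := e.injective.ne (by decide)
    have h2 : e 1 ≠ e 2 := e.injective.ne (by decide)
    simp [apply, h1, h2]
  | reset i => exact absurd rfl (hγ i)
  | query e =>
    funext k; by_cases h : ∃ j, e (Sum.inr (Sum.inr j)) = k
    · obtain ⟨j, rfl⟩ := h; rw [query_apply, query_apply]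
      have h1 : ∀ j, (CGate.query e).apply K z (e (Sum.inl j)) = z (e (Sum.inl j)) := fun j => query_apply_of_ne e z (by simp)
      have h2 : ∀ j, (CGate.query e).apply K z (e (Sum.inr (Sum.inl j))) =
        z (e (Sum.inr (Sum.inl j))) := fun j => query_apply_of_ne e z (by simp)
      simp only [h1, h2, Bool.xor_assoc, Bool.xor_self, Bool.xor_false]
    · push Not at h
      rw [query_apply_of_ne _ _ h, query_apply_of_ne _ _ h]

end CGate

namespace QGate
variable {n w : ℕ} {K K' : Oracle n}

/-- The strings that are queried by a gate. -/
def reads (z : Bits w) : QGate n w → List (Str n)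
  | .classical γ => γ.reads z
  | _ => []

theorem reads_congr (γ : QGate n w) {z z' : Bits w} (h : ∀ i ∈ γ.support, z i = z' i) : γ.reads z = γ.reads z' := by
  cases γ with
  | classical γ => exact γ.reads_congr h
  | _ => rfl

/-- The entries of the matrix of a gate, up to a factor. -/
def imat (K : Oracle n) : QGate n w → Matrix (Bits w) (Bits w) GaussianInt
  | .classical γ => Matrix.of fun y u => if y = γ.apply K u then 1 else 0
  | .hadamard i => Matrix.of fun y u =>
    if ∀ j, j ≠ i → y j = u j then if u i && y i then -1 else 1 else 0
  | .phase i => Matrix.of fun y u => if y = u then if u i then ⟨0, 1⟩ else 1 else 0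

/-- The number of factors `1 / √2`. -/
def root (γ : QGate n w) : ℕ := match γ with
  | .hadamard _ => 1
  | _ => 0

/-- The matrix of a gate. -/
def mat (K : Oracle n) (γ : QGate n w) : Op w := Matrix.of fun y u =>
  ((γ.imat K y u : GaussianInt) : ℂ) / (Real.sqrt 2 : ℂ) ^ γ.root

theorem imat_ne_zero (γ : QGate n w) {y u : Bits w} (h : γ.imat K y u ≠ 0) : (∀ j ∉ γ.support, y j = u j) ∧ γ.reads y = γ.reads u := by
  cases γ with
  | classical γ =>
    simp only [imat, of_apply, ne_eq, ite_eq_right_iff, one_ne_zero, imp_false, not_not] at h; subst h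
    exact ⟨fun j hj => γ.apply_of_notMem u hj, γ.reads_apply u⟩
  | hadamard i =>
    simp only [imat, of_apply, ne_eq, ite_eq_right_iff, Classical.not_imp] at h
    exact ⟨fun j hj => h.1 j (by simpa [support] using hj), rfl⟩
  | phase i =>
    simp only [imat, of_apply, ne_eq, ite_eq_right_iff, Classical.not_imp] at h
    exact ⟨fun j _ => by rw [h.1], rfl⟩

theorem imat_congr (γ : QGate n w) (y : Bits w) {u : Bits w} (h : ∀ x ∈ γ.reads u, ∀ c, K x c = K' x c) : γ.imat K y u = γ.imat K' y u := by
  cases γ with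
  | classical γ =>
    simp only [imat, of_apply]; rw [γ.apply_congr u h]
  | _ => rfl

theorem sum_off {R : Type*} [AddCommMonoid R] (i : Fin w) (u : Bits w) (F : Bits w → R) :
  (∑ y, if ∀ j, j ≠ i → y j = u j then F y else 0) = F (update u i false) + F (update u i true) := by
  have h1 : univ.filter (fun y : Bits w => ∀ j, j ≠ i → y j = u j) = {update u i false, update u i true} := by
    ext y; simp only [mem_filter, mem_univ, true_and, mem_insert, mem_singleton]; constructor
    · grind
    · rintro (rfl | rfl) <;> exact fun j hj => update_of_ne hj _ _
  rw [← sum_filter, h1, Finset.sum_pair]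
  intro h
  have := congrFun h i
  simp at this

theorem kraus_eq (γ : QGate n w) (hγ : ∀ i, γ ≠ .classical (.reset i)) (K : Oracle n) : γ.kraus K = [γ.mat K] := by
  have h2 : ∀ γ : CGate n w, basisMap (γ.apply K) = mat K (.classical γ) := by
    intro γ; ext y u; simp only [basisMap, mat, imat, root, of_apply, pow_zero, div_one]; split_ifs <;> simp
  cases γ with
  | classical γ =>
    cases γ with
    | reset i => exact absurd rfl (hγ i)
    | _ => exact congrArg (fun A => [A]) (h2 _)
  | hadamard i =>
    refine congrArg (fun A => [A]) ?_; ext y u; simp only [mat, imat, root, of_apply, pow_one]; split_ifs <;> simp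
  | phase i =>
    refine congrArg (fun A => [A]) ?_; ext y u
    simp only [mat, imat, root, of_apply, pow_zero, div_one, Matrix.diagonal_apply]; by_cases h : y = u
    · subst h; split_ifs <;> simp [GaussianInt.toComplex_def]
    · simp [h]

theorem mat_unitary (γ : QGate n w) (hγ : ∀ i, γ ≠ .classical (.reset i)) (K : Oracle n) : (γ.mat K)ᴴ * γ.mat K = 1 := by
  cases γ with
  | classical γ =>
    have h0 : ∀ i, γ ≠ .reset i := fun i h => hγ i (by rw [h])
    have h1 : Function.Injective (γ.apply K) := Function.LeftInverse.injective (g := γ.apply K) (γ.apply_apply h0); ext u u'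
    simp only [mul_apply, conjTranspose_apply, mat, imat, root, of_apply, pow_zero, div_one, Matrix.one_apply]
    rw [sum_eq_single (γ.apply K u)]
    · simp only [if_true, h1.eq_iff]; split_ifs <;> simp
    · intro y _ hy; simp [hy]
    · simp
  | phase i =>
    ext u u'; simp only [mul_apply, conjTranspose_apply, mat, imat, root, of_apply, pow_zero, div_one, Matrix.one_apply]
    rw [sum_eq_single u]
    · by_cases h : u = u'
      · subst h; by_cases hb : u i = true <;> simp [hb, GaussianInt.toComplex_def]
      · simp [h]
    · intro y _ hy; simp [hy]
    · simp
  | hadamard i =>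
    ext u u'
    have h3 : (Real.sqrt 2 : ℂ) * (Real.sqrt 2 : ℂ) = 2 := by
      rw [← Complex.ofReal_mul, Real.mul_self_sqrt (by norm_num)]; norm_num
    have h4 : ∀ y : Bits w, star ((QGate.hadamard i).mat K y u) * (QGate.hadamard i).mat K y u' =
        if ∀ j, j ≠ i → y j = u j then (if ∀ j, j ≠ i → y j = u' j then
          (if u i && y i then -1 else 1) * (if u' i && y i then -1 else 1) / 2 else 0 : ℂ)
        else 0 := by
      intro y; simp only [mat, imat, root, of_apply, pow_one]; by_cases h1 : ∀ j, j ≠ i → y j = u j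
      · by_cases h2 : ∀ j, j ≠ i → y j = u' j
        · rw [if_pos h1, if_pos h2, if_pos h1, if_pos h2, ← h3]; cases u i <;> cases u' i <;> cases y i <;> simp <;> ring
        · simp [h2]
      · simp [h1]
    rw [mul_apply]; simp only [conjTranspose_apply, h4]; rw [sum_off]
    have h5 : ∀ b, (∀ j, j ≠ i → update u i b j = u' j) ↔ ∀ j, j ≠ i → u j = u' j := by grind
    simp only [h5, update_self, Matrix.one_apply]; by_cases h6 : ∀ j, j ≠ i → u j = u' j
    · grind
    · grind

/-- The bits that are measured by a gate have to agree. -/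
def link (γ : QGate n w) (u u' : Bits w) : Prop := match γ with
  | .classical (.reset i) => u i = u' i
  | _ => True

/-- The action of a gate on operators, where the ket and the bra see different oracles. -/
def sup (K K' : Oracle n) (γ : QGate n w) (ρ : Op w) : Op w := (List.zipWith (fun A A' => A * ρ * A'ᴴ) (γ.kraus K) (γ.kraus K')).sum

theorem apply_eq_sup (γ : QGate n w) (ρ : Op w) : γ.apply K ρ = γ.sup K K ρ := by
  unfold apply sup
  rw [List.zipWith_self]

theorem sup_eq (γ : QGate n w) (hγ : ∀ i, γ ≠ .classical (.reset i)) (ρ : Op w) : γ.sup K K' ρ = γ.mat K * ρ * (γ.mat K')ᴴ := by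
  unfold sup
  rw [kraus_eq γ hγ, kraus_eq γ hγ]
  simp

open Classical in
/-- The action of a gate on operators with integer entries, up to a factor. -/
def isup (K K' : Oracle n) (γ : QGate n w) (B : Matrix (Bits w) (Bits w) GaussianInt) :
  Matrix (Bits w) (Bits w) GaussianInt := Matrix.of fun y y' =>
  ∑ u, ∑ u', if γ.link u u' then γ.imat K y u * B u u' * star (γ.imat K' y' u') else 0

theorem sum_reset {R : Type*} [AddCommMonoid R] (i : Fin w) (b : Bool) (y : Bits w)
  (F : Bits w → R) : (∑ u, if y = update u i false ∧ u i = b then F u else 0) =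
    if y i = false then F (update y i b) else 0 := by
  rw [sum_eq_single (update y i b)]
  · rw [Function.update_idem, update_self]; by_cases h : y i = false
    · grind
    · rw [if_neg h, if_neg]; rintro ⟨h1, -⟩; rw [h1, update_self] at h; exact h rfl
  · intro u _ hu; refine if_neg ?_; rintro ⟨rfl, rfl⟩; rw [Function.update_idem, update_eq_self] at hu; exact hu rfl
  · simp

theorem sup_reset_apply (i : Fin w) (ρ : Op w) (y y' : Bits w) :
  sup K K' (.classical (.reset i)) ρ y y' = if y i = false ∧ y' i = false then
    ρ (update y i false) (update y' i false) + ρ (update y i true) (update y' i true) else 0 := by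
  have h1 : ∀ b, (basisMap (CGate.apply K (.reset i)) * bitProj i b * ρ * (basisMap (CGate.apply K' (.reset i)) * bitProj i b)ᴴ) y y' =
      if y i = false ∧ y' i = false then ρ (update y i b) (update y' i b)
      else 0 := by
    intro b
    have h2 : ∀ u', (basisMap (CGate.apply K (.reset i)) * bitProj i b * ρ) y u' =
        if y i = false then ρ (update y i b) u' else 0 := by
      intro u'; rw [← sum_reset (F := fun u => ρ u u'), mul_apply]; refine sum_congr rfl fun u _ => ?_
      simp only [bitProj, Matrix.mul_diagonal, basisMap, of_apply, CGate.apply]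
      by_cases h1 : y = update u i false <;> by_cases h3 : u i = b <;> simp [h1, h3]
    have h3 := sum_reset i b y' (F := fun u' => if y i = false then ρ (update y i b) u' else 0)
    rw [ite_and, mul_apply]; simp only [h2]; refine Eq.trans ?_ (h3.trans ?_)
    · refine sum_congr rfl fun u _ => ?_
      simp only [bitProj, conjTranspose_apply, Matrix.mul_diagonal, basisMap, of_apply, CGate.apply]
      by_cases h1 : y' = update u i false <;> by_cases h3 : u i = b <;> simp [h1, h3]
    · grind
  unfold sup kraus
  simp only [List.zipWith_cons_cons, List.zipWith_nil_left, List.sum_cons, List.sum_nil, add_zero, Matrix.add_apply, h1]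
  split_ifs <;> simp

/-- A Hadamard gate acts on ket and bra, so its two factors `1 / √2` combine to `1 / 2` and no
square roots remain. Ket and bra may see different oracles, which the first-order corrections need.
-/
theorem toComplex_isup (γ : QGate n w) (B : Matrix (Bits w) (Bits w) GaussianInt) :
  (γ.isup K K' B).map GaussianInt.toComplex = (2 : ℂ) ^ γ.root • γ.sup K K' (B.map GaussianInt.toComplex) := by
  classical
  ext y y'
  by_cases hγ : ∃ i, γ = .classical (.reset i)
  · obtain ⟨i, rfl⟩ := hγ; simp only [Matrix.map_apply, isup, of_apply, map_sum, root, pow_zero, one_smul, sup_reset_apply]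
    have h1 : ∀ b, (if y i = false ∧ y' i = false then
        GaussianInt.toComplex (B (update y i b) (update y' i b)) else 0) =
        ∑ u, ∑ u', if y = update u i false ∧ u i = b then
          if y' = update u' i false ∧ u' i = b then GaussianInt.toComplex (B u u') else 0
          else 0 := by
      intro b; simp only [Finset.sum_ite_irrel, sum_const_zero, sum_reset]; rw [ite_and]
    have h2 : ∀ (p : Prop) [Decidable p] (a b : ℂ), (if p then a + b else 0) = (if p then a else 0) + if p then b else 0 := by grind
    rw [h2, h1, h1, ← sum_add_distrib]; refine sum_congr rfl fun u _ => ?_; rw [← sum_add_distrib]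
    refine sum_congr rfl fun u' _ => ?_; simp only [link, imat, CGate.apply, of_apply]
    by_cases h1 : y = update u i false <;> by_cases h2 : y' = update u' i false <;>
      rcases Bool.eq_false_or_eq_true (u i) with hu | hu <;>
      rcases Bool.eq_false_or_eq_true (u' i) with hu' | hu' <;> simp [h1, h2, hu, hu']
  · push Not at hγ
    have hl : ∀ u u', γ.link u u' := by
      intro u u'; unfold link
      split
      · grind
      · trivial
    rw [sup_eq γ hγ, Matrix.smul_apply, mul_apply]
    simp only [Matrix.map_apply, isup, of_apply, map_sum, hl, if_true, map_mul]; rw [sum_comm, Finset.smul_sum]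
    refine sum_congr rfl fun u' _ => ?_; rw [mul_apply, sum_mul, Finset.smul_sum]; refine sum_congr rfl fun u _ => ?_
    simp only [Matrix.map_apply, conjTranspose_apply, mat, of_apply, smul_eq_mul]
    have h3 : (Real.sqrt 2 : ℂ) * (Real.sqrt 2 : ℂ) = 2 := by
      rw [← Complex.ofReal_mul, Real.mul_self_sqrt (by norm_num)]; norm_num
    have h4 : (Real.sqrt 2 : ℂ) ≠ 0 := by rw [Complex.ofReal_ne_zero]; positivity
    rw [GaussianInt.toComplex_star, star_div₀, star_pow]
    have h5 : star (Real.sqrt 2 : ℂ) = (Real.sqrt 2 : ℂ) := Complex.conj_ofReal _; rw [h5, ← h3, mul_pow]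
    have h6 : (Real.sqrt 2 : ℂ) ^ γ.root ≠ 0 := pow_ne_zero _ h4; field_simp; rfl

end QGate

/-! ### Gates as unitary maps with ancillas -/

section
variable {n : ℕ} {Z E : Type*} [Fintype Z] [Fintype E]

/-- The operator `|ψ⟩⟨φ|` with the environment traced out. -/
def bl (ψ φ : Vec (Z × E)) : Matrix Z Z ℂ := Matrix.of fun y y' => ∑ e, ψ (y, e) * star (φ (y', e))

theorem bl_add (ψ ψ' φ : Vec (Z × E)) : bl (ψ + ψ') φ = bl ψ φ + bl ψ' φ := by
  ext y y'
  simp [bl, add_mul, sum_add_distrib]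

theorem bl_sub (ψ ψ' φ : Vec (Z × E)) : bl (ψ - ψ') φ = bl ψ φ - bl ψ' φ := by
  ext y y'
  simp [bl, sub_mul, sum_sub_distrib]

theorem outP_eq_bl (ψ : Vec (Z × E)) (z : Z) : (outP ψ z : ℂ) = bl ψ ψ z z := by
  simp only [outP, bl, of_apply]
  push_cast
  exact sum_congr rfl fun e _ => (RCLike.mul_conj _).symm

theorem outD_eq_bl (φ δ : Vec (Z × E)) (z : Z) : outD φ δ z = 2 * (bl δ φ z z).re := by
  simp only [outD, bl, of_apply, Complex.re_sum]
  congr 1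
  exact sum_congr rfl fun e _ => by rw [mul_comm]; rfl

/-- The action of a matrix on the first factor. -/
def tensMap (A : Matrix Z Z ℂ) : Vec (Z × E) →ₗ[ℂ] Vec (Z × E) where
  toFun ψ := WithLp.toLp 2 fun ω => ∑ u, A ω.1 u * ψ (u, ω.2)
  map_add' ψ φ := by ext ω; simp [mul_add, sum_add_distrib]
  map_smul' a ψ := by
    ext ω; simp only [PiLp.smul_apply, smul_eq_mul, RingHom.id_apply, mul_sum]
    exact sum_congr rfl fun u _ => by ring

theorem tensMap_apply (A : Matrix Z Z ℂ) (ψ : Vec (Z × E)) (ω : Z × E) : tensMap A ψ ω = ∑ u, A ω.1 u * ψ (u, ω.2) := rfl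

theorem bl_tensMap (A A' : Matrix Z Z ℂ) (ψ φ : Vec (Z × E)) : bl (tensMap A ψ) (tensMap A' φ) = A * bl ψ φ * A'ᴴ := by
  ext y y'
  simp only [bl, of_apply, tensMap_apply, star_sum, Finset.sum_mul_sum]
  rw [sum_comm]
  refine (sum_congr rfl fun u _ => sum_comm).trans ?_
  rw [sum_comm, mul_apply]
  refine sum_congr rfl fun u' _ => ?_
  rw [mul_apply, sum_mul]
  refine sum_congr rfl fun u _ => ?_
  rw [of_apply, mul_sum, sum_mul]
  refine sum_congr rfl fun e _ => ?_
  rw [star_mul', conjTranspose_apply]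
  ring

theorem norm_sq_eq_trace (ψ : Vec (Z × E)) : ‖ψ‖ ^ 2 = (bl ψ ψ).trace.re := by
  rw [← sum_outP, Matrix.trace, Complex.re_sum]
  refine sum_congr rfl fun z _ => ?_
  rw [Matrix.diag_apply, ← outP_eq_bl, Complex.ofReal_re]

/-- A unitary matrix on the first factor. -/
def tens [DecidableEq Z] (A : Matrix Z Z ℂ) (hA : Aᴴ * A = 1) : Vec (Z × E) ≃ₗᵢ[ℂ] Vec (Z × E) :=
  LinearIsometry.toLinearIsometryEquiv ⟨tensMap A, fun ψ => by
    have h : ‖tensMap A ψ‖ ^ 2 = ‖ψ‖ ^ 2 := by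
      rw [norm_sq_eq_trace, norm_sq_eq_trace, bl_tensMap, Matrix.trace_mul_comm, ← Matrix.mul_assoc, hA, Matrix.one_mul]
    exact (sq_eq_sq₀ (norm_nonneg _) (norm_nonneg _)).1 h⟩ rfl

theorem tens_apply [DecidableEq Z] (A : Matrix Z Z ℂ) (hA : Aᴴ * A = 1) (ψ : Vec (Z × E)) : tens A hA ψ = tensMap A ψ := rfl

end

section
variable {Ω : Type*} [Fintype Ω] {n : ℕ}

/-- A unitary map that depends on an oracle does not change the queried strings, and depends only on
the answers to these. -/
def Respects (rd : Ω → Finset (Str n)) (V : Oracle n → Vec Ω ≃ₗᵢ[ℂ] Vec Ω) : Prop :=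
  (∀ (O : Oracle n) (p : Finset (Str n) → Prop) (ψ : Vec Ω), cut (fun ω => p (rd ω)) (V O ψ) = V O (cut (fun ω => p (rd ω)) ψ)) ∧
  ∀ (O O' : Oracle n) (ψ : Vec Ω), (∀ ω, ψ ω ≠ 0 → ∀ x ∈ rd ω, ∀ c, O x c = O' x c) → V O ψ = V O' ψ

theorem Respects.refl (rd : Ω → Finset (Str n)) : Respects rd fun _ => LinearIsometryEquiv.refl ℂ (Vec Ω) :=
  ⟨fun _ _ _ => rfl, fun _ _ _ _ => rfl⟩

theorem Respects.trans {rd : Ω → Finset (Str n)} {V W : Oracle n → Vec Ω ≃ₗᵢ[ℂ] Vec Ω} (hV : Respects rd V)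
  (hW : Respects rd W) : Respects rd fun O => (V O).trans (W O) := by
  refine ⟨fun O p ψ => ?_, fun O O' ψ h => ?_⟩
  · simp only [trans_apply]; rw [hW.1, hV.1]
  · simp only [trans_apply]; rw [← hV.2 O O' ψ h]; refine hW.2 O O' _ fun ω hω => ?_
    have h1 : cut (fun ω => ∀ x ∈ rd ω, ∀ c, O x c = O' x c) ψ = ψ := by
      conv_rhs => rw [← cut_true ψ]
      exact cut_congr fun ω hω => ⟨fun _ => trivial, fun _ => h ω hω⟩
    rw [← h1, ← hV.1 O (fun s => ∀ x ∈ s, ∀ c, O x c = O' x c), cut_apply] at hω; by_contra h2; exact hω (if_neg h2)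

end

section
variable {n d g : ℕ}

/-- The ancillas: one for each layer and each wire. -/
abbrev Env (d g : ℕ) : Type := Fin (d + 1) × Fin g → Bool

/-- The exchange of a wire with an ancilla. -/
def swp (a : Fin (d + 1) × Fin g) (ω : Bits g × Env d g) : Bits g × Env d g := (update ω.1 a.2 (ω.2 a), update ω.2 a (ω.1 a.2))

theorem swp_swp (a : Fin (d + 1) × Fin g) : Function.Involutive (swp a) := by
  intro ω
  simp [swp]

/-- The exchange of a wire with an ancilla, as a unitary map. -/
def swpIso (a : Fin (d + 1) × Fin g) : Vec (Bits g × Env d g) ≃ₗᵢ[ℂ] Vec (Bits g × Env d g) :=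
  LinearIsometryEquiv.piLpCongrLeft 2 ℂ ℂ (swp_swp a).toPerm

theorem swpIso_apply (a : Fin (d + 1) × Fin g) (ψ : Vec (Bits g × Env d g)) (ω : Bits g × Env d g) : swpIso a ψ ω = ψ (swp a ω) := by
  simp [swpIso, LinearIsometryEquiv.piLpCongrLeft_apply, Equiv.piCongrLeft'_apply]

open Classical in
/-- A gate in layer `k` as a unitary map. -/
def gateIso (k : Fin (d + 1)) (γ : QGate n g) (O : Oracle n) : Vec (Bits g × Env d g) ≃ₗᵢ[ℂ] Vec (Bits g × Env d g) :=
  if h : ∀ i, γ ≠ .classical (.reset i) then tens (γ.mat O) (γ.mat_unitary h O)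
  else swpIso (k, (not_forall.1 h).choose)

theorem gateIso_reset (k : Fin (d + 1)) (i : Fin g) (O : Oracle n) : gateIso k (.classical (.reset i)) O = swpIso (k, i) := by
  have h : ¬ ∀ j, (QGate.classical (.reset i) : QGate n g) ≠ .classical (.reset j) := fun h => h i rfl
  unfold gateIso
  rw [dif_neg h]
  have h1 := (not_forall.1 h).choose_spec
  rw [not_not, QGate.classical.injEq, CGate.reset.injEq] at h1
  rw [← h1]

variable {γ : QGate n g} {c : Set (Fin (d + 1) × Fin g)} {ψ φ : Vec (Bits g × Env d g)}

theorem gateIso_of_ne (h : ∀ i, γ ≠ .classical (.reset i)) (k : Fin (d + 1))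
  (O : Oracle n) : gateIso k γ O = tens (γ.mat O) (γ.mat_unitary h O) := dif_pos h

/-- Certain ancillas are zero. -/
def Clean (c : Set (Fin (d + 1) × Fin g)) (ψ : Vec (Bits g × Env d g)) : Prop := ∀ y e, ψ (y, e) ≠ 0 → ∀ a ∈ c, e a = false

theorem Clean.mono {c c' : Set (Fin (d + 1) × Fin g)} (h : Clean c ψ) (hc : c' ⊆ c) : Clean c' ψ := fun y e hψ a ha => h y e hψ a (hc ha)

theorem Clean.add (h : Clean c ψ) (h' : Clean c φ) : Clean c (ψ + φ) := by
  intro y e hψ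
  by_cases h0 : ψ (y, e) = 0
  · refine h' y e fun h1 => hψ ?_; rw [PiLp.add_apply, h0, h1, add_zero]
  · exact h y e h0

theorem Clean.sub (h : Clean c ψ) (h' : Clean c φ) : Clean c (ψ - φ) := by
  intro y e hψ
  by_cases h0 : ψ (y, e) = 0
  · refine h' y e fun h1 => hψ ?_; rw [PiLp.sub_apply, h0, h1, sub_zero]
  · exact h y e h0

/-- Of all ancillas, a gate in layer `k` can use only those of layer `k` on its own wires. -/
theorem Clean.gateIso (h : Clean c ψ) {k : Fin (d + 1)} (hc : ∀ i ∈ γ.support, (k, i) ∉ c) (O : Oracle n) : Clean c (gateIso k γ O ψ) := by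
  intro y e hψ a ha
  by_cases hγ : ∀ i, γ ≠ .classical (.reset i)
  · rw [gateIso_of_ne hγ, tens_apply, tensMap_apply] at hψ; obtain ⟨u, -, hu⟩ := Finset.exists_ne_zero_of_sum_ne_zero hψ
    exact h u e (right_ne_zero_of_mul hu) a ha
  · push Not at hγ
    obtain ⟨i, rfl⟩ := hγ; rw [gateIso_reset, swpIso_apply] at hψ; have h1 := h _ _ hψ a ha; rwa [update_of_ne] at h1; rintro rfl
    exact hc i (by simp [QGate.support, CGate.support]) ha

theorem sum_ancilla (a : Fin (d + 1) × Fin g) (G : Bool → Env d g → ℂ) (h : ∀ b e, e a = true → G b e = 0) :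
  ∑ e : Env d g, G (e a) (update e a false) = ∑ e, (G false e + G true e) := by
  have hσ : Function.Involutive fun e : Env d g => update e a (!(e a)) := by intro e; simp
  rw [sum_add_distrib, ← Equiv.sum_comp hσ.toPerm (G true), ← sum_add_distrib]
  refine sum_congr rfl fun e _ => ?_
  rw [Function.Involutive.coe_toPerm]
  cases he : e a
  · rw [h true (update e a (!false)) (by simp), add_zero, ← he, update_eq_self]
  · grind

/-- A reset moves the old bit into an ancilla that is zero; tracing out the ancilla sums over the
two values of the old bit, as the two Kraus operators do. -/
theorem bl_gateIso {k : Fin (d + 1)} (hψ : Clean c ψ) (hφ : Clean c φ) (hc : ∀ i ∈ γ.support, (k, i) ∈ c) (K K' : Oracle n) :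
  bl (gateIso k γ K ψ) (gateIso k γ K' φ) = γ.sup K K' (bl ψ φ) := by
  classical
  by_cases hγ : ∀ i, γ ≠ .classical (.reset i)
  · rw [gateIso_of_ne hγ, gateIso_of_ne hγ, tens_apply, tens_apply, bl_tensMap, QGate.sup_eq γ hγ]
  · push Not at hγ
    obtain ⟨i, rfl⟩ := hγ
    have hki := hc i (by simp [QGate.support, CGate.support])
    rw [gateIso_reset, gateIso_reset]; ext y y'; rw [QGate.sup_reset_apply]
    simp only [bl, of_apply, swpIso_apply, swp]; split_ifs with hy
    · rw [hy.1, hy.2, ← sum_add_distrib]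
      refine sum_ancilla (k, i) (fun b e => ψ (update y i b, e) * star (φ (update y' i b, e))) fun b e he => ?_
      have h0 : ψ (update y i b, e) = 0 := by
        by_contra h0; have := hψ _ e h0 _ hki; rw [he] at this
        exact absurd this (by decide)
      simp only [h0, zero_mul]
    · refine sum_eq_zero fun e _ => ?_; by_contra h0; refine hy ⟨?_, ?_⟩
      · have := hψ _ _ (left_ne_zero_of_mul h0) _ hki; rwa [update_self] at this
      · have := hφ _ _ (star_ne_zero.1 (right_ne_zero_of_mul h0)) _ hki; rwa [update_self] at this

end

/-! ### Layers of gates as unitary maps -/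

section
variable {n d g : ℕ}

/-- The gates of a list, one after the other, in layer `k`. -/
def listIso (k : Fin (d + 1)) : List (QGate n g) → Oracle n → Vec (Bits g × Env d g) ≃ₗᵢ[ℂ] Vec (Bits g × Env d g)
  | [], _ => LinearIsometryEquiv.refl ℂ _
  | γ :: l, O => (gateIso k γ O).trans (listIso k l O)

/-- The strings that are queried by the gates of a list. -/
def listReads (l : List (QGate n g)) (z : Bits g) : Finset (Str n) := (l.flatMap (QGate.reads z)).toFinset

/-- The gates of a list act on disjoint sets of wires. -/
def Apart (l : List (QGate n g)) : Prop := l.Pairwise fun a b => Disjoint a.support b.support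

variable {l : List (QGate n g)} {k : ℕ} {L : Fin d → QLayer n g}

theorem Apart.forall (h : Apart l) {a b : QGate n g} (ha : a ∈ l) (hb : b ∈ l) (hab : a ≠ b) : Disjoint a.support b.support := by
  have h0 : l.Pairwise fun a b => Disjoint a.support b.support := h
  have h1 : l.Pairwise fun a b => a ≠ b → Disjoint a.support b.support :=
    List.Pairwise.imp (S := fun a b : QGate n g => a ≠ b → Disjoint a.support b.support) (fun h _ => h) h0
  have h2 : l.Pairwise (flip fun a b => a ≠ b → Disjoint a.support b.support) :=
    List.Pairwise.imp (S := fun a b : QGate n g => b ≠ a → Disjoint b.support a.support) (fun h _ => h.symm) h0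
  exact List.Pairwise.forall_of_forall_of_flip (fun x _ hx => absurd rfl hx) h1 h2 ha hb hab

/-- The matrix of a gate connects only basis states that agree outside its support and query the
same string by that gate. It suffices that such a move does not change `rd`. -/
theorem Respects.gateIso (k : Fin (d + 1)) (γ : QGate n g) (rd : Bits g → Finset (Str n)) (hsub : ∀ z, ∀ x ∈ γ.reads z, x ∈ rd z)
  (hmove : ∀ z z', (∀ j ∉ γ.support, z j = z' j) → γ.reads z = γ.reads z' → rd z = rd z') :
  Respects (fun ω : Bits g × Env d g => rd ω.1) (gateIso k γ) := by
  by_cases hγ : ∀ i, γ ≠ .classical (.reset i)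
  · have h0 : ∀ (O : Oracle n) y u, γ.mat O y u ≠ 0 → γ.imat O y u ≠ 0 := by
      intro O y u h h1
      exact h (by simp [QGate.mat, h1])
    have h1 : ∀ (O : Oracle n) y u, γ.mat O y u ≠ 0 → rd y = rd u := fun O y u h =>
      hmove _ _ (γ.imat_ne_zero (h0 O y u h)).1 (γ.imat_ne_zero (h0 O y u h)).2
    refine ⟨fun O p ψ => ?_, fun O O' ψ h => ?_⟩
    · rw [gateIso_of_ne hγ, tens_apply, tens_apply]; ext ω; rw [cut_apply, tensMap_apply, tensMap_apply]; split_ifs with hp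
      · refine sum_congr rfl fun u _ => ?_; by_cases h2 : γ.mat O ω.1 u = 0
        · grind
        · rw [cut_apply, if_pos (show p (rd u) from h1 O _ _ h2 ▸ hp)]
      · refine (sum_eq_zero fun u _ => ?_).symm; by_cases h2 : γ.mat O ω.1 u = 0
        · grind
        · rw [cut_apply, if_neg (show ¬ p (rd u) from h1 O _ _ h2 ▸ hp), mul_zero]
    · rw [gateIso_of_ne hγ, gateIso_of_ne hγ, tens_apply, tens_apply]; ext ω; rw [tensMap_apply, tensMap_apply]
      refine sum_congr rfl fun u _ => ?_; by_cases h2 : ψ (u, ω.2) = 0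
      · rw [h2, mul_zero, mul_zero]
      · simp only [QGate.mat, of_apply]; rw [γ.imat_congr ω.1 fun x hx c => h _ h2 x (hsub u x hx) c]
  · push Not at hγ
    obtain ⟨i, rfl⟩ := hγ
    refine ⟨fun O p ψ => ?_, fun O O' ψ _ => by rw [gateIso_reset, gateIso_reset]⟩
    rw [gateIso_reset]; ext ω; rw [cut_apply, swpIso_apply, swpIso_apply, cut_apply]
    have h2 : rd (swp (k, i) ω).1 = rd ω.1 := by
      refine hmove _ _ (fun j hj => ?_) rfl; refine update_of_ne ?_ _ _; simpa [QGate.support, CGate.support] using hj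
    have h3 : p (rd ω.1) ↔ p (rd (swp (k, i) ω).1) := by rw [h2]
    by_cases hp : p (rd ω.1)
    · grind
    · grind

theorem Respects.listIso (k : Fin (d + 1)) (rd : Bits g → Finset (Str n))
  (l : List (QGate n g)) (hl : ∀ γ ∈ l, Respects (fun ω : Bits g × Env d g => rd ω.1) (HybridWelded.gateIso k γ)) :
  Respects (fun ω : Bits g × Env d g => rd ω.1) (listIso k l) := by
  induction l with
  | nil => exact Respects.refl _
  | cons γ l ih =>
    exact (hl γ List.mem_cons_self).trans (ih fun γ' h => hl γ' (List.mem_cons_of_mem _ h))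

/-- A gate preserves its own query register, and the registers of the other gates lie on disjoint
wires. So the strings that are queried by the whole layer can be read off before any of its gates
acts. -/
theorem Apart.respects (h : Apart l) (k : Fin (d + 1)) : Respects (fun ω : Bits g × Env d g => listReads l ω.1) (listIso k l) := by
  refine Respects.listIso k _ l fun γ hγ => Respects.gateIso k γ _ (fun z x hx => ?_) ?_
  · exact List.mem_toFinset.2 (List.mem_flatMap.2 ⟨γ, hγ, hx⟩)
  · intro z z' h1 h2; refine congrArg List.toFinset (List.flatMap_congr fun γ' hγ' => ?_); by_cases h3 : γ' = γ
    · grind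
    · exact γ'.reads_congr fun i hi =>
        h1 i fun h4 => Finset.disjoint_left.1 (h.forall hγ' hγ h3) hi h4

/-- The numbers of the layers from `k` on. -/
def later (d g k : ℕ) : Set (Fin (d + 1) × Fin g) := {a | k ≤ a.1}

theorem Clean.listIso {c : Set (Fin (d + 1) × Fin g)} {k : Fin (d + 1)} (hc : ∀ i, (k, i) ∉ c)
  (l : List (QGate n g)) (O : Oracle n) {ψ : Vec (Bits g × Env d g)}
  (h : Clean c ψ) : Clean c (listIso k l O ψ) := by
  induction l generalizing ψ with
  | nil => exact h
  | cons γ l ih => exact ih (h.gateIso (fun i _ => hc i) O)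

theorem Apart.bl_listIso (hl : Apart l) {k : Fin (d + 1)} {ψ φ : Vec (Bits g × Env d g)} (K K' : Oracle n)
  (hψ : Clean {a | a.1 = k ∧ ∃ γ ∈ l, a.2 ∈ γ.support} ψ)
  (hφ : Clean {a | a.1 = k ∧ ∃ γ ∈ l, a.2 ∈ γ.support} φ) :
  bl (listIso k l K ψ) (listIso k l K' φ) = l.foldl (fun ρ γ => γ.sup K K' ρ) (bl ψ φ) := by
  induction l generalizing ψ φ with
  | nil => rfl
  | cons γ l ih =>
    rw [List.foldl_cons, ← bl_gateIso hψ hφ (fun i hi => ⟨rfl, γ, List.mem_cons_self, hi⟩)]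
    have h1 : {a : Fin (d + 1) × Fin g | a.1 = k ∧ ∃ γ ∈ l, a.2 ∈ γ.support} ⊆ {a | a.1 = k ∧ ∃ γ' ∈ γ :: l, a.2 ∈ γ'.support} :=
      fun a ⟨ha, γ', h, h'⟩ => ⟨ha, γ', List.mem_cons_of_mem _ h, h'⟩
    have h2 : ∀ i ∈ γ.support, (k, i) ∉ {a : Fin (d + 1) × Fin g | a.1 = k ∧ ∃ γ ∈ l, a.2 ∈ γ.support} := by
      rintro i hi ⟨-, γ', h, h'⟩; exact Finset.disjoint_left.1 ((List.pairwise_cons.1 hl).1 γ' h) hi h'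
    exact ih (List.pairwise_cons.1 hl).2 ((hψ.mono h1).gateIso h2 K) ((hφ.mono h1).gateIso h2 K')

theorem sum_card_support_le (hl : Apart l) : (l.map fun γ => γ.support.card).sum ≤ g := by
  have h1 : ∀ l : List (QGate n g), Apart l → ∃ s : Finset (Fin g),
      s.card = (l.map fun γ => γ.support.card).sum ∧ ∀ i, i ∈ s ↔ ∃ γ ∈ l, i ∈ γ.support := by
    intro l hl
    induction l with
    | nil => exact ⟨∅, by simp⟩
    | cons γ l ih =>
      obtain ⟨s, hs, hs'⟩ := ih (List.pairwise_cons.1 hl).2; refine ⟨γ.support ∪ s, ?_, fun i => ?_⟩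
      · rw [Finset.card_union_of_disjoint, hs, List.map_cons, List.sum_cons]; rw [Finset.disjoint_left]; intro i hi his
        obtain ⟨γ', h, h'⟩ := (hs' i).1 his; exact Finset.disjoint_left.1 ((List.pairwise_cons.1 hl).1 γ' h) hi h'
      · simp [hs']
  obtain ⟨s, hs, -⟩ := h1 l hl
  rw [← hs]
  exact (Finset.card_le_univ s).trans (le_of_eq (card_fin g))

theorem card_support_pos (γ : QGate n g) : 1 ≤ γ.support.card := by
  rcases γ with (_ | _ | _ | _) | _ | _ <;> simp [QGate.support, CGate.support]
  omega

theorem length_le (hl : Apart l) : l.length ≤ g := by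
  refine le_trans ?_ (sum_card_support_le hl)
  have := List.card_nsmul_le_sum (l.map fun γ => γ.support.card) 1 (by
    intro x hx; obtain ⟨γ, -, rfl⟩ := List.mem_map.1 hx
    exact card_support_pos γ)
  simpa using this

/-- A query gate occupies `2 * n + 4 + 2 * n` wires, and different gates occupy different wires. -/
theorem card_listReads_le (hl : Apart l) (z : Bits g) : (listReads l z).card * (4 * n + 4) ≤ g := by
  refine le_trans ?_ (sum_card_support_le hl)
  refine (Nat.mul_le_mul_right _ (List.toFinset_card_le _)).trans ?_
  rw [List.length_flatMap, ← List.sum_map_mul_right]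
  refine List.sum_le_sum fun γ _ => ?_
  rcases γ with (_ | _ | _ | _) | _ | _ <;>
    simp [QGate.support, CGate.support, QGate.reads, CGate.reads]
  omega

/-- The gates of layer `k`; the layers from `d` on are empty. -/
def gatesOf (L : Fin d → QLayer n g) (k : ℕ) : List (QGate n g) :=
  if h : k < d then (L ⟨k, h⟩).gates else []

theorem apart_gatesOf (L : Fin d → QLayer n g) (k : ℕ) : Apart (gatesOf L k) := by
  unfold gatesOf
  split_ifs with h
  · exact (L ⟨k, h⟩).disjoint
  · exact List.Pairwise.nil

/-- The layers of a quantum tier as unitary maps. -/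
def layOf (L : Fin d → QLayer n g) (k : ℕ) : QLay n (Bits g × Env d g) where
  U := listIso (Fin.ofNat (d + 1) k) (gatesOf L k)
  rd ω := listReads (gatesOf L k) ω.1
  comm := ((apart_gatesOf L k).respects _).1
  loc := ((apart_gatesOf L k).respects _).2

theorem ofNat_val (hk : k ≤ d) : ((Fin.ofNat (d + 1) k : Fin (d + 1)) : ℕ) = k := Nat.mod_eq_of_lt (by omega)

theorem Clean.layOf (hk : k ≤ d) {ψ : Vec (Bits g × Env d g)} (h : Clean (later d g k) ψ) (O : Oracle n) :
  Clean (later d g (k + 1)) ((layOf L k).U O ψ) := by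
  refine Clean.listIso (fun i hi => ?_) _ O (h.mono fun a (ha : k + 1 ≤ a.1) => ?_)
  · have : k + 1 ≤ ((Fin.ofNat (d + 1) k : Fin (d + 1)) : ℕ) := hi; rw [ofNat_val hk] at this; omega
  · exact (le_succ k).trans ha

/-- The action of a list of gates on operators. -/
def supList (K K' : Oracle n) (l : List (QGate n g)) (ρ : Op g) : Op g := l.foldl (fun ρ γ => γ.sup K K' ρ) ρ

theorem bl_layOf (hk : k ≤ d) {ψ φ : Vec (Bits g × Env d g)} (hψ : Clean (later d g k) ψ) (hφ : Clean (later d g k) φ) (K K' : Oracle n) :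
  bl ((layOf L k).U K ψ) ((layOf L k).U K' φ) = supList K K' (gatesOf L k) (bl ψ φ) := by
  have h1 : {a : Fin (d + 1) × Fin g | a.1 = Fin.ofNat (d + 1) k ∧ ∃ γ ∈ gatesOf L k, a.2 ∈ γ.support} ⊆ later d g k := by
    rintro a ⟨ha, -⟩; change k ≤ (a.1 : ℕ); rw [ha, ofNat_val hk]
  exact (apart_gatesOf L k).bl_listIso K K' (hψ.mono h1) (hφ.mono h1)

/-- The basis state `z` with ancillas that are zero. -/
def basisState (d : ℕ) (z : Bits g) : Vec (Bits g × Env d g) := EuclideanSpace.single (z, fun _ => false) 1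

theorem norm_basisState (z : Bits g) : ‖basisState d z‖ = 1 := by simp [basisState]

theorem clean_basisState (c : Set (Fin (d + 1) × Fin g)) (z : Bits g) : Clean c (basisState d z) := by
  intro y e h a _
  by_contra h1
  refine h ?_
  rw [basisState, PiLp.single_apply, if_neg]
  intro h2
  rw [Prod.ext_iff] at h2
  exact h1 (congrFun h2.2 a)

theorem bl_basisState (z : Bits g) : bl (basisState d z) (basisState d z) = Matrix.single z z (1 : ℂ) := by
  ext y y'
  simp only [bl, basisState, of_apply, PiLp.single_apply, Prod.mk.injEq]
  rw [sum_eq_single (fun _ => false)]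
  · rw [Matrix.single_apply]; by_cases h : y = z <;> by_cases h' : y' = z <;> simp [h, h', Ne.symm]
  · grind
  · simp

theorem clean_evo (Os : ℕ → Oracle n) (z : Bits g) (hk : k ≤ d) : Clean (later d g k) (evo (layOf L) Os k (basisState d z)) := by
  induction k with
  | zero => exact clean_basisState _ z
  | succ k ih => exact (ih (by omega)).layOf (by omega) (Os k)

/-- Each layer has fresh ancillas for its resets, so tracing them out at the end reproduces the
density matrix of the tier layer by layer. -/
theorem prob_quantum {c : ℕ} (L : Fin d → QLayer n g) (K : Oracle n) (z y : Bits g) :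
  (Tier.quantum (c := c) L).prob K z y = outP (real (layOf L) K (basisState d z) d) y := by
  have h1 : ∀ k ≤ d, bl (real (layOf L) K (basisState d z) k) (real (layOf L) K (basisState d z) k) =
      ((List.range k).map (gatesOf L)).foldl (fun ρ l => supList K K l ρ) (Matrix.single z z (1 : ℂ)) := by
    intro k hk
    induction k with
    | zero => exact bl_basisState z
    | succ k ih =>
      have h3 : Clean (later d g k) (real (layOf L) K (basisState d z) k) := clean_evo _ z (by omega)
      rw [real_succ, bl_layOf (by omega) h3 h3, ih (by omega), List.range_succ, List.map_append, List.foldl_append]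
      rfl
  have h2 : ∀ (ρ : Op g), (List.ofFn L).foldl (fun s l => l.apply K s) ρ =
      ((List.range d).map (gatesOf L)).foldl (fun ρ l => supList K K l ρ) ρ := by
    intro ρ
    have h3 : (List.range d).map (gatesOf L) = (List.ofFn L).map QLayer.gates := by
      refine List.ext_getElem (by simp) fun i h h' => ?_
      simp only [List.length_map, List.length_range] at h; simp [gatesOf, h]
    rw [h3, List.foldl_map]
    have h4 : (fun (s : Op g) (l : QLayer n g) => l.apply K s) = fun s l => supList K K l.gates s := by
      funext s l; unfold QLayer.apply supList; simp only [QGate.apply_eq_sup]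
    rw [h4]
  change ((List.ofFn L).foldl (fun s l => l.apply K s) (Matrix.single z z (1 : ℂ)) y y).re = _
  rw [h2, ← h1 d le_rfl, ← outP_eq_bl, Complex.ofReal_re]

end

/-! ### The simulation of a quantum tier in integers -/

section
variable {n d g : ℕ}

/-- The action of a list of gates on operators with integer entries, up to a factor. -/
def isupList (K K' : Oracle n) (l : List (QGate n g)) (B : Matrix (Bits g) (Bits g) GaussianInt) : Matrix (Bits g) (Bits g) GaussianInt :=
  l.foldl (fun B γ => γ.isup K K' B) B

/-- The number of Hadamard gates in the first layers. -/
def roots (L : Fin d → QLayer n g) (k : ℕ) : ℕ := ∑ j ∈ range k, ((gatesOf L j).map QGate.root).sum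

theorem roots_succ (L : Fin d → QLayer n g) (k : ℕ) : roots L (k + 1) = roots L k + ((gatesOf L k).map QGate.root).sum := sum_range_succ _ _

theorem QGate.sup_smul (K K' : Oracle n) (γ : QGate n g) (a : ℂ) (ρ : Op g) : γ.sup K K' (a • ρ) = a • γ.sup K K' ρ := by
  by_cases hγ : ∀ i, γ ≠ .classical (.reset i)
  · rw [QGate.sup_eq γ hγ, QGate.sup_eq γ hγ, Matrix.mul_smul, Matrix.smul_mul]
  · push Not at hγ
    obtain ⟨i, rfl⟩ := hγ; ext y y'; rw [Matrix.smul_apply, QGate.sup_reset_apply, QGate.sup_reset_apply]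
    split_ifs <;> simp [mul_add]

theorem supList_smul (K K' : Oracle n) (l : List (QGate n g)) (a : ℂ) (ρ : Op g) : supList K K' l (a • ρ) = a • supList K K' l ρ := by
  induction l generalizing ρ with
  | nil => rfl
  | cons γ l ih =>
    unfold supList at ih ⊢; rw [List.foldl_cons, QGate.sup_smul, ih]; rfl

theorem toComplex_isupList (K K' : Oracle n) (l : List (QGate n g)) (B : Matrix (Bits g) (Bits g) GaussianInt) :
  (isupList K K' l B).map GaussianInt.toComplex = (2 : ℂ) ^ (l.map QGate.root).sum • supList K K' l (B.map GaussianInt.toComplex) := by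
  induction l generalizing B with
  | nil => simp [isupList, supList]
  | cons γ l ih =>
    have h1 : isupList K K' (γ :: l) B = isupList K K' l (γ.isup K K' B) := rfl
    have h2 : ∀ ρ, supList K K' (γ :: l) ρ = supList K K' l (γ.sup K K' ρ) := fun _ => rfl
    rw [h1, ih, γ.toComplex_isup, supList_smul, smul_smul, h2, List.map_cons, List.sum_cons, pow_add, mul_comm]

theorem roots_le (L : Fin d → QLayer n g) : roots L d ≤ g * d := by
  unfold roots
  refine (Finset.sum_le_card_nsmul _ _ g fun j _ => ?_).trans (by grind)
  refine le_trans ?_ (length_le (apart_gatesOf L j))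
  have h1 : ∀ l : List (QGate n g), (l.map QGate.root).sum ≤ l.length := by
    intro l
    induction l with
    | nil => simp
    | cons γ l ih =>
      have : γ.root ≤ 1 := by
        unfold QGate.root
        split <;> omega
      simp only [List.map_cons, List.sum_cons, length_cons]; omega
  exact h1 _

/-- The density matrix of the simulation with the oracles `Os`, up to a factor. -/
def iB (L : Fin d → QLayer n g) (Os : ℕ → Oracle n) (z : Bits g) : ℕ → Matrix (Bits g) (Bits g) GaussianInt
  -- The initial power of two supplies the factors that missing Hadamard gates would have
  -- contributed. After `d` layers the common denominator is `2 ^ (g * d)` for every circuit.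
  | 0 => Matrix.single z z (2 ^ (g * d - roots L d))
  | k + 1 => isupList (Os k) (Os k) (gatesOf L k) (iB L Os z k)

/-- The first-order change of the density matrix, if the ket sees the oracles `Os''` and `Os'` when
it starts to differ and afterwards. -/
def iC (L : Fin d → QLayer n g) (Os Os' Os'' : ℕ → Oracle n) (z : Bits g) : ℕ → Matrix (Bits g) (Bits g) GaussianInt
  | 0 => 0
  | k + 1 => isupList (Os' k) (Os k) (gatesOf L k) (iC L Os Os' Os'' z k) +
    (isupList (Os'' k) (Os k) (gatesOf L k) (iB L Os z k) - isupList (Os k) (Os k) (gatesOf L k) (iB L Os z k))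

/-- The oracles of the simulation, and those that reveal also the string `x`. -/
def revO (K : Oracle n) (S : Finset (Str n)) (x : Str n) (k : ℕ) : Oracle n := mask K (insert x (ball K S k))

variable (L : Fin d → QLayer n g) (K : Oracle n) (S : Finset (Str n)) (z : Bits g)

variable {k : ℕ}

theorem toComplex_iB (hk : k ≤ d) : (iB L (simO K S) z k).map GaussianInt.toComplex = (2 : ℂ) ^ (g * d - roots L d + roots L k) •
    bl (phi (layOf L) K S (basisState d z) k) (phi (layOf L) K S (basisState d z) k) := by
  induction k with
  | zero =>
    ext y y'
    change GaussianInt.toComplex (Matrix.single z z _ y y') =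
      ((2 : ℂ) ^ (g * d - roots L d + roots L 0)) • bl (basisState d z) (basisState d z) y y'
    rw [bl_basisState, Matrix.single_apply, Matrix.single_apply]; split_ifs
    · rw [map_pow, map_ofNat, smul_eq_mul, mul_one]; rfl
    · simp
  | succ k ih =>
    have h3 : Clean (later d g k) (phi (layOf L) K S (basisState d z) k) := clean_evo _ z (by omega)
    rw [iB, toComplex_isupList, ih (by omega), phi_succ, bl_layOf (by omega) h3 h3, supList_smul, smul_smul, roots_succ, ← pow_add]
    congr 2; omega

theorem clean_dd (x : Str n) (hk : k ≤ d) : Clean (later d g k) (dd (layOf L) K S (basisState d z) x k) := by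
  induction k with
  | zero => exact fun y e h => absurd rfl h
  | succ k ih =>
    have h3 : Clean (later d g k) (phi (layOf L) K S (basisState d z) k) := clean_evo _ z (by omega)
    exact ((ih (by omega)).layOf (by omega) _).add ((h3.layOf (by omega) _).sub (h3.layOf (by omega) _))

/-- The recursion of `iC` copies that of `dd` on the side of the ket, while the bra follows the
simulated state. -/
theorem toComplex_iC (x : Str n) (hk : k ≤ d) : (iC L (simO K S) (simO K (insert x S)) (revO K S x) z k).map GaussianInt.toComplex =
    (2 : ℂ) ^ (g * d - roots L d + roots L k) •
    bl (dd (layOf L) K S (basisState d z) x k) (phi (layOf L) K S (basisState d z) k) := by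
  induction k with
  | zero =>
    ext y y'; simp [iC, dd, bl]
  | succ k ih =>
    have h3 : Clean (later d g k) (phi (layOf L) K S (basisState d z) k) := clean_evo _ z (by omega)
    have h4 := clean_dd L K S z x (k := k) (by omega)
    rw [iC, Matrix.map_add _ (map_add _), Matrix.map_sub _ (map_sub _), toComplex_isupList,
      toComplex_isupList, toComplex_isupList, ih (by omega), toComplex_iB L K S z (by omega), phi_succ,
      dd, bl_add, bl_sub, bl_layOf (by omega) h4 h3, bl_layOf (by omega) h3 h3,
      bl_layOf (by omega) h3 h3]
    simp only [supList_smul, smul_smul, smul_add, smul_sub]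
    have h5 : g * d - roots L d + roots L (k + 1) = ((gatesOf L k).map QGate.root).sum + (g * d - roots L d + roots L k) := by
      rw [roots_succ]; omega
    rw [h5, pow_add _ ((gatesOf L k).map QGate.root).sum]; rfl

/-- The integer weights of the outcomes of the simulation of a quantum tier. -/
def qwt (z' : Bits g) : ℕ := (iB L (simO K S) z d z' z').re.toNat

/-- The integer corrections of the weights. -/
def qcr (Y : Finset (Str n)) (z' : Bits g) : ℤ := ∑ x ∈ Y, 2 * (iC L (simO K S) (simO K (insert x S)) (revO K S x) z d z' z').re

theorem iB_re (z' : Bits g) : ((iB L (simO K S) z d z' z').re : ℝ) = 2 ^ (g * d) * outP (phi (layOf L) K S (basisState d z) d) z' := by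
  have h1 := congrFun (congrFun (toComplex_iB L K S z le_rfl) z') z'
  rw [Matrix.map_apply, Matrix.smul_apply, ← outP_eq_bl, Nat.sub_add_cancel (roots_le L)] at h1
  have h2 := congrArg Complex.re h1
  rw [← GaussianInt.intCast_re, smul_eq_mul] at h2
  rw [h2]
  norm_cast

/-- The simulated probabilities are exact multiples of `2 ^ (-(g * d))` and are sampled without
rounding from `g * d` fair bits. -/
theorem qwt_div (z' : Bits g) : (qwt L K S z z' : ℝ) / (2 ^ (g * d) : ℕ) = outP (phi (layOf L) K S (basisState d z) d) z' := by
  have h1 := iB_re L K S z z'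
  have h2 : 0 ≤ (iB L (simO K S) z d z' z').re := by
    have h3 : (0 : ℝ) ≤ ((iB L (simO K S) z d z' z').re : ℝ) := by
      rw [h1]
      exact mul_nonneg (by positivity) (outP_nonneg _ _)
    exact_mod_cast h3
  have h4 : (qwt L K S z z' : ℝ) = ((iB L (simO K S) z d z' z').re : ℝ) := by
    unfold qwt; exact_mod_cast congrArg (Int.cast) (Int.toNat_of_nonneg h2)
  rw [h4, h1]
  push_cast
  rw [mul_div_cancel_left₀ _ (by positivity)]

theorem qcr_div (Y : Finset (Str n)) (z' : Bits g) : (qcr L K S z Y z' : ℝ) / (2 ^ (g * d) : ℕ) =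
    outD (phi (layOf L) K S (basisState d z) d) (∑ x ∈ Y, dd (layOf L) K S (basisState d z) x d) z' := by
  rw [outD_sum, qcr]
  push_cast
  rw [sum_div]
  refine sum_congr rfl fun x _ => ?_
  have h1 := congrFun (congrFun (toComplex_iC L K S z x le_rfl) z') z'
  rw [Matrix.map_apply, Matrix.smul_apply, Nat.sub_add_cancel (roots_le L)] at h1
  have h2 := congrArg Complex.re h1
  rw [← GaussianInt.intCast_re, smul_eq_mul] at h2
  have h3 : ((2 : ℂ) ^ (g * d)) = (((2 : ℝ) ^ (g * d) : ℝ) : ℂ) := by push_cast; rfl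
  rw [h3, Complex.re_ofReal_mul] at h2
  rw [h2, outD_eq_bl]
  field_simp

variable {L K S z}

/-- Cauchy–Schwarz for the factorisation of a difference of squares. -/
theorem sum_abs_outP_sub_sq_le {Z E : Type*} [Fintype Z] [Fintype E] (ψ φ : Vec (Z × E)) (hψ : ‖ψ‖ ≤ 1) (hφ : ‖φ‖ ≤ 1) :
  (∑ z, |outP ψ z - outP φ z|) ^ 2 ≤ 4 * ‖ψ - φ‖ ^ 2 := by
  have h1 : ∑ z, |outP ψ z - outP φ z| ≤ ∑ ω, ‖(ψ - φ) ω‖ * (‖ψ ω‖ + ‖φ ω‖) := by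
    rw [sum_prod_type]; refine sum_le_sum fun z _ => ?_; unfold outP; rw [← sum_sub_distrib]
    refine (abs_sum_le_sum_abs _ _).trans (sum_le_sum fun e _ => ?_)
    have h2 : ‖ψ (z, e)‖ ^ 2 - ‖φ (z, e)‖ ^ 2 = (‖ψ (z, e)‖ - ‖φ (z, e)‖) * (‖ψ (z, e)‖ + ‖φ (z, e)‖) := by ring
    rw [h2, abs_mul, abs_of_nonneg (add_nonneg (norm_nonneg (ψ (z, e))) (norm_nonneg (φ (z, e))))]
    exact mul_le_mul_of_nonneg_right (abs_norm_sub_norm_le _ _) (by positivity)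
  have h3 : (∑ ω, ‖(ψ - φ) ω‖ * (‖ψ ω‖ + ‖φ ω‖)) ^ 2 ≤
      (∑ ω, ‖(ψ - φ) ω‖ ^ 2) * ∑ ω, (‖ψ ω‖ + ‖φ ω‖) ^ 2 := Finset.sum_mul_sq_le_sq_mul_sq _ _ _
  have h4 : ∑ ω, (‖ψ ω‖ + ‖φ ω‖) ^ 2 ≤ 4 := by
    calc ∑ ω, (‖ψ ω‖ + ‖φ ω‖) ^ 2 ≤ ∑ ω, (2 * ‖ψ ω‖ ^ 2 + 2 * ‖φ ω‖ ^ 2) := sum_le_sum fun ω _ => by nlinarith [sq_nonneg (‖ψ ω‖ - ‖φ ω‖)]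
      _ = 2 * ‖ψ‖ ^ 2 + 2 * ‖φ‖ ^ 2 := by rw [sum_add_distrib, ← mul_sum, ← mul_sum, norm_sq_eq, norm_sq_eq]
      _ ≤ 4 := by nlinarith [norm_nonneg ψ, norm_nonneg φ]
  rw [← norm_sq_eq] at h3
  have h5 : 0 ≤ ∑ z, |outP ψ z - outP φ z| := sum_nonneg fun _ _ => abs_nonneg _
  calc (∑ z, |outP ψ z - outP φ z|) ^ 2 ≤ (∑ ω, ‖(ψ - φ) ω‖ * (‖ψ ω‖ + ‖φ ω‖)) ^ 2 := pow_le_pow_left₀ h5 h1 2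
    _ ≤ _ := h3.trans (by nlinarith [sq_nonneg ‖ψ - φ‖])

theorem qwt_congr {K' : Oracle n} (h : Agree K K' (ball K S d)) : qwt L K' S z = qwt L K S z := by
  have h1 : ∀ k ≤ d, iB L (simO K' S) z k = iB L (simO K S) z k := by
    intro k hk
    induction k with
    | zero => rw [iB, iB]
    | succ k ih => rw [iB, iB, ih (by omega), h.simO_eq (by omega)]
  funext z'
  unfold qwt
  rw [h1 d le_rfl]

/-- A quantum tier and its simulation. -/
def qTier (c : ℕ) (L : Fin d → QLayer n g) : STier n (Bits g) (2 ^ (g * d)) where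
  known K S _ := ball K S d
  wt K S z := qwt L K S z
  cr K S z := qcr L K S z
  prob K := (Tier.quantum (c := c) L).prob K
  dev K S z := ‖real (layOf L) K (basisState d z) d - phi (layOf L) K S (basisState d z) d‖ ^ 2
  sum_wt K S z := by
    have h1 : ((∑ z', qwt L K S z z' : ℕ) : ℝ) / (2 ^ (g * d) : ℕ) = 1 := by
      push_cast; rw [sum_div]; have h2 := qwt_div L K S z; push_cast at h2; simp only [h2]
      rw [sum_outP, norm_phi, norm_basisState, one_pow]
    rw [div_eq_one_iff_eq (by positivity)] at h1
    exact_mod_cast h1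
  loc K K' S z h := ⟨h.ball_eq le_rfl, qwt_congr h⟩
  subset_known K S _ := subset_ball d
  prob_nonneg K z z' := by rw [prob_quantum]; exact outP_nonneg _ _
  sum_prob K z := by simp only [prob_quantum]; rw [sum_outP, norm_real, norm_basisState, one_pow]
  dev_nonneg K S z := by positivity
  sum_abs_mul_le K S z A hA _ := by
    simp only [prob_quantum, qwt_div]; set ψ := real (layOf L) K (basisState d z) d; set φ := phi (layOf L) K S (basisState d z) d
    have h1 : ψ = φ + (ψ - φ) := by abel
    -- One of the three error terms comes from `abs_outD_mul_le`, the other two from the quadratic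
    -- part and `A z' ≤ 2`.
    have h2 : ∀ z', |outP ψ z' - outP φ z'| * A z' ≤ outP φ z' * A z' ^ 2 + 3 * outP (ψ - φ) z' := by
      intro z'; have h3 := abs_outD_mul_le φ (ψ - φ) z' (hA z'); have h4 := outP_nonneg (ψ - φ) z'
      have h5 : outP ψ z' - outP φ z' = outD φ (ψ - φ) z' + outP (ψ - φ) z' := by
        conv_lhs => rw [h1, outP_add]
        ring
      rw [h5]
      have h6 : |outD φ (ψ - φ) z' + outP (ψ - φ) z'| ≤ |outD φ (ψ - φ) z'| + outP (ψ - φ) z' :=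
        (abs_add_le _ _).trans (by rw [abs_of_nonneg h4])
      have h7 := mul_le_mul_of_nonneg_right h6 (hA z')
      have h8 : outP (ψ - φ) z' * A z' ≤ outP (ψ - φ) z' * 2 := mul_le_mul_of_nonneg_left (by solve_by_elim) h4
      linarith
    refine (sum_le_sum fun z' _ => h2 z').trans (le_of_eq ?_); rw [sum_add_distrib, ← mul_sum, sum_outP]
  sum_abs_sq_le K S z := by
    simp only [prob_quantum, qwt_div]; refine sum_abs_outP_sub_sq_le _ _ ?_ ?_
    · rw [norm_real, norm_basisState]
    · rw [norm_phi, norm_basisState]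

/-! ### The simulation of a classical tier -/

/-- A classical gate, with the strings that are known afterwards. -/
def cstep (K : Oracle n) (σ : Bits g × Finset (Str n)) (γ : CGate n g) : Bits g × Finset (Str n) :=
  -- The valid answers for all colours are recorded, not only the one that was asked for. Agreement
  -- of two oracles on the known strings then determines every answer that the gate may have used.
  (γ.apply K σ.1, σ.2 ∪ grow K (γ.reads σ.1).toFinset)

/-- A list of classical gates, with the strings that are known afterwards. -/
def crun (K : Oracle n) (l : List (CGate n g)) (σ : Bits g × Finset (Str n)) : Bits g × Finset (Str n) := l.foldl (cstep K) σ

theorem subset_crun (K : Oracle n) (l : List (CGate n g)) (σ : Bits g × Finset (Str n)) : σ.2 ⊆ (crun K l σ).2 := by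
  induction l generalizing σ with
  | nil => exact subset_rfl
  | cons γ l ih => exact subset_union_left.trans (ih (cstep K σ γ))

theorem crun_fst (K : Oracle n) (l : List (CGate n g)) (σ : Bits g × Finset (Str n)) :
  (crun K l σ).1 = l.foldl (fun s γ => γ.apply K s) σ.1 := by
  induction l generalizing σ with
  | nil => rfl
  | cons γ l ih => exact ih (cstep K σ γ)

theorem crun_congr {K K' : Oracle n} (l : List (CGate n g)) (σ : Bits g × Finset (Str n))
  (h : Agree K K' (crun K l σ).2) : crun K' l σ = crun K l σ := by
  induction l generalizing σ with
  | nil => rfl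
  | cons γ l ih =>
    have h1 : Agree K K' (ball K (γ.reads σ.1).toFinset 1) := h.mono (Finset.subset_union_right.trans (subset_crun K l (cstep K σ γ)))
    have h2 : ∀ x ∈ (γ.reads σ.1).toFinset, ∀ c, K' x c = K x c := fun x hx c => h1.answer Nat.zero_lt_one hx c
    have h3 : cstep K' σ γ = cstep K σ γ := by
      unfold cstep; rw [γ.apply_congr σ.1 fun x hx c => (h2 x (List.mem_toFinset.2 hx) c), grow_congr h2]
    change crun K' l (cstep K' σ γ) = crun K l (cstep K σ γ); rw [h3]; exact ih _ h

/-- The number of queries of a list of classical gates. -/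
def countQ (l : List (CGate n g)) : ℕ := l.countP CGate.isQuery

/-- A query adds at most a ball of radius one around one string, and `3 * 2 = 6`. -/
theorem card_crun_le {K : Oracle n} (hK : Tame K) (l : List (CGate n g))
  (σ : Bits g × Finset (Str n)) : (crun K l σ).2.card ≤ σ.2.card + 6 * countQ l := by
  induction l generalizing σ with
  | nil => exact le_rfl
  | cons γ l ih =>
    refine (ih (cstep K σ γ)).trans ?_
    have h1 : (cstep K σ γ).2.card ≤ σ.2.card + (ball K (γ.reads σ.1).toFinset 1).card := Finset.card_union_le _ _
    have h2 := hK.card_ball (γ.reads σ.1).toFinset 1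
    have h3 : (γ.reads σ.1).toFinset.card ≤ if γ.isQuery then 1 else 0 := by cases γ <;> simp [CGate.reads, CGate.isQuery]
    unfold countQ; rw [List.countP_cons]; omega

/-- The gates of a classical tier. -/
def tierGates {c : ℕ} (L : Fin c → CLayer n g) : List (CGate n g) := (List.ofFn L).flatMap CLayer.gates

theorem foldl_tierGates {c : ℕ} (L : Fin c → CLayer n g) (K : Oracle n) (z : Bits g) :
  (List.ofFn L).foldl (fun s l => l.apply K s) z = (tierGates L).foldl (fun s γ => γ.apply K s) z := by
  unfold tierGates
  rw [List.foldl_flatMap]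
  rfl

theorem cTier_prob_sub {q c D : ℕ} (hD : 0 < D) (L : Fin c → CLayer n g) (K : Oracle n)
  (S : Finset (Str n)) (z z' : Bits g) : (Tier.classical (q := q) L).prob K z z' -
      ((if z' = (crun K (tierGates L) (z, S)).1 then D else 0 : ℕ) : ℝ) / D = 0 := by
  have h1 : (D : ℝ) ≠ 0 := by positivity
  have h2 : (crun K (tierGates L) (z, S)).1 = (List.ofFn L).foldl (fun s l => l.apply K s) z := by rw [crun_fst, foldl_tierGates]
  rw [h2]
  change (if z' = _ then (1 : ℝ) else 0) - _ = 0
  split_ifs <;> simp [h1]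

/-- A classical tier and its simulation. -/
def cTier (q : ℕ) {c D : ℕ} (hD : 0 < D) (L : Fin c → CLayer n g) : STier n (Bits g) D where
  known K S z := (crun K (tierGates L) (z, S)).2
  wt K S z z' := if z' = (crun K (tierGates L) (z, S)).1 then D else 0
  cr _ _ _ _ _ := 0
  prob K := (Tier.classical (q := q) L).prob K
  dev _ _ _ := 0
  sum_wt K S z := by simp
  loc K K' S z h := by rw [crun_congr _ _ h]; exact ⟨rfl, rfl⟩
  subset_known K S z := subset_crun K (tierGates L) (z, S)
  prob_nonneg K z z' := by change 0 ≤ (if z' = _ then (1 : ℝ) else 0); split_ifs <;> simp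
  sum_prob K z := by simp [Tier.prob]
  dev_nonneg _ _ _ := le_rfl
  sum_abs_mul_le K S z A hA hA' := by
    rw [mul_zero, add_zero]; refine sum_le_sum fun z' _ => ?_; rw [cTier_prob_sub hD, abs_zero, zero_mul]; positivity
  sum_abs_sq_le K S z := by
    refine le_of_eq ?_; rw [mul_zero, sum_eq_zero, zero_pow two_ne_zero]; intro z' _; rw [cTier_prob_sub hD, abs_zero]

end

/-! ### The average errors of the simulated tiers -/

section
variable {n d g : ℕ}

/-- The largest number of query gates in a layer. -/
def capQ (n g : ℕ) : ℕ := g / (4 * n + 4)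

theorem card_rd_le (L : Fin d → QLayer n g) (k : ℕ) (ω : Bits g × Env d g) : ((layOf L k).rd ω).card ≤ capQ n g :=
  (Nat.le_div_iff_mul_le (by omega)).2 (card_listReads_le (apart_gatesOf L k) ω.1)

/-- The simulation before a quantum tier, as a state. -/
def Pre.start (p : Pre n (Bits g)) (d : ℕ) : Start n (Bits g × Env d g) where
  S K := (p.st K).2
  ψ K := basisState d (p.st K).1
  loc K K' h := by rw [p.loc K K' h]; exact ⟨rfl, rfl⟩
  zero_mem := p.zero_mem
  norm_le K := (norm_basisState _).le

/-- The rest of the computation, as a function of the state after a quantum tier. -/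
def Post.cont {c : ℕ} {L : Fin d → QLayer n g} {p : Pre n (Bits g)} (q : Post (qTier c L) p) : Cont (p.start d) d where
  Q K ω := q.Q K ω.1
  f K ω := q.f K ω.1
  loc K K' ω h := q.loc K K' ω.1 h
  sub K ω := q.sub K ω.1
  bound K ω e := q.bound K ω.1 e

/-- The average squared error of a simulated quantum tier. -/
def devBound (n d g : ℕ) : ℝ := 4 * d ^ 2 * capQ n g * luck n * card (Vertex n)

/-- The error from strings that are not near the touched strings. -/
def farBound (n d g M : ℕ) : ℝ := 2 * (card (Vertex n) * (d * luck n * (13 * capQ n g + 36 * 2 ^ d * M + 144 * d ^ 2 * 2 ^ d * capQ n g)) +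
    3 * 2 ^ d * ((2 ^ n)⁻¹ + 2 ^ n * (4 * d ^ 2 * capQ n g * luck n)))

/-- The error of a simulated quantum tier, with corrections. -/
def mainBound (n d g s M : ℕ) : ℝ := farBound n d g M + 2 * ((2 ^ n)⁻¹ * (6 * 2 ^ d * M) +
    2 ^ n * (64 * d ^ 4 * capQ n g ^ 2 * luck n ^ 2 * card (Vertex n) ^ 2)) +
  2 * (2 ^ s * (6 * 2 ^ d * M * devBound n d g)) + 2 * devBound n d g

/-- The error of a simulated quantum tier that is the last one. -/
def lastBound (n d g M : ℕ) : ℝ := farBound n d g (3 * 2 ^ d * M) + 2 * ((2 ^ n)⁻¹ * (3 * 2 ^ (2 * d + 1) * M) +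
    2 ^ n * (4 * d ^ 2 * capQ n g * luck n * (3 * 2 ^ (2 * d + 1) * M))) + 2 * devBound n d g

theorem devBound_nonneg (hl : 0 ≤ luck n) : 0 ≤ devBound n d g := by unfold devBound; positivity

theorem farBound_nonneg (hl : 0 ≤ luck n) (M : ℕ) : 0 ≤ farBound n d g M := by unfold farBound; positivity

theorem mainBound_nonneg (hl : 0 ≤ luck n) (s M : ℕ) : 0 ≤ mainBound n d g s M := by
  have h1 := devBound_nonneg (d := d) (g := g) hl
  have h2 := farBound_nonneg (d := d) (g := g) hl M
  unfold mainBound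
  positivity

variable {T : WeldedTree n} {χ : EdgeColouring T.graph}

theorem abs_average_le_of_forall {f : Labelling n → ℝ} {a : ℝ} {f' : Labelling n → ℝ}
  (h : ∀ ℓ, |f ℓ| ≤ f' ℓ) (h' : average f' ≤ a) : |average f| ≤ a :=
  (abs_average_le f).trans ((average_mono h).trans h')

theorem er_qTier {c : ℕ} (L : Fin d → QLayer n g) (p : Pre n (Bits g)) (K : Oracle n)
  (z' : Bits g) : (qTier c L).er K (p.st K) z' = outD ((p.start d).ph (layOf L) K d)
      ((p.start d).re (layOf L) K d - (p.start d).ph (layOf L) K d) z' +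
    outP ((p.start d).re (layOf L) K d - (p.start d).ph (layOf L) K d) z' := by
  have h1 : (qTier c L).er K (p.st K) z' = outP ((p.start d).re (layOf L) K d) z' - outP ((p.start d).ph (layOf L) K d) z' :=
    congrArg₂ (fun a b : ℝ => a - b) (prob_quantum (c := c) L K _ _) (qwt_div L K _ _ z')
  rw [h1]
  have h2 := outP_add ((p.start d).ph (layOf L) K d) ((p.start d).re (layOf L) K d - (p.start d).ph (layOf L) K d) z'
  rw [add_sub_cancel] at h2
  rw [h2]
  ring

theorem average_outP_mul_le (hl : 0 ≤ luck n) (L : Fin d → QLayer n g) (p : Pre n (Bits g))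
  {f : Labelling n → Bits g → ℝ} (hf : ∀ ℓ z, |f ℓ z| ≤ 2) :
  |average fun ℓ => ∑ z', outP ((p.start d).re (layOf L) 𝔎 d - (p.start d).ph (layOf L) 𝔎 d) z' * f ℓ z'| ≤ 2 * devBound n d g := by
  have h1 := Start.average_real_sub_ph_sq_le (p := p.start d) (T := T) (χ := χ) (card_rd_le L) hl ∅ d
  refine abs_average_le_of_forall (f' := fun ℓ => 2 * ‖(p.start d).re (layOf L) 𝔎 d - (p.start d).ph (layOf L) 𝔎 d‖ ^ 2) (fun ℓ => ?_) ?_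
  · rw [← sum_outP, mul_sum]; refine (abs_sum_le_sum_abs _ _).trans (sum_le_sum fun z' _ => ?_)
    rw [abs_mul, abs_of_nonneg (outP_nonneg _ _), mul_comm]; exact mul_le_mul_of_nonneg_right (hf ℓ z') (outP_nonneg _ _)
  · rw [average_mul_left]; exact mul_le_mul_of_nonneg_left h1 zero_le_two

/-- The error of a probability is `outD + outP`. The three estimates concern `outD` minus the
unclipped correction, the effect of clipping, and the quadratic part. -/
theorem qTier_bounded (hl : 0 ≤ luck n) (c s M : ℕ) (L : Fin d → QLayer n g) :
  (qTier c L).Bounded T χ d M (2 ^ s)⁻¹ (mainBound n d g s M) (devBound n d g) where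
  dev_le p := Start.average_real_sub_ph_sq_le (p := p.start d) (card_rd_le L) hl ∅ d
  main p q hM := by
    have hM' : ∀ K ω, Tame K → (q.cont.Q K ω).card ≤ M := fun K ω hK => hM K ω.1 hK
    have h1 := Cont.average_first_order_le (q := q.cont) (lay := layOf L) (T := T) (χ := χ)
      (card_rd_le L) hl hM' (fun K z e e' => ⟨rfl, rfl⟩) (fun _ => false)
    have h2 := Cont.average_clip_error_le (q := q.cont) (lay := layOf L) (T := T) (χ := χ)
      (card_rd_le L) hl hM' (fun _ => false) (t := (2 ^ s)⁻¹) (by positivity)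
    have h3 := average_outP_mul_le (T := T) (χ := χ) hl L p (f := fun ℓ z' => q.f 𝔎 z' (ℓ.1 (exit n))) fun ℓ z' => q.bound _ _ _
    rw [inv_inv] at h2
    refine le_trans (le_of_eq ?_) (((abs_add_le _ _).trans (add_le_add ((abs_add_le _ _).trans
      (add_le_add h1 h2)) h3)).trans (le_of_eq rfl))
    rw [← average_add, ← average_add]; congr 2; funext ℓ; rw [← sum_add_distrib, ← sum_add_distrib]
    refine sum_congr rfl fun z' _ => ?_; rw [er_qTier]
    have h4 : (((qTier c L).cr 𝔎 (p.st 𝔎).2 (p.st 𝔎).1 (ball 𝔎 (q.Q 𝔎 z') (d + 1)) z' : ℤ) : ℝ) / (2 ^ (g * d) : ℕ) =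
        (p.start d).corr (layOf L) 𝔎 d (ball 𝔎 (q.cont.Q 𝔎 (z', fun _ => false)) (d + 1)) z' :=
      qcr_div L _ _ _ _ z'
    have h5 : (qTier c L).sp 𝔎 (p.st 𝔎) z' = outP ((p.start d).ph (layOf L) 𝔎 d) z' := qwt_div L _ _ _ z'; rw [h4, h5]
    have h6 : q.cont.f 𝔎 (z', fun _ => false) (ℓ.1 (exit n)) = q.f 𝔎 z' (ℓ.1 (exit n)) := rfl; rw [h6]; ring

/-- Without later tiers only the ball of radius `d` is touched, whatever the outcome. The near
vertices lie within `d + (d + 1)` steps of the strings known before the tier, and `average_near_le`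
controls just these, so that the weight `2 ^ n` does no harm. -/
theorem qTier_lastBounded (hl : 0 ≤ luck n) (c M : ℕ) (L : Fin d → QLayer n g) : (qTier c L).LastBounded T χ M (lastBound n d g M) := by
  classical
  intro p f hM hf
  have hf2 : ∀ z x, |f z x| ≤ 2 := fun z x => (hf z x).trans (by norm_num)
  set q : Cont (p.start d) d :=
    { Q := fun K _ => ball K (p.st K).2 d
      f := fun _ ω => f ω.1
      loc := fun K K' ω h => ⟨by
        rw [p.loc K K' (h.mono (subset_ball d))]
        exact h.ball_eq le_rfl, rfl⟩
      sub := fun _ _ => subset_rfl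
      bound := fun _ ω e => hf2 ω.1 e } with hq
  have hM' : ∀ K ω, Tame K → (q.Q K ω).card ≤ 3 * 2 ^ d * M := fun K ω hK =>
    (hK.card_ball _ _).trans (Nat.mul_le_mul_left _ (hM K hK))
  have h1 := Cont.sum_far_le (q := q) (lay := layOf L) (T := T) (χ := χ) (card_rd_le L) hl hM'
  have h2 := Start.average_near_le (p := p.start d) (T := T) (χ := χ) (card_rd_le L) hl hM (2 * d + 1) d
  have h3 := average_outP_mul_le (T := T) (χ := χ) hl L p (f := fun ℓ z' => f z' (ℓ.1 (exit n))) fun ℓ z' => hf2 _ _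
  set nr : Labelling n → Vertex n → Prop := fun ℓ v =>
    ℓ.1 v ∈ ball 𝔎 ((p.start d).S 𝔎) (2 * d + 1) with hnr
  set near : Labelling n → ℝ := fun ℓ => ∑ v ∈ univ.filter (nr ℓ), ∑ z', f z' (ℓ.1 (exit n)) * outD ((p.start d).ph (layOf L) 𝔎 d)
      ((p.start d).del (layOf L) 𝔎 (ℓ.1 v) d) z' with hnear
  have h4 : |average near| ≤ 2 * ((2 ^ n)⁻¹ * (3 * 2 ^ (2 * d + 1) * M) +
      2 ^ n * (4 * d ^ 2 * capQ n g * luck n * (3 * 2 ^ (2 * d + 1) * M))) := by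
    refine abs_average_le_of_forall (f' := fun ℓ => 2 * ((2 ^ n)⁻¹ * (3 * 2 ^ (2 * d + 1) * M) +
      2 ^ n * ∑ v, if nr ℓ v then ‖(p.start d).del (layOf L) 𝔎 (ℓ.1 v) d‖ ^ 2 else 0))
      (fun ℓ => ?_) ?_
    · have h5 : ∀ v, |∑ z', f z' (ℓ.1 (exit n)) * outD ((p.start d).ph (layOf L) 𝔎 d)
          ((p.start d).del (layOf L) 𝔎 (ℓ.1 v) d) z'| ≤ 2 * ((2 ^ n)⁻¹ +
          2 ^ n * ‖(p.start d).del (layOf L) 𝔎 (ℓ.1 v) d‖ ^ 2) := by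
        intro v; refine (abs_sum_le_sum_abs _ _).trans ?_
        calc _ ≤ ∑ z', 2 * ((2 ^ n)⁻¹ * outP ((p.start d).ph (layOf L) 𝔎 d) z' +
              2 ^ n * outP ((p.start d).del (layOf L) 𝔎 (ℓ.1 v) d) z') := by
              refine sum_le_sum fun z' _ => ?_; rw [abs_mul]
              have := abs_outD_le ((p.start d).ph (layOf L) 𝔎 d) ((p.start d).del (layOf L) 𝔎 (ℓ.1 v) d) z'
                (t := ((2 : ℝ) ^ n)⁻¹) (by positivity)
              rw [inv_inv] at this; exact mul_le_mul (hf2 _ _) this (abs_nonneg _) zero_le_two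
          _ ≤ _ := by
              rw [← mul_sum, sum_add_distrib, ← mul_sum, ← mul_sum, sum_outP, sum_outP]
              refine mul_le_mul_of_nonneg_left (add_le_add_left ?_ _) zero_le_two
              exact mul_le_of_le_one_right (by positivity) (Start.norm_ph_sq_le _ _)
      have h6 : ((univ.filter (nr ℓ)).card : ℝ) ≤ 3 * 2 ^ (2 * d + 1) * M := by
        have h7 := Cont.card_filter_label_le ℓ (ball 𝔎 ((p.start d).S 𝔎) (2 * d + 1))
        have h8 := (tame_hid (T := T) (χ := χ) (ℓ := ℓ) (H := ∅)).card_ball ((p.start d).S 𝔎) (2 * d + 1)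
        have h9 := Nat.mul_le_mul_left (3 * 2 ^ (2 * d + 1)) (hM 𝔎 tame_hid); exact_mod_cast h7.trans (h8.trans h9)
      refine (abs_sum_le_sum_abs _ _).trans ((sum_le_sum fun v _ => h5 v).trans ?_)
      rw [← mul_sum, sum_add_distrib, sum_const, nsmul_eq_mul, ← mul_sum, sum_filter, mul_comm _ ((2 : ℝ) ^ n)⁻¹]; gcongr
    · rw [average_mul_left, average_add, average_mul_left ((2 : ℝ) ^ n)]
      refine mul_le_mul_of_nonneg_left (add_le_add (average_const_le (by positivity))
        (mul_le_mul_of_nonneg_left ?_ (pow_nonneg zero_le_two n))) zero_le_two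
      push_cast at h2; exact h2
  refine le_trans (le_of_eq ?_) (((abs_add_le _ _).trans (add_le_add ((abs_add_le _ _).trans (add_le_add h1 h4)) h3)).trans (le_of_eq ?_))
  · rw [← average_add, ← average_add]; congr 2; funext ℓ
    simp only [Cont.inner_test_eq (lay := layOf L) q (fun K z e e' => ⟨rfl, rfl⟩) (fun _ => false)]
    simp only [er_qTier, add_mul, sum_add_distrib]; congr 1
    have h7 : ∀ v, (ℓ.1 v ∈ ball 𝔎 (ball 𝔎 (p.st 𝔎).2 d) (d + 1) ↔ nr ℓ v) := by
      intro v
      rw [ball_add, show d + (d + 1) = 2 * d + 1 by ring]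
      rfl
    rw [Start.re_eq, hnear]; simp only [hq, h7, outD_sum, sum_mul]; rw [sum_comm, sum_filter, ← sum_add_distrib]
    refine sum_congr rfl fun v _ => ?_; split_ifs
    · rw [sum_const_zero, zero_add]; exact sum_congr rfl fun z' _ => mul_comm _ _
    · grind
  · unfold lastBound farBound; push_cast; ring

theorem er_cTier {q c D : ℕ} (hD : 0 < D) (L : Fin c → CLayer n g) (K : Oracle n)
  (σ : State n (Bits g)) (z' : Bits g) : (cTier q hD L).er K σ z' = 0 :=
  cTier_prob_sub (q := q) hD L K σ.2 σ.1 z'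

theorem average_zero : average (fun _ : Labelling n => (0 : ℝ)) = 0 := by simp [average]

theorem cTier_bounded {q c D : ℕ} (hD : 0 < D) (L : Fin c → CLayer n g) {M : ℕ} {th e1 e2 : ℝ}
  (hth : 0 ≤ th) (p1 : 0 ≤ e1) (p2 : 0 ≤ e2) : (cTier q hD L).Bounded T χ d M th e1 e2 where
  dev_le p := average_zero.le.trans p2
  main p r hM := by
    refine le_trans (le_of_eq ?_) p1; rw [abs_eq_zero, ← average_zero]; congr 1; funext ℓ
    refine sum_eq_zero fun z' _ => ?_; rw [er_cTier hD]
    have h1 : (cTier q hD L).cr 𝔎 (p.st 𝔎).2 (p.st 𝔎).1 (ball 𝔎 (r.Q 𝔎 z') (d + 1)) z' = 0 := rfl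
    have h2 := mul_nonneg hth ((cTier q hD L).sp_nonneg (K := 𝔎) (p.st 𝔎) z')
    rw [h1, Int.cast_zero, zero_div, clip, min_eq_right h2, max_eq_right (neg_nonpos.2 h2), sub_zero, zero_mul]

theorem cTier_lastBounded {q c D : ℕ} (hD : 0 < D) (L : Fin c → CLayer n g) {M : ℕ} {e : ℝ}
  (he : 0 ≤ e) : (cTier q hD L).LastBounded T χ M e := by
  intro p f _ _
  simp only [er_cTier, zero_mul, sum_const_zero, average_zero, abs_zero]
  exact he

/-! ### Hybrid circuits -/

variable {η c : ℕ}

/-- The simulation of a tier. -/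
def simTier : Tier n g c d → STier n (Bits g) (2 ^ (g * d))
  | .classical L => cTier d (by positivity) L
  | .quantum L => qTier c L

/-- The simulations of the tiers of a circuit; the tiers from `η` on are empty. -/
def simTiers (C : HybridCircuit n η c d g) (i : ℕ) : STier n (Bits g) (2 ^ (g * d)) :=
  if h : i < η then simTier (C.tier ⟨i, h⟩) else cTier d (by positivity) Fin.elim0

theorem simTier_prob (t : Tier n g c d) : (simTier t).prob = fun K => t.prob K := by cases t <;> rfl

/-- Pushing distributions forward is dual to pulling functionals back. -/
theorem foldl_prob (F : Bits g → ℝ) (K : Oracle n) (l : List (Tier n g c d)) (P : Bits g → ℝ) :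
  ∑ y, l.foldl (fun P t y => ∑ z, P z * t.prob K z y) P y * F y = ∑ z, P z * l.foldr (fun t V z => ∑ z', t.prob K z z' * V z') F z := by
  induction l generalizing P with
  | nil => rfl
  | cons t l ih =>
    rw [List.foldl_cons, ih, List.foldr_cons]; simp only [sum_mul, mul_sum]; rw [sum_comm]
    exact sum_congr rfl fun z _ => sum_congr rfl fun z' _ => mul_assoc _ _ _

theorem sum_prob_mul (C : HybridCircuit n η c d g) (K : Oracle n) (x : Bits n) (F : Bits g → ℝ) :
  ∑ y, C.prob K x y * F y = vr (simTiers C) K F η 0 (padInput g x) := by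
  have h1 : ∀ k i, i + k = η → ((List.ofFn C.tier).drop i).foldr (fun t V z => ∑ z', t.prob K z z' * V z') F = vr (simTiers C) K F k i := by
    intro k
    induction k with
    | zero =>
      intro i hi
      rw [List.drop_of_length_le (by simp; omega)]
      rfl
    | succ k ih =>
      intro i hi
      have h2 : i < (List.ofFn C.tier).length := by simp; omega
      rw [List.drop_eq_getElem_cons h2, List.foldr_cons, ih (i + 1) (by omega)]
      funext z
      rw [vr, simTiers, dif_pos (by omega), simTier_prob, List.getElem_ofFn]
  have h2 := h1 η 0 (zero_add η)
  rw [List.drop_zero] at h2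
  unfold HybridCircuit.prob
  rw [foldl_prob, h2]
  simp

end

/-! ### Straight-line programs and their translation to gates -/

section
variable {n : ℕ} {W : Type} (o : W → Oracle n)

/-- From the Boolean functions in `S`, those in `S'` are computed with `q` queries and `t` steps. -/
inductive Reach (S : Set (W → Bool)) : ℕ → ℕ → Set (W → Bool) → Prop
  | refl : Reach S 0 0 S
  | nand {q t S'} (f f' : W → Bool) : Reach S q t S' → f ∈ S' → f' ∈ S' → Reach S q (t + 1) (insert (fun w => !(f w && f' w)) S')
  | query {q t S'} (s : W → Str n) (c : W → Bits 4) : Reach S q t S' → (∀ j, (fun w => s w j) ∈ S') → (∀ j, (fun w => c w j) ∈ S') →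
      Reach S (q + 1) (t + 1) (S' ∪ Set.range fun j w => o w (s w) (c w) j)

variable {o} {wd : ℕ}

/-- The effect of a list of gates. -/
def gatesApply (K : Oracle n) (l : List (CGate n wd)) (z : Bits wd) : Bits wd := l.foldl (fun z γ => γ.apply K z) z

theorem gatesApply_append (K : Oracle n) (l l' : List (CGate n wd)) (z : Bits wd) :
  gatesApply K (l ++ l') z = gatesApply K l' (gatesApply K l z) := List.foldl_append

theorem gatesApply_not (K : Oracle n) (a : Fin wd) {z : Bits wd} (h : z a = false) : gatesApply K [.not a] z = update z a true := by
  change update z a (!z a) = _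
  rw [h]
  rfl

/-- Gates that add the conjunction of two wires to a third wire. -/
def andGate (a b c : Fin wd) : List (CGate n wd) :=
  if h : Function.Injective ![a, b, c] then [.toffoli ⟨![a, b, c], h⟩] else []

theorem andGate_apply (K : Oracle n) {a b c : Fin wd} (hab : a ≠ b) (hac : a ≠ c) (hbc : b ≠ c) (z : Bits wd) :
  gatesApply K (andGate a b c) z = update z c (xor (z c) (z a && z b)) := by
  have h : Function.Injective ![a, b, c] := by
    intro i j hij
    fin_cases i <;> fin_cases j <;> simp_all
  unfold andGate
  rw [dif_pos h]
  rfl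

theorem countP_andGate (a b c : Fin wd) : (andGate (n := n) a b c).countP CGate.isQuery = 0 ∧ (andGate (n := n) a b c).length ≤ 1 := by
  unfold andGate
  split_ifs <;> simp [CGate.isQuery]

/-- Gates that copy wires to clean wires, where the wire `a` holds `1`. -/
def copyGates {ι : Type} (a : Fin wd) (src dst : ι → Fin wd) (J : List ι) : List (CGate n wd) :=
  J.flatMap fun j => andGate a (src j) (dst j)

theorem countP_copyGates {ι : Type} (a : Fin wd) (src dst : ι → Fin wd) (J : List ι) :
  (copyGates (n := n) a src dst J).countP CGate.isQuery = 0 ∧ (copyGates (n := n) a src dst J).length ≤ J.length := by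
  induction J with
  | nil => simp [copyGates]
  | cons j J ih =>
    have h1 : copyGates (n := n) a src dst (j :: J) = andGate a (src j) (dst j) ++ copyGates a src dst J := rfl
    have h2 := countP_andGate (n := n) a (src j) (dst j); rw [h1, countP_append, length_append, length_cons]; omega

theorem copyGates_apply {ι : Type} (K : Oracle n) {a : Fin wd} {src dst : ι → Fin wd}
  (hdst : Function.Injective dst) (hs : ∀ j j', src j ≠ dst j') (ha : ∀ j, a ≠ dst j)
  (has : ∀ j, a ≠ src j) (J : List ι) (hJ : J.Nodup) (z : Bits wd) (hz : z a = true)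
  (hc : ∀ j ∈ J, z (dst j) = false) :
  (∀ j ∈ J, gatesApply K (copyGates a src dst J) z (dst j) = z (src j)) ∧
  ∀ i, (∀ j, dst j ≠ i) → gatesApply K (copyGates a src dst J) z i = z i := by
  suffices h : (∀ j ∈ J, gatesApply K (copyGates a src dst J) z (dst j) = z (src j)) ∧
      ∀ i, (∀ j ∈ J, dst j ≠ i) → gatesApply K (copyGates a src dst J) z i = z i from
    ⟨h.1, fun i hi => h.2 i fun j _ => hi j⟩
  induction J generalizing z with
  | nil => exact ⟨fun j hj => absurd hj (by simp), fun i _ => rfl⟩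
  | cons j J ih =>
    rw [List.nodup_cons] at hJ
    have h1 : gatesApply K (copyGates a src dst (j :: J)) z = gatesApply K (copyGates a src dst J) (update z (dst j) (z (src j))) := by
      have h2 : copyGates (n := n) a src dst (j :: J) = andGate a (src j) (dst j) ++ copyGates a src dst J := rfl
      rw [h2, gatesApply_append, andGate_apply K (has j) (ha j) (hs j j), hz, hc j List.mem_cons_self]; simp
    obtain ⟨h3, h4⟩ := ih hJ.2 (update z (dst j) (z (src j))) (by rw [update_of_ne (ha j), hz]) (fun j' hj' => by grind)
    rw [h1]; refine ⟨fun j' hj' => ?_, fun i hi => ?_⟩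
    · grind
    · grind

/-- The gates `l` produce the functions in `S` on the first `u` wires and keep the others clean. -/
def Layout (o : W → Oracle n) (st : W → Bits wd) (l : List (CGate n wd)) (u : ℕ) (S : Set (W → Bool)) : Prop :=
  (∀ w i, u ≤ i.1 → gatesApply (o w) l (st w) i = false) ∧ ∀ f ∈ S, ∃ i : Fin wd, i.1 < u ∧ ∀ w, gatesApply (o w) l (st w) i = f w

variable {st : W → Bits wd} {l : List (CGate n wd)} {S : Set (W → Bool)} {u : ℕ}

theorem Layout.mono {u u' : ℕ}
  (h : Layout o st l u S) (hu : u ≤ u') : Layout o st l u' S :=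
  ⟨fun w i hi => h.1 w i (hu.trans hi), fun f hf => by
    obtain ⟨i, hi, hi'⟩ := h.2 f hf
    exact ⟨i, hi.trans_le hu, hi'⟩⟩

/-- Three fresh wires are used: `a` is set to one and controls the copying of `f'` to `b`; `c` is
set to one and flipped by the conjunction. The copy ensures that the Toffoli gate acts on distinct
wires even if both functions sit on the same wire. -/
theorem Layout.nand
  (h : Layout o st l u S) (hu : u + 3 ≤ wd) {f f' : W → Bool} (hf : f ∈ S) (hf' : f' ∈ S) :
  ∃ l' : List (CGate n wd), l'.countP CGate.isQuery = 0 ∧ l'.length ≤ 4 ∧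
    Layout o st (l ++ l') (u + 3) (insert (fun w => !(f w && f' w)) S) := by
  obtain ⟨i, hi, hi'⟩ := h.2 f hf
  obtain ⟨j, hj, hj'⟩ := h.2 f' hf'
  set a : Fin wd := ⟨u, by omega⟩ with ha
  set b : Fin wd := ⟨u + 1, by omega⟩ with hb
  set c : Fin wd := ⟨u + 2, by omega⟩ with hc
  have e1 : a ≠ j := by rw [ne_eq, Fin.ext_iff, ha]; dsimp only; omega
  have e2 : a ≠ b := by rw [ne_eq, Fin.ext_iff, ha, hb]; dsimp only; omega
  have e3 : j ≠ b := by rw [ne_eq, Fin.ext_iff, hb]; dsimp only; omega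
  have e4 : i ≠ b := by rw [ne_eq, Fin.ext_iff, hb]; dsimp only; omega
  have e5 : i ≠ c := by rw [ne_eq, Fin.ext_iff, hc]; dsimp only; omega
  have e6 : b ≠ c := by rw [ne_eq, Fin.ext_iff, hb, hc]; dsimp only; omega
  have e7 : i ≠ a := by rw [ne_eq, Fin.ext_iff, ha]; dsimp only; omega
  have e8 : a ≠ c := by rw [ne_eq, Fin.ext_iff, ha, hc]; dsimp only; omega
  have e9 : j ≠ c := by rw [ne_eq, Fin.ext_iff, hc]; dsimp only; omega
  have key : ∀ w, gatesApply (o w) (l ++ ([.not a, .not c] ++ (andGate a j b ++ andGate i b c)))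
      (st w) = update (update (update (gatesApply (o w) l (st w)) a true) b (f' w)) c (!(f w && f' w)) := by
    intro w
    have ha0 := h.1 w a (by rw [ha])
    have hb0 := h.1 w b (by rw [hb]; dsimp only; omega)
    have hc0 := h.1 w c (by rw [hc]; dsimp only; omega)
    rw [gatesApply_append, gatesApply_append, gatesApply_append, andGate_apply _ e1 e2 e3, andGate_apply _ e4 e5 e6]
    have h1 : gatesApply (o w) [.not a, .not c] (gatesApply (o w) l (st w)) =
        update (update (gatesApply (o w) l (st w)) a true) c true := by
      change gatesApply (o w) [.not c] (gatesApply (o w) [.not a] _) = _; rw [gatesApply_not _ _ ha0, gatesApply_not]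
      rw [update_of_ne e8.symm, hc0]
    rw [h1]; funext k; by_cases hk : k = c
    · subst hk; simp [e6.symm, e6, e4, e5, e7, e8, e9, e1.symm, e2, e2.symm, hi' w, hj' w, hb0]
    · grind
  refine ⟨[.not a, .not c] ++ (andGate a j b ++ andGate i b c), ?_, ?_, fun w k hk => ?_, fun f0 hf0 => ?_⟩
  · rw [countP_append, countP_append, (countP_andGate a j b).1, (countP_andGate i b c).1]; rfl
  · have h1 := (countP_andGate (n := n) a j b).2; have h2 := (countP_andGate (n := n) i b c).2
    simp only [length_append, length_cons, List.length_nil]; omega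
  · rw [key, update_of_ne, update_of_ne, update_of_ne, h.1 w k (by omega)] <;> rw [ne_eq, Fin.ext_iff] <;> simp only [ha, hb, hc] <;> omega
  · rcases hf0 with rfl | hf0
    · exact ⟨c, by rw [hc]; dsimp only; omega, fun w => by rw [key, update_self]⟩
    · obtain ⟨k, hk, hk'⟩ := h.2 f0 hf0
      refine ⟨k, by omega, fun w => ?_⟩
      rw [key, update_of_ne, update_of_ne, update_of_ne, hk' w] <;>
        rw [ne_eq, Fin.ext_iff] <;> simp only [ha, hb, hc] <;> omega

/-- The number of a wire of a query gate. -/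
def wireNo : QueryWires n → ℕ := Sum.elim (fun j => j) (Sum.elim (fun j => 2 * n + j) fun j => 2 * n + 4 + j)

theorem wireNo_lt (x : QueryWires n) : wireNo x < 4 * n + 4 := by
  rcases x with j | j | j <;> simp only [wireNo, Sum.elim_inl, Sum.elim_inr] <;> omega

theorem wireNo_injective : Function.Injective (wireNo (n := n)) := by
  rintro (j | j | j) (j' | j' | j') h <;> simp only [wireNo, Sum.elim_inl, Sum.elim_inr] at h <;>
    first
    | (exfalso; omega)
    | (congr; apply Fin.ext; omega)

/-- The fresh wires are one constant for copying and a complete query register of `4 * n + 4` wires,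
whose answer part is clean. -/
theorem Layout.query
  (h : Layout o st l u S) (hu : u + (4 * n + 5) ≤ wd) {s : W → Str n} {c : W → Bits 4}
  (hs : ∀ j, (fun w => s w j) ∈ S) (hc : ∀ j, (fun w => c w j) ∈ S) :
  ∃ l' : List (CGate n wd), l'.countP CGate.isQuery = 1 ∧ l'.length ≤ 2 * n + 6 ∧
    Layout o st (l ++ l') (u + (4 * n + 5)) (S ∪ Set.range fun j w => o w (s w) (c w) j) := by
  choose src1 hs1 hs1' using fun j => h.2 _ (hs j)
  choose src2 hs2 hs2' using fun j => h.2 _ (hc j)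
  set a : Fin wd := ⟨u, by omega⟩ with ha
  have hlt : ∀ x : QueryWires n, u + 1 + wireNo x < wd := fun x => by have := wireNo_lt x; omega
  set e : QueryWires n ↪ Fin wd := ⟨fun x => ⟨u + 1 + wireNo x, hlt x⟩, fun x y hxy => by
    rw [Fin.mk.injEq] at hxy
    exact wireNo_injective (by omega)⟩ with he
  have hev : ∀ x, (e x).1 = u + 1 + wireNo x := fun x => rfl
  set src : Fin (2 * n) ⊕ Fin 4 → Fin wd := Sum.elim src1 src2 with hsrc
  set emb : Fin (2 * n) ⊕ Fin 4 → QueryWires n := Sum.elim Sum.inl fun j => Sum.inr (Sum.inl j) with hemb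
  have hsrcu : ∀ j, (src j).1 < u := by rintro (j | j); exacts [hs1 j, hs2 j]
  have hembi : Function.Injective emb := by rintro (j | j) (j' | j') hj <;> simp_all [emb]
  set J : List (Fin (2 * n) ⊕ Fin 4) := univ.toList with hJ
  have hJl : J.length = 2 * n + 4 := by simp [hJ]
  have key : ∀ w, ∃ z : Bits wd, gatesApply (o w) (l ++ ([.not a] ++ (copyGates a src (fun j => e (emb j)) J ++ [.query e]))) (st w) =
        (CGate.query e).apply (o w) z ∧ (∀ j, z (e (Sum.inl j)) = s w j) ∧
        (∀ j, z (e (Sum.inr (Sum.inl j))) = c w j) ∧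
        (∀ j, z (e (Sum.inr (Sum.inr j))) = false) ∧
        ∀ i, i ≠ a → (∀ x, e x ≠ i) → z i = gatesApply (o w) l (st w) i := by
    intro w; set z1 := gatesApply (o w) [CGate.not a] (gatesApply (o w) l (st w)) with hz1
    have hz1' : z1 = update (gatesApply (o w) l (st w)) a true := by
      exact gatesApply_not _ _ (h.1 w a (by rw [ha]))
    have hne : ∀ x, e x ≠ a := fun x => by rw [ne_eq, Fin.ext_iff, hev, ha]; dsimp only; omega
    have hz₁e : ∀ x, z1 (e x) = false := fun x => by
      rw [hz1', update_of_ne (hne x)]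
      exact h.1 w _ (by rw [hev]; omega)
    have hz₁s : ∀ j, z1 (src j) = gatesApply (o w) l (st w) (src j) := fun j => by
      rw [hz1', update_of_ne]; rw [ne_eq, Fin.ext_iff, ha]; have := hsrcu j; dsimp only; omega
    obtain ⟨h1, h2⟩ := copyGates_apply (o w) (a := a) (src := src) (dst := fun j => e (emb j)) (fun j j' hj => hembi (e.injective hj))
      (fun j j' => by rw [ne_eq, Fin.ext_iff, hev]; have := hsrcu j; omega)
      (fun j => (hne _).symm)
      (fun j => by rw [ne_eq, Fin.ext_iff, ha]; have := hsrcu j; dsimp only; omega)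
      J (nodup_toList _) z1 (by rw [hz1', update_self]) fun j _ => hz₁e _
    refine ⟨gatesApply (o w) (copyGates a src (fun j => e (emb j)) J) z1, ?_, fun j => ?_, fun j => ?_, fun j => ?_, fun i hi hi' => ?_⟩
    · rw [gatesApply_append, gatesApply_append, gatesApply_append]; rfl
    · exact (h1 (Sum.inl j) (by simp [hJ])).trans ((hz₁s _).trans (hs1' j w))
    · exact (h1 (Sum.inr j) (by simp [hJ])).trans ((hz₁s _).trans (hs2' j w))
    · grind
    · rw [h2 i fun j => hi' _, hz1', update_of_ne hi]
  refine ⟨[.not a] ++ (copyGates a src (fun j => e (emb j)) J ++ [.query e]), ?_, ?_, fun w k hk => ?_, fun f0 hf0 => ?_⟩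
  · rw [countP_append, countP_append, (countP_copyGates _ _ _ _).1]; rfl
  · have := (countP_copyGates (n := n) a src (fun j => e (emb j)) J).2
    simp only [length_append, length_cons, List.length_nil]; omega
  · obtain ⟨z, hz, -, -, -, hz'⟩ := key w
    have h1 : ∀ x, e x ≠ k := fun x => by rw [ne_eq, Fin.ext_iff, hev]; have := wireNo_lt x; omega
    rw [hz, CGate.query_apply_of_ne _ _ fun j => h1 _, hz' k ?_ h1, h.1 w k (by omega)]
    rw [ne_eq, Fin.ext_iff, ha]; dsimp only; omega
  · rcases hf0 with hf0 | ⟨j, rfl⟩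
    · obtain ⟨k, hk, hk'⟩ := h.2 f0 hf0
      refine ⟨k, by omega, fun w => ?_⟩
      obtain ⟨z, hz, -, -, -, hz'⟩ := key w
      have h1 : ∀ x, e x ≠ k := fun x => by rw [ne_eq, Fin.ext_iff, hev]; omega
      rw [hz, CGate.query_apply_of_ne _ _ fun j => h1 _, hz' k ?_ h1, hk' w]; rw [ne_eq, Fin.ext_iff, ha]; dsimp only; omega
    · refine ⟨e (Sum.inr (Sum.inr j)), ?_, fun w => ?_⟩
      · rw [hev]; have := wireNo_lt (Sum.inr (Sum.inr j) : QueryWires n); omega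
      · obtain ⟨z, hz, h1, h2, h3, -⟩ := key w; rw [hz, CGate.query_apply, h3, Bool.false_xor]; simp only [h1, h2]

theorem Reach.layout {S S' : Set (W → Bool)} {q t : ℕ} (h : Reach o S q t S') (h0 : Layout o st [] u S) (hu : u + t * (4 * n + 5) ≤ wd) :
  ∃ l : List (CGate n wd), l.countP CGate.isQuery ≤ q ∧ l.length ≤ t * (2 * n + 6) ∧ Layout o st l (u + t * (4 * n + 5)) S' := by
  induction h with
  | refl => exact ⟨[], by simp, by simp, by simpa using h0⟩
  | @nand q t S' f f' _ hf hf' ih =>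
    rw [add_mul, one_mul] at hu
    obtain ⟨l, h1, h2, h3⟩ := ih (by omega)
    obtain ⟨l', h4, h5, h6⟩ := h3.nand (by omega) hf hf'
    refine ⟨l ++ l', ?_, ?_, h6.mono (by rw [add_mul]; omega)⟩
    · grind
    · grind
  | @query q t S' s c _ hs hc ih =>
    rw [add_mul, one_mul] at hu
    obtain ⟨l, h1, h2, h3⟩ := ih (by omega)
    obtain ⟨l', h4, h5, h6⟩ := h3.query (by omega) hs hc
    refine ⟨l ++ l', ?_, ?_, h6.mono (by rw [add_mul]; omega)⟩
    · grind
    · grind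

theorem gatesApply_reset (K : Oracle n) (J : List (Fin wd)) (z : Bits wd) (i : Fin wd) :
  gatesApply K (J.map CGate.reset) z i = if i ∈ J then false else z i := by
  induction J generalizing z with
  | nil => simp [gatesApply]
  | cons j J ih =>
    have h1 : gatesApply K ((j :: J).map CGate.reset) z = gatesApply K (J.map CGate.reset) (update z j false) := rfl
    rw [h1, ih]; by_cases hi : i = j
    · subst hi; simp
    · simp [hi]

/-- The inputs of a program are functions on a set of worlds: an oracle, an input and random bits.
One list of gates serves all worlds, since a program contains no choices that depend on the world.
-/
theorem Reach.exists_algorithm {m g q t : ℕ} {p : Oracle n → Prop} {S' : Set ({K : Oracle n // p K} × Bits n × Bits m → Bool)}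
  (h : Reach (fun w => w.1.1) (Set.range (fun i w => w.2.1 i) ∪ Set.range fun j w => w.2.2 j)
    q t S') {y : {K : Oracle n // p K} × Bits n × Bits m → Bits g}
  (hy : ∀ i, (fun w => y w i) ∈ S') :
  ∃ A : ClassicalAlgorithm n g, A.queries ≤ q ∧ A.time ≤ n + m + 5 * g + 3 + t * (6 * n + 11) ∧
    ∀ (K : {K : Oracle n // p K}) x y0, A.prob K x y0 = (∑ r : Bits m, if y (K, x, r) = y0 then (1 : ℝ) else 0) / 2 ^ m := by
  classical
  set u := n + m + g with hu
  set v := u + t * (4 * n + 5) with hv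
  set wd := v + 1 + g with hwd
  set st : {K : Oracle n // p K} × Bits n × Bits m → Bits wd := fun w i =>
    if h : (i : ℕ) < n then w.2.1 ⟨i, h⟩
    else if h' : (i : ℕ) - n < m then w.2.2 ⟨i - n, h'⟩
    else false with hst
  have h0 : Layout (fun w : {K : Oracle n // p K} × Bits n × Bits m => w.1.1) st [] u
      (Set.range (fun i w => w.2.1 i) ∪ Set.range fun j w => w.2.2 j) := by
    refine ⟨fun w i hi => ?_, ?_⟩
    · change st w i = false; rw [hst]; dsimp only
      rw [dif_neg (by omega), dif_neg (by omega)]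
    · rintro f (⟨i, rfl⟩ | ⟨j, rfl⟩)
      · refine ⟨⟨i, by omega⟩, show i.1 < u by omega, fun w => ?_⟩
        change st w _ = _; rw [hst]; dsimp only; rw [dif_pos i.2]
      · refine ⟨⟨n + j, by omega⟩, show n + j.1 < u by omega, fun w => ?_⟩
        change st w _ = _; rw [hst]; dsimp only
        rw [dif_neg (by omega), dif_pos (by omega)]
        exact congrArg w.2.2 (Fin.ext (Nat.add_sub_cancel_left n j))
  obtain ⟨l, hl1, hl2, hl3⟩ := h.layout h0 (by omega)
  choose src hs hs' using fun i => hl3.2 _ (hy i)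
  set a : Fin wd := ⟨v, by omega⟩ with ha
  set blk : Fin g → Fin wd := fun i => ⟨v + 1 + i, by omega⟩ with hblk
  set fst : Fin g → Fin wd := fun i => ⟨i, by omega⟩ with hfst
  set J : List (Fin g) := univ.toList with hJ
  have hJl : J.length = g := by simp [hJ]
  have hab : ∀ i, a ≠ blk i := fun i => by rw [ne_eq, Fin.ext_iff, ha, hblk]; dsimp only; omega
  have haf : ∀ i, a ≠ fst i := fun i => by rw [ne_eq, Fin.ext_iff, ha, hfst]; dsimp only; omega
  have hbf : ∀ i j, blk i ≠ fst j := fun i j => by rw [ne_eq, Fin.ext_iff, hblk, hfst]; dsimp only; omega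
  have hbi : Function.Injective blk := fun i j hij => by grind
  have hfi : Function.Injective fst := fun i j hij => by grind
  -- The output belongs on the first wires, where inputs or earlier results may be stored. The
  -- results are saved in a block at the end, the first wires are reset, and the results are copied
  -- there.
  set L : List (CGate n wd) := l ++ ([.not a] ++ (copyGates a src blk J ++ ((J.map fst).map CGate.reset ++ copyGates a blk fst J))) with hL
  have key : ∀ w i, gatesApply w.1.1 L (st w) (fst i) = y w i := by
    intro w i; set z0 := gatesApply w.1.1 l (st w) with hz0; set z1 := gatesApply w.1.1 [CGate.not a] z0 with hz1
    have hz1' : z1 = update z0 a true := by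
      exact gatesApply_not _ _ (hl3.1 w a (by rw [ha]))
    obtain ⟨h1, h2⟩ := copyGates_apply w.1.1 (a := a) (src := src) (dst := blk) hbi
      (fun j j' => by rw [ne_eq, Fin.ext_iff, hblk]; have := hs j; dsimp only; omega) hab
      (fun j => by rw [ne_eq, Fin.ext_iff, ha]; have := hs j; dsimp only; omega)
      J (nodup_toList _) z1 (by rw [hz1', update_self]) fun j _ => by
        rw [hz1', update_of_ne (hab j).symm]
        exact hl3.1 w _ (by rw [hblk]; dsimp only; omega)
    set z2 := gatesApply w.1.1 (copyGates a src blk J) z1 with hz2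
    set z3 := gatesApply w.1.1 ((J.map fst).map CGate.reset) z2 with hz3
    have h3 : ∀ i, (∀ j, i ≠ fst j) → z3 i = z2 i := fun i hi => by
      rw [hz3, gatesApply_reset, if_neg]; simp only [List.mem_map, not_exists, not_and]; exact fun j _ hj => hi j hj.symm
    obtain ⟨h4, -⟩ := copyGates_apply w.1.1 hfi hbf haf hab J (nodup_toList _) z3 (by
        rw [h3 a haf, h2 a fun j => (hab j).symm, hz1', update_self]) fun j hj => by
        rw [hz3, gatesApply_reset, if_pos (List.mem_map_of_mem hj)]
    have h5 : gatesApply w.1.1 L (st w) = gatesApply w.1.1 (copyGates a blk fst J) z3 := by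
      rw [hL, gatesApply_append, gatesApply_append, gatesApply_append, gatesApply_append]
    rw [h5, h4 i (by simp [hJ]), h3 _ (hbf i), h1 i (by simp [hJ]), hz1', update_of_ne]
    · exact hs' i w
    rw [ne_eq, Fin.ext_iff, ha]; have := hs i; dsimp only; omega
  refine ⟨⟨m, wd, by omega, by omega, L⟩, ?_, ?_, fun K x y0 => ?_⟩
  · have h1 : ∀ J : List (Fin wd), (J.map (CGate.reset (n := n))).countP CGate.isQuery = 0 := by
      intro J; rw [List.countP_eq_zero]; simp [CGate.isQuery]
    change L.countP _ ≤ q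
    rw [hL, countP_append, countP_append, countP_append, countP_append,
      (countP_copyGates _ _ _ _).1, (countP_copyGates _ _ _ _).1, h1]
    simpa [CGate.isQuery] using hl1
  · have h1 := (countP_copyGates (n := n) a src blk J).2; have h2 := (countP_copyGates (n := n) a blk fst J).2
    change wd + L.length ≤ _
    have h3 : t * (6 * n + 11) = t * (4 * n + 5) + t * (2 * n + 6) := by ring
    rw [hL]; simp only [length_append, length_cons, List.length_nil, List.length_map]; omega
  · unfold ClassicalAlgorithm.prob; congr 1; refine sum_congr rfl fun r _ => ?_
    have h1 : ClassicalAlgorithm.run ⟨m, wd, by omega, by omega, L⟩ K.1 x r = y (K, x, r) :=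
      funext fun i => key (K, x, r) i
    exact if_congr (by rw [h1]) rfl rfl

end

/-! ### Programs of bounded length -/

section
variable {n : ℕ} {W : Type}

theorem Reach.subset {o : W → Oracle n} {S S' : Set (W → Bool)} {q t : ℕ} (h : Reach o S q t S') : S ⊆ S' := by
  induction h with
  | refl => exact subset_rfl
  | nand f f' _ _ _ ih => exact ih.trans (Set.subset_insert _ _)
  | query s c _ _ _ ih => exact ih.trans Set.subset_union_left

theorem Reach.trans {o : W → Oracle n} {S S' S'' : Set (W → Bool)} {q t q' t' : ℕ}
  (h : Reach o S q t S') (h' : Reach o S' q' t' S'') : Reach o S (q + q') (t + t') S'' := by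
  induction h' with
  | refl => exact h
  | nand f f' _ hf hf' ih => exact ih.nand f f' hf hf'
  | query s c _ hs hc ih => exact ih.query s c hs hc

/-- Sets of Boolean functions that contain the constants, for programs with the oracles `o` and
with step counts in powers of `P`. -/
abbrev Stock (_o : W → Oracle n) (_P : ℕ) : Type := {S : Set (W → Bool) // (fun _ => true) ∈ S ∧ (fun _ => false) ∈ S}

variable {g : ℕ} {o : W → Oracle n} {P : ℕ}

/-- The functions in `S'` are computed from those in `S` with `q` queries and `P ^ a` steps. -/
def Steps (S S' : Stock o P) (q a : ℕ) : Prop := ∃ q' ≤ q, ∃ t ≤ P ^ a, Reach o S.1 q' t S'.1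

/-- The property `Q` is obtained from `S` with `q` queries and `P ^ a` steps. -/
def Can (S : Stock o P) (q a : ℕ) (Q : Stock o P → Prop) : Prop := ∃ S', Steps S S' q a ∧ Q S'

open Classical in
/-- The function `f` is available in `S`: there are the Boolean functions that test its values. -/
def Has {α : Type} (S : Stock o P) (f : W → α) : Prop := ∀ a, (fun w => decide (f w = a)) ∈ S.1

/-- The integer `X` is available in two's complement representation with `wd` bits. -/
def HasInt (wd : ℕ) (S : Stock o P) (X : W → ℤ) : Prop := ∀ j < wd, (fun w => (BitVec.ofInt wd (X w)).getLsbD j) ∈ S.1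

/-- A set of strings is available: there are the tests of membership. -/
def HasSet (S : Stock o P) (E : W → Finset (Str n)) : Prop := ∀ x, (fun w => decide (x ∈ E w)) ∈ S.1

/-- An oracle is available: there are all its answers. -/
def HasOr (S : Stock o P) (O : W → Oracle n) : Prop := ∀ x c, Has S fun w => O w x c

/-- A state of a simulation is available. -/
def HasState (S : Stock o P) (σ : W → State n (Bits g)) : Prop := (Has S fun w => (σ w).1) ∧ HasSet S fun w => (σ w).2

/-- A Gaussian integer is available. -/
def HasG (wd : ℕ) (S : Stock o P) (X : W → GaussianInt) : Prop := (HasInt wd S fun w => (X w).re) ∧ HasInt wd S fun w => (X w).im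

/-- The entries of a matrix are available. -/
def HasM (wd : ℕ) (S : Stock o P) (B : W → Matrix (Bits g) (Bits g) GaussianInt) : Prop := ∀ y y', HasG wd S fun w => B w y y'

variable [hP : Fact (16 ≤ P)] {S S' S'' : Stock o P} {q q' a a' b : ℕ}

theorem Steps.le (h : Steps S S' q a) : S ≤ S' := by
  obtain ⟨q', _, t, _, h⟩ := h
  exact h.subset

theorem one_le_pow_room (hP : 16 ≤ P) (a : ℕ) : 1 ≤ P ^ a := Nat.one_le_pow _ _ (by omega)

include hP in
theorem Steps.weaken (h : Steps S S' q a) (hq : q ≤ q' := by omega) (ha : a ≤ a' := by omega) : Steps S S' q' a' := by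
  obtain ⟨q1, hq1, t, ht, h⟩ := h
  exact ⟨q1, hq1.trans hq, t, ht.trans (pow_le_pow_right (by have := hP.out; omega) ha), h⟩

theorem Steps.refl (S : Stock o P) : Steps S S 0 a := ⟨0, le_rfl, 0, Nat.zero_le _, .refl⟩

include hP in
-- Costs are recorded only as exponents of `P`: composition raises the larger exponent by one, and a
-- loop with at most `P ^ b` rounds adds `b`.
theorem add_pow_le {m k : ℕ} (hm : m ≤ P ^ a) (hk : k ≤ P ^ b) : m + k ≤ P ^ (max a b + 1) := by
  have hP := hP.out
  have h1 : P ^ a ≤ P ^ max a b := pow_le_pow_right (by omega) (le_max_left _ _)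
  have h2 : P ^ b ≤ P ^ max a b := pow_le_pow_right (by omega) (le_max_right _ _)
  have h3 : P ^ max a b * 2 ≤ P ^ max a b * P := Nat.mul_le_mul_left _ (by omega)
  rw [pow_succ]
  omega

include hP in
theorem Steps.trans (h : Steps S S' q a) (h' : Steps S' S'' q' b) : Steps S S'' (q + q') (max a b + 1) := by
  obtain ⟨q1, hq1, t1, ht1, p1⟩ := h
  obtain ⟨q2, hq2, t2, ht2, p2⟩ := h'
  exact ⟨q1 + q2, add_le_add hq1 hq2, t1 + t2, add_pow_le ht1 ht2, p1.trans p2⟩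

include hP in
theorem Can.mono {Q Q' : Stock o P → Prop} (h : Can S q a Q) (hq : q ≤ q') (ha : a ≤ a')
  (hQ : ∀ S', S ≤ S' → Q S' → Q' S') : Can S q' a' Q' := by
  obtain ⟨S', r, h⟩ := h
  exact ⟨S', r.weaken hq ha, hQ S' r.le h⟩

theorem Can.weaken {Q : Stock o P → Prop} (h : Can S q a Q) (hq : q ≤ q' := by omega)
    (ha : a ≤ a' := by omega) : Can S q' a' Q := h.mono hq ha fun _ _ h => h

theorem Can.now {Q : Stock o P → Prop} (h : Q S) : Can S 0 a Q := ⟨S, .refl S, h⟩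

theorem Can.loop {I : ℕ → Stock o P → Prop} {m : ℕ} (hm : m ≤ P ^ b) (h0 : I 0 S)
  (h : ∀ k < m, ∀ S', S ≤ S' → I k S' → Can S' q a (I (k + 1))) :
  Can S (m * q) (a + b) (I m) := by
  have key : ∀ k ≤ m, ∃ S', (∃ q' ≤ k * q, ∃ t ≤ k * P ^ a, Reach o S.1 q' t S'.1) ∧ I k S' := by
    intro k hk
    induction k with
    | zero => exact ⟨S, ⟨0, Nat.zero_le _, 0, Nat.zero_le _, .refl⟩, h0⟩
    | succ k ih =>
      obtain ⟨S1, ⟨q1, hq1, t1, ht1, r1⟩, p1⟩ := ih (by omega)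
      obtain ⟨S2, ⟨q2, hq2, t2, ht2, r2⟩, p2⟩ := h k (by omega) S1 r1.subset p1
      refine ⟨S2, ⟨q1 + q2, ?_, t1 + t2, ?_, r1.trans r2⟩, p2⟩ <;> rw [add_mul, one_mul] <;> omega
  obtain ⟨S', ⟨q', hq', t, ht, r⟩, hI⟩ := key m le_rfl
  refine ⟨S', ⟨q', hq', t, ht.trans ?_, r⟩, hI⟩
  rw [pow_add, mul_comm]
  exact Nat.mul_le_mul_left _ hm

theorem Can.forall' {ι : Type} [Fintype ι] (hι : card ι ≤ P ^ b) {Q : ι → Stock o P → Prop} (hQ : ∀ i ⦃S S'⦄, S ≤ S' → Q i S → Q i S')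
  (h : ∀ i, ∀ S', S ≤ S' → Can S' q a (Q i)) :
  Can S (card ι * q) (a + b) fun S' => ∀ i, Q i S' := by
  obtain ⟨S', r, h'⟩ := Can.loop (I := fun k S' => ∀ i, (equivFin ι i).1 < k → Q i S') hι
    (fun i hi => absurd hi (Nat.not_lt_zero _)) (fun k hk S1 hS hI => by
      obtain ⟨S2, r, p2⟩ := h ((equivFin ι).symm ⟨k, hk⟩) S1 hS; refine ⟨S2, r, fun i hi => ?_⟩
      rcases Nat.lt_succ_iff_lt_or_eq.1 hi with hi | hi
      · exact hQ i r.le (hI i hi)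
      · have : i = (equivFin ι).symm ⟨k, hk⟩ := by rw [Equiv.eq_symm_apply]; exact Fin.ext hi
        rw [this]
        exact p2)
  exact ⟨S', r, fun i => h' i (Fin.is_lt _)⟩

theorem Can.forall {ι : Type} [Fintype ι] (hι : card ι ≤ P ^ b) {Q : ι → Stock o P → Prop} (hQ : ∀ i ⦃S S'⦄, S ≤ S' → Q i S → Q i S')
  (h : ∀ i, ∀ S', S ≤ S' → Can S' 0 a (Q i)) :
  Can S 0 (a + b) fun S' => ∀ i, Q i S' := Can.forall' hι hQ h

variable {f f' : W → Bool} {c : ℕ} {X : W → ℤ}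

theorem mem_mono ⦃S S' : Stock o P⦄ (h : S ≤ S') (hf : f ∈ S.1) : f ∈ S'.1 := h hf

theorem Has.mono {α : Type} {f : W → α} ⦃S S' : Stock o P⦄ (h : S ≤ S') (hf : Has S f) : Has S' f := fun a => h (hf a)

theorem Has.const {α : Type} (c : α) : Has S fun _ => c := by
  classical
  intro a
  by_cases h : c = a
  · grind
  · grind

/-! ### Boolean operations -/

theorem can_nand (hf : f ∈ S.1) (hf' : f' ∈ S.1) : Can S 0 0 fun S' => (fun w => !(f w && f' w)) ∈ S'.1 :=
  ⟨⟨_, Set.mem_insert_of_mem _ S.2.1, Set.mem_insert_of_mem _ S.2.2⟩,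
    ⟨0, le_rfl, 1, le_rfl, Reach.refl.nand f f' hf hf'⟩, Set.mem_insert _ _⟩

theorem can_not (hf : f ∈ S.1) : Can S 0 0 fun S' => (fun w => !(f w)) ∈ S'.1 := by
  obtain ⟨S', r, h⟩ := can_nand hf hf
  simp only [Bool.and_self] at h
  exact ⟨S', r, h⟩

theorem can_and (hf : f ∈ S.1) (hf' : f' ∈ S.1) : Can S 0 1 fun S' => (fun w => f w && f' w) ∈ S'.1 := by
  obtain ⟨S1, r1, p1⟩ := can_nand hf hf'
  obtain ⟨S2, r2, p2⟩ := can_not p1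
  simp only [Bool.not_not] at p2
  exact ⟨S2, (r1.trans r2).weaken, p2⟩

theorem can_or (hf : f ∈ S.1) (hf' : f' ∈ S.1) : Can S 0 2 fun S' => (fun w => f w || f' w) ∈ S'.1 := by
  obtain ⟨S1, r1, p1⟩ := can_not hf
  obtain ⟨S2, r2, p2⟩ := can_not (r1.le hf')
  obtain ⟨S3, r3, p3⟩ := can_nand (r2.le p1) p2
  simp only [← Bool.not_or, Bool.not_not] at p3
  exact ⟨S3, ((r1.trans r2).trans r3).weaken, p3⟩

open Classical in
theorem can_exists {ι : Type} [Fintype ι] (hι : card ι ≤ P ^ b) {f : ι → W → Bool} (hf : ∀ i, f i ∈ S.1) :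
  Can S 0 (2 + b) fun S' => (fun w => decide (∃ i, f i w = true)) ∈ S'.1 := by
  obtain ⟨S', r, h⟩ := Can.loop (I := fun k S' =>
    (fun w => decide (∃ i, (equivFin ι i).1 < k ∧ f i w = true)) ∈ S'.1) hι
    (by
      simp only [Nat.not_lt_zero, false_and, exists_false, decide_false]
      exact S.2.2) (fun k hk S1 hS hI => by
      obtain ⟨S2, r, p2⟩ := can_or hI (hS (hf ((equivFin ι).symm ⟨k, hk⟩))); refine ⟨S2, r, ?_⟩; convert p2 using 1
      funext w; rw [Bool.eq_iff_iff, Bool.or_eq_true, decide_eq_true_iff, decide_eq_true_iff]; constructor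
      · rintro ⟨i, hi, hfi⟩; rcases Nat.lt_succ_iff_lt_or_eq.1 hi with hi | hi
        · grind
        · have : i = (equivFin ι).symm ⟨k, hk⟩ := by rw [Equiv.eq_symm_apply]; exact Fin.ext hi
          exact .inr (this ▸ hfi)
      · grind)
  refine ⟨S', r, ?_⟩
  simpa only [Fin.is_lt, true_and] using h

/-- Branching without branches: all values `F a` are computed beforehand, and the one with `s = a`
is selected by a disjunction. -/
theorem can_mux_bool {α : Type} [Fintype α] (hα : card α ≤ P ^ b) {s : W → α} (hs : Has S s) {F : α → W → Bool} (hF : ∀ a, F a ∈ S.1) :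
  Can S 0 (b + 3) fun S' => (fun w => F (s w) w) ∈ S'.1 := by
  classical
  obtain ⟨S1, r1, p1⟩ := Can.forall hα (Q := fun a S' => (fun w => decide (s w = a) && F a w) ∈ S'.1) (fun a => mem_mono)
    fun a S' h => can_and (h (hs a)) (h (hF a))
  obtain ⟨S2, r2, p2⟩ := can_exists hα p1
  refine ⟨S2, (r1.trans r2).weaken, ?_⟩
  convert p2 using 1
  funext w
  rw [Bool.eq_iff_iff, decide_eq_true_iff]
  simp

theorem can_mux {α β : Type} [Fintype α] [Fintype β] (hα : card α ≤ P ^ b) (hβ : card β ≤ P ^ c) {s : W → α} (hs : Has S s) {F : α → W → β}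
  (hF : ∀ a, Has S (F a)) : Can S 0 (b + c + 3) fun S' => Has S' fun w => F (s w) w := by
  classical
  obtain ⟨S1, r1, p1⟩ := Can.forall hβ (Q := fun z S' => (fun w => decide (F (s w) w = z)) ∈ S'.1) (fun a => mem_mono)
    fun z S' h => can_mux_bool (F := fun a w => decide (F a w = z)) hα (hs.mono h) fun a => h (hF a z)
  exact ⟨S1, r1.weaken, p1⟩

theorem can_map {α β : Type} [Fintype α] [Fintype β] (hα : card α ≤ P ^ b) (hβ : card β ≤ P ^ c) (F : α → β) {s : W → α} (hs : Has S s) :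
  Can S 0 (b + c + 3) fun S' => Has S' fun w => F (s w) :=
  can_mux hα hβ hs fun a => Has.const (F a)

theorem can_map₂ {α α' β : Type} [Fintype α] [Fintype α'] [Fintype β] {b' c : ℕ}
  (hα : card α ≤ P ^ b) (hα' : card α' ≤ P ^ b') (hβ : card β ≤ P ^ c)
  (F : α → α' → β) {s : W → α} {s' : W → α'} (hs : Has S s) (hs' : Has S s') :
  Can S 0 (b + b' + c + 4) fun S' => Has S' fun w => F (s w) (s' w) := by
  obtain ⟨S1, r1, p1⟩ := Can.forall hα (Q := fun a S' => Has S' fun w => F a (s' w)) (fun a => Has.mono)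
    fun a S' h => can_map hα' hβ (F a) (hs'.mono h)
  obtain ⟨S2, r2, p2⟩ := can_mux hα hβ (hs.mono r1.le) p1
  exact ⟨S2, (r1.trans r2).weaken, p2⟩

theorem card_bool_le : card Bool ≤ P ^ 1 := by
  have := hP.out
  rw [card_bool, pow_one]
  omega

theorem Has.mem (h : Has S f) : f ∈ S.1 := by
  classical
  have h1 := h true
  simpa using h1

theorem can_has (h : f ∈ S.1) : Can S 0 0 fun S' => Has S' f := by
  classical
  obtain ⟨S', r, h'⟩ := can_not h
  refine ⟨S', r, fun b => ?_⟩
  cases b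
  · simpa using h'
  · simpa using r.le h

theorem can_bool₂ (F : Bool → Bool → Bool) (hf : f ∈ S.1) (hf' : f' ∈ S.1) : Can S 0 9 fun S' => (fun w => F (f w) (f' w)) ∈ S'.1 := by
  obtain ⟨S1, r1, p1⟩ := can_has hf
  obtain ⟨S2, r2, p2⟩ := can_has (r1.le hf')
  obtain ⟨S3, r3, p3⟩ := can_map₂ card_bool_le card_bool_le (card_bool_le) F (p1.mono r2.le) p2
  exact ⟨S3, ((r1.trans r2).trans r3).weaken, p3.mem⟩

theorem can_bool₃ (F : Bool → Bool → Bool → Bool) {f f' f'' : W → Bool} (hf : f ∈ S.1) (hf' : f' ∈ S.1) (hf'' : f'' ∈ S.1) :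
  Can S 0 12 fun S' => (fun w => F (f w) (f' w) (f'' w)) ∈ S'.1 := by
  obtain ⟨S1, r1, p1⟩ := can_has hf
  obtain ⟨S2, r2, p2⟩ := Can.forall (S := S1) (card_bool_le (P := P))
    (Q := fun a S' => (fun w => F a (f' w) (f'' w)) ∈ S'.1) (fun a => mem_mono)
    fun a S' h => can_bool₂ (F a) ((r1.le.trans h) hf') ((r1.le.trans h) hf'')
  obtain ⟨S3, r3, p3⟩ := can_mux_bool (card_bool_le (P := P)) (p1.mono r2.le) p2
  exact ⟨S3, ((r1.trans r2).trans r3).weaken, p3⟩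

theorem can_ofBits {ι : Type} [Fintype ι] [DecidableEq ι] (hι : card ι ≤ P ^ b)
  (hc : card (ι → Bool) ≤ P ^ c) {f : W → ι → Bool} (hf : ∀ i, (fun w => f w i) ∈ S.1) :
  Can S 0 (b + c + 4) fun S' => Has S' f := by
  classical
  obtain ⟨S1, r1, p1⟩ := Can.forall hι (Q := fun i S' => (fun w => !f w i) ∈ S'.1) (fun a => mem_mono) fun i S' h => can_not (h (hf i))
  obtain ⟨S2, r2, p2⟩ := Can.forall (S := S1) hc (a := 2 + b + 1) (Q := fun y S' => (fun w => decide (f w = y)) ∈ S'.1) (fun a => mem_mono)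
    fun y S' h => by
      obtain ⟨S3, r3, p3⟩ := can_exists (S := S') hι (f := fun i w => if y i then !f w i else f w i) fun i => by
          cases y i
          · exact (r1.le.trans h) (hf i)
          · exact h (p1 i)
      obtain ⟨S4, r4, p4⟩ := can_not p3; refine ⟨S4, (r3.trans r4).weaken, ?_⟩; convert p4 using 1; funext w
      rw [← decide_not]; refine decide_eq_decide.2 ⟨?_, fun h => ?_⟩
      · grind
      · grind
  exact ⟨S2, (r1.trans r2).weaken, fun y => by convert p2 y⟩

theorem can_bits {α ι : Type} [Fintype α] [Fintype ι] (hι : card ι ≤ P ^ b)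
  (hα : card α ≤ P ^ c) (F : α → ι → Bool) {f : W → α} (hf : Has S f) :
  Can S 0 (b + c + 3) fun S' => ∀ i, (fun w => F (f w) i) ∈ S'.1 := by
  obtain ⟨S1, r1, p1⟩ := Can.forall hι (Q := fun i S' => (fun w => F (f w) i) ∈ S'.1) (fun i => mem_mono)
    fun i S' h => can_mux_bool (F := fun a _ => F a i) hα (hf.mono h) fun a => by grind
  exact ⟨S1, r1.weaken, p1⟩

/-! ### Integers -/

variable {wd c : ℕ}

theorem HasInt.mono ⦃S S' : Stock o P⦄ (h : S ≤ S') (hX : HasInt wd S X) : HasInt wd S' X := fun j hj => h (hX j hj)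

theorem mem_const (b : Bool) : (fun _ => b) ∈ S.1 := by grind

theorem HasInt.const (x : ℤ) : HasInt wd S fun _ => x := fun _ _ => mem_const _

variable [hwd : Fact (wd ≤ P ^ 4)]

theorem can_mux_int {α : Type} [Fintype α] (hα : card α ≤ P ^ b) {s : W → α} (hs : Has S s) {F : α → W → ℤ} (hF : ∀ a, HasInt wd S (F a)) :
  Can S 0 (b + 7) fun S' => HasInt wd S' fun w => F (s w) w := by
  obtain ⟨S1, r1, p1⟩ := Can.forall (ι := Fin wd) (by rw [card_fin]; exact hwd.out)
    (Q := fun j S' => (fun w => (BitVec.ofInt wd (F (s w) w)).getLsbD j) ∈ S'.1) (fun a => mem_mono)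
    fun j S' h => can_mux_bool (F := fun a w => (BitVec.ofInt wd (F a w)).getLsbD j) hα (hs.mono h) fun a => h (hF a j j.2)
  exact ⟨S1, r1.weaken, fun j hj => p1 ⟨j, hj⟩⟩

theorem can_add {X Y : W → ℤ} (hX : HasInt wd S X) (hY : HasInt wd S Y) : Can S 0 17 fun S' => HasInt wd S' fun w => X w + Y w := by
  obtain ⟨S', r, h⟩ := Can.loop (S := S) (q := 0) (a := 13) (I := fun k S' =>
      (∀ j < k, (fun w => (BitVec.ofInt wd (X w + Y w)).getLsbD j) ∈ S'.1) ∧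
      (fun w => BitVec.carry k (BitVec.ofInt wd (X w)) (BitVec.ofInt wd (Y w)) false) ∈ S'.1)
    hwd.out ⟨fun j hj => absurd hj (Nat.not_lt_zero _), by
      simp only [BitVec.carry_zero]
      exact S.2.2⟩ (fun k hk S1 hS hI => by
      obtain ⟨S2, r2, p2⟩ := can_bool₃ (fun x y c => x ^^ (y ^^ c)) (hS (hX k hk)) (hS (hY k hk)) hI.2
      obtain ⟨S3, r3, p3⟩ := can_bool₃ Bool.atLeastTwo ((hS.trans r2.le) (hX k hk)) ((hS.trans r2.le) (hY k hk)) (r2.le hI.2)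
      refine ⟨S3, (r2.trans r3).weaken, fun j hj => ?_, ?_⟩
      · rcases Nat.lt_succ_iff_lt_or_eq.1 hj with hj | rfl
        · exact (r2.le.trans r3.le) (hI.1 j hj)
        · simp only [BitVec.ofInt_add, BitVec.getLsbD_add hk]; exact r3.le p2
      · simp only [BitVec.carry_succ]
        exact p3)
  exact ⟨S', r, h.1⟩

theorem can_neg (hX : HasInt wd S X) : Can S 0 18 fun S' => HasInt wd S' fun w => -X w := by
  obtain ⟨S1, r1, p1⟩ := Can.forall (ι := Fin wd) (by rw [card_fin]; exact hwd.out)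
    (Q := fun j S' => (fun w => !(BitVec.ofInt wd (X w)).getLsbD j) ∈ S'.1) (fun a => mem_mono)
    fun j S' h => can_not (h (hX j j.2))
  have p2 : HasInt wd S1 fun w => -X w - 1 := by
    intro j hj
    -- In two's complement, complementing all bits of `x` yields `-x - 1`.
    have h3 : ∀ x : ℤ, BitVec.ofInt wd (-x - 1) = ~~~(BitVec.ofInt wd x) := by
      intro x; have h4 := BitVec.neg_eq_not_add (BitVec.ofInt wd x)
      rw [← BitVec.ofInt_neg, show -x = (-x - 1) + 1 by ring, BitVec.ofInt_add] at h4
      exact add_right_cancel h4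
    simp only [h3, BitVec.getLsbD_not, hj, decide_true, Bool.true_and]; exact p1 ⟨j, hj⟩
  obtain ⟨S3, r3, p3⟩ := can_add p2 (HasInt.const 1)
  simp only [sub_add_cancel] at p3
  exact ⟨S3, (r1.trans r3).weaken, p3⟩

theorem can_sub {X Y : W → ℤ} (hX : HasInt wd S X) (hY : HasInt wd S Y) : Can S 0 19 fun S' => HasInt wd S' fun w => X w - Y w := by
  obtain ⟨S1, r1, p1⟩ := can_neg hY
  obtain ⟨S2, r2, p2⟩ := can_add (hX.mono r1.le) p1
  simp only [← sub_eq_add_neg] at p2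
  exact ⟨S2, (r1.trans r2).weaken, p2⟩

theorem can_sum {ι : Type} [Fintype ι] (hι : card ι ≤ P ^ b) {X : ι → W → ℤ}
  (hX : ∀ i, ∀ S', S ≤ S' → Can S' 0 a fun S'' => HasInt wd S'' (X i)) :
  Can S 0 (max a 17 + 1 + b) fun S' => HasInt wd S' fun w => ∑ i, X i w := by
  classical
  obtain ⟨S', r, h⟩ := Can.loop (S := S) (q := 0) (a := max a 17 + 1) (I := fun k S' =>
      HasInt wd S' fun w => ∑ i, if (equivFin ι i).1 < k then X i w else 0) hι
    (by simpa using HasInt.const 0) (fun k hk S1 hS hI => by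
      obtain ⟨S2, r2, p2⟩ := hX ((equivFin ι).symm ⟨k, hk⟩) S1 hS; obtain ⟨S3, r3, p3⟩ := can_add (hI.mono r2.le) p2
      refine ⟨S3, (r2.trans r3).weaken, ?_⟩; convert p3 using 2 with w
      rw [← sum_filter, ← sum_filter, add_comm (Finset.sum _ _),  ← sum_insert (f := fun i => X i w) (by simp)]
      refine sum_congr ?_ fun _ _ => rfl; ext i
      simp only [mem_filter, mem_univ, true_and, mem_insert, Nat.lt_succ_iff_lt_or_eq, Equiv.eq_symm_apply, Fin.ext_iff]
      exact or_comm)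
  exact ⟨S', r, by simpa using h⟩

/-- The top bit is the sign provided that there is no overflow. Intermediate results may overflow,
because arithmetic is modulo `2 ^ wd`; a size bound is needed only where a sign is read. -/
theorem HasInt.mem_neg (hX : HasInt wd S X) {k : ℕ} (hk : k < wd) (h : ∀ w, |X w| < 2 ^ k) : (fun w => decide (X w < 0)) ∈ S.1 := by
  convert hX (wd - 1) (by omega) using 1
  funext w
  have h1 : (2 : ℤ) ^ k ≤ 2 ^ (wd - 1) := pow_le_pow_right₀ (by norm_num) (by omega)
  have h2 := abs_lt.1 (h w)
  rw [← BitVec.msb_eq_getLsbD_last, BitVec.msb_eq_toInt, BitVec.toInt_ofInt_eq_self (by omega) (by omega) (by omega)]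

end

/-! ### Programs with oracles -/

section
variable {n d g : ℕ} {W : Type} {o : W → Oracle n} {P : ℕ} [hP : Fact (16 ≤ P)]
  [hn : Fact (2 ^ n ≤ P)] [hg : Fact (2 ^ g ≤ P)] [hd : Fact (2 ^ d ≤ P)] {S S' : Stock o P}
  {q a b wd c : ℕ} [hwd : Fact (wd ≤ P ^ 4)] {O : W → Oracle n} {E Q : W → Finset (Str n)}
  {σ : W → State n (Bits g)}

include hn in
theorem card_strings_le : card (Str n) ≤ P ^ 2 := by
  rw [card_fun, card_bool, card_fin, mul_comm, pow_mul]
  exact Nat.pow_le_pow_left hn.out 2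

theorem card_colours_le : card (Bits 4) ≤ P ^ 1 := by
  have := hP.out
  simpa using this

include hn in
theorem two_mul_le_room : 2 * n ≤ P ^ 2 := by
  have h1 := hn.out
  have h2 := hP.out
  have h3 : n < 2 ^ n := lt_two_pow_self
  nlinarith

theorem Can.list {ι : Type} {J : List ι → Stock o P → Prop} {q : ι → ℕ} (l : List ι) (hl : l.length ≤ P ^ b) (h0 : J [] S)
  (h : ∀ l' x S', S ≤ S' → J l' S' → Can S' (q x) a (J (l' ++ [x]))) :
  Can S (l.map q).sum (a + b) (J l) := by
  have key : ∃ S', (∃ q' ≤ (l.map q).sum, ∃ t ≤ l.length * P ^ a, Reach o S.1 q' t S'.1) ∧ J l S' := by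
    clear hl
    induction l using List.reverseRecOn with
    | nil => exact ⟨S, ⟨0, Nat.zero_le _, 0, Nat.zero_le _, .refl⟩, h0⟩
    | append_singleton l x ih =>
      obtain ⟨S1, ⟨q1, hq1, t1, ht1, r1⟩, p1⟩ := ih; obtain ⟨S2, ⟨q2, hq2, t2, ht2, r2⟩, p2⟩ := h l x S1 r1.subset p1
      refine ⟨S2, ⟨q1 + q2, ?_, t1 + t2, ?_, r1.trans r2⟩, p2⟩
      · grind
      · rw [length_append, List.length_singleton, add_mul, one_mul]; omega
  obtain ⟨S', ⟨q', hq', t, ht, r⟩, hI⟩ := key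
  refine ⟨S', ⟨q', hq', t, ht.trans ?_, r⟩, hI⟩
  rw [pow_add, mul_comm]
  exact Nat.mul_le_mul_left _ hl

theorem HasSet.mono ⦃S S' : Stock o P⦄ (h : S ≤ S') (hE : HasSet S E) : HasSet S' E := fun x => h (hE x)

theorem HasOr.mono ⦃S S' : Stock o P⦄ (h : S ≤ S') (hO : HasOr S O) : HasOr S' O := fun x c => (hO x c).mono h

theorem HasSet.const (E : Finset (Str n)) : HasSet S fun _ => E := fun _ => mem_const _

theorem can_set (h : ∀ x S', S ≤ S' → Can S' 0 a fun S'' => (fun w => decide (x ∈ E w)) ∈ S''.1) : Can S 0 (a + 2) fun S' => HasSet S' E :=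
  Can.forall card_strings_le (fun _ => mem_mono) h

theorem can_union {E E' : W → Finset (Str n)} (hE : HasSet S E) (hE' : HasSet S E') :
  Can S 0 4 fun S' => HasSet S' fun w => E w ∪ E' w := by
  refine can_set fun x S' h => ?_
  obtain ⟨S1, r1, p1⟩ := can_or (h (hE x)) (h (hE' x))
  exact ⟨S1, r1, by simpa only [Finset.mem_union, Bool.decide_or] using p1⟩

theorem can_sdiff {E E' : W → Finset (Str n)} (hE : HasSet S E) (hE' : HasSet S E') :
  Can S 0 4 fun S' => HasSet S' fun w => E w \ E' w := by
  refine can_set fun x S' h => ?_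
  obtain ⟨S1, r1, p1⟩ := can_not (h (hE' x))
  obtain ⟨S2, r2, p2⟩ := can_and ((h.trans r1.le) (hE x)) p1
  refine ⟨S2, (r1.trans r2).weaken, ?_⟩
  simpa only [mem_sdiff, Bool.decide_and, decide_not] using p2

variable {s : W → Str n} {z : W → Bits g} {X : W → GaussianInt} {B : W → Matrix (Bits g) (Bits g) GaussianInt}

theorem can_insert (hE : HasSet S E) (hs : Has S s) : Can S 0 4 fun S' => HasSet S' fun w => insert (s w) (E w) := by
  refine can_set fun x S' h => ?_
  obtain ⟨S1, r1, p1⟩ := can_or (h (hs x)) (h (hE x))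
  refine ⟨S1, r1, ?_⟩
  convert p1 using 1
  funext w
  simp only [mem_insert, Bool.decide_or, eq_comm (a := x)]
  congr

theorem can_grow (hO : HasOr S O) (hE : HasSet S E) : Can S 0 9 fun S' => HasSet S' fun w => grow (O w) (E w) := by
  classical
  refine (can_set (a := 7) fun x S' h => ?_).mono le_rfl (by omega) fun _ _ h => h
  by_cases hx : x = invalid _
  · refine Can.now ?_; simp only [mem_grow, ne_eq, hx, not_true_eq_false, false_and, or_false]; exact h (hE _)
  have hc : card (Str n × Bits 4) ≤ P ^ 3 := by
    rw [card_prod, pow_succ]; refine Nat.mul_le_mul card_strings_le ?_; have := card_colours_le (P := P); rwa [pow_one] at this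
  obtain ⟨S1, r1, p1⟩ := Can.forall hc (Q := fun p S' => (fun w => decide (p.1 ∈ E w) && decide (O w p.1 p.2 = x)) ∈ S'.1)
    (fun _ => mem_mono) fun p S1 h' => can_and ((h.trans h') (hE p.1)) (by convert (h.trans h') (hO p.1 p.2 x))
  obtain ⟨S2, r2, p2⟩ := can_exists hc p1
  obtain ⟨S3, r3, p3⟩ := can_or ((h.trans (r1.le.trans r2.le)) (hE x)) p2
  refine ⟨S3, ((r1.trans r2).trans r3).weaken, ?_⟩
  convert p3 using 1
  funext w
  rw [← Bool.decide_or]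
  refine decide_eq_decide.2 ?_
  rw [mem_grow]
  simp [hx]

theorem can_ball (hO : HasOr S O) (hE : HasSet S E) {k : ℕ} (hk : k ≤ P ^ b) :
  Can S 0 (9 + b) fun S' => HasSet S' fun w => ball (O w) (E w) k :=
  Can.loop (I := fun k S' => HasSet S' fun w => ball (O w) (E w) k) hk hE fun _ _ _ hS hI => can_grow (hO.mono hS) hI

theorem can_mask (hO : HasOr S O) (hE : HasSet S E) : Can S 0 11 fun S' => HasOr S' fun w => mask (O w) (E w) := by
  refine (Can.forall (a := 8) (S := S) card_strings_le (Q := fun x S' => ∀ c, Has S' fun w =>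
    mask (O w) (E w) x c) (fun x _ _ h hQ c => (hQ c).mono h) fun x S' h => ?_).weaken
  refine (Can.forall (a := 7) (S := S') card_colours_le (Q := fun c S' => Has S' fun w =>
    mask (O w) (E w) x c) (fun c => Has.mono) fun c S1 h' => ?_).weaken
  obtain ⟨S2, r2, p2⟩ := can_has ((h.trans h') (hE x))
  obtain ⟨S3, r3, p3⟩ := can_mux (card_bool_le (P := P)) card_strings_le p2 (F := fun b w => if b then O w x c else invalid _) fun b => by
      cases b
      · exact Has.const _
      · exact (hO x c).mono ((h.trans h').trans r2.le)
  refine ⟨S3, (r2.trans r3).weaken, ?_⟩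
  convert p3 using 1
  funext w
  simp [mask]

theorem can_query (hs : Has S s) (c : Bits 4) : Can S 1 11 fun S' => Has S' fun w => o w (s w) c := by
  obtain ⟨S1, r1, p1⟩ := can_bits (S := S) (ι := Fin (2 * n)) (b := 2) (by
    rw [card_fin]; exact two_mul_le_room) card_strings_le (fun x => x) hs
  obtain ⟨S2, r2, p2⟩ : Can S1 1 0 fun S' => ∀ j, (fun w => o w (s w) c j) ∈ S'.1 :=
    ⟨⟨_, Set.mem_union_left _ S1.2.1, Set.mem_union_left _ S1.2.2⟩,
      ⟨1, le_rfl, 1, le_rfl, Reach.refl.query s (fun _ => c) p1 fun _ => mem_const _⟩,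
      fun j => Set.mem_union_right _ ⟨j, rfl⟩⟩
  obtain ⟨S3, r3, p3⟩ := can_ofBits (S := S2) (ι := Fin (2 * n)) (b := 2) (by
    rw [card_fin]; exact two_mul_le_room) card_strings_le p2
  exact ⟨S3, ((r1.trans r2).trans r3).weaken, p3⟩

/-- The sixteen queries are those for all colour words of four bits. Afterwards the answers for the
new string are stored, so the masked oracle can be evaluated without further queries. -/
theorem can_expand (hs : Has S s) (hE : HasSet S E) (hO : HasOr S fun w => mask (o w) (E w)) :
  Can S 16 14 fun S' => HasSet S' (fun w => insert (s w) (E w)) ∧ HasOr S' fun w => mask (o w) (insert (s w) (E w)) := by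
  obtain ⟨S1, r1, p1⟩ := can_insert hE hs
  obtain ⟨S2, r2, p2⟩ := Can.forall' (S := S1) (card_colours_le (P := P)) (Q := fun c S' => Has S' fun w => o w (s w) c) (fun c => Has.mono)
    fun c S' h => can_query (hs.mono (r1.le.trans h)) c
  have hle := r1.le.trans r2.le
  obtain ⟨S3, r3, p3⟩ := Can.forall (a := 8) (S := S2) card_strings_le (Q := fun x S' =>
    ∀ c, Has S' fun w => mask (o w) (insert (s w) (E w)) x c)
    (fun x _ _ h hQ c => (hQ c).mono h) fun x S' h => by
      refine (Can.forall (a := 7) (S := S') card_colours_le (Q := fun c S' => Has S' fun w =>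
        mask (o w) (insert (s w) (E w)) x c) (fun c => Has.mono) fun c S1 h' => ?_).weaken
      obtain ⟨S4, r4, h4⟩ := can_mux card_strings_le card_strings_le (hs.mono (hle.trans (h.trans h')))
        (F := fun y w => if y = x then o w (s w) c else mask (o w) (E w) x c) fun y => by
          split_ifs
          · exact (p2 c).mono (h.trans h')
          · exact (hO x c).mono (hle.trans (h.trans h'))
      refine ⟨S4, r4, ?_⟩; convert h4 using 1; funext w; by_cases hx : s w = x
      · simp [mask, hx]
      · simp [mask, hx, Ne.symm hx]
  exact ⟨S3, ((r1.trans r2).trans r3).weaken (by simp) (by omega), p1.mono (r2.le.trans r3.le), p3⟩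

theorem can_choose {A : W → Finset (Str n)} (hA : HasSet S A) :
  Can S 0 17 fun S' => ∃ s : W → Str n, Has S' s ∧ ∀ w, (A w).Nonempty → s w ∈ A w := by
  have hc : card (Option (Str n)) ≤ P ^ 3 := by
    have h1 := card_strings_le (n := n) (P := P); have h2 := hP.out; have h3 : 1 ≤ P ^ 2 := one_le_pow_room h2 2
    rw [Fintype.card_option, pow_succ]; nlinarith
  obtain ⟨S1, r1, p1⟩ := Can.list (S := S) (q := fun _ => 0) (a := 13) (b := 2)
    (J := fun l S' => Has S' fun w => l.find? fun x => decide (x ∈ A w))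
    (univ : Finset (Str n)).toList
    (by rw [Finset.length_toList]; exact card_strings_le) (Has.const none) fun l x S' h hl => by
      obtain ⟨S1, r1, p1⟩ := can_has (h (hA x))
      obtain ⟨S2, r2, p2⟩ := can_map₂ hc (card_bool_le (P := P)) hc (fun y b => y.or (if b then some x else none)) (hl.mono r1.le) p1
      refine ⟨S2, (r1.trans r2).weaken, ?_⟩; convert p2 using 2 with w; rw [List.find?_append]
      by_cases hx : x ∈ A w <;> simp [hx]
  -- If the set is empty, the zero string is returned; querying it is superfluous but harmless.
  obtain ⟨S2, r2, p2⟩ := can_map hc card_strings_le (fun y => y.getD fun _ => false) p1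
  refine ⟨S2, (r1.trans r2).weaken (by simp) (by omega), _, p2, fun w ⟨x, hx⟩ => ?_⟩
  cases h : (univ : Finset (Str n)).toList.find? fun x => decide (x ∈ A w) with
  | none => simpa [hx] using List.find?_eq_none.1 h x (by simp)
  | some y => simpa using List.find?_some h

theorem mask_apply {K : Oracle n} {E : Finset (Str n)} {x : Str n} (h : x ∈ E) (c : Bits 4) : mask K E x c = K x c := if_pos h

theorem ball_mask_subset (K : Oracle n) (E S : Finset (Str n)) (k : ℕ) : ball (mask K E) S k ⊆ ball K S k := by
  induction k with
  | zero => exact subset_rfl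
  | succ k ih =>
    intro y hy; rcases mem_grow.1 hy with hy | ⟨h1, x, hx, c, hc⟩
    · exact mem_grow.2 (Or.inl (ih hy))
    · refine mem_grow.2 (Or.inr ⟨h1, x, ih hx, c, ?_⟩); by_cases hE : x ∈ E
      · rw [← hc, mask_apply hE]
      · simp only [mask, hE, if_false] at hc; exact absurd hc.symm h1

/-- Each round computes the ball from the answers collected so far and queries one of its strings
that has not been queried. Either the number of queried strings inside the true ball increases, or
the ball seen so far is fully queried and hence is the true ball. After `cap` rounds the second case
has occurred in every world. -/
theorem can_explore {E0 : W → Finset (Str n)} (hE0 : HasSet S E0) {k cap : ℕ} {a₁ : ℕ}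
  (hk : k ≤ P ^ a₁) (hcap : ∀ w, (ball (o w) (E0 w) k).card ≤ cap) (hb : cap ≤ P ^ b) :
  Can S (cap * 16) (21 + a₁ + b) fun S' => ∃ E : W → Finset (Str n),
    (∀ w, ball (o w) (E0 w) k ⊆ E w) ∧ HasOr S' fun w => mask (o w) (E w) := by
  obtain ⟨S', r, E, hE, -, hO⟩ := Can.loop (S := S) (q := 16) (a := 21 + a₁) (I := fun j S' => ∃ E : W → Finset (Str n),
      (∀ w, ball (o w) (E0 w) k ⊆ E w ∨ j ≤ (E w ∩ ball (o w) (E0 w) k).card) ∧ HasSet S' E ∧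
      HasOr S' fun w => mask (o w) (E w)) hb
    ⟨fun _ => ∅, fun w => Or.inr (Nat.zero_le _), HasSet.const _, fun x c => by
      simpa [mask] using Has.const _⟩ fun j _ S1 hS ⟨E, hE, hE', hO⟩ => by
      obtain ⟨S2, r2, p2⟩ := can_ball hO (hE0.mono hS) hk; obtain ⟨S3, r3, p3⟩ := can_sdiff p2 (hE'.mono r2.le)
      obtain ⟨S4, r4, s, hs, hs'⟩ := can_choose p3; have hle := r2.le.trans (r3.le.trans r4.le)
      obtain ⟨S5, r5, h5, h5'⟩ := can_expand hs (hE'.mono hle) (hO.mono hle)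
      refine ⟨S5, (((r2.trans r3).trans r4).trans r5).weaken, _, fun w => ?_, h5, h5'⟩; rcases hE w with h | h
      · grind
      by_cases hne : (ball (mask (o w) (E w)) (E0 w) k \ E w).Nonempty
      · have h6 := mem_sdiff.1 (hs' w hne); refine .inr ?_
        rw [Finset.insert_inter_of_mem (ball_mask_subset _ _ _ _ h6.1), Finset.card_insert_of_notMem fun h => h6.2 (Finset.mem_inter.1 h).1]
        omega
      · rw [Finset.not_nonempty_iff_eq_empty, Finset.sdiff_eq_empty_iff_subset] at hne
        refine .inl (subset_trans ?_ (hne.trans (subset_insert _ _)))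
        rw [ball_congr fun i hi x hx c => (mask_apply (hne (ball_mono hi.le hx)) c).symm]
  refine ⟨S', r, E, fun w => ?_, hO⟩
  rcases hE w with h | h
  · exact h
  · exact Finset.inter_eq_right.1 (Finset.eq_of_subset_of_card_le Finset.inter_subset_right ((hcap w).trans h))

/-! ### Programs for gates -/

include hg in
theorem card_state_le : card (Bits g) ≤ P ^ 1 := by simpa using hg.out

include hd in
theorem le_room : d ≤ P ^ 1 := by
  rw [pow_one]
  exact lt_two_pow_self.le.trans hd.out

theorem can_apply (hO : HasOr S O) (γ : CGate n g) (z : Bits g) : Can S 0 6 fun S' => Has S' fun w => γ.apply (O w) z := by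
  cases γ with
  | query e =>
    exact can_map card_strings_le card_state_le (fun y k => if h : ∃ j, e (Sum.inr (Sum.inr j)) = k then xor (z k) (y h.choose) else z k)
      (hO (fun j => z (e (Sum.inl j))) fun j => z (e (Sum.inr (Sum.inl j))))
  | _ => exact Can.now (Has.const _)

theorem can_apply' (hO : HasOr S O) (γ : CGate n g) (hz : Has S z) : Can S 0 8 fun S' => Has S' fun w => γ.apply (O w) (z w) := by
  obtain ⟨S1, r1, p1⟩ := Can.forall (S := S) card_state_le (Q := fun z S' => Has S' fun w => γ.apply (O w) z) (fun _ => Has.mono)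
    fun z S' h => can_apply (hO.mono h) γ z
  obtain ⟨S2, r2, h2⟩ := can_mux card_state_le card_state_le (hz.mono r1.le) p1
  exact ⟨S2, (r1.trans r2).weaken, h2⟩

theorem HasState.mono ⦃S S' : Stock o P⦄ (h : S ≤ S') (hσ : HasState S σ) : HasState S' σ := ⟨hσ.1.mono h, hσ.2.mono h⟩

theorem can_reads (γ : CGate n g) (hz : Has S z) : Can S (if γ.isQuery then 16 else 0) 16 fun S' =>
    HasSet S' (fun w => (γ.reads (z w)).toFinset) ∧
    HasOr S' fun w => mask (o w) (γ.reads (z w)).toFinset := by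
  have h0 : ∀ S : Stock o P, HasOr S fun w => mask (o w) ∅ := fun S x c => by simpa [mask] using Has.const _
  cases γ with
  | query e =>
    obtain ⟨S1, r1, p1⟩ := can_map card_state_le card_strings_le (fun (z : Bits g) (j : Fin (2 * n)) => z (e (Sum.inl j))) hz
    obtain ⟨S2, r2, h2⟩ := can_expand p1 (HasSet.const ∅) (h0 _)
    refine ⟨S2, (r1.trans r2).weaken (by simp [CGate.isQuery]) (by omega), ?_⟩
    simpa [CGate.reads] using h2
  | _ => exact Can.now ⟨by simpa [CGate.reads] using HasSet.const ∅, by simpa [CGate.reads] using h0 _⟩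

theorem can_cstep (γ : CGate n g) (hσ : HasState S σ) : Can S (if γ.isQuery then 16 else 0) 20 fun S' =>
    HasState S' fun w => cstep (o w) (σ w) γ := by
  obtain ⟨S1, r1, p1, h1'⟩ := can_reads γ hσ.1
  obtain ⟨S2, r2, h2⟩ := can_apply' h1' γ (hσ.1.mono r1.le)
  obtain ⟨S3, r3, p3⟩ := can_grow (h1'.mono r2.le) (p1.mono r2.le)
  obtain ⟨S4, r4, h4⟩ := can_union (hσ.2.mono (r1.le.trans (r2.le.trans r3.le))) p3
  have h5 : ∀ w, ∀ x ∈ (γ.reads (σ w).1).toFinset, ∀ c,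
      mask (o w) (γ.reads (σ w).1).toFinset x c = o w x c := fun w x hx c => mask_apply hx c
  refine ⟨S4, (((r1.trans r2).trans r3).trans r4).weaken, ?_, ?_⟩
  · convert h2.mono (r3.le.trans r4.le) using 2 with w
    exact γ.apply_congr _ fun x hx c => (h5 w x (List.mem_toFinset.2 hx) c).symm
  · convert h4 using 2 with w; rw [grow_congr (h5 w)]; rfl

theorem can_crun (l : List (CGate n g)) (hl : l.length ≤ P ^ b) (hσ : HasState S σ) :
  Can S (countQ l * 16) (20 + b) fun S' => HasState S' fun w => crun (o w) l (σ w) := by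
  refine (Can.list (J := fun l S' => HasState S' fun w => crun (o w) l (σ w))
    (q := fun γ : CGate n g => if γ.isQuery then 16 else 0) l hl hσ fun l γ S' _ h => ?_).mono
    (le_of_eq ?_) le_rfl fun _ _ h => h
  · have h1 : ∀ w, crun (o w) (l ++ [γ]) (σ w) = cstep (o w) (crun (o w) l (σ w)) γ := fun w => by simp [crun]
    simp only [h1]; exact can_cstep γ h
  · unfold countQ
    induction l with
    | nil => rfl
    | cons γ l ih => grind

/-! ### Programs for matrices -/

theorem HasG.mono ⦃S S' : Stock o P⦄ (h : S ≤ S') (hX : HasG wd S X) : HasG wd S' X := ⟨hX.1.mono h, hX.2.mono h⟩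

theorem HasM.mono ⦃S S' : Stock o P⦄ (h : S ≤ S') (hB : HasM wd S B) : HasM wd S' B := fun y y' => (hB y y').mono h

theorem HasG.const (x : GaussianInt) : HasG wd S fun _ => x := ⟨HasInt.const _, HasInt.const _⟩

theorem can_G_add {X Y : W → GaussianInt} (hX : HasG wd S X) (hY : HasG wd S Y) : Can S 0 18 fun S' => HasG wd S' fun w => X w + Y w := by
  obtain ⟨S1, r1, p1⟩ := can_add hX.1 hY.1
  obtain ⟨S2, r2, h2⟩ := can_add (hX.2.mono r1.le) (hY.2.mono r1.le)
  exact ⟨S2, (r1.trans r2).weaken, p1.mono r2.le, h2⟩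

theorem can_G_sub {X Y : W → GaussianInt} (hX : HasG wd S X) (hY : HasG wd S Y) : Can S 0 20 fun S' => HasG wd S' fun w => X w - Y w := by
  obtain ⟨S1, r1, p1⟩ := can_sub hX.1 hY.1
  obtain ⟨S2, r2, h2⟩ := can_sub (hX.2.mono r1.le) (hY.2.mono r1.le)
  exact ⟨S2, (r1.trans r2).weaken, p1.mono r2.le, h2⟩

theorem can_G_star (hX : HasG wd S X) : Can S 0 18 fun S' => HasG wd S' fun w => star (X w) := by
  obtain ⟨S1, r1, p1⟩ := can_neg hX.2
  exact ⟨S1, r1, hX.1.mono r1.le, p1⟩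

theorem can_G_mux {α : Type} [Fintype α] (hα : card α ≤ P ^ b) {s : W → α}
  (hs : Has S s) {F : α → W → GaussianInt} (hF : ∀ a, HasG wd S (F a)) :
  Can S 0 (b + 8) fun S' => HasG wd S' fun w => F (s w) w := by
  obtain ⟨S1, r1, p1⟩ := can_mux_int hα hs fun a => (hF a).1
  obtain ⟨S2, r2, h2⟩ := can_mux_int hα (hs.mono r1.le) fun a => (hF a).2.mono r1.le
  exact ⟨S2, (r1.trans r2).weaken, p1.mono r2.le, h2⟩

theorem can_G_sum {ι : Type} [Fintype ι] (hι : card ι ≤ P ^ b) {X : ι → W → GaussianInt}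
  (hX : ∀ i, ∀ S', S ≤ S' → Can S' 0 a fun S'' => HasG wd S'' (X i)) :
  Can S 0 (max a 17 + 2 + b) fun S' => HasG wd S' fun w => ∑ i, X i w := by
  classical
  obtain ⟨S1, r1, p1⟩ := can_sum hι fun i S' h =>
    (hX i S' h).mono le_rfl le_rfl fun _ _ h => h.1
  obtain ⟨S2, r2, h2⟩ := can_sum hι fun i S' h =>
    (hX i S' (r1.le.trans h)).mono le_rfl le_rfl fun _ _ h => h.2
  have h3 : ∀ (s : Finset ι) (f : ι → GaussianInt), (∑ i ∈ s, f i).re = ∑ i ∈ s, (f i).re ∧ (∑ i ∈ s, f i).im = ∑ i ∈ s, (f i).im := by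
    intro s f
    induction s using Finset.induction_on with
    | empty => exact ⟨rfl, rfl⟩
    | insert i s hi ih => simp [sum_insert hi, ih.1, ih.2]
  refine ⟨S2, (r1.trans r2).weaken, ?_, ?_⟩
  · simpa only [(h3 _ _).1] using p1.mono r2.le
  · grind

theorem can_unit_mul {m : GaussianInt} (hm : m = 0 ∨ m = 1 ∨ m = -1 ∨ m = ⟨0, 1⟩) (hX : HasG wd S X) :
  Can S 0 20 fun S' => HasG wd S' fun w => m * X w := by
  rcases hm with rfl | rfl | rfl | rfl
  · simpa only [zero_mul] using Can.now (HasG.const 0)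
  · simpa only [one_mul] using Can.now hX
  · obtain ⟨S1, r1, p1⟩ := can_G_sub (HasG.const 0) hX
    exact ⟨S1, r1, by simpa only [neg_one_mul, zero_sub] using p1⟩
  · obtain ⟨S1, r1, p1⟩ := can_neg hX.2
    refine ⟨S1, r1.weaken le_rfl (by omega), ?_, ?_⟩
    · simpa using p1
    · simpa using hX.1.mono r1.le

theorem can_imat_mul (hO : HasOr S O) (γ : QGate n g) (y u : Bits g) (hX : HasG wd S X) :
  Can S 0 20 fun S' => HasG wd S' fun w => γ.imat (O w) y u * X w := by
  cases γ with
  | classical γ =>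
    obtain ⟨S1, r1, p1⟩ := can_apply hO γ u
    obtain ⟨S2, r2, h2⟩ := can_G_mux card_state_le p1 (F := fun v w => (if y = v then 1 else 0) * X w) fun v => by
        split_ifs
        · simpa only [one_mul] using hX.mono r1.le
        · simpa only [zero_mul] using HasG.const 0
    exact ⟨S2, (r1.trans r2).weaken, h2⟩
  | hadamard i =>
    have h1 : ∀ (p q : Prop) [Decidable p] [Decidable q] (m : GaussianInt),
        (m = if p then if q then -1 else 1 else 0) → m = 0 ∨ m = 1 ∨ m = -1 ∨ m = ⟨0, 1⟩ := by grind
    exact can_unit_mul (h1 _ _ _ rfl) hX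
  | phase i =>
    have h1 : ∀ (p q : Prop) [Decidable p] [Decidable q] (m : GaussianInt),
        (m = if p then if q then ⟨0, 1⟩ else 1 else 0) → m = 0 ∨ m = 1 ∨ m = -1 ∨ m = ⟨0, 1⟩ := by grind
    exact can_unit_mul (h1 _ _ _ rfl) hX

theorem can_mul_star_imat (hO : HasOr S O) (γ : QGate n g) (y u : Bits g) (hX : HasG wd S X) :
  Can S 0 22 fun S' => HasG wd S' fun w => X w * star (γ.imat (O w) y u) := by
  obtain ⟨S1, r1, p1⟩ := can_G_star hX
  obtain ⟨S2, r2, h2⟩ := can_imat_mul (hO.mono r1.le) γ y u p1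
  obtain ⟨S3, r3, p3⟩ := can_G_star h2
  refine ⟨S3, ((r1.trans r2).trans r3).weaken, ?_⟩
  simpa only [star_mul, star_star] using p3

theorem can_matrix (h : ∀ y y', ∀ S', S ≤ S' → Can S' 0 a fun S'' => HasG wd S'' fun w => B w y y') :
  Can S 0 (a + 2) fun S' => HasM wd S' B :=
  Can.forall card_state_le (fun _ _ _ h hQ y' => (hQ y').mono h) fun y S' hS =>
    Can.forall card_state_le (fun _ => HasG.mono) fun y' S'' hS' => h y y' S'' (hS.trans hS')

theorem can_isup {O O' : W → Oracle n} (hO : HasOr S O) (hO' : HasOr S O') (γ : QGate n g) (hB : HasM wd S B) :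
  Can S 0 31 fun S' => HasM wd S' fun w => γ.isup (O w) (O' w) (B w) := by
  classical
  refine can_matrix fun y y' S' hS => ?_
  refine can_G_sum (a := 26) card_state_le fun u S1 p1 => ?_
  refine can_G_sum (a := 23) card_state_le fun u' S2 h2 => ?_
  have hle := hS.trans (p1.trans h2)
  by_cases hl : γ.link u u'
  · obtain ⟨S3, r3, p3⟩ := can_imat_mul (hO.mono hle) γ y u ((hB u u').mono hle)
    obtain ⟨S4, r4, h4⟩ := can_mul_star_imat (hO'.mono (hle.trans r3.le)) γ y' u' p3
    refine ⟨S4, (r3.trans r4).weaken, ?_⟩; simpa only [if_pos hl] using h4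
  · simpa only [if_neg hl] using Can.now (HasG.const 0)

theorem can_isupList {O O' : W → Oracle n} (hO : HasOr S O) (hO' : HasOr S O') (l : List (QGate n g)) (hl : l.length ≤ g)
  (hB : HasM wd S B) :
  Can S 0 32 fun S' => HasM wd S' fun w => isupList (O w) (O' w) l (B w) := by
  refine (Can.list (J := fun l S' => HasM wd S' fun w => isupList (O w) (O' w) l (B w))
    (q := fun _ => 0) l (hl.trans (le_room)) hB fun l γ S' hS h => ?_).mono
    (by simp) le_rfl fun _ _ h => h
  have h1 : ∀ w, isupList (O w) (O' w) (l ++ [γ]) (B w) = γ.isup (O w) (O' w) (isupList (O w) (O' w) l (B w)) := fun w => by simp [isupList]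
  simp only [h1]
  exact can_isup (hO.mono hS) (hO'.mono hS) γ h

theorem can_iC (L : Fin d → QLayer n g) {Os Os' Os'' : W → ℕ → Oracle n}
  (hO : ∀ k < d, HasOr S fun w => Os w k) (hO' : ∀ k < d, HasOr S fun w => Os' w k)
  (hO'' : ∀ k < d, HasOr S fun w => Os'' w k) (hz : Has S z) :
  Can S 0 41 fun S' => (HasM wd S' fun w => iB L (Os w) (z w) d) ∧ HasM wd S' fun w => iC L (Os w) (Os' w) (Os'' w) (z w) d := by
  obtain ⟨S1, r1, p1⟩ := can_matrix (S := S) (a := 9) (wd := wd) (B := fun w => iB L (Os w) (z w) 0) fun y y' S' h =>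
      can_G_mux (F := fun z _ => Matrix.single z z (2 ^ (g * d - roots L d)) y y') card_state_le (hz.mono h) fun a => HasG.const _
  obtain ⟨S2, r2, h2⟩ := Can.loop (S := S1) (q := 0) (a := 38) (b := 1) (I := fun k S' => (HasM wd S' fun w => iB L (Os w) (z w) k) ∧
      HasM wd S' fun w => iC L (Os w) (Os' w) (Os'' w) (z w) k) le_room
    ⟨p1, fun _ _ => HasG.const 0⟩ fun k hk S' hS ⟨hB, hC⟩ => by
      have hl : (gatesOf L k).length ≤ g := length_le (apart_gatesOf L k)
      have e := fun {O : W → Oracle n} {S'' : Stock o P} (h : S' ≤ S'') (hO : HasOr S O) =>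
        hO.mono (r1.le.trans (hS.trans h))
      obtain ⟨S2, r2, h2⟩ := can_isupList (e le_rfl (hO k hk)) (e le_rfl (hO k hk)) _ hl hB
      obtain ⟨S3, r3, p3⟩ := can_isupList (e r2.le (hO'' k hk)) (e r2.le (hO k hk)) _ hl (hB.mono r2.le)
      obtain ⟨S4, r4, h4⟩ := can_isupList (e (r2.le.trans r3.le) (hO' k hk))
        (e (r2.le.trans r3.le) (hO k hk)) _ hl (hC.mono (r2.le.trans r3.le))
      obtain ⟨S5, r5, p5⟩ := can_matrix (S := S4) (a := 21) (wd := wd)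
        (B := fun w => iC L (Os w) (Os' w) (Os'' w) (z w) (k + 1)) fun y y' S'' h => by
          obtain ⟨S6, r6, h6⟩ := can_G_sub ((p3 y y').mono (r4.le.trans h)) ((h2 y y').mono (r3.le.trans (r4.le.trans h)))
          obtain ⟨S7, r7, h7⟩ := can_G_add ((h4 y y').mono (h.trans r6.le)) h6; exact ⟨S7, (r6.trans r7).weaken, h7⟩
      exact ⟨S5, (((r2.trans r3).trans r4).trans r5).weaken, h2.mono (r3.le.trans (r4.le.trans r5.le)), p5⟩
  exact ⟨S2, (r1.trans r2).weaken, h2⟩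

/-! ### Programs for the steps of the simulation -/

theorem norm_sum_dd_le (L : Fin d → QLayer n g) (K : Oracle n) (S Y : Finset (Str n))
  (z : Bits g) : ‖∑ x ∈ Y, dd (layOf L) K S (basisState d z) x d‖ ≤ 2 ^ (2 * n + d + 1) := by
  have h1 : ∀ x, ‖dd (layOf L) K S (basisState d z) x d‖ ≤ 2 * d := by
    intro x
    refine (norm_dd_le x d).trans ((Finset.sum_le_card_nsmul _ _ 2 fun j _ => ?_).trans (by rw [card_range, nsmul_eq_mul, mul_comm]))
    have h2 : amp (layOf L) K S (basisState d z) j x ≤ 1 := by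
      unfold amp; split_ifs
      · exact (norm_cut_le _ _).trans (by rw [norm_phi, norm_basisState])
      · grind
    linarith
  refine (norm_sum_le_of_le _ fun x _ => h1 x).trans ?_
  rw [sum_const, nsmul_eq_mul]
  have h3 : (Y.card : ℝ) ≤ 2 ^ (2 * n) := by have := Finset.card_le_univ Y; rw [card_fun, card_bool, card_fin] at this; exact_mod_cast this
  have h4 : (d : ℝ) ≤ 2 ^ d := by exact_mod_cast lt_two_pow_self.le
  calc (Y.card : ℝ) * (2 * d) ≤ 2 ^ (2 * n) * (2 * 2 ^ d) := by gcongr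
    _ = _ := by ring

/-- A crude bound, over arbitrary sets of strings, whose only use is to fix the number of bits with
which the signs of corrections can be computed. -/
theorem abs_qcr_lt (L : Fin d → QLayer n g) (K : Oracle n) (S Y : Finset (Str n))
  (z z' : Bits g) : |qcr L K S z Y z'| < 2 ^ (g * d + 4 * n + 2 * d + 3) := by
  have h1 := qcr_div L K S z Y z'
  have h2 := abs_outD_le (phi (layOf L) K S (basisState d z) d) (∑ x ∈ Y, dd (layOf L) K S (basisState d z) x d) z' one_pos
  have h3 : ∀ ψ : Vec (Bits g × Env d g), outP ψ z' ≤ ‖ψ‖ ^ 2 := fun ψ => by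
    rw [← sum_outP]; exact single_le_sum (fun z _ => outP_nonneg ψ z) (mem_univ z')
  have h4 := h3 (phi (layOf L) K S (basisState d z) d)
  rw [norm_phi, norm_basisState] at h4
  have h5 := (h3 _).trans (pow_le_pow_left₀ (norm_nonneg _) (norm_sum_dd_le L K S Y z) 2)
  rw [← h1, inv_one, abs_div, div_le_iff₀ (by positivity), abs_of_pos (show (0 : ℝ) < ((2 ^ (g * d) : ℕ) : ℝ) by positivity)] at h2
  have h6 : (1 : ℝ) ≤ 2 ^ (4 * n + 2 * d) := one_le_pow₀ (by norm_num)
  have h7 : ((2 : ℝ) ^ (2 * n + d + 1)) ^ 2 = 4 * 2 ^ (4 * n + 2 * d) := by ring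
  have h8 : |(qcr L K S z Y z' : ℝ)| < 2 ^ (g * d + 4 * n + 2 * d + 3) := by
    refine h2.trans_lt ?_; push_cast; rw [h7] at h5
    calc _ ≤ (1 * 2 ^ (4 * n + 2 * d) + 1 * (4 * 2 ^ (4 * n + 2 * d))) * (2 : ℝ) ^ (g * d) := by
          gcongr; linarith
      _ < 8 * 2 ^ (4 * n + 2 * d) * (2 : ℝ) ^ (g * d) := by gcongr; linarith
      _ = _ := by ring
  exact_mod_cast h8

theorem coe_qwt (L : Fin d → QLayer n g) (K : Oracle n) (S : Finset (Str n))
  (z z' : Bits g) : (qwt L K S z z' : ℤ) = (iB L (simO K S) z d z' z').re := by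
  refine Int.toNat_of_nonneg ?_
  have h3 : (0 : ℝ) ≤ ((iB L (simO K S) z d z' z').re : ℝ) := by
    rw [iB_re]
    exact mul_nonneg (by positivity) (outP_nonneg _ _)
  exact_mod_cast h3

theorem exists_owner {Z : Type} [Fintype Z] {N : Z → ℕ} {γ : ℕ} (h : γ < ∑ z, N z) : ∃ z, cum N z ≤ γ ∧ γ < cum N z + N z := by
  by_contra! h1
  have h2 := sum_range_eq N fun j => if j = γ then 1 else 0
  rw [sum_ite_eq' (range _), if_pos (mem_range.2 h), sum_eq_zero fun z _ => sum_eq_zero fun r hr => if_neg ?_] at h2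
  · grind
  · grind

theorem pick_spec {Z : Type} [Fintype Z] [Nonempty Z] {N : Z → ℕ} {γ : ℕ} (h : γ < ∑ z, N z) :
  cum N (pick N γ) ≤ γ ∧ γ < cum N (pick N γ) + N (pick N γ) := by
  obtain ⟨z, hz⟩ := exists_owner h
  rwa [pick_eq hz]

theorem ball_mask_of_subset {K : Oracle n} {S E : Finset (Str n)} {r k : ℕ}
  (h : ball K S r ⊆ E) (hk : k ≤ r) : ball (mask K E) S k = ball K S k :=
  ball_congr fun j hj x hx c => mask_apply (h (ball_mono (by omega) hx)) c

theorem mask_mask_of_subset {K : Oracle n} {S E : Finset (Str n)} (h : S ⊆ E) :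
  mask (mask K E) S = mask K S := mask_congr fun _ hx c => mask_apply (h hx) c

theorem simO_mask_of_subset {K : Oracle n} {S E : Finset (Str n)} {r k : ℕ}
  (h : ball K S r ⊆ E) (hk : k ≤ r) : simO (mask K E) S k = simO K S k := by
  unfold simO
  rw [ball_mask_of_subset h hk, mask_mask_of_subset ((ball_mono hk).trans h)]

theorem length_gates_le (L : CLayer n g) : L.gates.length ≤ g ∧ countQ L.gates ≤ capQ n g := by
  have h1 : Apart (L.gates.map QGate.classical) := List.pairwise_map.2 L.disjoint
  refine ⟨by simpa using length_le h1, (Nat.le_div_iff_mul_le (by omega)).2 ?_⟩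
  refine le_trans ?_ (sum_card_support_le h1)
  generalize L.gates = l
  induction l with
  | nil => simp [countQ]
  | cons γ l ih =>
    rw [countQ, List.countP_cons, List.map_cons, List.map_cons, List.sum_cons, add_mul]
    have h2 : (if γ.isQuery = true then 1 else 0) * (4 * n + 4) ≤ γ.support.card := by
      cases γ <;> simp [CGate.isQuery, CGate.support]; omega
    rw [countQ] at ih; exact (Nat.add_le_add ih h2).trans (le_of_eq (add_comm _ _))

theorem length_tierGates_le (L : Fin c → CLayer n g) : (tierGates L).length ≤ c * g ∧ countQ (tierGates L) ≤ c * capQ n g := by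
  have h : ∀ l : List (CLayer n g), (l.flatMap CLayer.gates).length ≤ l.length * g ∧
      countQ (l.flatMap CLayer.gates) ≤ l.length * capQ n g := by
    intro l
    induction l with
    | nil => simp [countQ]
    | cons L l ih =>
      have h1 := length_gates_le L; rw [List.flatMap_cons, length_append, length_cons, add_mul, one_mul, add_mul, one_mul]
      unfold countQ at *
      rw [countP_append]; omega
  simpa [tierGates] using h (List.ofFn L)

theorem can_simO (hO : HasOr S O) (hE : HasSet S E) : Can S 0 13 fun S' => ∀ k < d, HasOr S' fun w => simO (O w) (E w) k := by
  obtain ⟨S1, r1, p1⟩ := Can.forall (S := S) (ι := Fin d) (a := 12) (b := 1) (by rw [card_fin]; exact le_room)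
    (Q := fun k S' => HasOr S' fun w => simO (O w) (E w) k) (fun _ => HasOr.mono) fun k S' h => by
      obtain ⟨S1, r1, p1⟩ := can_ball (hO.mono h) (hE.mono h) (k := k) (k.2.le.trans (le_room (P := P)))
      obtain ⟨S2, r2, p2⟩ := can_mask (hO.mono (h.trans r1.le)) p1; exact ⟨S2, (r1.trans r2).weaken, p2⟩
  exact ⟨S1, r1, fun k hk => p1 ⟨k, hk⟩⟩

theorem can_qwt (L : Fin d → QLayer n g) (hO : HasOr S fun w => mask (o w) (E w))
  (hσ : HasState S σ) (hE : ∀ w, ball (o w) (σ w).2 d ⊆ E w) :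
  Can S 0 42 fun S' => ∀ y, HasInt wd S' fun w => (qwt L (o w) (σ w).2 (σ w).1 y : ℤ) := by
  obtain ⟨S1, r1, p1⟩ := can_simO (d := d) hO hσ.2
  obtain ⟨S2, r2, p2, -⟩ := can_iC (wd := wd) L p1 p1 p1 (hσ.1.mono r1.le)
  refine ⟨S2, (r1.trans r2).weaken, fun y => ?_⟩
  convert (p2 y y).1 using 2 with w
  rw [← qwt_congr (K := o w) (K' := mask (o w) (E w)), coe_qwt]
  exact fun x hx c _ => mask_apply (hE w hx) c

theorem can_sub_cum {N : W → Bits g → ℕ} (hN : ∀ y, HasInt wd S fun w => (N w y : ℤ)) {c : W → ℕ} (hc : HasInt wd S fun w => (c w : ℤ)) :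
  Can S 0 21 fun S' => ∀ z, HasInt wd S' fun w => (c w : ℤ) - cum (N w) z := by
  obtain ⟨S1, r1, p1⟩ := Can.forall (S := S) (a := 20) card_state_le
    (Q := fun z S' => HasInt wd S' fun w => (c w : ℤ) - cum (N w) z) (fun _ => HasInt.mono)
    fun z S' h => by
      obtain ⟨S1, r1, p1⟩ := can_sum (S := S') (wd := wd) (a := 0) card_state_le
        (X := fun y w => if equivFin _ y < equivFin _ z then (N w y : ℤ) else 0)
        fun y S'' h' => by
          split_ifs
          · exact Can.now ((hN y).mono (h.trans h'))
          · exact Can.now (HasInt.const 0)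
      obtain ⟨S2, r2, p2⟩ := can_sub (hc.mono (h.trans r1.le)) p1; refine ⟨S2, (r1.trans r2).weaken, ?_⟩
      convert p2 using 3 with w; unfold cum; push_cast; rfl
  exact ⟨S1, r1, p1⟩

/-- The outcome is `z` exactly if `c - cum z` is nonnegative and `c - cum z - N z` is negative, that
is, if two sign bits have the right values. -/
theorem can_pick {N : W → Bits g → ℕ} (hN : ∀ y, HasInt wd S fun w => (N w y : ℤ)) {c : W → ℕ}
  (hc : HasInt wd S fun w => (c w : ℤ)) {k : ℕ} (hk : k + 1 < wd) (hsum : ∀ w, ∑ y, N w y = 2 ^ k)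
  (hc' : ∀ w, c w < 2 ^ k) : Can S 0 23 fun S' => Has S' fun w => pick (N w) (c w) := by
  classical
  obtain ⟨S1, r1, p1⟩ := can_sub_cum hN hc
  obtain ⟨S2, r2, p2⟩ := Can.forall (S := S1) (a := 21) card_state_le
    (Q := fun z S' => (fun w => decide (pick (N w) (c w) = z)) ∈ S'.1) (fun _ => mem_mono)
    fun z S' h => by
      have hb : ∀ w, cum (N w) z + N w z ≤ 2 ^ k := fun w => hsum w ▸ cum_add_le_sum _ _
      have hb' : ((2 ^ k : ℕ) : ℤ) = 2 ^ k := by push_cast; rfl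
      obtain ⟨S3, r3, p3⟩ := can_sub ((p1 z).mono h) ((hN z).mono (r1.le.trans h))
      obtain ⟨S4, r4, p4⟩ := can_not (r3.le (((p1 z).mono h).mem_neg hk fun w => by grind))
      obtain ⟨S5, r5, p5⟩ := can_and p4 (r4.le (p3.mem_neg hk fun w => by grind))
      refine ⟨S5, ((r3.trans r4).trans r5).weaken, ?_⟩; convert p5 using 1; funext w; rw [← decide_not, ← Bool.decide_and]
      refine decide_eq_decide.2 ⟨fun h => ?_, fun h => pick_eq ⟨by omega, by omega⟩⟩
      have := pick_spec (N := N w) (γ := c w) (by rw [hsum]; exact hc' w)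
      rw [h] at this; omega
  exact ⟨S2, (r1.trans r2).weaken, fun z => by convert p2 z⟩

theorem can_step_classical {D : ℕ} (hD : 0 < D) (L : Fin c → CLayer n g) (hc : c * g ≤ P ^ 4)
  (hσ : HasState S σ) {γ : W → ℕ} (hγ : ∀ w, γ w < D) :
  Can S (c * capQ n g * 16) 24 fun S' =>
    HasState S' fun w => (cTier d hD L).step (o w) (σ w) (γ w) := by
  refine (can_crun (tierGates L) ((length_tierGates_le L).1.trans hc) hσ).mono
    (Nat.mul_le_mul_right _ (length_tierGates_le L).2) le_rfl fun S' _ h => ?_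
  convert h using 2 with w
  refine Prod.ext (pick_eq ?_) rfl
  have h1 : cum ((cTier d hD L).wt (o w) (σ w).2 (σ w).1) (crun (o w) (tierGates L) (σ w)).1 = 0 := by
    unfold cum; refine sum_eq_zero fun y _ => ?_; split_ifs with h
    · exact if_neg fun h' => h.ne (by rw [h'])
    · rfl
  have h2 : (cTier d hD L).wt (o w) (σ w).2 (σ w).1 (crun (o w) (tierGates L) (σ w)).1 = D := if_pos rfl
  rw [h1, h2]
  exact ⟨Nat.zero_le _, by rw [zero_add]; exact hγ w⟩

theorem can_step_quantum (L : Fin d → QLayer n g) {cap : ℕ} (hcap : cap ≤ P ^ 4) (hσ : HasState S σ)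
  (hb : ∀ w, (ball (o w) (σ w).2 d).card ≤ cap) {γ : W → ℕ} (hγ : HasInt wd S fun w => (γ w : ℤ))
  (hγ' : ∀ w, γ w < 2 ^ (g * d)) (hw : g * d + 1 < wd) :
  Can S (cap * 16) 46 fun S' =>
    HasState S' fun w => (qTier c L).step (o w) (σ w) (γ w) := by
  obtain ⟨S1, r1, E, hE, p1⟩ := can_explore hσ.2 le_room hb hcap
  obtain ⟨S2, r2, p2⟩ := can_qwt (wd := wd) L p1 (hσ.mono r1.le) hE
  obtain ⟨S3, r3, p3⟩ := can_pick p2 (hγ.mono (r1.le.trans r2.le)) hw (fun w => (qTier c L).sum_wt _ _ _) hγ'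
  obtain ⟨S4, r4, p4⟩ := can_ball (p1.mono (r2.le.trans r3.le)) (hσ.2.mono (r1.le.trans (r2.le.trans r3.le))) (k := d) le_room
  refine ⟨S4, (((r1.trans r2).trans r3).trans r4).weaken, p3.mono r4.le, ?_⟩
  convert p4 using 2 with w
  exact (ball_mask_of_subset (hE w) le_rfl).symm

/-! ### Programs for the corrections -/

include hd in
theorem succ_le_room : d + 1 ≤ P ^ 1 := by
  rw [pow_one]
  exact (succ_le_of_lt lt_two_pow_self).trans hd.out

theorem can_revO (hO : HasOr S O) (hE : HasSet S E) (x : Str n) : Can S 0 14 fun S' => ∀ k < d, HasOr S' fun w => revO (O w) (E w) x k := by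
  obtain ⟨S1, r1, p1⟩ := Can.forall (S := S) (ι := Fin d) (a := 13) (b := 1) (by rw [card_fin]; exact le_room)
    (Q := fun k S' => HasOr S' fun w => revO (O w) (E w) x k) (fun _ => HasOr.mono) fun k S' h => by
      obtain ⟨S1, r1, p1⟩ := can_ball (hO.mono h) (hE.mono h) (k := k) (k.2.le.trans (le_room (P := P)))
      obtain ⟨S2, r2, p2⟩ := can_insert p1 (Has.const x)
      obtain ⟨S3, r3, p3⟩ := can_mask (hO.mono (h.trans (r1.le.trans r2.le))) p2; exact ⟨S3, ((r1.trans r2).trans r3).weaken, p3⟩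
  exact ⟨S1, r1, fun k hk => p1 ⟨k, hk⟩⟩

theorem iC_congr (L : Fin d → QLayer n g) {Os1 Os1' Os1'' Os Os' Os'' : ℕ → Oracle n} (z : Bits g)
  (h : ∀ k < d, Os1 k = Os k ∧ Os1' k = Os' k ∧ Os1'' k = Os'' k) :
  iC L Os1 Os1' Os1'' z d = iC L Os Os' Os'' z d := by
  have key : ∀ k ≤ d, iB L Os1 z k = iB L Os z k ∧ iC L Os1 Os1' Os1'' z k = iC L Os Os' Os'' z k := by
    intro k hk
    induction k with
    | zero => exact ⟨rfl, rfl⟩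
    | succ k ih =>
      obtain ⟨h1, h2, h3⟩ := h k (by omega)
      obtain ⟨h4, h5⟩ := ih (by omega)
      exact ⟨by rw [iB, iB, h1, h4], by rw [iC, iC, h1, h2, h3, h4, h5]⟩
  exact (key d le_rfl).2

/-- The correction sums over `x` within distance `d + 1` of the touched strings, and the
approximation for such an `x` looks `d` steps further. Hence the radius `2 * d + 1` of the
exploration. -/
theorem qcr_mask (L : Fin d → QLayer n g) {K : Oracle n} {E Q S : Finset (Str n)}
  (hE : ball K Q (2 * d + 1) ⊆ E) (hS : S ⊆ Q) (z z' : Bits g) :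
  qcr L K S z (ball K Q (d + 1)) z' = ∑ x, if x ∈ ball (mask K E) Q (d + 1) then
    2 * (iC L (simO (mask K E) S) (simO (mask K E) (insert x S)) (revO (mask K E) S x) z d z' z').re else 0 := by
  have hsub : ∀ T ⊆ ball K Q (d + 1), ball K T d ⊆ E := fun T hT =>
    ((ball_mono_left hT d).trans (by rw [ball_add])).trans ((ball_mono (by omega)).trans hE)
  have hS := hS.trans (subset_ball (K := K) (d + 1))
  rw [qcr, ball_mask_of_subset hE (by omega), ← sum_filter, Finset.filter_mem_eq_inter, Finset.univ_inter]
  refine sum_congr rfl fun x hx => ?_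
  have h6 : insert x S ⊆ ball K Q (d + 1) := Finset.insert_subset hx hS
  rw [iC_congr L z fun k hk => ⟨simO_mask_of_subset (hsub _ hS) hk.le, simO_mask_of_subset (hsub _ h6) hk.le, ?_⟩]
  unfold revO
  rw [ball_mask_of_subset (hsub _ hS) hk.le, mask_mask_of_subset]
  exact Finset.insert_subset (hsub _ h6 (subset_ball d (Finset.mem_insert_self _ _))) ((ball_mono hk.le).trans (hsub _ hS))

theorem can_iC_simO (L : Fin d → QLayer n g) (hO : HasOr S O) (hσ : HasState S σ) (x : Str n) : Can S 0 44 fun S' => HasM wd S' fun w =>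
    iC L (simO (O w) (σ w).2) (simO (O w) (insert x (σ w).2)) (revO (O w) (σ w).2 x) (σ w).1 d := by
  obtain ⟨S2, r2, p2⟩ := can_simO (d := d) hO hσ.2
  obtain ⟨S3, r3, p3⟩ := can_insert (hσ.2.mono r2.le) (Has.const x)
  obtain ⟨S4, r4, p4⟩ := can_simO (d := d) (hO.mono (r2.le.trans r3.le)) p3
  have hle := r2.le.trans (r3.le.trans r4.le)
  obtain ⟨S5, r5, p5⟩ := can_revO (d := d) (hO.mono hle) (hσ.2.mono hle) x
  obtain ⟨S6, r6, -, p6⟩ := can_iC (wd := wd) L (fun k hk => (p2 k hk).mono (r3.le.trans (r4.le.trans r5.le)))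
    (fun k hk => (p4 k hk).mono r5.le) p5 (hσ.1.mono (hle.trans r5.le))
  exact ⟨S6, ((((r2.trans r3).trans r4).trans r5).trans r6).weaken, p6⟩

theorem can_sum_ite {X : Str n → W → ℤ} {Y : W → Finset (Str n)} (hX : ∀ x, HasInt wd S (X x)) (hY : HasSet S Y) :
  Can S 0 23 fun S' => HasInt wd S' fun w => ∑ x, if x ∈ Y w then 2 * X x w else 0 := by
  refine can_sum (a := 20) card_strings_le fun x S'' h' => ?_
  obtain ⟨S4, r4, p4⟩ := can_add ((hX x).mono h') ((hX x).mono h')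
  obtain ⟨S5, r5, p5⟩ := can_has ((h'.trans r4.le) (hY x))
  obtain ⟨S6, r6, p6⟩ := can_mux_int (wd := wd) card_bool_le p5 (F := fun b w => if b then X x w + X x w else 0) fun b => by
      cases b
      · exact HasInt.const 0
      · exact p4.mono r5.le
  refine ⟨S6, ((r4.trans r5).trans r6).weaken, ?_⟩
  simpa only [decide_eq_true_eq, two_mul] using p6

theorem can_qcr (L : Fin d → QLayer n g) (hO : HasOr S fun w => mask (o w) (E w)) (hQ : HasSet S Q)
  (hE : ∀ w, ball (o w) (Q w) (2 * d + 1) ⊆ E w)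
  (hσ : HasState S σ) (hσQ : ∀ w, (σ w).2 ⊆ Q w) :
  Can S 0 50 fun S' => ∀ z', HasInt wd S' fun w =>
    qcr L (o w) (σ w).2 (σ w).1 (ball (o w) (Q w) (d + 1)) z' := by
  simp only [fun w => qcr_mask L (hE w) (hσQ w) (σ w).1]
  obtain ⟨S1, r1, p1⟩ := can_ball hO hQ (k := d + 1) succ_le_room
  obtain ⟨S3, r3, p3⟩ := Can.forall (S := S1) (a := 44) card_strings_le
    (fun _ => HasM.mono) fun x S' h => can_iC_simO (wd := wd) L (hO.mono (r1.le.trans h)) (hσ.mono (r1.le.trans h)) x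
  obtain ⟨S4, r4, p4⟩ := Can.forall (S := S3) (a := 23) card_state_le
    (fun _ => HasInt.mono) fun z' S' h => can_sum_ite (fun x => (p3 x z' z').1.mono h) (p1.mono (r3.le.trans h))
  exact ⟨S4, ((r1.trans r3).trans r4).weaken, p4⟩

variable {s : ℕ}

theorem can_shift {X : W → ℤ} (hX : HasInt wd S X) (hs : s ≤ P ^ 1) : Can S 0 18 fun S' => HasInt wd S' fun w => 2 ^ s * X w := by
  refine Can.loop (q := 0) (a := 17) (I := fun k S' => HasInt wd S' fun w => 2 ^ k * X w) hs (by simpa using hX) fun k _ S' _ h => ?_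
  obtain ⟨S1, r1, p1⟩ := can_add h h
  refine ⟨S1, r1, ?_⟩
  simpa only [pow_succ, mul_assoc, two_mul, mul_add] using p1

theorem can_flag (t : Tier n g c d) (hO : HasOr S fun w => mask (o w) (E w)) (hQ : HasSet S Q)
  (hE : ∀ w, ball (o w) (Q w) (2 * d + 1) ⊆ E w)
  (hσ : HasState S σ) (hσQ : ∀ w, (simTier t).known (o w) (σ w).2 (σ w).1 ⊆ Q w) {γ : W → ℕ}
  (hγ : HasInt wd S fun w => (γ w : ℤ)) (hγ' : ∀ w, γ w < 2 ^ (g * d)) (hs : s ≤ P ^ 1)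
  (hw : g * d + 4 * n + 2 * d + s + 4 < wd) {sgn : ℤ} (hsgn : sgn = 1 ∨ sgn = -1) :
  Can S 0 55 fun S' => (fun w => decide (((γ w - cum ((simTier t).wt (o w) (σ w).2 (σ w).1)
    (pick ((simTier t).wt (o w) (σ w).2 (σ w).1) (γ w)) : ℕ) : ℤ) < sgn * (2 ^ s *
      (simTier t).cr (o w) (σ w).2 (σ w).1 (ball (o w) (Q w) (d + 1)) (pick ((simTier t).wt (o w) (σ w).2 (σ w).1) (γ w))))) ∈ S'.1 := by
  cases t with
  | classical L =>
    refine Can.now ?_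
    have h1 : ∀ w Y z', (simTier (Tier.classical (q := d) L)).cr (o w) (σ w).2 (σ w).1 Y z' = 0 := fun _ _ _ => rfl
    simp only [h1, mul_zero, not_lt.2 (Int.natCast_nonneg _), decide_false]; exact S.2.2
  | quantum L =>
    set N : W → Bits g → ℕ := fun w => qwt L (o w) (σ w).2 (σ w).1 with hN
    set X : Bits g → W → ℤ := fun z' w =>
      qcr L (o w) (σ w).2 (σ w).1 (ball (o w) (Q w) (d + 1)) z' with hX
    have hsum : ∀ w, ∑ y, N w y = 2 ^ (g * d) := fun w => (qTier c L).sum_wt _ _ _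
    have hEQ : ∀ w, ball (o w) (σ w).2 d ⊆ E w := fun w =>
      (hσQ w).trans ((subset_ball _).trans (hE w))
    obtain ⟨S1, r1, p1⟩ := can_qwt (wd := wd) L hO hσ hEQ
    obtain ⟨S2, r2, p2⟩ := can_qcr (wd := wd) L (hO.mono r1.le) (hQ.mono r1.le) hE (hσ.mono r1.le) fun w => (subset_ball d).trans (hσQ w)
    obtain ⟨S3, r3, p3⟩ := can_sub_cum (fun y => (p1 y).mono r2.le) (hγ.mono (r1.le.trans r2.le))
    obtain ⟨S4, r4, p4⟩ := can_pick (fun y => (p1 y).mono (r2.le.trans r3.le))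
      (hγ.mono (r1.le.trans (r2.le.trans r3.le))) (k := g * d) (by omega) hsum hγ'
    obtain ⟨S5, r5, p5⟩ := Can.forall (S := S4) (a := 22) card_state_le
      (Q := fun z' S' => (fun w => decide ((γ w : ℤ) - cum (N w) z' - sgn * (2 ^ s * X z' w) < 0)) ∈
        S'.1) (fun _ => mem_mono) fun z' S' h => by
        obtain ⟨S5, r5, p5⟩ := can_shift ((p2 z').mono (r3.le.trans (r4.le.trans h))) hs
        obtain ⟨S6, r6, p6⟩ : Can S5 0 18 fun S' => HasInt wd S' fun w =>
            sgn * (2 ^ s * X z' w) := by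
          rcases hsgn with rfl | rfl
          · simpa only [one_mul] using Can.now p5
          · simpa only [neg_one_mul] using can_neg p5
        obtain ⟨S7, r7, h7⟩ := can_sub ((p3 z').mono (r4.le.trans (h.trans (r5.le.trans r6.le)))) p6
        refine ⟨S7, ((r5.trans r6).trans r7).weaken, h7.mem_neg hw fun w => ?_⟩
        have e1 : |sgn * (2 ^ s * X z' w)| < 2 ^ (g * d + 4 * n + 2 * d + s + 3) := by
          have : |sgn| = 1 := by rcases hsgn with rfl | rfl <;> rfl
          rw [abs_mul, this, one_mul, abs_mul, abs_of_pos (by positivity),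
            show g * d + 4 * n + 2 * d + s + 3 = s + (g * d + 4 * n + 2 * d + 3) by ring, pow_add]
          exact mul_lt_mul_of_pos_left (abs_qcr_lt L _ _ _ _ _) (by positivity)
        have e2 : (2 : ℤ) ^ (g * d) ≤ 2 ^ (g * d + 4 * n + 2 * d + s + 3) := pow_le_pow_right₀ (by norm_num) (by omega)
        have e3 : cum (N w) z' ≤ 2 ^ (g * d) := (Nat.le_add_right _ _).trans (hsum w ▸ cum_add_le_sum (N w) z')
        have e4 := hγ' w; zify at e3 e4; rw [pow_succ]; rw [abs_lt] at e1 ⊢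
        constructor <;> linarith [Int.natCast_nonneg (γ w), Int.natCast_nonneg (cum (N w) z')]
    obtain ⟨S6, r6, p6⟩ := can_mux_bool card_state_le (p4.mono r5.le) p5
    refine ⟨S6, (((((r1.trans r2).trans r3).trans r4).trans r5).trans r6).weaken, ?_⟩; convert p6 using 1; funext w
    refine decide_eq_decide.2 ?_
    have := (pick_spec (N := N w) (γ := γ w) (by rw [hsum]; exact hγ' w)).1
    change ((γ w - cum (N w) (pick (N w) (γ w)) : ℕ) : ℤ) < sgn * (2 ^ s * X (pick (N w) (γ w)) w) ↔ _
    rw [Nat.cast_sub this, sub_neg]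

end

/-! ### The program of the corrected simulation -/

/-- A bound for the number of strings that the simulation knows before tier `i`, if there are at
most `G` queries in a layer. -/
def mu (d G : ℕ) : ℕ → ℕ
  | 0 => 1
  | i + 1 => if Even i then mu d G i + 6 * (4 ^ d * G) else 3 * 2 ^ d * mu d G i

theorem mu_le_succ (d G i : ℕ) : mu d G i ≤ mu d G (i + 1) := by
  rw [mu]
  split_ifs
  · omega
  · exact Nat.le_mul_of_pos_left _ (by positivity)

theorem mu_mono (d G : ℕ) : Monotone (mu d G) := monotone_nat_of_le_succ (mu_le_succ d G)

section
variable {n d g η : ℕ} (C : HybridCircuit n η (4 ^ d) d g)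

theorem card_known_le {K : Oracle n} (hK : Tame K) (i : ℕ) (S : Finset (Str n)) (z : Bits g) (hS : S.card ≤ mu d (capQ n g) i) :
  ((simTiers C i).known K S z).card ≤ mu d (capQ n g) (i + 1) := by
  have h1 : ∀ {c : ℕ} (L : Fin c → CLayer n g), (crun K (tierGates L) (z, S)).2.card ≤ mu d (capQ n g) i + 6 * (c * capQ n g) := fun L =>
    (card_crun_le hK _ _).trans (add_le_add hS (Nat.mul_le_mul_left 6 (length_tierGates_le L).2))
  by_cases hi : i < η
  · rw [simTiers, dif_pos hi]; have h2 := C.alternates ⟨i, hi⟩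
    revert h2
    cases C.tier ⟨i, hi⟩ with
    | classical L =>
      intro h2; rw [mu, if_pos (h2.1 trivial)]; exact h1 L
    | quantum L =>
      intro h2; rw [mu, if_neg h2.2]; exact (hK.card_ball S d).trans (Nat.mul_le_mul_left _ hS)
  · rw [simTiers, dif_neg hi]
    exact (h1 Fin.elim0).trans (by simpa using mu_le_succ d (capQ n g) i)

variable {W : Type} {o : W → Oracle n} {P : ℕ} [hP : Fact (16 ≤ P)]
  [hn : Fact (2 ^ n ≤ P)] [hg : Fact (2 ^ g ≤ P)] [hd : Fact (2 ^ d ≤ P)] {S S' : Stock o P}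
  {q a b wd : ℕ} [hwd : Fact (wd ≤ P ^ 4)] {C} {E Q : W → Finset (Str n)}
  {σ : W → State n (Bits g)}

theorem can_simStep (ho : ∀ w, Tame (o w)) {i : ℕ} (hi : i < η) (hc : 4 ^ d * g ≤ P ^ 4) (hm : mu d (capQ n g) (i + 1) ≤ P ^ 4)
  (hσ : HasState S σ) (hσc : ∀ w, (σ w).2.card ≤ mu d (capQ n g) i) {γ : W → ℕ}
  (hγ : HasInt wd S fun w => (γ w : ℤ)) (hγ' : ∀ w, γ w < 2 ^ (g * d)) (hw : g * d + 1 < wd) :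
  Can S (mu d (capQ n g) (i + 1) * 16) 46 fun S' =>
    HasState S' fun w => (simTiers C i).step (o w) (σ w) (γ w) := by
  rw [simTiers, dif_pos hi]
  have h2 := C.alternates ⟨i, hi⟩
  revert h2
  cases C.tier ⟨i, hi⟩ with
  | classical L =>
    intro h2
    refine (can_step_classical (by positivity) L hc hσ hγ').mono (Nat.mul_le_mul_right _ ?_) (by omega) fun _ _ h => h
    rw [mu, if_pos (h2.1 trivial)]; omega
  | quantum L =>
    intro h2
    have h3 : mu d (capQ n g) (i + 1) = 3 * 2 ^ d * mu d (capQ n g) i := by rw [mu, if_neg h2.2]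
    exact can_step_quantum L hm hσ (fun w => ((ho w).card_ball _ d).trans (h3 ▸ Nat.mul_le_mul_left _ (hσc w))) hγ hγ' hw

theorem can_run (ho : ∀ w, Tame (o w)) (hη : η ≤ P ^ 1) (hc : 4 ^ d * g ≤ P ^ 4) (hm : mu d (capQ n g) η ≤ P ^ 4)
  (hσ : HasState S σ) (hσc : ∀ w, (σ w).2.card ≤ 1) {γ : W → ℕ → ℕ}
  (hγ : ∀ i < η, HasInt wd S fun w => (γ w i : ℤ)) (hγ' : ∀ w i, γ w i < 2 ^ (g * d))
  (hw : g * d + 1 < wd) :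
  Can S (η * (mu d (capQ n g) η * 16)) 47 fun S' => ∀ j ≤ η, HasState S' fun w => run (simTiers C) (o w) (γ w) 0 (σ w) j := by
  refine Can.loop (I := fun k S' => ∀ j ≤ k, HasState S' fun w => run (simTiers C) (o w) (γ w) 0 (σ w) j) hη
    (fun j hj => by rw [Nat.le_zero.1 hj]; exact hσ) fun k hk S' hS hI => ?_
  have h1 : ∀ w, (run (simTiers C) (o w) (γ w) 0 (σ w) k).2.card ≤ mu d (capQ n g) k := fun w => by
    simpa using card_run_le (card_known_le C (ho w)) (γ w) (i := 0) (hσc w) k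
  have h2 := mu_mono d (capQ n g) (succ_le_of_lt hk)
  refine (can_simStep (C := C) ho hk hc (h2.trans hm) (hI k le_rfl) h1
    ((hγ k hk).mono hS) (fun w => hγ' w k) hw).mono (Nat.mul_le_mul_right _ h2) le_rfl
    fun S'' h h3 j hj => ?_
  rcases Nat.lt_or_ge j (k + 1) with hj' | hj'
  · exact (hI j (by omega)).mono h
  · obtain rfl : j = k + 1 := by omega
    simpa only [run, zero_add] using h3

variable {s : ℕ}

theorem can_flags (hη : η ≤ P ^ 1) (hO : HasOr S fun w => mask (o w) (E w)) (hQ : HasSet S Q) (hE : ∀ w, ball (o w) (Q w) (2 * d + 1) ⊆ E w)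
  {γ γ' : W → ℕ → ℕ}
  (hσ : ∀ j ≤ η, HasState S fun w => run (simTiers C) (o w) (γ w) 0 (σ w) j)
  (hQ' : ∀ w, (run (simTiers C) (o w) (γ w) 0 (σ w) η).2 ∪ (run (simTiers C) (o w) (γ' w) 0 (σ w) η).2 = Q w)
  (hγ : ∀ i < η, HasInt wd S fun w => (γ w i : ℤ)) (hγ' : ∀ w i, γ w i < 2 ^ (g * d))
  (hs : s ≤ P ^ 1) (hw : g * d + 4 * n + 2 * d + s + 4 < wd) {sgn : ℤ}
  (hsgn : sgn = 1 ∨ sgn = -1) {κ : W → ℕ} {f : ℕ → ℕ}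
  (hκ : ∀ i < η, (fun w => decide (κ w = f i)) ∈ S.1) :
  Can S 0 59 fun S' => ∀ i : Fin η, ∃ F : W → Bool, F ∈ S'.1 ∧ ∀ w, F w = true ↔
    κ w = f i ∧ flag (simTiers C) η s (σ w) (fun K Y => ball K Y (d + 1)) (o w) (γ w) (γ' w) i
      sgn := by
  refine Can.forall (a := 58) (b := 1) (by rwa [card_fin]) (fun _ S S' h ⟨F, h1, h2⟩ =>
    ⟨F, h h1, h2⟩) fun i S1 h => ?_
  have e1 : simTiers C i = simTier (C.tier i) := dif_pos i.2
  obtain ⟨S2, r2, p2⟩ := can_flag (C.tier i) (hO.mono h) (hQ.mono h) hE ((hσ i i.2.le).mono h) (fun w => by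
      rw [← hQ', ← e1]; refine subset_trans ?_ subset_union_left
      refine subset_trans (subset_of_eq ?_) (run_subset (γ w) 0 (σ w) (succ_le_of_lt i.2)); rw [run, zero_add]
      rfl)
    ((hγ i i.2).mono h) (fun w => hγ' w i) hs hw hsgn
  obtain ⟨S3, r3, p3⟩ := can_and ((h.trans r2.le) (hκ i i.2)) p2
  refine ⟨S3, (r2.trans r3).weaken, _, p3, fun w => ?_⟩
  rw [Bool.and_eq_true, decide_eq_true_eq, decide_eq_true_eq, flag, hQ', e1]

theorem can_out (ho : ∀ w, Tame (o w)) (hη : η ≤ P ^ 1) (hc : 4 ^ d * g ≤ P ^ 4)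
  (hm : 3 * 2 ^ (2 * d + 1) * (2 * mu d (capQ n g) η) ≤ P ^ 4)
  (hσ : HasState S σ) (hσc : ∀ w, (σ w).2.card ≤ 1)
  {γ γ' : W → ℕ → ℕ} (hγ : ∀ i < η, HasInt wd S fun w => (γ w i : ℤ))
  (hγ1 : ∀ i < η, HasInt wd S fun w => (γ' w i : ℤ)) (hγ' : ∀ w i, γ w i < 2 ^ (g * d))
  (hγ1' : ∀ w i, γ' w i < 2 ^ (g * d)) (hs : s ≤ P ^ 1)
  (hw : g * d + 4 * n + 2 * d + s + 4 < wd) {κ : W → ℕ}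
  (hκ : ∀ k < 2 * η, (fun w => decide (κ w = k)) ∈ S.1) :
  Can S (2 * (η * (mu d (capQ n g) η * 16)) + 3 * 2 ^ (2 * d + 1) * (2 * mu d (capQ n g) η) * 16) 70 fun S' => Has S' fun w =>
      out (simTiers C) η s (σ w) (fun K Y => ball K Y (d + 1)) (o w) (γ w) (γ' w) (κ w) := by
  classical
  have hm' : mu d (capQ n g) η ≤ P ^ 4 := le_trans (by
    have : 1 ≤ 2 ^ (2 * d + 1) := Nat.one_le_two_pow
    nlinarith) hm
  obtain ⟨S1, r1, p1⟩ := can_run (C := C) ho hη hc hm' hσ hσc hγ hγ' (by omega)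
  obtain ⟨S2, r2, p2⟩ := can_run (C := C) ho hη hc hm' (hσ.mono r1.le) hσc (fun i hi => (hγ1 i hi).mono r1.le) hγ1' (by omega)
  obtain ⟨S3, r3, p3⟩ := can_union ((p1 η le_rfl).2.mono r2.le) (p2 η le_rfl).2
  have hle : ∀ w (γ : W → ℕ → ℕ), (run (simTiers C) (o w) (γ w) 0 (σ w) η).2.card ≤ mu d (capQ n g) η := fun w γ => by
    simpa using card_run_le (card_known_le C (ho w)) (γ w) (i := 0) (hσc w) η
  obtain ⟨S4, r4, E, hE, h4⟩ := can_explore (a₁ := 2) (k := 2 * d + 1) p3 (by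
      have h1 := hd.out; have h2 := hP.out; have h3 : d < 2 ^ d := lt_two_pow_self
      nlinarith)
    (fun w => ((ho w).card_ball _ _).trans (Nat.mul_le_mul_left _ ((Finset.card_union_le _ _).trans
      ((add_le_add (hle w γ) (hle w γ')).trans (two_mul _).ge)))) hm
  have hle1 := r2.le.trans (r3.le.trans r4.le)
  have hle2 := r1.le.trans hle1
  obtain ⟨S5, r5, h5⟩ := can_flags (C := C) (wd := wd) (s := s) hη h4 (p3.mono r4.le) hE (fun j hj => (p1 j hj).mono hle1) (fun w => rfl)
    (fun i hi => (hγ i hi).mono hle2) hγ' hs hw (Or.inr rfl) (κ := κ)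
    (f := fun i => 2 * i) fun i hi => hle2 (hκ _ (by omega))
  -- The positive flags belong to the second run, so the runs change their roles; the union of their
  -- known strings stays the same.
  obtain ⟨S6, r6, h6⟩ := can_flags (C := C) (wd := wd) (s := s) hη (h4.mono r5.le) (p3.mono (r4.le.trans r5.le)) hE
    (fun j hj => (p2 j hj).mono (r3.le.trans (r4.le.trans r5.le)))
    (fun w => Finset.union_comm _ _)
    (fun i hi => (hγ1 i hi).mono (hle2.trans r5.le)) hγ1' hs hw (Or.inl rfl) (κ := κ)
    (f := fun i => 2 * i + 1) fun i hi => (hle2.trans r5.le) (hκ _ (by omega))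
  choose F hF hF' using h5
  choose F1 hF1 hF1' using h6
  have hcard : card (Fin η × Bool) ≤ P ^ 2 := by
    rw [card_prod, card_fin, pow_succ]; exact Nat.mul_le_mul hη ((card_bool_le (P := P)).trans (pow_one P).le)
  obtain ⟨S7, r7, h7⟩ := can_exists (S := S6) hcard (f := fun i => if i.2 then F1 i.1 else F i.1) fun i => by
      split_ifs
      · exact hF1 _
      · exact r6.le (hF _)
  obtain ⟨S8, r8, h8⟩ := can_has h7
  obtain ⟨S9, r9, h9⟩ := can_mux card_bool_le card_state_le h8 (F := fun b w => if b then (run (simTiers C) (o w) (γ' w) 0 (σ w) η).1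
      else (run (simTiers C) (o w) (γ w) 0 (σ w) η).1) fun b => by
      have hle3 := r3.le.trans (r4.le.trans (r5.le.trans (r6.le.trans (r7.le.trans r8.le)))); cases b
      · exact (p1 η le_rfl).1.mono (r2.le.trans hle3)
      · exact (p2 η le_rfl).1.mono hle3
  refine ⟨S9, ((((((((r1.trans r2).trans r3).trans r4).trans r5).trans r6).trans r7).trans r8).trans r9).weaken, ?_⟩
  convert h9 using 2 with w
  unfold out
  refine if_congr ?_ rfl rfl
  rw [decide_eq_true_eq]
  constructor
  · rintro ⟨i, hi, h | h⟩
    · exact ⟨(⟨i, hi⟩, false), (hF' ⟨i, hi⟩ w).2 h⟩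
    · exact ⟨(⟨i, hi⟩, true), (hF1' ⟨i, hi⟩ w).2 h⟩
  · grind

end

/-! ### Random coins from random bits -/

/-- Bit strings as binary numbers. -/
def bitsEquiv (h : ℕ) : Bits h ≃ Fin (2 ^ h) := ((Equiv.refl _).arrowCongr finTwoEquiv.symm).trans finFunctionFinEquiv

theorem bitsEquiv_apply {h : ℕ} (b : Bits h) : ((bitsEquiv h b : ℕ) : ℤ) = ∑ j, if b j then 2 ^ (j : ℕ) else 0 := by
  have h1 : (bitsEquiv h b : ℕ) = ∑ j, (finTwoEquiv.symm (b j) : ℕ) * 2 ^ (j : ℕ) := finFunctionFinEquiv_apply _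
  rw [h1]
  push_cast
  refine sum_congr rfl fun j _ => ?_
  cases b j <;> simp [finTwoEquiv]

/-- The random bits for two sequences of `η` coins from `0, …, 2 ^ h - 1` and a coin from
`0, …, 2 ^ s - 1`. -/
abbrev CoinBits (η h s : ℕ) : Type := (Fin η × Fin h) ⊕ (Fin η × Fin h) ⊕ Fin s

/-- The number of random bits. -/
abbrev coinBits (η h s : ℕ) : ℕ := card (CoinBits η h s)

/-- Random coins are made of random bits. -/
def coinEquiv (η h s : ℕ) : Bits (coinBits η h s) ≃ (Fin η → Fin (2 ^ h)) × (Fin η → Fin (2 ^ h)) × Fin (2 ^ s) :=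
  let A : (Fin η × Fin h → Bool) ≃ (Fin η → Fin (2 ^ h)) := (Equiv.curry _ _ _).trans (Equiv.piCongrRight fun _ => bitsEquiv h)
  ((equivFin (CoinBits η h s)).symm.arrowCongr (Equiv.refl _)).trans ((Equiv.sumArrowEquivProdArrow _ _ _).trans
      (A.prodCongr ((Equiv.sumArrowEquivProdArrow _ _ _).trans (A.prodCongr (bitsEquiv s)))))

section
variable {n d g η s : ℕ} {W : Type} {o : W → Oracle n} {P : ℕ} [hP : Fact (16 ≤ P)]
  {S S' : Stock o P} {q a b wd : ℕ} [hwd : Fact (wd ≤ P ^ 4)]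

theorem can_number {h : ℕ} (hh : h ≤ P ^ 2) {f : W → Bits h} (hf : ∀ j, (fun w => f w j) ∈ S.1) :
  Can S 0 20 fun S' => HasInt wd S' fun w => ((bitsEquiv h (f w) : ℕ) : ℤ) := by
  simp only [bitsEquiv_apply]
  refine can_sum (a := 9) (b := 2) (by rwa [card_fin]) fun j S' h => ?_
  obtain ⟨S1, r1, p1⟩ := can_has (h (hf j))
  obtain ⟨S2, r2, h2⟩ := can_mux_int (wd := wd) card_bool_le p1 (F := fun b _ => if b then 2 ^ (j : ℕ) else 0) fun b => HasInt.const _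
  exact ⟨S2, (r1.trans r2).weaken, h2⟩

theorem can_coins {h : ℕ} (hh : h ≤ P ^ 2) (hη : η ≤ P ^ 1) {f : W → Fin η → Bits h}
  (hf : ∀ i j, (fun w => f w i j) ∈ S.1) : Can S 0 21 fun S' => ∀ i < η,
    HasInt wd S' fun w => ((ext (fun i => bitsEquiv h (f w i)) i : ℕ) : ℤ) := by
  refine (Can.forall (ι := Fin η) (by rwa [card_fin])
    (Q := fun i S' => HasInt wd S' fun w => ((bitsEquiv h (f w i) : ℕ) : ℤ)) (fun _ => HasInt.mono)
    fun i S' h => can_number hh fun j => h (hf i j)).mono le_rfl le_rfl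
    fun S' _ h i hi => ?_
  simpa only [ext, dif_pos hi] using h ⟨i, hi⟩

theorem can_slot (hs : s ≤ P ^ 1) (hs' : 2 ^ s ≤ P ^ 1) {f : W → Bits s}
  (hf : ∀ j, (fun w => f w j) ∈ S.1) : Can S 0 7 fun S' => ∀ k < 2 ^ s, (fun w => decide ((bitsEquiv s (f w) : ℕ) = k)) ∈ S'.1 := by
  have hc : card (Fin s → Bool) ≤ P ^ 1 := by simpa using hs'
  obtain ⟨S1, r1, p1⟩ := can_ofBits (by rwa [card_fin]) hc hf
  obtain ⟨S2, r2, h2⟩ := can_map hc (by rwa [card_fin]) (bitsEquiv s) p1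
  refine ⟨S2, (r1.trans r2).weaken, fun k hk => ?_⟩
  convert h2 ⟨k, hk⟩ using 2 with w
  exact decide_eq_decide.2 (Fin.ext_iff (b := ⟨k, hk⟩)).symm

end

theorem exists_algorithm_of_can {n m g q a P : ℕ} (hn : 0 < n) {p : Oracle n → Prop} {y : {K : Oracle n // p K} × Bits n × Bits m → Bits g}
  (h : ∀ S : Stock (fun w : {K : Oracle n // p K} × Bits n × Bits m => w.1.1) P,
    (∀ i, (fun w => w.2.1 i) ∈ S.1) → (∀ j, (fun w => w.2.2 j) ∈ S.1) → Can S q a fun S' =>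
      ∀ i, (fun w => y w i) ∈ S'.1) :
  ∃ A : ClassicalAlgorithm n g, A.queries ≤ q ∧ A.time ≤ n + m + 5 * g + 3 + (P ^ a + 3) * (6 * n + 11) ∧
    ∀ (K : {K : Oracle n // p K}) x (F : Bits g → ℝ), ∑ z, A.prob K x z * F z = (∑ r : Bits m, F (y (K, x, r))) / 2 ^ m := by
  obtain ⟨S1, r1, h1, h0, hS⟩ : ∃ S1, Reach (fun w : {K : Oracle n // p K} × Bits n × Bits m => w.1.1)
      (Set.range (fun i w => w.2.1 i) ∪ Set.range fun j w => w.2.2 j) 0 3 S1 ∧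
      (fun _ => true) ∈ S1 ∧ (fun _ => false) ∈ S1 ∧
      (Set.range (fun i w => w.2.1 i) ∪ Set.range fun j w => w.2.2 j) ⊆ S1 := by
    -- The constants are made from the first input bit: its negation, then the NAND of both, which
    -- is true, then the NAND of that with itself.
    have r1 := (((Reach.refl (o := fun w : {K : Oracle n // p K} × Bits n × Bits m => w.1.1)
      (S := Set.range (fun i w => w.2.1 i) ∪ Set.range fun j w => w.2.2 j)).nand _ _
      (Or.inl ⟨⟨0, hn⟩, rfl⟩) (Or.inl ⟨⟨0, hn⟩, rfl⟩)).nand _ _ (Set.mem_insert _ _)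
      (Or.inr (Or.inl ⟨⟨0, hn⟩, rfl⟩))).nand _ _ (Set.mem_insert _ _) (Set.mem_insert _ _)
    refine ⟨_, r1, Or.inr (Or.inl ?_), Or.inl ?_, r1.subset⟩ <;> funext w <;> simp
  obtain ⟨S', ⟨q', hq', t, ht, r2⟩, hy⟩ := h ⟨S1, h1, h0⟩ (fun i => hS (Or.inl ⟨i, rfl⟩)) fun j => hS (Or.inr ⟨j, rfl⟩)
  obtain ⟨A, hA, hA', hA''⟩ := (r1.trans r2).exists_algorithm hy
  refine ⟨A, by omega, hA'.trans ?_, fun K x F => ?_⟩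
  · exact Nat.add_le_add_left (Nat.mul_le_mul_right _ (by omega)) _
  · simp only [hA'', sum_div, sum_mul]; rw [sum_comm]; refine sum_congr rfl fun r _ => ?_; rw [sum_eq_single (y (K, x, r))]
    · grind
    · grind
    · grind

section
variable {n d g η s P : ℕ} (C : HybridCircuit n η (4 ^ d) d g) [hP : Fact (16 ≤ P)]
  [hg : Fact (2 ^ g ≤ P)] {wd : ℕ} [hwd : Fact (wd ≤ P ^ 4)]

theorem sum_coinEquiv {η h s : ℕ} (φ : (ℕ → ℕ) → (ℕ → ℕ) → ℕ → ℝ) :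
  (∑ r : Bits (coinBits η h s), φ (ext (coinEquiv η h s r).1) (ext (coinEquiv η h s r).2.1)
    (coinEquiv η h s r).2.2) / 2 ^ coinBits η h s =
  coinAv η (2 ^ h) fun c => coinAv η (2 ^ h) fun c' =>
    (∑ κ ∈ range (2 ^ s), φ c c' κ) / 2 ^ s := by
  rw [(coinEquiv η h s).sum_comp fun e => φ (ext e.1) (ext e.2.1) e.2.2, sum_prod_type]
  simp only [sum_prod_type, coinAv, sum_div, Finset.sum_range]
  refine sum_congr rfl fun c _ => sum_congr rfl fun c' _ =>
    sum_congr rfl fun κ _ => ?_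
  rw [div_div, div_div]
  congr 1
  push_cast
  simp only [Fintype.card_sum, card_prod, card_fin]
  rw [← pow_mul, ← pow_add, ← pow_add]
  congr 1
  ring

/-- The rule `ns` for the strings to correct for is left open, so that the same translation serves
the corrected simulation and the one without corrections. -/
theorem exists_algorithm_outAv (hn : 0 < n) (hη : η ≤ P ^ 1) (hd : g * d ≤ P ^ 2) (hs : s ≤ P ^ 1)
  (hs' : 2 ^ s ≤ P ^ 1) (hηs : 2 * η ≤ 2 ^ s)
  (ns : Oracle n → Finset (Str n) → Finset (Str n)) {q : ℕ}
  (h : ∀ {W : Type} {o : W → Oracle n} {S : Stock o P}, (∀ w, Tame (o w)) →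
    ∀ {σ : W → State n (Bits g)}, HasState S σ → (∀ w, (σ w).2.card ≤ 1) →
    ∀ {γ γ' : W → ℕ → ℕ}, (∀ i < η, HasInt wd S fun w => (γ w i : ℤ)) →
    (∀ i < η, HasInt wd S fun w => (γ' w i : ℤ)) → (∀ w i, γ w i < 2 ^ (g * d)) →
    (∀ w i, γ' w i < 2 ^ (g * d)) → ∀ {κ : W → ℕ},
    (∀ k < 2 * η, (fun w => decide (κ w = k)) ∈ S.1) → Can S q 70 fun S' => Has S' fun w =>
      out (simTiers C) η s (σ w) ns (o w) (γ w) (γ' w) (κ w)) :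
  ∃ A : ClassicalAlgorithm n g, A.queries ≤ q ∧ A.time ≤ n + coinBits η (g * d) s + 5 * g + 3 + (P ^ 75 + 3) * (6 * n + 11) ∧
    ∀ (K : Oracle n) (x : Bits n) (F : Bits g → ℝ), Tame K → ∑ z, A.prob K x z * F z =
      outAv (simTiers C) η s (padInput g x, {fun _ => false}) ns K F := by
  have hpos : ∀ (c : Fin η → Fin (2 ^ (g * d))) (i : ℕ), ext c i < 2 ^ (g * d) := fun c i => by
    unfold ext; split_ifs
    · grind
    · positivity
  obtain ⟨A, hA, hA', hA''⟩ := exists_algorithm_of_can (m := coinBits η (g * d) s) (q := q) (a := 75) (P := P) hn (p := Tame)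
    (y := fun w : {K : Oracle n // Tame K} × Bits n × Bits (coinBits η (g * d) s) =>
      out (simTiers C) η s (padInput g w.2.1, {fun _ => false}) ns w.1.1
      (ext (coinEquiv η (g * d) s w.2.2).1) (ext (coinEquiv η (g * d) s w.2.2).2.1)
      (coinEquiv η (g * d) s w.2.2).2.2) fun S hS hS' => by
    have hg' : card (Fin g) ≤ P ^ 1 := by rw [card_fin, pow_one]; exact lt_two_pow_self.le.trans hg.out
    obtain ⟨S1, r1, p1⟩ := can_coins (S := S) (wd := wd) hd hη (f := fun w i j => w.2.2 (equivFin (CoinBits η (g * d) s) (.inl (i, j))))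
      fun i j => hS' _
    obtain ⟨S2, r2, h2⟩ := can_coins (S := S1) (wd := wd) hd hη
      (f := fun w i j => w.2.2 (equivFin (CoinBits η (g * d) s) (.inr (.inl (i, j)))))
      fun i j => r1.le (hS' _)
    obtain ⟨S3, r3, h3⟩ := can_slot (S := S2) hs hs' (f := fun w j => w.2.2 (equivFin (CoinBits η (g * d) s) (.inr (.inr j))))
      fun j => (r1.le.trans r2.le) (hS' _)
    obtain ⟨S4, r4, h4⟩ := can_ofBits (S := S3) hg' (card_state_le (P := P) (g := g)) (f := fun w => padInput g w.2.1) fun i => by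
        unfold padInput; split_ifs
        · exact (r1.le.trans (r2.le.trans r3.le)) (hS _)
        · grind
    obtain ⟨S5, r5, h5⟩ := h (W := {K : Oracle n // Tame K} × Bits n × Bits (coinBits η (g * d) s)) (S := S4) (fun w => w.1.2)
      (σ := fun w => (padInput g w.2.1, {fun _ => false})) ⟨h4, fun x => mem_const (decide (x ∈ {fun _ => false}))⟩
      (fun w => (Finset.card_singleton _).le)
      (fun i hi => (p1 i hi).mono (r2.le.trans (r3.le.trans r4.le)))
      (fun i hi => (h2 i hi).mono (r3.le.trans r4.le)) (fun w => hpos _)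
      (fun w => hpos _) fun k hk => r4.le (h3 k (hk.trans_le hηs))
    obtain ⟨S6, r6, h6⟩ := can_bits hg' card_state_le (fun z => z) h5
    exact ⟨S6, (((((r1.trans r2).trans r3).trans r4).trans r5).trans r6).weaken, h6⟩
  refine ⟨A, hA, hA', fun K x F hK => ?_⟩
  rw [hA'' ⟨K, hK⟩ x F]
  exact sum_coinEquiv fun c c' κ => F (out (simTiers C) η s (padInput g x, {fun _ => false}) ns K c c' κ)

end

/-! ### Numerical estimates -/

theorem sq_le_two_mul_two_pow (d : ℕ) : d ^ 2 ≤ 2 * 2 ^ d := by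
  induction d with
  | zero => simp
  | succ d ih =>
    have : d < 2 ^ d := lt_two_pow_self; rw [pow_succ 2 d]; nlinarith

/-- The share of the labels among all strings. -/
def density (n : ℕ) : ℝ := (2 ^ (n + 2) - 2) / 2 ^ (2 * n)

section
variable {n d g η : ℕ}

theorem density_ge (hn : 1 ≤ n) : 3 * (2 ^ n : ℝ)⁻¹ ≤ density n := by
  have h1 : (2 : ℝ) ≤ 2 ^ n := by simpa using pow_le_pow_right₀ (one_le_two) hn
  rw [density, two_mul, pow_add, pow_add, ← div_eq_mul_inv, div_le_div_iff₀ (by positivity) (by positivity)]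
  nlinarith

/-- The exponent `(η + 2) * (d + 2)` is at least `9`, and `4 ^ 9 * n ^ 2 * 3 / 2 ^ n` is at least
`2` for all smaller `n`. -/
theorem le_of_bound_lt (hn : 2 ≤ n) (hη : 1 ≤ η) (hd : 1 ≤ d) (hng : n ≤ g)
  (h : (4 : ℝ) ^ ((η + 2) * (d + 2)) * (g : ℝ) ^ 2 * density n < 2) : 27 ≤ n := by
  have h1 : (4 : ℝ) ^ 9 ≤ 4 ^ ((η + 2) * (d + 2)) := pow_le_pow_right₀ (by norm_num) (by nlinarith)
  have h2 : (n : ℝ) ^ 2 ≤ g ^ 2 := pow_le_pow_left₀ n.cast_nonneg (Nat.cast_le.2 hng) 2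
  have h3 : (4 : ℝ) ^ 9 * (n : ℝ) ^ 2 * (3 * (2 ^ n)⁻¹) < 2 :=
    (mul_le_mul (mul_le_mul h1 h2 (by positivity) (by positivity)) (density_ge (by omega)) (by positivity) (by positivity)).trans_lt h
  by_contra h4
  push Not at h4
  interval_cases n <;> norm_num at h3

variable (hn : 27 ≤ n)
include hn

theorem two_pow_ge : (8 : ℝ) ≤ 2 ^ n := le_trans (by norm_num) (pow_le_pow_right₀ (one_le_two) (show 3 ≤ n by omega))

theorem luck_facts : 0 ≤ luck n ∧ luck n * card (Vertex n) ≤ 2 * density n ∧ 2 ^ n * luck n ≤ density n := by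
  have h1 := two_pow_ge hn
  have h2 : (card (Vertex n) : ℝ) = 4 * 2 ^ n - 2 := by
    rw [card_vertex, Nat.cast_sub (by grind)]
    push_cast; rw [pow_add]; ring
  have h4 : (4 : ℝ) ^ n = 2 ^ n * 2 ^ n := by rw [← mul_pow]; norm_num
  have h5 : density n = (4 * 2 ^ n - 2) / (2 ^ n * 2 ^ n) := by rw [density, two_mul, pow_add, pow_add]; ring
  rw [luck, h2, h4, h5]
  set u : ℝ := 2 ^ n
  have h6 : 0 < u * u - (4 * u - 2) := by nlinarith
  refine ⟨by positivity, ?_, ?_⟩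
  · rw [div_mul_eq_mul_div, one_mul, ← mul_div_assoc, div_le_div_iff₀ h6 (by positivity)]
    have : 0 ≤ (4 * u - 2) * (u * u - 2 * (4 * u - 2)) := mul_nonneg (by linarith) (by nlinarith)
    nlinarith
  · rw [mul_one_div, div_le_div_iff₀ h6 (by positivity)]
    have : 0 ≤ u * (u - 8) := mul_nonneg (by linarith) (by linarith)
    nlinarith [mul_nonneg (by linarith : (0:ℝ) ≤ u) this]

theorem density_facts : 0 ≤ density n ∧ ((2 : ℝ) ^ n)⁻¹ ≤ density n ∧ 2 ^ n * density n ≤ 4 := by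
  have h1 := two_pow_ge hn
  have h2 := density_ge (n := n) (by omega)
  have h3 : 0 < ((2 : ℝ) ^ n)⁻¹ := by positivity
  refine ⟨by linarith, by linarith, ?_⟩
  rw [density, two_mul, pow_add, pow_add, ← mul_div_assoc, div_le_iff₀ (by positivity)]
  nlinarith

/-- For `n ≥ 27` a query gate has at least `112` wires. This factor pays for the numerical constants
in the error bounds. -/
theorem capQ_le : 112 * capQ n g ≤ g := le_trans (Nat.mul_le_mul_right _ (by omega)) (Nat.mul_div_le g (4 * n + 4))

theorem devBound_le : devBound n d g ≤ density n * (2 ^ d * g) := by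
  obtain ⟨h1, h2, -⟩ := luck_facts hn
  obtain ⟨h3, -⟩ := density_facts hn
  have h4 : (d : ℝ) ^ 2 ≤ 2 * 2 ^ d := mod_cast sq_le_two_mul_two_pow d
  have h5 : (112 : ℝ) * capQ n g ≤ g := mod_cast capQ_le hn
  calc devBound n d g = 4 * d ^ 2 * capQ n g * (luck n * card (Vertex n)) := by
        unfold devBound; ring
    _ ≤ 4 * (2 * 2 ^ d) * capQ n g * (2 * density n) := by gcongr
    _ = density n * (2 ^ d * (16 * capQ n g)) := by ring
    _ ≤ _ := by gcongr; linarith [(capQ n g).cast_nonneg (α := ℝ)]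

variable (hg : 1 ≤ g)
include hg

theorem farBound_le (M : ℕ) : farBound n d g M ≤ density n * (144 * (2 ^ d) ^ 2 * M + 20 * (2 ^ d) ^ 3 * g) := by
  obtain ⟨h1, h2, h2'⟩ := luck_facts hn
  obtain ⟨h3, h3', -⟩ := density_facts hn
  have h4 : (d : ℝ) ^ 2 ≤ 2 * 2 ^ d := mod_cast sq_le_two_mul_two_pow d
  have h4' : (d : ℝ) ≤ 2 ^ d := mod_cast lt_two_pow_self.le
  have h5 : (112 : ℝ) * capQ n g ≤ g := mod_cast capQ_le hn
  have h6 : (1 : ℝ) ≤ g := mod_cast hg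
  have h7 : (1 : ℝ) ≤ 2 ^ d := one_le_pow₀ one_le_two
  have h0 : (0 : ℝ) ≤ capQ n g := cast_nonneg _
  calc farBound n d g M = 2 * (d * (luck n * card (Vertex n)) * (13 * capQ n g + 36 * 2 ^ d * M + 144 * d ^ 2 * 2 ^ d * capQ n g) +
        3 * 2 ^ d * ((2 ^ n)⁻¹ + 4 * d ^ 2 * capQ n g * (2 ^ n * luck n))) := by
        unfold farBound; ring
    _ ≤ 2 * (2 ^ d * (2 * density n) * (13 * capQ n g + 36 * 2 ^ d * M + 144 * (2 * 2 ^ d) * 2 ^ d * capQ n g) +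
        3 * 2 ^ d * (density n + 4 * (2 * 2 ^ d) * capQ n g * density n)) := by gcongr
    _ = density n * (144 * (2 ^ d) ^ 2 * M + (52 * 2 ^ d * capQ n g +
        1152 * (2 ^ d) ^ 3 * capQ n g + 6 * 2 ^ d + 48 * (2 ^ d) ^ 2 * capQ n g)) := by ring
    _ ≤ _ := by
      refine mul_le_mul_of_nonneg_left (add_le_add_right ?_ _) h3; set D : ℝ := 2 ^ d
      have e1 : D ≤ D ^ 3 := le_self_pow₀ h7 (by norm_num)
      have e2 : D ^ 2 ≤ D ^ 3 := pow_le_pow_right₀ h7 (by norm_num)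
      have e3 : D * capQ n g ≤ D ^ 3 * capQ n g := by gcongr
      have e4 : D ^ 2 * capQ n g ≤ D ^ 3 * capQ n g := by gcongr
      have e5 : D ≤ D ^ 3 * g := by nlinarith [pow_nonneg (by linarith : (0 : ℝ) ≤ D) 3]
      have e6 : D ^ 3 * (112 * capQ n g) ≤ D ^ 3 * g := by gcongr
      linarith

theorem mainBound_le (s M : ℕ) : mainBound n d g s M ≤
  density n * ((156 + 12 * 2 ^ s) * (2 ^ d) ^ 2 * M * g + 23 * (2 ^ d) ^ 3 * g ^ 2) := by
  obtain ⟨h1, h2, h2'⟩ := luck_facts hn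
  obtain ⟨h3, h3', h3''⟩ := density_facts hn
  have h4 : (d : ℝ) ^ 2 ≤ 2 * 2 ^ d := mod_cast sq_le_two_mul_two_pow d
  have h5 : (112 : ℝ) * capQ n g ≤ g := mod_cast capQ_le hn
  have h6 : (1 : ℝ) ≤ g := mod_cast hg
  have h7 : (1 : ℝ) ≤ 2 ^ d := one_le_pow₀ one_le_two
  have h0 : (0 : ℝ) ≤ capQ n g := cast_nonneg _
  have hM : (0 : ℝ) ≤ M := cast_nonneg _
  have e1 : 2 ^ n * (luck n * card (Vertex n)) ^ 2 ≤ 16 * density n := by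
    calc 2 ^ n * (luck n * card (Vertex n)) ^ 2 ≤ 2 ^ n * (2 * density n) ^ 2 := by gcongr
      _ = (2 ^ n * density n) * (4 * density n) := by ring
      _ ≤ 4 * (4 * density n) := by gcongr
      _ = _ := by ring
  calc mainBound n d g s M = farBound n d g M + 2 * ((2 ^ n)⁻¹ * (6 * 2 ^ d * M) + 64 * (d ^ 2) ^ 2 * capQ n g ^ 2 *
        (2 ^ n * (luck n * card (Vertex n)) ^ 2)) +
        12 * 2 ^ s * 2 ^ d * M * devBound n d g + 2 * devBound n d g := by
        unfold mainBound; ring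
    _ ≤ density n * (144 * (2 ^ d) ^ 2 * M + 20 * (2 ^ d) ^ 3 * g) +
        2 * (density n * (6 * 2 ^ d * M) + 64 * (2 * 2 ^ d) ^ 2 * capQ n g ^ 2 *
        (16 * density n)) + 12 * 2 ^ s * 2 ^ d * M * (density n * (2 ^ d * g)) +
        2 * (density n * (2 ^ d * g)) := by
        gcongr
        · exact farBound_le hn hg M
        · exact devBound_le hn
        · exact devBound_le hn
    _ = density n * (144 * (2 ^ d) ^ 2 * M + 20 * (2 ^ d) ^ 3 * g + 12 * 2 ^ d * M +
        8192 * (2 ^ d) ^ 2 * capQ n g ^ 2 + 12 * 2 ^ s * (2 ^ d) ^ 2 * M * g + 2 * 2 ^ d * g) := by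
        ring
    _ ≤ _ := by
      refine mul_le_mul_of_nonneg_left ?_ h3; set D : ℝ := 2 ^ d
      have e2 : D * M ≤ D ^ 2 * M := by gcongr; exact le_self_pow₀ h7 (by norm_num)
      have e3 : D ^ 2 * M ≤ D ^ 2 * M * g := le_mul_of_one_le_right (by positivity) h6
      have e4 : D ^ 2 * (112 * capQ n g) ^ 2 ≤ D ^ 3 * g ^ 2 := by gcongr; norm_num
      have e5 : D ^ 3 * g ≤ D ^ 3 * g ^ 2 := by gcongr; exact le_self_pow₀ h6 (by norm_num)
      have e6 : D * g ≤ D ^ 3 * g := by gcongr; exact le_self_pow₀ h7 (by norm_num)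
      have e7 : 0 ≤ D ^ 2 * capQ n g ^ 2 := by positivity
      nlinarith

theorem lastBound_le {M : ℕ} (hM : 15 * M ≤ 4 ^ d * g) : lastBound n d g M ≤ 4 ^ (4 * (d + 2)) * (g : ℝ) ^ 2 * density n := by
  obtain ⟨h1, h2, h2'⟩ := luck_facts hn
  obtain ⟨h3, h3', -⟩ := density_facts hn
  have h4 : (d : ℝ) ^ 2 ≤ 2 * 2 ^ d := mod_cast sq_le_two_mul_two_pow d
  have h5 : (112 : ℝ) * capQ n g ≤ g := mod_cast capQ_le hn
  have h6 : (1 : ℝ) ≤ g := mod_cast hg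
  have h7 : (1 : ℝ) ≤ 2 ^ d := one_le_pow₀ one_le_two
  have h0 : (0 : ℝ) ≤ capQ n g := cast_nonneg _
  have hM0 : (0 : ℝ) ≤ M := cast_nonneg _
  have e0 : (4 : ℝ) ^ d = (2 ^ d) ^ 2 := by rw [← pow_mul, mul_comm, pow_mul]; norm_num
  have hM' : 15 * (M : ℝ) ≤ (2 ^ d) ^ 2 * g := by rw [← e0]; exact_mod_cast hM
  have h8 := farBound_le (d := d) hn hg (3 * 2 ^ d * M)
  push_cast at h8
  calc lastBound n d g M = farBound n d g (3 * 2 ^ d * M) + 2 * ((2 ^ n)⁻¹ * (6 * (2 ^ d) ^ 2 * M) +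
        4 * d ^ 2 * capQ n g * (2 ^ n * luck n) * (6 * (2 ^ d) ^ 2 * M)) + 2 * devBound n d g := by
        unfold lastBound; rw [pow_succ 2 (2 * d), mul_comm 2 d, pow_mul]; ring
    _ ≤ density n * (144 * (2 ^ d) ^ 2 * (3 * 2 ^ d * M) + 20 * (2 ^ d) ^ 3 * g) + 2 * (density n * (6 * (2 ^ d) ^ 2 * M) +
        4 * (2 * 2 ^ d) * capQ n g * density n * (6 * (2 ^ d) ^ 2 * M)) +
        2 * (density n * (2 ^ d * g)) := by
        gcongr; exact devBound_le hn
    _ = density n * (432 * (2 ^ d) ^ 3 * M + 20 * (2 ^ d) ^ 3 * g + 12 * (2 ^ d) ^ 2 * M +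
        96 * (2 ^ d) ^ 3 * capQ n g * M + 2 * 2 ^ d * g) := by ring
    _ ≤ density n * (4 ^ (4 * (d + 2)) * (g : ℝ) ^ 2) := by
      refine mul_le_mul_of_nonneg_left ?_ h3
      have e1 : (4 : ℝ) ^ (4 * (d + 2)) = 4 ^ 8 * (2 ^ d) ^ 8 := by
        rw [show 4 * (d + 2) = 8 + d * 4 by ring, pow_add, pow_mul, e0, ← pow_mul]
      rw [e1]; set D : ℝ := 2 ^ d
      have a1 : D ^ 3 * (15 * M) ≤ D ^ 3 * (D ^ 2 * g) := by gcongr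
      have a2 : D ^ 2 * M ≤ D ^ 3 * M := by (gcongr; norm_num)
      have a3 : D ^ 3 * (112 * capQ n g) * (15 * M) ≤ D ^ 3 * g * (D ^ 2 * g) := by gcongr
      have a4 : D * g ≤ D ^ 5 * g := by gcongr; exact le_self_pow₀ h7 (by norm_num)
      have a5 : D ^ 3 * g ≤ D ^ 5 * g := by (gcongr; norm_num)
      have a6 : D ^ 5 * g ≤ D ^ 8 * g ^ 2 := by
        gcongr
        · norm_num
        · exact le_self_pow₀ h6 (by norm_num)
      have a7 : D ^ 5 * g ^ 2 ≤ D ^ 8 * g ^ 2 := by (gcongr; norm_num)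
      have a8 : 0 ≤ D ^ 8 * (g : ℝ) ^ 2 := by positivity
      nlinarith
    _ = _ := by ring

omit hg

theorem one_add_le (hd : 1 ≤ d) (hgn : n ≤ g) : 15 * (1 + 6 * (4 ^ d * capQ n g)) ≤ 4 ^ d * g := by
  have h1 : 4 ^ d * (112 * capQ n g) ≤ 4 ^ d * g := Nat.mul_le_mul_left _ (capQ_le hn)
  have h2 : 4 ^ 1 ≤ 4 ^ d := pow_le_pow_right (by norm_num) hd
  nlinarith

/-- A quantum tier multiplies the number of known strings by `3 * 2 ^ d`. One more `2 ^ d` in the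
base absorbs the additive growth in the next classical tier, so only every second tier counts. -/
theorem mu_le (hd : 1 ≤ d) (hgn : n ≤ g) (i : ℕ) : 15 * mu d (capQ n g) i ≤ 4 ^ d * g * (4 * 2 ^ d) ^ (i / 2) := by
  set c := 6 * (4 ^ d * capQ n g) with hc
  have h1 : ∀ j, mu d (capQ n g) (2 * j + 1) ≤ (1 + c) * (4 * 2 ^ d) ^ j ∧ mu d (capQ n g) (2 * j) ≤ (1 + c) * (4 * 2 ^ d) ^ j := by
    intro j
    induction j with
    | zero => simp [mu, hc]
    | succ j ih =>
      have h2 : mu d (capQ n g) (2 * (j + 1)) = 3 * 2 ^ d * mu d (capQ n g) (2 * j + 1) := by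
        rw [show 2 * (j + 1) = (2 * j + 1) + 1 by ring, mu, if_neg (by simp)]
      have h3 : mu d (capQ n g) (2 * (j + 1) + 1) = mu d (capQ n g) (2 * (j + 1)) + c := by
        rw [mu, if_pos (by simp)]
      have h4 : 3 * 2 ^ d * mu d (capQ n g) (2 * j + 1) ≤ 3 * 2 ^ d * ((1 + c) * (4 * 2 ^ d) ^ j) := Nat.mul_le_mul_left _ ih.1
      have h5 : (1 + c) * (4 * 2 ^ d) ^ (j + 1) = 3 * 2 ^ d * ((1 + c) * (4 * 2 ^ d) ^ j) + (1 + c) * (2 ^ d * (4 * 2 ^ d) ^ j) := by ring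
      have h6 : (1 + c) * 1 ≤ (1 + c) * (2 ^ d * (4 * 2 ^ d) ^ j) := Nat.mul_le_mul_left _ (Nat.one_le_iff_ne_zero.2 (by positivity))
      omega
  have h2 : mu d (capQ n g) i ≤ (1 + c) * (4 * 2 ^ d) ^ (i / 2) := by grind
  calc 15 * mu d (capQ n g) i ≤ 15 * ((1 + c) * (4 * 2 ^ d) ^ (i / 2)) := Nat.mul_le_mul_left _ h2
    _ = 15 * (1 + c) * (4 * 2 ^ d) ^ (i / 2) := by ring
    _ ≤ _ := Nat.mul_le_mul_right _ (one_add_le hn hd hgn)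

/-- The first summand pays for two runs, the second for the exploration around the union of their
known strings; each string costs sixteen queries. -/
theorem queries_le (hd : 1 ≤ d) (hgn : n ≤ g) (hη : 3 ≤ η) :
  2 * (η * (mu d (capQ n g) η * 16)) + 3 * 2 ^ (2 * d + 1) * (2 * mu d (capQ n g) η) * 16 ≤ 4 ^ (η * (d + 1)) * (g * d) := by
  obtain ⟨k, rfl⟩ := Nat.exists_eq_add_of_le hη
  have h1 := mu_le hn hd hgn (3 + k)
  have e0 : (4 : ℕ) ^ d = 2 ^ (2 * d) := by rw [pow_mul]; norm_num
  have h2 : 2 * (3 + k) * 16 + 3 * 2 ^ (2 * d + 1) * 2 * 16 ≤ 2 ^ (2 * d + k + 4) * 15 := by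
    have a1 : k < 2 ^ k := lt_two_pow_self
    have a2 : 2 ^ 2 ≤ 2 ^ (2 * d) := pow_le_pow_right (by norm_num) (by omega)
    have a3 : 1 ≤ 2 ^ k := Nat.one_le_two_pow; have a4 : 2 ^ 2 * 2 ^ k ≤ 2 ^ (2 * d) * 2 ^ k := Nat.mul_le_mul_right _ a2
    have a5 : 2 ^ (2 * d) * 1 ≤ 2 ^ (2 * d) * 2 ^ k := Nat.mul_le_mul_left _ a3
    have a6 : 2 ^ (2 * d + k + 4) = 2 ^ (2 * d) * 2 ^ k * 16 := by rw [pow_add, pow_add]; norm_num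
    rw [a6, pow_succ]; omega
  have h3 : 2 ^ (2 * d + k + 4) * (4 ^ d * (4 * 2 ^ d) ^ ((3 + k) / 2)) ≤ 4 ^ ((3 + k) * (d + 1)) := by
    rw [show (4 : ℕ) * 2 ^ d = 2 ^ (2 + d) by rw [pow_add]; norm_num, e0, ← pow_mul, ← pow_add,
      ← pow_add, show (4 : ℕ) = 2 ^ 2 by norm_num, ← pow_mul]
    refine pow_le_pow_right (by norm_num) ?_
    have a1 : 2 * ((3 + k) / 2) ≤ 3 + k := Nat.mul_div_le _ _
    have a2 : (2 * ((3 + k) / 2)) * d ≤ (3 + k) * d := Nat.mul_le_mul_right _ a1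
    obtain ⟨j, hj⟩ : ∃ j, (3 + k) / 2 = 1 + j := ⟨(3 + k) / 2 - 1, by omega⟩
    rw [hj] at a1 a2 ⊢
    have a3 : 2 * j ≤ 1 + k := by omega
    have a4 : 2 * j * d ≤ (1 + k) * d := Nat.mul_le_mul_right _ a3; have a5 : k * 1 ≤ k * d := Nat.mul_le_mul_left _ hd; nlinarith
  calc _ = (2 * (3 + k) * 16 + 3 * 2 ^ (2 * d + 1) * 2 * 16) * mu d (capQ n g) (3 + k) := by ring
    _ ≤ 2 ^ (2 * d + k + 4) * 15 * mu d (capQ n g) (3 + k) := Nat.mul_le_mul_right _ h2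
    _ = 2 ^ (2 * d + k + 4) * (15 * mu d (capQ n g) (3 + k)) := by ring
    _ ≤ 2 ^ (2 * d + k + 4) * (4 ^ d * g * (4 * 2 ^ d) ^ ((3 + k) / 2)) := Nat.mul_le_mul_left _ h1
    _ = 2 ^ (2 * d + k + 4) * (4 ^ d * (4 * 2 ^ d) ^ ((3 + k) / 2)) * g := by ring
    _ ≤ 4 ^ ((3 + k) * (d + 1)) * (g * d) := Nat.mul_le_mul h3 (Nat.le_mul_of_pos_right _ hd)

theorem queries_le_of_le_two (hd : 1 ≤ d) (hgn : n ≤ g) (hη : 1 ≤ η) (hη' : η ≤ 2) :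
  η * (mu d (capQ n g) η * 16) ≤ 4 ^ (η * (d + 1)) * (g * d) := by
  have h1 := mu_le hn hd hgn η
  have h2 : 2 ^ 1 ≤ 2 ^ d := pow_le_pow_right (by norm_num) hd
  have h3 : 4 ^ d * g ≤ 4 ^ d * (g * d) := Nat.mul_le_mul_left _ (Nat.le_mul_of_pos_right _ hd)
  interval_cases η
  · simp only [Nat.reduceDiv, pow_zero, mul_one, one_mul] at h1 ⊢; rw [pow_succ]; nlinarith
  · simp only [Nat.reduceDiv, pow_one] at h1
    have e0 : (4 : ℕ) ^ (2 * (d + 1)) = 16 * (4 ^ d * (2 ^ d * 2 ^ d)) := by rw [← mul_pow 2, mul_comm 2, pow_mul, pow_succ]; norm_num; ring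
    rw [e0]; have h4 : 4 ^ d * g * (4 * 2 ^ d) ≤ 4 ^ d * (g * d) * (4 * 2 ^ d) := Nat.mul_le_mul_right _ h3
    have h5 : 4 ^ d * (g * d) * 2 ^ d * 2 ^ 1 ≤ 4 ^ d * (g * d) * 2 ^ d * 2 ^ d := Nat.mul_le_mul_left _ h2; nlinarith

theorem total_le (hd : 1 ≤ d) (hgn : n ≤ g) (hη : 3 ≤ η) :
  η * (mainBound n d g (η + 1) (2 * mu d (capQ n g) η) + (4 * η ^ 2 + 3) * devBound n d g) ≤
    4 ^ ((η + 2) * (d + 2)) * (g : ℝ) ^ 2 * density n := by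
  obtain ⟨h3, -⟩ := density_facts hn
  have h6 : (1 : ℝ) ≤ g := mod_cast (by omega : 1 ≤ g)
  have h7 : (1 : ℝ) ≤ 2 ^ d := one_le_pow₀ one_le_two
  have hM : ((2 * mu d (capQ n g) η : ℕ) : ℝ) ≤ g * 2 ^ η * (2 ^ d) ^ (η + 2) := by
    have e1 : (4 : ℕ) ^ d * g * (4 * 2 ^ d) ^ (η / 2) ≤ g * 2 ^ η * (2 ^ d) ^ (η + 2) := by
      rw [mul_pow, show (4 : ℕ) = 2 ^ 2 by norm_num, ← pow_mul, ← pow_mul,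
        show (2 ^ d) ^ (η + 2) = (2 ^ d) ^ η * 2 ^ (2 * d) by
          rw [pow_add, ← pow_mul 2 d 2, mul_comm d 2]]
      calc 2 ^ (2 * d) * g * (2 ^ (2 * (η / 2)) * (2 ^ d) ^ (η / 2)) ≤ 2 ^ (2 * d) * g * (2 ^ η * (2 ^ d) ^ η) := by
            gcongr
            · norm_num
            · omega
            · grind
            · omega
        _ = _ := by ring
    have e2 := mu_le hn hd hgn η
    have e3 : 2 * mu d (capQ n g) η ≤ g * 2 ^ η * (2 ^ d) ^ (η + 2) := by omega
    exact_mod_cast e3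
  have hmain := mainBound_le (d := d) hn (by omega : 1 ≤ g) (η + 1) (2 * mu d (capQ n g) η)
  have hdev := devBound_le (d := d) (g := g) hn
  have hX : (8 : ℝ) ≤ 2 ^ η := le_trans (by norm_num) (pow_le_pow_right₀ (one_le_two) hη)
  have hηX : (η : ℝ) ≤ 2 ^ η := mod_cast lt_two_pow_self.le
  have e16 : (4 : ℝ) ^ ((η + 2) * (d + 2)) = 256 * (2 ^ η) ^ 4 * (2 ^ d) ^ (2 * η + 4) := by
    rw [← pow_mul, ← pow_mul, show (4 : ℝ) = 2 ^ 2 by norm_num, ← pow_mul,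
      show (256 : ℝ) = 2 ^ 8 by norm_num, ← pow_add, ← pow_add]
    congr 1; ring
  rw [e16]
  rw [pow_succ] at hmain
  set D : ℝ := 2 ^ d
  set X : ℝ := 2 ^ η
  have b1 : D ^ (η + 4) ≤ D ^ (2 * η + 4) := pow_le_pow_right₀ h7 (by omega)
  have b2 : D ≤ D ^ (2 * η + 4) := le_self_pow₀ h7 (by omega)
  have b3 : D ^ 3 ≤ D ^ (2 * η + 4) := pow_le_pow_right₀ h7 (by omega)
  set B : ℝ := D ^ (2 * η + 4)
  have hB : 1 ≤ B := h7.trans b2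
  have c1 : (156 + 12 * (X * 2)) * D ^ 2 * ((2 * mu d (capQ n g) η : ℕ) : ℝ) * g ≤ (44 * X) * X * B * g ^ 2 := by
    calc _ ≤ (44 * X) * D ^ 2 * (g * X * D ^ (η + 2)) * g := by gcongr; linarith
      _ = (44 * X) * X * D ^ (η + 4) * g ^ 2 := by ring
      _ ≤ _ := by gcongr
  have c2 : 23 * D ^ 3 * (g : ℝ) ^ 2 ≤ X ^ 2 * B * g ^ 2 := by gcongr; nlinarith
  have c3 : (4 * (η : ℝ) ^ 2 + 3) * (D * g) ≤ 5 * X ^ 2 * B * g ^ 2 := by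
    calc _ ≤ (5 * X ^ 2) * (B * g ^ 2) := by
          gcongr
          · nlinarith [pow_le_pow_left₀ η.cast_nonneg hηX 2]
          · exact le_self_pow₀ h6 (by norm_num)
      _ = _ := by ring
  calc _ ≤ X * (density n * ((156 + 12 * (X * 2)) * D ^ 2 * ((2 * mu d (capQ n g) η : ℕ) : ℝ) * g +
        23 * D ^ 3 * g ^ 2) + (4 * η ^ 2 + 3) * (density n * (D * g))) := by
        refine mul_le_mul hηX (add_le_add hmain (mul_le_mul_of_nonneg_left hdev (by positivity))) ?_ (by positivity)
        have := devBound_nonneg (d := d) (g := g) (luck_facts hn).1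
        have := mainBound_nonneg (d := d) (g := g) (luck_facts hn).1 (η + 1) (2 * mu d (capQ n g) η); positivity
    _ = X * density n * ((156 + 12 * (X * 2)) * D ^ 2 * ((2 * mu d (capQ n g) η : ℕ) : ℝ) * g +
        23 * D ^ 3 * g ^ 2 + (4 * η ^ 2 + 3) * (D * g)) := by ring
    _ ≤ X * density n * ((44 * X) * X * B * g ^ 2 + X ^ 2 * B * g ^ 2 + 5 * X ^ 2 * B * g ^ 2) := by gcongr
    _ = density n * (50 * X ^ 3 * (B * g ^ 2)) := by ring
    _ ≤ density n * (256 * X ^ 4 * (B * g ^ 2)) := by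
        gcongr density n * (?_ * _)
        nlinarith [pow_nonneg (by linarith : (0 : ℝ) ≤ X) 3]
    _ = _ := by ring

end

/-! ### The simulation theorem -/

section
variable {n d g η : ℕ} {T : WeldedTree n} {χ : EdgeColouring T.graph} {p p' : Oracle n → Bits g → ℝ}

/-- The sum of absolute differences is attained by the functional of signs, and the success
probability is the functional that compares the output with the label of the exit. For the latter,
functionals must be allowed to depend on that label. -/
theorem claims_of_functional {R : ℝ} (h : ∀ F : Bits g → Str n → ℝ, (∀ z e, |F z e| ≤ 1) →
    |average fun ℓ => ∑ z, p (blackBox T χ ℓ) z * F z (ℓ.1 (exit n)) - ∑ z, p' (blackBox T χ ℓ) z * F z (ℓ.1 (exit n))| ≤ R) :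
  ∑ y, |outputProb p T χ y - outputProb p' T χ y| ≤ R ∧
    |successProb p T χ - successProb p' T χ| ≤ R := by
  classical
  constructor
  · set sg : Bits g → ℝ := fun y => if 0 ≤ outputProb p T χ y - outputProb p' T χ y then 1 else -1 with hsg
    refine (le_of_eq ?_).trans ((le_abs_self _).trans (h (fun z _ => sg z) fun z _ => ?_))
    · simp only [← sum_sub_distrib, ← sub_mul]; rw [average_sum]; refine sum_congr rfl fun y _ => ?_
      have h1 : |outputProb p T χ y - outputProb p' T χ y| = sg y * (outputProb p T χ y - outputProb p' T χ y) := by grind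
      rw [h1, outputProb, outputProb, ← average_sub, ← average_mul_left]; exact congrArg average (funext fun ℓ => mul_comm _ _)
    · grind
  · have h1 := h (fun z e => if padInput (2 * n) z = e then 1 else 0) fun z e => by split_ifs <;> simp
    rw [average_sub] at h1; simp only [mul_ite, mul_one, mul_zero] at h1; simp only [successProb, ReturnsExit]
    convert h1 <;> congr

theorem le_two_of_trivial (C : HybridCircuit n η (4 ^ d) d g) {A : ClassicalAlgorithm n g} (x : Bits n)
  {y : Bits g} (hA : ∀ K (F : Bits g → ℝ), ∑ z, A.prob K x z * F z = F y)
  (F : Bits g → Str n → ℝ) (hF : ∀ z e, |F z e| ≤ 1) :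
  |average fun ℓ => ∑ z, C.prob (blackBox T χ ℓ) x z * F z (ℓ.1 (exit n)) -
    ∑ z, A.prob (blackBox T χ ℓ) x z * F z (ℓ.1 (exit n))| ≤ 2 := by
  refine (abs_average_le _).trans (average_le zero_le_two fun ℓ => ?_)
  rw [hA, sum_prob_mul C (blackBox T χ ℓ) x fun z => F z (ℓ.1 (exit n))]
  refine (abs_sub _ _).trans ?_
  have h1 := abs_vr_le (τ := simTiers C) (K := blackBox T χ ℓ) (fun z => hF z (ℓ.1 (exit n))) η 0 (padInput g x)
  have h2 := hF y (ℓ.1 (exit n))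
  linarith

theorem simTiers_bounded (C : HybridCircuit n η (4 ^ d) d g) (hl : 0 ≤ luck n) (s M : ℕ) {i : ℕ}
  (hi : i < η) : (simTiers C i).Bounded T χ d M (2 ^ s)⁻¹ (mainBound n d g s M) (devBound n d g) := by
  rw [simTiers, dif_pos hi]
  cases C.tier ⟨i, hi⟩ with
  | classical L =>
    exact cTier_bounded (by positivity) L (by positivity) (mainBound_nonneg hl s M) (devBound_nonneg hl)
  | quantum L => exact qTier_bounded hl _ s M L

theorem simTiers_cr_empty (C : HybridCircuit n η (4 ^ d) d g) (i : ℕ) (K : Oracle n)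
  (S : Finset (Str n)) (z z' : Bits g) : (simTiers C i).cr K S z ∅ z' = 0 := by
  rw [simTiers]
  split_ifs with hi
  · cases C.tier ⟨i, hi⟩ with
    | classical L => rfl
    | quantum L =>
      change qcr L K S z ∅ z' = 0; rw [qcr, Finset.sum_empty]
  · rfl

theorem outAv_error_le (C : HybridCircuit n η (4 ^ d) d g) (hn : 27 ≤ n) (hη : 3 ≤ η) (hd : 1 ≤ d)
  (hgn : n ≤ g) (x : Bits n) (F : Bits g → Str n → ℝ) (hF : ∀ z e, |F z e| ≤ 1) :
  |average fun ℓ => ∑ z, C.prob (blackBox T χ ℓ) x z * F z (ℓ.1 (exit n)) -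
    outAv (simTiers C) η (η + 1) (padInput g x, {fun _ => false}) (fun K Y => ball K Y (d + 1))
      (blackBox T χ ℓ) fun z => F z (ℓ.1 (exit n))| ≤
    4 ^ ((η + 2) * (d + 2)) * (g : ℝ) ^ 2 * density n := by
  have hl := (luck_facts hn).1
  refine le_trans (le_of_eq ?_) ((abs_average_sub_outAv_le (T := T) (χ := χ) (s := η + 1)
    (σ0 := (padInput g x, {fun _ => false})) (τ := simTiers C) (by positivity) (by
      have : η < 2 ^ η := lt_two_pow_self
      rw [pow_succ]; omega) (Finset.mem_singleton_self _) hF (devBound_nonneg hl)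
    (fun K hK => card_known_le C hK) (Finset.card_singleton _).le fun i hi =>
      simTiers_bounded C hl (η + 1) _ hi).trans (total_le hn hd hgn hη))
  simp only [hid_empty, ← sum_prob_mul]

theorem outAv_empty_error_le (C : HybridCircuit n η (4 ^ d) d g) (hn : 27 ≤ n) (hη : 1 ≤ η)
  (hη' : η ≤ 2) (hd : 1 ≤ d) (hgn : n ≤ g) (x : Bits n) (F : Bits g → Str n → ℝ)
  (hF : ∀ z e, |F z e| ≤ 1) :
  |average fun ℓ => ∑ z, C.prob (blackBox T χ ℓ) x z * F z (ℓ.1 (exit n)) -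
    outAv (simTiers C) η (η + 1) (padInput g x, {fun _ => false}) (fun _ _ => ∅) (blackBox T χ ℓ) fun z => F z (ℓ.1 (exit n))| ≤
    4 ^ ((η + 2) * (d + 2)) * (g : ℝ) ^ 2 * density n := by
  have hl := (luck_facts hn).1
  have hdn := (density_facts hn).1
  obtain ⟨m, rfl⟩ : ∃ m, η = m + 1 := ⟨η - 1, by omega⟩
  refine le_trans (le_of_eq ?_) (abs_average_sub_outAv_last_le (T := T) (χ := χ) (s := m + 1 + 1)
    (σ0 := (padInput g x, {fun _ => false})) (τ := simTiers C) (m := m) (by positivity)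
    (Finset.mem_singleton_self _) hF (fun K hK => card_known_le C hK) (Finset.card_singleton _).le
    (simTiers_cr_empty C) (fun i hi K σ z' => ?_) ?_)
  · simp only [hid_empty, ← sum_prob_mul]
  · have h1 : i < m + 1 := by omega
    have h2 := C.alternates ⟨i, h1⟩; rw [simTiers, dif_pos h1]
    revert h2
    cases C.tier ⟨i, h1⟩ with
    | classical L => exact fun _ => er_cTier (by positivity) L K σ z'
    | quantum L => exact fun h => (h.2 (show Even i from ⟨0, by omega⟩)).elim
  · have h2 := C.alternates ⟨m, by omega⟩
    rw [simTiers, dif_pos (by omega)]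
    revert h2
    cases C.tier ⟨m, by omega⟩ with
    | classical L => exact fun _ => cTier_lastBounded (by positivity) L (by positivity)
    | quantum L =>
      intro h
      obtain rfl : m = 1 := by
        by_contra h'
        exact h.2 (show Even m from ⟨0, by omega⟩)
      have h3 : 15 * mu d (capQ n g) 1 ≤ 4 ^ d * g := by simpa using mu_le hn hd hgn 1
      exact fun p f hM hf => (qTier_lastBounded hl _ _ L p f hM hf).trans (lastBound_le hn (by omega) h3)

end

/-! ### Assembly of the classical algorithm. -/

section
variable {n d g η : ℕ}

theorem can_out_empty {P wd : ℕ} [Fact (16 ≤ P)] [Fact (2 ^ n ≤ P)] [Fact (2 ^ g ≤ P)]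
  [Fact (2 ^ d ≤ P)] [Fact (wd ≤ P ^ 4)] {C : HybridCircuit n η (4 ^ d) d g} {s : ℕ} {W : Type}
  {o : W → Oracle n} {S : Stock o P} (ho : ∀ w, Tame (o w)) (hη : η ≤ P ^ 1) (hc : 4 ^ d * g ≤ P ^ 4)
  (hm : mu d (capQ n g) η ≤ P ^ 4) {σ : W → State n (Bits g)}
  (hσ : HasState S σ) (hσc : ∀ w, (σ w).2.card ≤ 1) {γ γ' : W → ℕ → ℕ}
  (hγ : ∀ i < η, HasInt wd S fun w => (γ w i : ℤ)) (hγ' : ∀ w i, γ w i < 2 ^ (g * d))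
  (hw : g * d + 1 < wd) (κ : W → ℕ) :
  Can S (η * (mu d (capQ n g) η * 16)) 70 fun S' => Has S' fun w =>
    out (simTiers C) η s (σ w) (fun _ _ => ∅) (o w) (γ w) (γ' w) (κ w) := by
  refine (can_run (C := C) ho hη hc hm hσ hσc hγ hγ' hw).mono le_rfl (by omega) fun S' _ h => ?_
  convert (h η le_rfl).1 using 2 with w
  exact out_empty (simTiers_cr_empty C) _ _ _

/-- The room from `P ^ 75` to `P ^ 80` covers the wires, the random bits and the gates per program
step; this fixes the absolute constant as `80`. -/
theorem time_le {P m : ℕ} (hP : 16 ≤ P) (hn : n ≤ P) (hg : g ≤ P) (hm : m ≤ P ^ 4) :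
  n + m + 5 * g + 3 + (P ^ 75 + 3) * (6 * n + 11) ≤ P ^ 80 := by
  have h1 : 6 * n + 11 ≤ P ^ 2 := by nlinarith
  have h2 : P ^ 75 + 3 ≤ P ^ 76 := by
    have : 1 ≤ P ^ 75 := Nat.one_le_pow _ _ (by omega)
    rw [pow_succ P 75]; nlinarith
  have h3 : (P ^ 75 + 3) * (6 * n + 11) ≤ P ^ 78 := by
    calc _ ≤ P ^ 76 * P ^ 2 := Nat.mul_le_mul h2 h1
      _ = P ^ 78 := by rw [← pow_add]
  have h4 : P ^ 4 ≤ P ^ 78 := pow_le_pow_right (by omega) (by norm_num)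
  have h5 : P ≤ P ^ 78 := le_self_pow₀ (by omega) (by norm_num)
  have h6 : P ^ 80 = P ^ 78 * P ^ 2 := by rw [← pow_add]
  have h7 : P ^ 78 * 16 ^ 2 ≤ P ^ 78 * P ^ 2 := Nat.mul_le_mul_left _ (Nat.pow_le_pow_left hP 2)
  omega

theorem coinBits_le {P : ℕ} (hP : 16 ≤ P) (hη : η ≤ P) (hη' : η + 1 ≤ P) (hgd : g * d ≤ P ^ 2) : coinBits η (g * d) (η + 1) ≤ P ^ 4 := by
  simp only [coinBits, CoinBits, Fintype.card_sum, card_prod, card_fin]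
  have h1 : η * (g * d) ≤ P * P ^ 2 := Nat.mul_le_mul hη hgd
  have h2 : P * P ^ 2 * 16 ≤ P * P ^ 2 * P := Nat.mul_le_mul_left _ hP
  have h3 : P * P ^ 2 * P = P ^ 4 := by ring
  have h4 : P * 1 ≤ P * P ^ 2 := Nat.mul_le_mul_left _ (Nat.one_le_pow _ _ (by omega))
  omega

theorem exists_algorithm (C : HybridCircuit n η (4 ^ d) d g) (hn : 27 ≤ n) (hη : 1 ≤ η) (hd : 1 ≤ d) (hgn : n ≤ g) :
  ∃ A : ClassicalAlgorithm n g, A.queries ≤ 4 ^ (η * (d + 1)) * (g * d) ∧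
    A.time ≤ 2 ^ (80 * (g + η * (d + 1))) ∧ ∀ (x : Bits n) (T : WeldedTree n)
      (χ : EdgeColouring T.graph) (F : Bits g → Str n → ℝ), (∀ z e, |F z e| ≤ 1) →
    |average fun ℓ => ∑ z, C.prob (blackBox T χ ℓ) x z * F z (ℓ.1 (exit n)) - ∑ z, A.prob (blackBox T χ ℓ) x z * F z (ℓ.1 (exit n))| ≤
      4 ^ ((η + 2) * (d + 2)) * (g : ℝ) ^ 2 * density n := by
  -- With this `P`, the numbers of strings, wire contents, layers, tiers, slots and known strings
  -- are all bounded by small powers of `P`.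
  set P := 2 ^ (g + η * (d + 1)) with hP
  have hpow : ∀ {a}, a ≤ g + η * (d + 1) → 2 ^ a ≤ P := fun h => pow_le_pow_right two_pos h
  have hlt : ∀ {a}, a ≤ g + η * (d + 1) → a ≤ P := fun h => lt_two_pow_self.le.trans (hpow h)
  have hdη : d + 1 ≤ η * (d + 1) := Nat.le_mul_of_pos_left _ hη
  have hηd : η * 2 ≤ η * (d + 1) := Nat.mul_le_mul_left _ (by omega)
  have f16 : Fact (16 ≤ P) := ⟨hpow (a := 4) (by omega)⟩
  have fn : Fact (2 ^ n ≤ P) := ⟨hpow (by omega)⟩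
  have fg : Fact (2 ^ g ≤ P) := ⟨hpow (by omega)⟩
  have fd : Fact (2 ^ d ≤ P) := ⟨hpow (by omega)⟩
  have hg' : g ≤ P := hlt (by omega)
  have hd' : d ≤ P := hlt (by omega)
  have hgd : g * d ≤ P ^ 2 := by rw [sq]; exact Nat.mul_le_mul hg' hd'
  have hη1 : η ≤ P ^ 1 := by rw [pow_one]; exact hlt (by omega)
  have hs1 : η + 1 ≤ P ^ 1 := by rw [pow_one]; exact hlt (by omega)
  have hs2 : 2 ^ (η + 1) ≤ P ^ 1 := by rw [pow_one]; exact hpow (by omega)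
  have hP2 : 16 ^ 2 ≤ P ^ 2 := Nat.pow_le_pow_left f16.out 2
  have hn' : n ≤ P := hlt (by omega)
  have hPP : P * 16 ≤ P ^ 2 := by rw [sq]; exact Nat.mul_le_mul_left _ f16.out
  have hP4 : P ^ 2 * 16 ^ 2 ≤ P ^ 4 := by
    rw [show P ^ 4 = P ^ 2 * P ^ 2 by ring]; exact Nat.mul_le_mul_left _ hP2
  have fw : Fact (g * d + 4 * n + 2 * d + (η + 1) + 5 ≤ P ^ 4) := ⟨by grind⟩
  have hc : 4 ^ d * g ≤ P ^ 4 := by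
    have h1 : 4 ^ d * g ≤ (P * P) * P := Nat.mul_le_mul (by
      rw [show 4 = 2 * 2 by norm_num, mul_pow]; exact Nat.mul_le_mul fd.out fd.out) hg'
    have h2 : P * P * P * 1 ≤ P * P * P * P := Nat.mul_le_mul_left _ (by omega)
    rw [show P ^ 4 = P * P * P * P by ring]; omega
  have hq : 4 ^ (η * (d + 1)) * (g * d) ≤ P ^ 4 := by
    rw [show P ^ 4 = P ^ 2 * P ^ 2 by ring]
    refine Nat.mul_le_mul ?_ hgd
    rw [show 4 = 2 ^ 2 by norm_num, ← pow_mul, mul_comm, pow_mul]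
    exact Nat.pow_le_pow_left (hpow (by omega)) 2
  have hηs : 2 * η ≤ 2 ^ (η + 1) := by have : η < 2 ^ η := lt_two_pow_self; rw [pow_succ]; omega
  have htime : n + coinBits η (g * d) (η + 1) + 5 * g + 3 + (P ^ 75 + 3) * (6 * n + 11) ≤ 2 ^ (80 * (g + η * (d + 1))) := by
    rw [mul_comm 80, pow_mul]; exact time_le f16.out hn' hg' (coinBits_le f16.out (pow_one P ▸ hη1) (pow_one P ▸ hs1) hgd)
  have htame : ∀ (T : WeldedTree n) (χ : EdgeColouring T.graph) ℓ, Tame (blackBox T χ ℓ) := fun T χ ℓ => hid_empty ▸ tame_hid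
  -- With at most two tiers, only the last one can be quantum, and a single run without corrections
  -- suffices.
  rcases Nat.lt_or_ge η 3 with h3 | h3
  · have h4 := queries_le_of_le_two hn hd hgn hη (by omega)
    obtain ⟨A, hA, hA', hA''⟩ := exists_algorithm_outAv C
      (wd := g * d + 4 * n + 2 * d + (η + 1) + 5) (s := η + 1) (by omega) hη1 hgd hs1 hs2 hηs
      (fun _ _ => ∅) fun ho _ hσ hσc _ _ hγ _ hγ' _ κ _ => can_out_empty ho hη1 hc (by
        have : mu d (capQ n g) η * 1 ≤ mu d (capQ n g) η * (η * 16) := Nat.mul_le_mul_left _ (by omega)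
        nlinarith) hσ hσc hγ hγ' (by omega) κ
    refine ⟨A, hA.trans h4, hA'.trans htime, fun x T χ F hF => ?_⟩
    simp only [fun ℓ => hA'' _ x (fun z => F z (ℓ.1 (exit n))) (htame T χ ℓ)]
    exact outAv_empty_error_le C hn hη (by omega) hd hgn x F hF
  · have h4 := queries_le hn hd hgn h3
    obtain ⟨A, hA, hA', hA''⟩ := exists_algorithm_outAv C
      (wd := g * d + 4 * n + 2 * d + (η + 1) + 5) (s := η + 1) (by omega) hη1 hgd hs1 hs2 hηs
      (fun K Y => ball K Y (d + 1)) fun ho _ hσ hσc _ _ hγ hγ1 hγ' hγ1' κ hκ =>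
        can_out ho hη1 hc (by omega) hσ hσc hγ hγ1 hγ' hγ1' hs1 (by omega) hκ
    refine ⟨A, hA.trans h4, hA'.trans htime, fun x T χ F hF => ?_⟩
    simp only [fun ℓ => hA'' _ x (fun z => F z (ℓ.1 (exit n))) (htame T χ ℓ)]; exact outAv_error_le C hn h3 hd hgn x F hF

theorem exists_algorithm_const (hn : 2 ≤ n) (hη : 1 ≤ η) (hd : 1 ≤ d) (hng : n ≤ g) :
  ∃ A : ClassicalAlgorithm n g, A.queries ≤ 0 ∧ A.time ≤ 2 ^ (80 * (g + η * (d + 1))) ∧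
    ∀ K (x : Bits n) (F : Bits g → ℝ), ∑ z, A.prob K x z * F z = F fun _ => false := by
  have h2 : 1 * 2 ≤ η * (d + 1) := Nat.mul_le_mul hη (by omega)
  have h3 : ∀ {a}, a ≤ g + η * (d + 1) → a ≤ 2 ^ (g + η * (d + 1)) := fun h =>
    lt_two_pow_self.le.trans (pow_le_pow_right two_pos h)
  have f16 : Fact (16 ≤ 2 ^ (g + η * (d + 1))) := ⟨(pow_le_pow_right two_pos (by omega) : 2 ^ 4 ≤ _)⟩
  obtain ⟨A, hA, hA', hA''⟩ := exists_algorithm_of_can (m := 0) (q := 0) (a := 75)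
    (P := 2 ^ (g + η * (d + 1))) (by omega : 0 < n) (p := fun _ => True) (y := fun _ _ => false)
    fun S _ _ => Can.now fun _ => S.2.2
  refine ⟨A, hA, hA'.trans ?_, fun K x F => ?_⟩
  · rw [mul_comm 80, pow_mul]
    exact time_le f16.out (h3 (by omega)) (h3 (by omega)) (Nat.zero_le _)
  · rw [hA'' ⟨K, trivial⟩ x F]; simp

end

end

end HybridWelded

theorem mainTheorem5 :
    ∃ k : ℕ, ∀ n η d g : ℕ, 2 ≤ n → 1 ≤ η → 1 ≤ d → n ≤ g →
      ∀ C : HybridWelded.HybridCircuit n η (4 ^ d) d g,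
        ∃ A : HybridWelded.ClassicalAlgorithm n g,
          A.queries ≤ 4 ^ (η * (d + 1)) * (g * d) ∧
          A.time ≤ 2 ^ (k * (g + η * (d + 1))) ∧
          ∀ (x : HybridWelded.Bits n) (T : HybridWelded.WeldedTree n)
            (χ : HybridWelded.EdgeColouring T.graph),
            (∑ y : HybridWelded.Bits g,
                |HybridWelded.outputProb (fun K => C.prob K x) T χ y -
                  HybridWelded.outputProb (fun K => A.prob K x) T χ y| ≤
              (4 : ℝ) ^ ((η + 2) * (d + 2)) * (g : ℝ) ^ 2 *
                (((2 : ℝ) ^ (n + 2) - 2) / (2 : ℝ) ^ (2 * n))) ∧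
            (|HybridWelded.successProb (fun K => C.prob K x) T χ -
                HybridWelded.successProb (fun K => A.prob K x) T χ| ≤
              (4 : ℝ) ^ ((η + 2) * (d + 2)) * (g : ℝ) ^ 2 *
                (((2 : ℝ) ^ (n + 2) - 2) / (2 : ℝ) ^ (2 * n))) := by
  refine ⟨80, fun n η d g hn hη hd hng C => ?_⟩
  -- Expectations of functionals bounded by one differ by at most `2`, so a bound of at least `2`
  -- holds for any algorithm, in particular for a constant one without queries.
  rcases lt_or_ge ((4 : ℝ) ^ ((η + 2) * (d + 2)) * (g : ℝ) ^ 2 * HybridWelded.density n) 2 with h | h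
  · obtain ⟨A, hA, hA', hA''⟩ := HybridWelded.exists_algorithm C
      (HybridWelded.le_of_bound_lt hn hη hd hng h) hη hd hng
    exact ⟨A, hA, hA', fun x T χ => HybridWelded.claims_of_functional (hA'' x T χ)⟩
  · obtain ⟨A, hA, hA', hA''⟩ := HybridWelded.exists_algorithm_const hn hη hd hng
    exact ⟨A, hA.trans (Nat.zero_le _), hA', fun x T χ => HybridWelded.claims_of_functional
      fun F hF => (HybridWelded.le_two_of_trivial C x (fun K F => hA'' K x F) F hF).trans h⟩
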